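/- Let $\Bbbk$ be a field of characteristic zero. Operads are symmetric operads in cochain complexes over $\Bbbk$. Let $\mathrm{Ass}_+$ be the unitary associative operad: $\mathrm{Ass}_+(n)=\Bbbk[\Sigma_n]$ for all $n\ge 0$, in degree $0$. A *Sullivan minimal model* of an operad $Q$ is a quasi-isomorphism of operads $\rho:P_\infty\to Q$ such that $P_\infty$ is the union of an increasing sequence $P_1\subset P_2\subset\cdots$ of suboperads with the following properties. The operad $P_1$ has $P_1(0)=\Bbbk\cdot 1$, $P_1(1)=\Bbbk\cdot\mathrm{id}$, and is zero in all other arities. For $n\ge 2$, $P_n$ is a unitary arity $n$ principal extension of $P_{n-1}$: there are graded $\Sigma_j$-submodules $E(j)\subset P_j(j)$, $j\ge 2$, such that $P_n(0)=\Bbbk\cdot 1$ with $1\ne 0$ of degree $0$, the positive-arity part of $P_n$ is, forgetting the differential, the free graded operad on $E(2)\oplus\cdots\oplus E(n)$, the differential maps $E(n)$ to $P_{n-1}(n)$, and the restriction operations $\delta_i=(-)\circ_i 1$ map $E(n)$ to $P_{n-1}(n-1)$. Moreover $\rho|_{P_n}$ is a quasi-isomorphism in arities $\le n$, for every $n\ge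 2$. *Burke's model* $suA_\infty$ is the dg operad generated by $u$ of arity $0$ and degree $0$ and $\mu_n$, $n\ge2$, of arity $n$ and degree $2-n$, with the relations $\mu_2\circ_1u=\mathrm{id}=\mu_2\circ_2u$, $\mu_n\circ_iu=0$ for $n\ge 3$ and $1\le i\le n$, $\partial u=0$, and $$\partial\mu_n=-\sum_{\substack{r+s+t=n\\ 2\le s\le n-1}}(-1)^{r+st}\,\mu_{r+1+t}\circ_{r+1}\mu_s .$$ An *$A_\infty$-algebra with strict unit* is a graded vector space $A$ with operations $m_n:A^{\otimes n}\to A$, $n\ge1$, of degree $2-n$, with $\sum_{r+s+t=n,\ s\ge 1}(-1)^{r+st}m_{r+1+t}(1^{\otimes r}\otimes m_s\otimes1^{\otimes t})=0$ for all $n\ge 1$, and an element $\eta\in A^0$ with $m_1(\eta)=0$, $m_2(\eta,a)=a=m_2(a,\eta)$ for all $a\in A$, and $m_n(\dots,\eta,\dots)=0$ for $n\ge3$. **Theorem.** 1. There is a morphism of dg operads $\beta:suA_\infty\to\mathrm{Ass}_+$ which sends $u$ to the unit, $\mu_2$ to the product, and $\mu_n$ to $0$ for $n\ge 3$; it is a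 Sullivan minimal model of $\mathrm{Ass}_+$. 2. For every Sullivan minimal model $\rho:(\mathrm{Ass}_+)_\infty\to\mathrm{Ass}_+$ there is an isomorphism of dg operads $\varphi:suA_\infty\to(\mathrm{Ass}_+)_\infty$ with $\rho\varphi=\beta$, which can be chosen so that the $(\mathrm{Ass}_+)_\infty$-algebras are exactly the $A_\infty$-algebras with strict units, as follows. For every cochain complex $(A,d)$, letting $\varphi(\mu_n)$ act as $m_n$ $(n\ge2)$ and $\varphi(u)$ as $\eta$ defines a bijection from the $(\mathrm{Ass}_+)_\infty$-algebra structures on $(A,d)$ to the strictly unital $A_\infty$-structures on the graded vector space $A$ with $m_1=d$. Under this bijection, a linear map of degree $0$ is a morphism of $(\mathrm{Ass}_+)_\infty$-algebras (a cochain map commuting with all operations) if and only if it commutes with all $m_n$, $n\ge1$, and preserves $\eta$. -/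

import Mathlib

open scoped DirectSum

universe u v w

namespace StrictUnits

/-! ### Indexing the inputs of a partial composition

If `x` has `m` inputs and `y` has `n` inputs, then `x ∘ᵢ y` has `l = m + n - 1` inputs; this is
written `l + 1 = m + n`, so that no transport between arities is ever needed.  Inputs are numbered
from `0`. -/

/-- The position, among the inputs of `x ∘ᵢ y`, of the input `t` of `y`. -/
def innerIdx {m n l : ℕ} (h : l + 1 = m + n) (i : Fin m) (t : Fin n) : Fin l :=
  ⟨i.val + t.val, by omega⟩

/-- The position, among the inputs of `x ∘ᵢ y`, of the input `j ≠ i` of `x`. -/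
def outerIdx {m n l : ℕ} (h : l + 1 = m + n) (i j : Fin m) (hj : j ≠ i) : Fin l :=
  ⟨if j.val < i.val then j.val else j.val + n - 1, by
    have := Fin.val_ne_of_ne hj
    split_ifs <;> omega⟩

theorem slot_bijective {m n l : ℕ} (h : l + 1 = m + n) (i : Fin m) :
    Function.Bijective
      (Sum.elim (fun j : {j : Fin m // j ≠ i} => outerIdx h i j.1 j.2) (innerIdx h i)) := by
  constructor
  · rintro (⟨a, ha⟩ | a) (⟨b, hb⟩ | b) hab
    all_goals
      simp only [Sum.elim_inl, Sum.elim_inr, outerIdx, innerIdx, Fin.mk.injEq] at hab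
    · have h1 := Fin.val_ne_of_ne ha
      have h2 := Fin.val_ne_of_ne hb
      congr 2
      apply Fin.ext
      split_ifs at hab <;> omega
    · have h1 := Fin.val_ne_of_ne ha
      exfalso
      split_ifs at hab <;> omega
    · have h2 := Fin.val_ne_of_ne hb
      exfalso
      split_ifs at hab <;> omega
    · congr 1
      apply Fin.ext
      omega
  · intro q
    by_cases h1 : q.val < i.val
    · refine ⟨Sum.inl ⟨⟨q.val, by omega⟩, ?_⟩, ?_⟩
      · intro e
        have := congrArg Fin.val e
        simp only at this
        omega
      · apply Fin.ext
        simp only [Sum.elim_inl, outerIdx, if_pos h1]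
    · by_cases h2 : q.val < i.val + n
      · refine ⟨Sum.inr ⟨q.val - i.val, by omega⟩, ?_⟩
        apply Fin.ext
        simp only [Sum.elim_inr, innerIdx]
        omega
      · refine ⟨Sum.inl ⟨⟨q.val + 1 - n, by omega⟩, ?_⟩, ?_⟩
        · intro e
          have := congrArg Fin.val e
          simp only at this
          omega
        · apply Fin.ext
          simp only [Sum.elim_inl, outerIdx]
          split_ifs <;> omega

/-- The inputs of `x ∘ᵢ y` are the inputs of `x` other than `i` and the inputs of `y`. -/
noncomputable def slotEquiv {m n l : ℕ} (h : l + 1 = m + n) (i : Fin m) :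
    {j : Fin m // j ≠ i} ⊕ Fin n ≃ Fin l :=
  Equiv.ofBijective _ (slot_bijective h i)

/-- The relabelling of the inputs of `x ∘ᵢ y` induced by relabellings `σ` of the inputs of `x`
and `τ` of the inputs of `y`. -/
noncomputable def blockPerm {m n l : ℕ} (h : l + 1 = m + n) (i : Fin m)
    (σ : Equiv.Perm (Fin m)) (τ : Equiv.Perm (Fin n)) : Equiv.Perm (Fin l) :=
  (slotEquiv h i).symm.trans
    ((Equiv.sumCongr (σ.subtypeEquiv (fun _ => not_congr σ.injective.eq_iff.symm)) τ).trans
      (slotEquiv h (σ i)))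

theorem blockPerm_inner {m n l : ℕ} (h : l + 1 = m + n) (i : Fin m)
    (σ : Equiv.Perm (Fin m)) (τ : Equiv.Perm (Fin n)) (t : Fin n) :
    blockPerm h i σ τ (innerIdx h i t) = innerIdx h (σ i) (τ t) := by
  have : (slotEquiv h i).symm (innerIdx h i t) = Sum.inr t := by
    rw [Equiv.symm_apply_eq]; rfl
  simp only [blockPerm, Equiv.trans_apply, this]
  rfl

theorem blockPerm_outer {m n l : ℕ} (h : l + 1 = m + n) (i : Fin m)
    (σ : Equiv.Perm (Fin m)) (τ : Equiv.Perm (Fin n)) (j : Fin m) (hj : j ≠ i) :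
    blockPerm h i σ τ (outerIdx h i j hj) =
      outerIdx h (σ i) (σ j) (fun e => hj (σ.injective e)) := by
  have : (slotEquiv h i).symm (outerIdx h i j hj) = Sum.inl ⟨j, hj⟩ := by
    rw [Equiv.symm_apply_eq]; rfl
  simp only [blockPerm, Equiv.trans_apply, this]
  rfl

/-- The tuple `(v₁, …, vᵢ₋₁, g (vᵢ, …, vᵢ₊ₙ₋₁), vᵢ₊ₙ, …, v_l)`. -/
def plug {V : Type w} {m n l : ℕ} (h : l + 1 = m + n) (i : Fin m) (g : (Fin n → V) → V)
    (a : Fin l → V) : Fin m → V :=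
  fun j => if hj : j = i then g (fun t => a (innerIdx h i t)) else a (outerIdx h i j hj)

/-! ### Cochain complexes, graded operads and dg operads -/

/-- A cochain complex of `k`-vector spaces, as a `ℤ`-graded vector space (the internal direct sum
of its homogeneous parts) with a differential of degree `+1`. -/
structure Cochain (k : Type u) [Field k] where
  carrier : Type w
  [addCommGroup : AddCommGroup carrier]
  [module : Module k carrier]
  gr : ℤ → Submodule k carrier
  internal : DirectSum.IsInternal gr
  d : carrier →ₗ[k] carrier
  d_mem : ∀ {a : ℤ} {x : carrier}, x ∈ gr a → d x ∈ gr (a + 1)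
  d_d : ∀ x, d (d x) = 0

attribute [instance] Cochain.addCommGroup Cochain.module

/-- A symmetric operad in `ℤ`-graded `k`-vector spaces, given by partial compositions.  Arity zero
is unrestricted.  The symmetric groups act on the left by relabelling inputs. -/
structure GradedOperad (k : Type u) [Field k] where
  X : ℕ → Type v
  [addCommGroup : ∀ n, AddCommGroup (X n)]
  [module : ∀ n, Module k (X n)]
  gr : ∀ n, ℤ → Submodule k (X n)
  internal : ∀ n, DirectSum.IsInternal (gr n)
  one : X 1
  one_mem : one ∈ gr 1 0
  perm : ∀ n, Representation k (Equiv.Perm (Fin n)) (X n)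
  perm_mem : ∀ {n : ℕ} {a : ℤ} (σ : Equiv.Perm (Fin n)) {x : X n},
    x ∈ gr n a → perm n σ x ∈ gr n a
  circ : ∀ {m n l : ℕ}, l + 1 = m + n → Fin m → X m →ₗ[k] X n →ₗ[k] X l
  circ_mem : ∀ {m n l : ℕ} (h : l + 1 = m + n) (i : Fin m) {a b : ℤ} {x : X m} {y : X n},
    x ∈ gr m a → y ∈ gr n b → circ h i x y ∈ gr l (a + b)
  circ_one : ∀ {m : ℕ} (i : Fin m) (x : X m), circ (n := 1) rfl i x one = x
  one_circ : ∀ {n : ℕ} (h : n + 1 = 1 + n) (x : X n), circ h 0 one x = x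
  circ_seq : ∀ {m n p l q r : ℕ} (h₁ : l + 1 = m + n) (h₂ : q + 1 = l + p) (h₃ : r + 1 = n + p)
    (h₄ : q + 1 = m + r) (i : Fin m) (j : Fin n) (x : X m) (y : X n) (z : X p),
    circ h₂ (innerIdx h₁ i j) (circ h₁ i x y) z = circ h₄ i x (circ h₃ j y z)
  circ_par : ∀ {m n p l l' q : ℕ} (h₁ : l + 1 = m + n) (h₂ : q + 1 = l + p)
    (h₃ : l' + 1 = m + p) (h₄ : q + 1 = l' + n) (i j : Fin m) (hij : j ≠ i) {b c : ℤ}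
    (x : X m) (y : X n) (z : X p), y ∈ gr n b → z ∈ gr p c →
    circ h₂ (outerIdx h₁ i j hij) (circ h₁ i x y) z =
      (b * c).negOnePow • circ h₄ (outerIdx h₃ j i hij.symm) (circ h₃ j x z) y
  circ_perm : ∀ {m n l : ℕ} (h : l + 1 = m + n) (i : Fin m) (σ : Equiv.Perm (Fin m))
    (τ : Equiv.Perm (Fin n)) (x : X m) (y : X n),
    circ h (σ i) (perm m σ x) (perm n τ y) = perm l (blockPerm h i σ τ) (circ h i x y)

attribute [instance] GradedOperad.addCommGroup GradedOperad.module

/-- A dg operad: a graded operad with a differential of degree `+1` which is equivariant and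
satisfies the Leibniz rule. -/
structure DGOperad (k : Type u) [Field k] extends GradedOperad.{u, v} k where
  d : ∀ n, X n →ₗ[k] X n
  d_mem : ∀ {n : ℕ} {a : ℤ} {x : X n}, x ∈ gr n a → d n x ∈ gr n (a + 1)
  d_d : ∀ {n : ℕ} (x : X n), d n (d n x) = 0
  d_perm : ∀ {n : ℕ} (σ : Equiv.Perm (Fin n)) (x : X n), d n (perm n σ x) = perm n σ (d n x)
  d_circ : ∀ {m n l : ℕ} (h : l + 1 = m + n) (i : Fin m) {a : ℤ} (x : X m) (y : X n),
    x ∈ gr m a →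
    d l (circ h i x y) = circ h i (d m x) y + a.negOnePow • circ h i x (d n y)

/-- Morphisms of dg operads. -/
structure DGOperad.Hom {k : Type u} [Field k] (P Q : DGOperad.{u, v} k) where
  app : ∀ n, P.X n →ₗ[k] Q.X n
  app_mem : ∀ {n : ℕ} {a : ℤ} {x : P.X n}, x ∈ P.gr n a → app n x ∈ Q.gr n a
  app_one : app 1 P.one = Q.one
  app_perm : ∀ {n : ℕ} (σ : Equiv.Perm (Fin n)) (x : P.X n),
    app n (P.perm n σ x) = Q.perm n σ (app n x)
  app_circ : ∀ {m n l : ℕ} (h : l + 1 = m + n) (i : Fin m) (x : P.X m) (y : P.X n),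
    app l (P.circ h i x y) = Q.circ h i (app m x) (app n y)
  app_d : ∀ {n : ℕ} (x : P.X n), app n (P.d n x) = Q.d n (app n x)

/-! ### Algebras over a dg operad -/

/-- The Koszul sign of the rearrangement of `v₁ ⊗ ⋯ ⊗ vₙ` into `v_{σ 1} ⊗ ⋯ ⊗ v_{σ n}`, where
`vⱼ` has degree `deg j`. -/
def koszulSign {n : ℕ} (σ : Equiv.Perm (Fin n)) (deg : Fin n → ℤ) : ℤˣ :=
  ∏ p : Fin n, ∏ q : Fin n,
    if p < q ∧ σ q < σ p then (deg (σ p) * deg (σ q)).negOnePow else 1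

/-- The sum of the degrees of the first `r` entries of a tuple. -/
def degBefore {n : ℕ} (deg : Fin n → ℤ) (r : ℕ) : ℤ :=
  ∑ j : Fin n, if j.val < r then deg j else 0

/-- The structure of a `P`-algebra on a cochain complex `A`, that is, a morphism of dg operads from
`P` to the endomorphism operad of `A`, written out on elements with Koszul signs. -/
@[ext]
structure OperadAlgebra {k : Type u} [Field k] (P : DGOperad.{u, v} k) (A : Cochain.{u, w} k) where
  act : ∀ n, P.X n →ₗ[k] MultilinearMap k (fun _ : Fin n => A.carrier) A.carrier
  act_mem : ∀ {n : ℕ} {a : ℤ} {deg : Fin n → ℤ} {x : P.X n} {v : Fin n → A.carrier},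
    x ∈ P.gr n a → (∀ j, v j ∈ A.gr (deg j)) → act n x v ∈ A.gr (a + ∑ j, deg j)
  act_one : ∀ v : Fin 1 → A.carrier, act 1 P.one v = v 0
  act_perm : ∀ {n : ℕ} {deg : Fin n → ℤ} (σ : Equiv.Perm (Fin n)) (x : P.X n)
    (v : Fin n → A.carrier), (∀ j, v j ∈ A.gr (deg j)) →
    act n (P.perm n σ x) v = koszulSign σ deg • act n x (fun j => v (σ j))
  act_circ : ∀ {m n l : ℕ} (h : l + 1 = m + n) (i : Fin m) {b : ℤ} {deg : Fin l → ℤ}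
    (x : P.X m) (y : P.X n) (v : Fin l → A.carrier), y ∈ P.gr n b → (∀ j, v j ∈ A.gr (deg j)) →
    act l (P.circ h i x y) v =
      (b * degBefore deg i.val).negOnePow • act m x (plug h i (act n y) v)
  act_d : ∀ {n : ℕ} {a : ℤ} {deg : Fin n → ℤ} (x : P.X n) (v : Fin n → A.carrier),
    x ∈ P.gr n a → (∀ j, v j ∈ A.gr (deg j)) →
    A.d (act n x v) = act n (P.d n x) v +
      a.negOnePow • ∑ i : Fin n, (degBefore deg i.val).negOnePow •
        act n x (Function.update v i (A.d (v i)))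

/-! ### `A∞`-algebras with strict units -/

/-- An `A∞`-structure on a graded vector space: operations `mₙ` of degree `2 - n`, `n ≥ 1`, with
`∑ (-1)^(r + s t) m_{r+1+t} (1^{⊗ r} ⊗ m_s ⊗ 1^{⊗ t}) = 0`, where the sum runs over all
`r + s + t = n` with `s ≥ 1`.  In the code `s` is `s + 1` and `t` is `n - s - 1 - r`; the sign
`(1 - s) * degBefore deg r` is the Koszul sign for moving the operation past the first `r`
inputs. There is no curvature: `m₀ = 0`. -/
structure AInfinity {k : Type u} [Field k] {V : Type w} [AddCommGroup V] [Module k V]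
    (gr : ℤ → Submodule k V) where
  m : ∀ n, MultilinearMap k (fun _ : Fin n => V) V
  m_zero : m 0 = 0
  m_mem : ∀ {n : ℕ} {deg : Fin n → ℤ} {v : Fin n → V},
    (∀ j, v j ∈ gr (deg j)) → m n v ∈ gr (2 - (n : ℤ) + ∑ j, deg j)
  stasheff : ∀ {n : ℕ} {deg : Fin n → ℤ} (v : Fin n → V), (∀ j, v j ∈ gr (deg j)) →
    ∑ s : Fin n, ∑ r : Fin (n - s.val),
      (((r.val : ℤ) + ((s.val : ℤ) + 1) * ((n : ℤ) - s.val - 1 - r.val)) +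
          (1 - (s.val : ℤ)) * degBefore deg r.val).negOnePow •
        m (n - s.val) (plug (n := s.val + 1) (by omega) r (m (s.val + 1)) v) = 0

/-- An `A∞`-structure with a strict unit. -/
@[ext]
structure StrictlyUnitalAInfinity {k : Type u} [Field k] {V : Type w} [AddCommGroup V]
    [Module k V] (gr : ℤ → Submodule k V) extends AInfinity gr where
  unit : V
  unit_mem : unit ∈ gr 0
  m_one_unit : m 1 ![unit] = 0
  unit_mul : ∀ x, m 2 ![unit, x] = x
  mul_unit : ∀ x, m 2 ![x, unit] = x
  m_unit : ∀ {n : ℕ}, 3 ≤ n → ∀ (v : Fin n → V) (i : Fin n), v i = unit → m n v = 0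

/-! ### Sullivan minimal models of unitary operads -/

/-- Graded subspaces. -/
def IsGradedSubmodule {k : Type u} [Field k] {V : Type w} [AddCommGroup V] [Module k V]
    (gr : ℤ → Submodule k V) (N : Submodule k V) : Prop :=
  N ≤ ⨆ a, N ⊓ gr a

/-- Sub-dg-operads. -/
structure DGSuboperad {k : Type u} [Field k] (P : DGOperad.{u, v} k) where
  carrier : ∀ n, Submodule k (P.X n)
  graded : ∀ n, IsGradedSubmodule (P.gr n) (carrier n)
  one_mem : P.one ∈ carrier 1
  perm_mem : ∀ {n : ℕ} (σ : Equiv.Perm (Fin n)) {x : P.X n},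
    x ∈ carrier n → P.perm n σ x ∈ carrier n
  circ_mem : ∀ {m n l : ℕ} (h : l + 1 = m + n) (i : Fin m) {x : P.X m} {y : P.X n},
    x ∈ carrier m → y ∈ carrier n → P.circ h i x y ∈ carrier l
  d_mem : ∀ {n : ℕ} {x : P.X n}, x ∈ carrier n → P.d n x ∈ carrier n

/-- Morphisms of graded operads from the positive-arity part of `S` to `Q` (the differentials are
forgotten). -/
@[ext]
structure PosHom {k : Type u} [Field k] {P : DGOperad.{u, v} k} (S : DGSuboperad P)
    (Q : GradedOperad.{u, v} k) where
  app : ∀ n, 0 < n → S.carrier n →ₗ[k] Q.X n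
  app_mem : ∀ {n : ℕ} (hn : 0 < n) {a : ℤ} (x : S.carrier n),
    (x : P.X n) ∈ P.gr n a → app n hn x ∈ Q.gr n a
  app_one : app 1 Nat.one_pos ⟨P.one, S.one_mem⟩ = Q.one
  app_perm : ∀ {n : ℕ} (hn : 0 < n) (σ : Equiv.Perm (Fin n)) (x : S.carrier n),
    app n hn ⟨P.perm n σ x, S.perm_mem σ x.2⟩ = Q.perm n σ (app n hn x)
  app_circ : ∀ {m n l : ℕ} (hm : 0 < m) (hn : 0 < n) (hl : 0 < l) (h : l + 1 = m + n)
    (i : Fin m) (x : S.carrier m) (y : S.carrier n),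
    app l hl ⟨P.circ h i x y, S.circ_mem h i x.2 y.2⟩ =
      Q.circ h i (app m hm x) (app n hn y)

/-- `S` is free as a unitary graded operad on the graded `Σ`-module `M`, where `M(0) = M(1) = 0`:
its arity zero part is the ground field, spanned by an element of degree `0` (the unit), and its
positive-arity part is the free graded operad on `M`.  The restriction operations are the partial
compositions with the unit. -/
structure IsFreeUnitary {k : Type u} [Field k] {P : DGOperad.{u, v} k} (S : DGSuboperad P)
    (M : ∀ n, Submodule k (P.X n)) : Prop where
  le : ∀ n, M n ≤ S.carrier n
  graded : ∀ n, IsGradedSubmodule (P.gr n) (M n)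
  perm_mem : ∀ {n : ℕ} (σ : Equiv.Perm (Fin n)) {x : P.X n}, x ∈ M n → P.perm n σ x ∈ M n
  arity_zero : M 0 = ⊥
  arity_one : M 1 = ⊥
  unit : ∃ e ∈ P.gr 0 0, e ≠ 0 ∧ S.carrier 0 = Submodule.span k {e}
  universal : ∀ (Q : GradedOperad.{u, v} k) (f : ∀ n, M n →ₗ[k] Q.X n),
    (∀ {n : ℕ} {a : ℤ} (x : M n), (x : P.X n) ∈ P.gr n a → f n x ∈ Q.gr n a) →
    (∀ {n : ℕ} (σ : Equiv.Perm (Fin n)) (x : M n),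
      f n ⟨P.perm n σ x, perm_mem σ x.2⟩ = Q.perm n σ (f n x)) →
    ∃! φ : PosHom S Q, ∀ (n : ℕ) (hn : 0 < n) (x : M n), φ.app n hn ⟨x, le n x.2⟩ = f n x

/-- `S'` is a unitary arity `n` principal extension of `S = Γ(M)` by the `Σₙ`-module `E`
(a family of subspaces concentrated in arity `n`): `S' = Γ(M ⊕ E)`, the differential maps `E` to
`S(n)`, and the restriction operations map `E` to `S(n - 1)`.  Compatibility of the restriction
operations with the differential and among themselves holds because all of this takes place
inside a dg operad. -/
structure IsUnitaryPrincipalExtension {k : Type u} [Field k] {P : DGOperad.{u, v} k} (n : ℕ)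
    (S S' : DGSuboperad P) (M E : ∀ m, Submodule k (P.X m)) : Prop where
  two_le : 2 ≤ n
  le : ∀ m, S.carrier m ≤ S'.carrier m
  free : IsFreeUnitary S M
  arity : ∀ m, m ≠ n → E m = ⊥
  graded : IsGradedSubmodule (P.gr n) (E n)
  perm_mem : ∀ (σ : Equiv.Perm (Fin n)) {e : P.X n}, e ∈ E n → P.perm n σ e ∈ E n
  disjoint : Disjoint (M n) (E n)
  free' : IsFreeUnitary S' (fun m => M m ⊔ E m)
  d_mem : ∀ {e : P.X n}, e ∈ E n → P.d n e ∈ S.carrier n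
  restrict_mem : ∀ {l : ℕ} (h : l + 1 = n + 0) (i : Fin n) {e : P.X n} {e₀ : P.X 0},
    e ∈ E n → e₀ ∈ S.carrier 0 → P.circ h i e e₀ ∈ S.carrier l

/-- The restriction of `ρ` to `N ⊆ P(n)`, a subcomplex, is a quasi-isomorphism `N → Q(n)`: it is
injective and surjective on cohomology. -/
def QuasiIsoOn {k : Type u} [Field k] {P Q : DGOperad.{u, v} k} (ρ : DGOperad.Hom P Q) (n : ℕ)
    (N : Submodule k (P.X n)) : Prop :=
  (∀ x ∈ N, P.d n x = 0 → (∃ y, ρ.app n x = Q.d n y) → ∃ z ∈ N, x = P.d n z) ∧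
  (∀ y, Q.d n y = 0 → ∃ x ∈ N, P.d n x = 0 ∧ ∃ z, ρ.app n x - y = Q.d n z)

/-- `ρ : P → Q` is a Sullivan minimal model of the (cohomologically unitary and connected) operad
`Q`: `ρ` is a quasi-isomorphism, and `P` is the union of a sequence `S 1 ≤ S 2 ≤ ⋯` which starts
with the free unitary operad on no generators, in which `S n` is a unitary arity `n` principal
extension of `S (n - 1)` by `E n`, and for which `ρ` restricted to `S n` is a quasi-isomorphism up
to arity `n`. -/
def IsSullivanMinimalModel {k : Type u} [Field k] {P Q : DGOperad.{u, v} k}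
    (ρ : DGOperad.Hom P Q) : Prop :=
  (∀ n, QuasiIsoOn ρ n ⊤) ∧
  ∃ (S : ℕ → DGSuboperad P) (E : ℕ → ∀ m, Submodule k (P.X m)),
    IsFreeUnitary (S 1) (fun _ => ⊥) ∧
    (∀ n, 1 ≤ n → IsUnitaryPrincipalExtension (n + 1) (S n) (S (n + 1))
      (fun m => ⨆ j ∈ Finset.Icc 2 n, E j m) (E (n + 1))) ∧
    (∀ m (x : P.X m), ∃ n, 1 ≤ n ∧ x ∈ (S n).carrier m) ∧
    (∀ n, 2 ≤ n → ∀ m ≤ n, QuasiIsoOn ρ m ((S n).carrier m))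

/-! ### The unitary associative operad -/

/-- Multilinear words: words in the letters `0, …, n - 1` in which every letter occurs exactly
once. -/
def Word (n : ℕ) : Type :=
  {W : List (Fin n) // W.Nodup ∧ ∀ j, j ∈ W}

/-- What is substituted for the letter `j` when the word `Y` is substituted for the letter `i`. -/
def substLetter {m n l : ℕ} (h : l + 1 = m + n) (i : Fin m) (Y : List (Fin n)) (j : Fin m) :
    List (Fin l) :=
  if hj : j = i then Y.map (innerIdx h i) else [outerIdx h i j hj]

theorem innerIdx_injective {m n l : ℕ} (h : l + 1 = m + n) (i : Fin m) :
    Function.Injective (innerIdx h i) := fun a b hab => by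
  simp only [innerIdx, Fin.mk.injEq] at hab
  apply Fin.ext
  omega

theorem substLetter_nodup {m n l : ℕ} (h : l + 1 = m + n) (i : Fin m) (W : List (Fin m))
    (Y : List (Fin n)) (hW : W.Nodup) (hY : Y.Nodup) :
    (W.flatMap (substLetter h i Y)).Nodup := by
  rw [List.nodup_flatMap]
  constructor
  · intro j _
    unfold substLetter
    split_ifs with hj
    · exact hY.map (innerIdx_injective h i)
    · exact List.nodup_singleton _
  · refine hW.imp ?_
    intro a b hab
    simp only [Function.onFun]
    have inj := (slot_bijective h i).1
    intro q hqa hqb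
    unfold substLetter at hqa hqb
    split_ifs at hqa hqb with ha hb hb
    · exact hab (ha.trans hb.symm)
    · obtain ⟨t, _, rfl⟩ := List.mem_map.1 hqa
      have := inj (a₁ := Sum.inr t) (a₂ := Sum.inl ⟨b, hb⟩) (by simpa using hqb)
      cases this
    · obtain ⟨t, _, rfl⟩ := List.mem_map.1 hqb
      have := inj (a₁ := Sum.inr t) (a₂ := Sum.inl ⟨a, ha⟩) (by simpa using hqa)
      cases this
    · have h1 := List.mem_singleton.1 hqa
      have h2 := List.mem_singleton.1 hqb
      have := inj (a₁ := Sum.inl ⟨a, ha⟩) (a₂ := Sum.inl ⟨b, hb⟩) (by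
        simpa using h1.symm.trans h2)
      cases this
      exact hab rfl

theorem mem_substLetter {m n l : ℕ} (h : l + 1 = m + n) (i : Fin m) (W : List (Fin m))
    (Y : List (Fin n)) (hW : ∀ j, j ∈ W) (hY : ∀ j, j ∈ Y) (q : Fin l) :
    q ∈ W.flatMap (substLetter h i Y) := by
  obtain ⟨j | t, rfl⟩ := (slot_bijective h i).2 q
  · exact List.mem_flatMap.2 ⟨j.1, hW _, by simp [substLetter, j.2]⟩
  · refine List.mem_flatMap.2 ⟨i, hW _, ?_⟩
    simp only [substLetter, dif_pos, Sum.elim_inr]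
    exact List.mem_map_of_mem (hY t)

namespace Word

/-- The word with one letter. -/
def one : Word 1 := ⟨[0], by decide, by decide⟩

/-- The empty word. -/
def empty : Word 0 := ⟨[], by decide, by decide⟩

/-- The word `x₀ x₁`. -/
def two : Word 2 := ⟨[0, 1], by decide, by decide⟩

/-- Relabelling the letters of a word. -/
def perm {n : ℕ} (σ : Equiv.Perm (Fin n)) (W : Word n) : Word n :=
  ⟨W.1.map σ, W.2.1.map σ.injective,
    fun j => List.mem_map.2 ⟨σ.symm j, W.2.2 _, σ.apply_symm_apply j⟩⟩

theorem perm_one {n : ℕ} (W : Word n) : perm 1 W = W := by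
  apply Subtype.ext
  simp [perm]

theorem perm_mul {n : ℕ} (σ τ : Equiv.Perm (Fin n)) (W : Word n) :
    perm (σ * τ) W = perm σ (perm τ W) := by
  apply Subtype.ext
  simp [perm]

/-- Substituting the word `Y` for the letter `i` of the word `W`. -/
def circ {m n l : ℕ} (h : l + 1 = m + n) (i : Fin m) (W : Word m) (Y : Word n) : Word l :=
  ⟨W.1.flatMap (substLetter h i Y.1), substLetter_nodup h i _ _ W.2.1 Y.2.1,
    mem_substLetter h i _ _ W.2.2 Y.2.2⟩

theorem circ_one {m : ℕ} (i : Fin m) (W : Word m) : circ (n := 1) rfl i W one = W := by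
  apply Subtype.ext
  have : ∀ j, substLetter (n := 1) (l := m) rfl i [0] j = [j] := by
    intro j
    unfold substLetter
    split_ifs with hj
    · subst hj
      simp [innerIdx]
    · have := Fin.val_ne_of_ne hj
      simp only [outerIdx, List.cons.injEq, and_true]
      apply Fin.ext
      simp
  simp only [circ, one]
  rw [show substLetter (n := 1) (l := m) rfl i [0] = fun j => [j] from funext this]
  exact List.flatMap_singleton' _

theorem one_circ {n : ℕ} (h : n + 1 = 1 + n) (W : Word n) : circ h 0 one W = W := by
  apply Subtype.ext
  have : (innerIdx h 0 : Fin n → Fin n) = id := by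
    funext t
    apply Fin.ext
    simp [innerIdx]
  simp [circ, one, substLetter, this]

theorem circ_seq {m n p l q r : ℕ} (h₁ : l + 1 = m + n) (h₂ : q + 1 = l + p)
    (h₃ : r + 1 = n + p) (h₄ : q + 1 = m + r) (i : Fin m) (j : Fin n) (x : Word m) (y : Word n)
    (z : Word p) :
    circ h₂ (innerIdx h₁ i j) (circ h₁ i x y) z = circ h₄ i x (circ h₃ j y z) := by
  apply Subtype.ext
  simp only [circ, List.flatMap_assoc]
  congr 1
  funext a
  by_cases ha : a = i
  · simp only [substLetter, ha, dif_pos, List.flatMap_map, List.map_flatMap]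
    congr 1
    funext b
    by_cases hb : b = j
    · subst hb
      simp only [dif_pos, List.map_map]
      congr 1
      funext c
      apply Fin.ext
      simp [innerIdx, add_assoc]
    · have hb' : innerIdx h₁ i b ≠ innerIdx h₁ i j := fun e => hb (innerIdx_injective h₁ i e)
      have := Fin.val_ne_of_ne hb
      simp only [hb, hb', dif_neg, not_false_eq_true, List.map_cons, List.map_nil,
        List.cons.injEq, and_true]
      apply Fin.ext
      simp only [innerIdx, outerIdx, add_lt_add_iff_left]
      split_ifs <;> omega
  · have := Fin.val_ne_of_ne ha
    have ha' : outerIdx h₁ i a ha ≠ innerIdx h₁ i j := by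
      intro e
      have := congrArg Fin.val e
      simp only [innerIdx, outerIdx] at this
      split_ifs at this <;> omega
    simp only [substLetter, ha, ha', dif_neg, not_false_eq_true, List.flatMap_cons,
      List.flatMap_nil, List.append_nil, List.cons.injEq, and_true]
    apply Fin.ext
    simp only [innerIdx, outerIdx]
    split_ifs <;> omega

theorem circ_par {m n p l l' q : ℕ} (h₁ : l + 1 = m + n) (h₂ : q + 1 = l + p)
    (h₃ : l' + 1 = m + p) (h₄ : q + 1 = l' + n) (i j : Fin m) (hij : j ≠ i)
    (x : Word m) (y : Word n) (z : Word p) :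
    circ h₂ (outerIdx h₁ i j hij) (circ h₁ i x y) z =
      circ h₄ (outerIdx h₃ j i hij.symm) (circ h₃ j x z) y := by
  have hij' := Fin.val_ne_of_ne hij
  have key : ∀ {n p l l' q : ℕ} (h₁ : l + 1 = m + n) (h₂ : q + 1 = l + p)
      (h₃ : l' + 1 = m + p) (h₄ : q + 1 = l' + n) (i j : Fin m) (hij : j ≠ i)
      (Y : List (Fin n)) (Z : List (Fin p)),
      (Y.map (innerIdx h₁ i)).flatMap (substLetter h₂ (outerIdx h₁ i j hij) Z) =
        Y.map (innerIdx h₄ (outerIdx h₃ j i hij.symm)) := by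
    intro n p l l' q h₁ h₂ h₃ h₄ i j hij Y Z
    have hij' := Fin.val_ne_of_ne hij
    have : ∀ t, substLetter h₂ (outerIdx h₁ i j hij) Z (innerIdx h₁ i t) =
        [innerIdx h₄ (outerIdx h₃ j i hij.symm) t] := by
      intro t
      have ht : innerIdx h₁ i t ≠ outerIdx h₁ i j hij := by
        intro e
        have := congrArg Fin.val e
        simp only [innerIdx, outerIdx] at this
        split_ifs at this <;> omega
      simp only [substLetter, ht, dif_neg, not_false_eq_true, List.cons.injEq, and_true]
      apply Fin.ext
      simp only [innerIdx, outerIdx]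
      split_ifs <;> omega
    rw [List.flatMap_map]
    simp only [this]
    exact List.map_eq_flatMap.symm
  apply Subtype.ext
  simp only [circ, List.flatMap_assoc]
  congr 1
  funext a
  by_cases ha : a = i
  · subst ha
    have e1 : substLetter h₁ a y.1 a = y.1.map (innerIdx h₁ a) := by simp [substLetter]
    have e2 : substLetter h₃ j z.1 a = [outerIdx h₃ j a hij.symm] := by
      simp [substLetter, hij.symm]
    rw [e1, e2, key h₁ h₂ h₃ h₄]
    simp [substLetter]
  · by_cases ha' : a = j
    · subst ha'
      have e1 : substLetter h₃ a z.1 a = z.1.map (innerIdx h₃ a) := by simp [substLetter]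
      have e2 : substLetter h₁ i y.1 a = [outerIdx h₁ i a ha] := by
        simp [substLetter, ha]
      rw [e1, e2, key h₃ h₄ h₁ h₂ a i hij.symm]
      simp [substLetter]
    · have h1 := Fin.val_ne_of_ne ha
      have h2 := Fin.val_ne_of_ne ha'
      have n1 : outerIdx h₁ i a ha ≠ outerIdx h₁ i j hij := by
        intro e
        have := (slot_bijective h₁ i).1 (a₁ := Sum.inl ⟨a, ha⟩) (a₂ := Sum.inl ⟨j, hij⟩) e
        cases this
        exact ha' rfl
      have n2 : outerIdx h₃ j a ha' ≠ outerIdx h₃ j i hij.symm := by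
        intro e
        have := (slot_bijective h₃ j).1 (a₁ := Sum.inl ⟨a, ha'⟩) (a₂ := Sum.inl ⟨i, hij.symm⟩) e
        cases this
        exact ha rfl
      simp only [substLetter, ha, ha', n1, n2, dif_neg, not_false_eq_true, List.flatMap_cons,
        List.flatMap_nil, List.append_nil, List.cons.injEq, and_true]
      apply Fin.ext
      simp only [outerIdx]
      split_ifs <;> omega

theorem circ_perm {m n l : ℕ} (h : l + 1 = m + n) (i : Fin m) (σ : Equiv.Perm (Fin m))
    (τ : Equiv.Perm (Fin n)) (x : Word m) (y : Word n) :
    circ h (σ i) (perm σ x) (perm τ y) = perm (blockPerm h i σ τ) (circ h i x y) := by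
  apply Subtype.ext
  simp only [circ, perm, List.flatMap_map, List.map_flatMap]
  congr 1
  funext a
  by_cases ha : a = i
  · subst ha
    simp only [substLetter, dif_pos, List.map_map]
    congr 1
    funext t
    exact (blockPerm_inner h a σ τ t).symm
  · have ha' : σ a ≠ σ i := fun e => ha (σ.injective e)
    simp [substLetter, ha, ha', blockPerm_outer]

end Word

/-- The one-degree grading: everything is in degree `0`. -/
def trivialGrading (k : Type u) [Field k] (V : Type w) [AddCommGroup V] [Module k V] :
    ℤ → Submodule k V :=
  fun a => if a = 0 then ⊤ else ⊥

theorem trivialGrading_zero (k : Type u) [Field k] {V : Type w} [AddCommGroup V] [Module k V]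
    (x : V) : x ∈ trivialGrading k V 0 := by
  simp [trivialGrading]

theorem eq_zero_of_mem_trivialGrading {k : Type u} [Field k] {V : Type w} [AddCommGroup V]
    [Module k V] {a : ℤ} {x : V} (hx : x ∈ trivialGrading k V a) (ha : a ≠ 0) : x = 0 := by
  simpa [trivialGrading, ha] using hx

theorem trivialGrading_internal (k : Type u) [Field k] (V : Type w) [AddCommGroup V]
    [Module k V] : DirectSum.IsInternal (trivialGrading k V) := by
  rw [DirectSum.isInternal_submodule_iff_iSupIndep_and_iSup_eq_top]
  constructor
  · intro a
    by_cases ha : a = 0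
    · have : (⨆ (j : ℤ) (_ : j ≠ a), trivialGrading k V j) = ⊥ := by
        simp only [iSup_eq_bot]
        intro j hj
        have hj0 : j ≠ 0 := fun e => hj (e.trans ha.symm)
        simp [trivialGrading, hj0]
      rw [this]
      exact disjoint_bot_right
    · have : trivialGrading k V a = ⊥ := by simp [trivialGrading, ha]
      rw [this]
      exact disjoint_bot_left
  · rw [eq_top_iff]
    exact le_iSup_of_le 0 (by simp [trivialGrading])

/-- The bilinear extension of a map on bases. -/
noncomputable def linearize₂ (k : Type u) [Field k] {S T U : Type*} (f : S → T → U) :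
    (S →₀ k) →ₗ[k] (T →₀ k) →ₗ[k] (U →₀ k) :=
  Finsupp.linearCombination k (fun s => Finsupp.lmapDomain k k (f s))

@[simp]
theorem linearize₂_single {k : Type u} [Field k] {S T U : Type*} (f : S → T → U) (s : S) (t : T)
    (a b : k) :
    linearize₂ k f (Finsupp.single s a) (Finsupp.single t b) =
      Finsupp.single (f s t) (a * b) := by
  simp only [linearize₂, Finsupp.linearCombination_single, LinearMap.smul_apply,
    Finsupp.lmapDomain_apply, Finsupp.mapDomain_single, Finsupp.smul_single, smul_eq_mul]

/-- The unitary associative operad `Ass₊`, concentrated in degree `0` with zero differential: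
`Ass₊(n)`, `n ≥ 0`, is the multilinear part of the free associative unital algebra on `n` letters
(the regular representation of `Σₙ`), and the partial compositions are substitutions. -/
noncomputable def AssPlus (k : Type u) [Field k] : DGOperad.{u, u} k where
  X n := Word n →₀ k
  gr n := trivialGrading k (Word n →₀ k)
  internal n := trivialGrading_internal k _
  one := Finsupp.single Word.one 1
  one_mem := trivialGrading_zero k _
  perm n :=
    { toFun := fun σ => Finsupp.lmapDomain k k (Word.perm σ)
      map_one' := by
        ext W : 2
        simp [Word.perm_one]
      map_mul' := fun σ τ => by
        ext W : 2
        simp [Word.perm_mul] }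
  perm_mem {n a} σ {x} hx := by
    by_cases ha : a = 0
    · subst ha
      exact trivialGrading_zero k _
    · rw [eq_zero_of_mem_trivialGrading hx ha, map_zero]
      exact zero_mem _
  circ h i := linearize₂ k (Word.circ h i)
  circ_mem {m n l} h i {a b x y} hx hy := by
    by_cases ha : a = 0
    · by_cases hb : b = 0
      · subst ha hb
        exact trivialGrading_zero k _
      · rw [eq_zero_of_mem_trivialGrading hy hb, map_zero]
        exact zero_mem _
    · rw [eq_zero_of_mem_trivialGrading hx ha, map_zero]
      exact zero_mem _
  circ_one {m} i x := by
    induction x using Finsupp.induction_linear with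
    | zero => simp
    | add x y hx hy => rw [map_add, LinearMap.add_apply, hx, hy]
    | single W c => simp [Word.circ_one]
  one_circ {n} h x := by
    induction x using Finsupp.induction_linear with
    | zero => simp
    | add x y hx hy => rw [map_add, hx, hy]
    | single W c => simp [Word.one_circ]
  circ_seq h₁ h₂ h₃ h₄ i j x y z := by
    induction x using Finsupp.induction_linear with
    | zero => simp
    | add x x' hx hx' => simp only [map_add, LinearMap.add_apply, hx, hx']
    | single W c =>
    induction y using Finsupp.induction_linear with
    | zero => simp
    | add y y' hy hy' => simp only [map_add, LinearMap.add_apply, hy, hy']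
    | single Y c' =>
    induction z using Finsupp.induction_linear with
    | zero => simp
    | add z z' hz hz' => simp only [map_add, hz, hz']
    | single Z c'' => simp only [linearize₂_single, Word.circ_seq h₁ h₂ h₃ h₄, mul_assoc]
  circ_par h₁ h₂ h₃ h₄ i j hij b c x y z hy hz := by
    by_cases hb : b = 0
    · subst hb
      rw [zero_mul, Int.negOnePow_zero, one_smul]
      clear hy hz
      induction x using Finsupp.induction_linear with
      | zero => simp
      | add x x' hx hx' => simp only [map_add, LinearMap.add_apply, hx, hx']
      | single W c =>
      induction y using Finsupp.induction_linear with
      | zero => simp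
      | add y y' hy hy' => simp only [map_add, LinearMap.add_apply, hy, hy']
      | single Y c' =>
      induction z using Finsupp.induction_linear with
      | zero => simp
      | add z z' hz hz' => simp only [map_add, LinearMap.add_apply, hz, hz']
      | single Z c'' =>
        simp only [linearize₂_single, Word.circ_par h₁ h₂ h₃ h₄ i j hij, mul_right_comm]
    · rw [eq_zero_of_mem_trivialGrading hy hb]
      simp
  circ_perm h i σ τ x y := by
    induction x using Finsupp.induction_linear with
    | zero => simp
    | add x x' hx hx' => simp only [map_add, LinearMap.add_apply, hx, hx']
    | single W c =>
    induction y using Finsupp.induction_linear with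
    | zero => simp
    | add y y' hy hy' => simp only [map_add, hy, hy']
    | single Y c' => simp [-Finsupp.single_mul, Word.circ_perm]
  d n := 0
  d_mem _ := zero_mem _
  d_d _ := rfl
  d_perm _ _ := by simp
  d_circ _ _ _ _ _ _ := by simp

/-! ### The operad of strictly unital `A∞`-algebras

The dg operad presented by a generator `u` of arity `0` and degree `0`, generators `mₙ` of arity
`n ≥ 2` and degree `2 - n`, and the relations
* `∂ u = 0` and `∂ mₙ = - ∑ (-1)^(r + s t) m_{r+1+t} ∘_{r+1} m_s`, where the sum runs over all
  `r + s + t = n` with `2 ≤ s ≤ n - 1`;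
* `m₂ ∘₁ u = id = m₂ ∘₂ u`, and `mₙ ∘ᵢ u = 0` for `n ≥ 3`. -/

/-- Formal operadic monomials in the generators. The generator `mul n` is `m_{n+2}`. -/
inductive Mon : ℕ → Type
  | unit : Mon 0
  | mul (n : ℕ) : Mon (n + 2)
  | one : Mon 1
  | perm {n : ℕ} (σ : Equiv.Perm (Fin n)) (x : Mon n) : Mon n
  | circ {m n l : ℕ} (h : l + 1 = m + n) (i : Fin m) (x : Mon m) (y : Mon n) : Mon l
  | diff {n : ℕ} (x : Mon n) : Mon n

namespace Mon

/-- The degree of a monomial. -/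
def deg : ∀ {n : ℕ}, Mon n → ℤ
  | _, unit => 0
  | _, mul n => -(n : ℤ)
  | _, one => 0
  | _, perm _ x => deg x
  | _, circ _ _ x y => deg x + deg y
  | _, diff x => deg x + 1

/-- Linear combinations of monomials. -/
abbrev Lin (k : Type u) [Field k] (n : ℕ) : Type u := Mon n →₀ k

variable {k : Type u} [Field k]

/-- A monomial, as a linear combination. -/
noncomputable def ι {n : ℕ} (x : Mon n) : Lin k n := Finsupp.single x 1

/-- Relabelling of linear combinations. -/
noncomputable def permL {n : ℕ} (σ : Equiv.Perm (Fin n)) : Lin k n →ₗ[k] Lin k n :=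
  Finsupp.lmapDomain k k (perm σ)

/-- Differential of linear combinations. -/
noncomputable def diffL {n : ℕ} : Lin k n →ₗ[k] Lin k n :=
  Finsupp.lmapDomain k k diff

/-- Partial composition of linear combinations. -/
noncomputable def circL {m n l : ℕ} (h : l + 1 = m + n) (i : Fin m) :
    Lin k m →ₗ[k] Lin k n →ₗ[k] Lin k l :=
  linearize₂ k (circ h i)

/-- The element `∑ (-1)^(r + s t) m_{r+1+t} ∘_{r+1} m_s` of arity `N + 2`, where the sum runs over
all `r + s + t = N + 2` with `2 ≤ s ≤ N + 1`.  In the code `s` is `s + 2`, and `r + 1 + t` is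
`N - s - 1 + 2`. -/
noncomputable def stasheffSum (k : Type u) [Field k] (N : ℕ) : Lin k (N + 2) :=
  ∑ s : Fin N, ∑ r : Fin (N - s.val - 1 + 2),
    ((r.val : ℤ) + ((s.val : ℤ) + 2) * ((N : ℤ) - s.val - r.val)).negOnePow •
      ι (circ (m := N - s.val - 1 + 2) (n := s.val + 2) (by omega) r
        (mul (N - s.val - 1)) (mul s.val))

/-- The elements which are declared to be zero: the axioms of a dg operad and the relations of the
presentation, and everything that follows by operadic operations. -/
inductive Rel (k : Type u) [Field k] : ∀ n, Lin k n → Prop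
  -- axioms of a graded operad
  | perm_one {n : ℕ} (x : Mon n) : Rel k n (ι (perm 1 x) - ι x)
  | perm_mul {n : ℕ} (σ τ : Equiv.Perm (Fin n)) (x : Mon n) :
      Rel k n (ι (perm (σ * τ) x) - ι (perm σ (perm τ x)))
  | circ_one {m : ℕ} (i : Fin m) (x : Mon m) :
      Rel k m (ι (circ (n := 1) rfl i x one) - ι x)
  | one_circ {n : ℕ} (h : n + 1 = 1 + n) (x : Mon n) : Rel k n (ι (circ h 0 one x) - ι x)
  | circ_seq {m n p l q r : ℕ} (h₁ : l + 1 = m + n) (h₂ : q + 1 = l + p) (h₃ : r + 1 = n + p)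
      (h₄ : q + 1 = m + r) (i : Fin m) (j : Fin n) (x : Mon m) (y : Mon n) (z : Mon p) :
      Rel k q (ι (circ h₂ (innerIdx h₁ i j) (circ h₁ i x y) z) -
        ι (circ h₄ i x (circ h₃ j y z)))
  | circ_par {m n p l l' q : ℕ} (h₁ : l + 1 = m + n) (h₂ : q + 1 = l + p)
      (h₃ : l' + 1 = m + p) (h₄ : q + 1 = l' + n) (i j : Fin m) (hij : j ≠ i)
      (x : Mon m) (y : Mon n) (z : Mon p) :
      Rel k q (ι (circ h₂ (outerIdx h₁ i j hij) (circ h₁ i x y) z) -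
        (deg y * deg z).negOnePow • ι (circ h₄ (outerIdx h₃ j i hij.symm) (circ h₃ j x z) y))
  | circ_perm {m n l : ℕ} (h : l + 1 = m + n) (i : Fin m) (σ : Equiv.Perm (Fin m))
      (τ : Equiv.Perm (Fin n)) (x : Mon m) (y : Mon n) :
      Rel k l (ι (circ h (σ i) (perm σ x) (perm τ y)) - ι (perm (blockPerm h i σ τ) (circ h i x y)))
  -- axioms of the differential
  | diff_diff {n : ℕ} (x : Mon n) : Rel k n (ι (diff (diff x)))
  | diff_perm {n : ℕ} (σ : Equiv.Perm (Fin n)) (x : Mon n) :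
      Rel k n (ι (diff (perm σ x)) - ι (perm σ (diff x)))
  | diff_circ {m n l : ℕ} (h : l + 1 = m + n) (i : Fin m) (x : Mon m) (y : Mon n) :
      Rel k l (ι (diff (circ h i x y)) -
        (ι (circ h i (diff x) y) + (deg x).negOnePow • ι (circ h i x (diff y))))
  -- the relations of the presentation
  | diff_unit : Rel k 0 (ι (diff unit))
  | diff_mul (N : ℕ) : Rel k (N + 2) (ι (diff (mul N)) + stasheffSum k N)
  | mul_two_unit (i : Fin 2) : Rel k 1 (ι (circ (n := 0) rfl i (mul 0) unit) - ι one)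
  | mul_unit (n : ℕ) (i : Fin (n + 1 + 2)) :
      Rel k (n + 2) (ι (circ (n := 0) rfl i (mul (n + 1)) unit))
  -- closure under the operations
  | perm {n : ℕ} (σ : Equiv.Perm (Fin n)) {v : Lin k n} : Rel k n v → Rel k n (permL σ v)
  | diff {n : ℕ} {v : Lin k n} : Rel k n v → Rel k n (diffL v)
  | circ_left {m n l : ℕ} (h : l + 1 = m + n) (i : Fin m) {v : Lin k m} (y : Mon n) :
      Rel k m v → Rel k l (circL h i v (ι y))
  | circ_right {m n l : ℕ} (h : l + 1 = m + n) (i : Fin m) (x : Mon m) {v : Lin k n} :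
      Rel k n v → Rel k l (circL h i (ι x) v)

/-- The operadic dg ideal generated by the relations. -/
noncomputable def relSpan (k : Type u) [Field k] (n : ℕ) : Submodule k (Lin k n) :=
  Submodule.span k {v | Rel k n v}

/-- Linear combinations of monomials of degree `a`. -/
noncomputable def homog (k : Type u) [Field k] (n : ℕ) (a : ℤ) : Submodule k (Lin k n) :=
  Finsupp.supported k k {x | deg x = a}

theorem ι_mem_homog {n : ℕ} (x : Mon n) : (ι x : Lin k n) ∈ homog k n (deg x) :=
  Finsupp.single_mem_supported k 1 rfl

theorem homog_eq_span (n : ℕ) (a : ℤ) :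
    homog k n a = Submodule.span k (ι '' {x : Mon n | deg x = a}) :=
  Finsupp.supported_eq_span_single k _

theorem permL_ι {n : ℕ} (σ : Equiv.Perm (Fin n)) (x : Mon n) :
    permL σ (ι x : Lin k n) = ι (perm σ x) := by
  simp [permL, ι]

theorem diffL_ι {n : ℕ} (x : Mon n) : diffL (ι x : Lin k n) = ι (diff x) := by
  simp [diffL, ι]

theorem circL_ι {m n l : ℕ} (h : l + 1 = m + n) (i : Fin m) (x : Mon m) (y : Mon n) :
    circL h i (ι x : Lin k m) (ι y) = ι (circ h i x y) := by
  simp [circL, ι]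

theorem lin_induction {n : ℕ} {p : Lin k n → Prop} (zero : p 0)
    (add : ∀ v w, p v → p w → p (v + w)) (smul : ∀ (c : k) v, p v → p (c • v))
    (basis : ∀ x, p (ι x)) (v : Lin k n) : p v := by
  induction v using Finsupp.induction_linear with
  | zero => exact zero
  | add v w hv hw => exact add v w hv hw
  | single x c =>
    have : (Finsupp.single x c : Lin k n) = c • ι x := by simp [ι]
    rw [this]
    exact smul c _ (basis x)

theorem homog_induction {n : ℕ} {a : ℤ} {p : Lin k n → Prop} (zero : p 0)
    (add : ∀ v w, p v → p w → p (v + w)) (smul : ∀ (c : k) v, p v → p (c • v))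
    (basis : ∀ x, deg x = a → p (ι x)) {v : Lin k n} (hv : v ∈ homog k n a) : p v := by
  rw [homog_eq_span] at hv
  induction hv using Submodule.span_induction with
  | mem v hv =>
    obtain ⟨x, hx, rfl⟩ := hv
    exact basis x hx
  | zero => exact zero
  | add v w _ _ hv hw => exact add v w hv hw
  | smul c v _ hv => exact smul c v hv

theorem permL_homog {n : ℕ} {a : ℤ} (σ : Equiv.Perm (Fin n)) {v : Lin k n}
    (hv : v ∈ homog k n a) : permL σ v ∈ homog k n a := by
  refine homog_induction (p := fun v => permL σ v ∈ homog k n a) ?_ ?_ ?_ ?_ hv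
  · simp
  · intro v w hv hw
    rw [map_add]
    exact add_mem hv hw
  · intro c v hv
    rw [map_smul]
    exact Submodule.smul_mem _ c hv
  · rintro x rfl
    rw [permL_ι]
    exact ι_mem_homog (perm σ x)

theorem diffL_homog {n : ℕ} {a : ℤ} {v : Lin k n}
    (hv : v ∈ homog k n a) : diffL v ∈ homog k n (a + 1) := by
  refine homog_induction (p := fun v => diffL v ∈ homog k n (a + 1)) ?_ ?_ ?_ ?_ hv
  · simp
  · intro v w hv hw
    rw [map_add]
    exact add_mem hv hw
  · intro c v hv
    rw [map_smul]
    exact Submodule.smul_mem _ c hv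
  · rintro x rfl
    rw [diffL_ι]
    exact ι_mem_homog (diff x)

theorem circL_homog {m n l : ℕ} (h : l + 1 = m + n) (i : Fin m) {a b : ℤ} {v : Lin k m}
    {w : Lin k n} (hv : v ∈ homog k m a) (hw : w ∈ homog k n b) :
    circL h i v w ∈ homog k l (a + b) := by
  refine homog_induction (p := fun v => circL h i v w ∈ homog k l (a + b)) ?_ ?_ ?_ ?_ hv
  · simp
  · intro v w hv hw
    rw [map_add, LinearMap.add_apply]
    exact add_mem hv hw
  · intro c v hv
    rw [map_smul, LinearMap.smul_apply]
    exact Submodule.smul_mem _ c hv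
  rintro x rfl
  refine homog_induction (p := fun w => circL h i (ι x) w ∈ homog k l (deg x + b)) ?_ ?_ ?_ ?_ hw
  · simp
  · intro v w hv hw
    rw [map_add]
    exact add_mem hv hw
  · intro c v hv
    rw [map_smul]
    exact Submodule.smul_mem _ c hv
  rintro y rfl
  rw [circL_ι]
  exact ι_mem_homog (circ h i x y)

theorem ι_mem_homog' {n : ℕ} {a : ℤ} (x : Mon n) (hx : deg x = a) :
    (ι x : Lin k n) ∈ homog k n a := hx ▸ ι_mem_homog x

theorem sign_smul_mem {V : Type w} [AddCommGroup V] [Module k V] (N : Submodule k V) (e : ℤˣ)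
    {x : V} (hx : x ∈ N) : e • x ∈ N := by
  rcases Int.units_eq_one_or e with rfl | rfl
  · rwa [one_smul]
  · rw [Units.neg_smul, one_smul]
    exact neg_mem hx

theorem stasheffSum_homog (N : ℕ) : stasheffSum k N ∈ homog k (N + 2) (-(N : ℤ) + 1) := by
  refine Submodule.sum_mem _ fun s _ => Submodule.sum_mem _ fun r _ => ?_
  refine sign_smul_mem _ _ (ι_mem_homog' _ ?_)
  have := s.2
  simp only [deg]
  omega

theorem Rel.homogeneous {n : ℕ} {v : Lin k n} (hv : Rel k n v) : ∃ a, v ∈ homog k n a := by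
  induction hv with
  | perm_one x => exact ⟨deg x, sub_mem (ι_mem_homog' _ (by simp [deg])) (ι_mem_homog x)⟩
  | perm_mul σ τ x =>
    exact ⟨deg x, sub_mem (ι_mem_homog' _ (by simp [deg])) (ι_mem_homog' _ (by simp [deg]))⟩
  | circ_one i x => exact ⟨deg x, sub_mem (ι_mem_homog' _ (by simp [deg])) (ι_mem_homog x)⟩
  | one_circ h x => exact ⟨deg x, sub_mem (ι_mem_homog' _ (by simp [deg])) (ι_mem_homog x)⟩
  | circ_seq h₁ h₂ h₃ h₄ i j x y z =>
    exact ⟨deg x + deg y + deg z, sub_mem (ι_mem_homog' _ (by simp only [deg]))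
      (ι_mem_homog' _ (by simp only [deg]; ring))⟩
  | circ_par h₁ h₂ h₃ h₄ i j hij x y z =>
    exact ⟨deg x + deg y + deg z, sub_mem (ι_mem_homog' _ (by simp only [deg]))
      (sign_smul_mem _ _ (ι_mem_homog' _ (by simp only [deg]; ring)))⟩
  | circ_perm h i σ τ x y =>
    exact ⟨deg x + deg y, sub_mem (ι_mem_homog' _ (by simp only [deg]))
      (ι_mem_homog' _ (by simp only [deg]))⟩
  | diff_diff x => exact ⟨_, ι_mem_homog _⟩
  | diff_perm σ x =>
    exact ⟨deg x + 1, sub_mem (ι_mem_homog' _ (by simp only [deg]))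
      (ι_mem_homog' _ (by simp only [deg]))⟩
  | diff_circ h i x y =>
    exact ⟨deg x + deg y + 1, sub_mem (ι_mem_homog' _ (by simp only [deg]))
      (add_mem (ι_mem_homog' _ (by simp only [deg]; ring))
        (sign_smul_mem _ _ (ι_mem_homog' _ (by simp only [deg]; ring))))⟩
  | diff_unit => exact ⟨_, ι_mem_homog _⟩
  | diff_mul N =>
    exact ⟨-(N : ℤ) + 1, add_mem (ι_mem_homog' _ (by simp only [deg])) (stasheffSum_homog N)⟩
  | mul_two_unit i =>
    exact ⟨0, sub_mem (ι_mem_homog' _ (by simp [deg])) (ι_mem_homog' _ (by simp only [deg]))⟩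
  | mul_unit n i => exact ⟨_, ι_mem_homog _⟩
  | perm σ _ ih => exact ⟨_, permL_homog σ ih.choose_spec⟩
  | diff _ ih => exact ⟨_, diffL_homog ih.choose_spec⟩
  | circ_left h i y _ ih => exact ⟨_, circL_homog h i ih.choose_spec (ι_mem_homog y)⟩
  | circ_right h i x _ ih => exact ⟨_, circL_homog h i (ι_mem_homog x) ih.choose_spec⟩

theorem permL_rel {n : ℕ} (σ : Equiv.Perm (Fin n)) :
    relSpan k n ≤ (relSpan k n).comap (permL σ) :=
  Submodule.span_le.2 fun _ hv => Submodule.subset_span (Rel.perm σ hv)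

theorem diffL_rel {n : ℕ} : relSpan k n ≤ (relSpan k n).comap diffL :=
  Submodule.span_le.2 fun _ hv => Submodule.subset_span (Rel.diff hv)

theorem circL_rel_left {m n l : ℕ} (h : l + 1 = m + n) (i : Fin m) {v : Lin k m}
    (hv : v ∈ relSpan k m) (w : Lin k n) : circL h i v w ∈ relSpan k l := by
  induction w using lin_induction with
  | zero => simp
  | add w w' hw hw' =>
    rw [map_add]
    exact add_mem hw hw'
  | smul c w hw =>
    rw [map_smul]
    exact Submodule.smul_mem _ c hw
  | basis y =>
    have : relSpan k m ≤ (relSpan k l).comap ((circL h i).flip (ι y)) :=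
      Submodule.span_le.2 fun _ hv => Submodule.subset_span (Rel.circ_left h i y hv)
    exact this hv

theorem circL_rel_right {m n l : ℕ} (h : l + 1 = m + n) (i : Fin m) (v : Lin k m) {w : Lin k n}
    (hw : w ∈ relSpan k n) : circL h i v w ∈ relSpan k l := by
  induction v using lin_induction with
  | zero => simp
  | add v v' hv hv' =>
    rw [map_add, LinearMap.add_apply]
    exact add_mem hv hv'
  | smul c v hv =>
    rw [map_smul, LinearMap.smul_apply]
    exact Submodule.smul_mem _ c hv
  | basis x =>
    have : relSpan k n ≤ (relSpan k l).comap (circL h i (ι x)) :=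
      Submodule.span_le.2 fun _ hv => Submodule.subset_span (Rel.circ_right h i x hv)
    exact this hw

/-- The projection to the part of degree `a`. -/
noncomputable def proj (k : Type u) [Field k] (n : ℕ) (a : ℤ) : Lin k n →ₗ[k] Lin k n :=
  Finsupp.lsum k fun x => if deg x = a then Finsupp.lsingle x else 0

theorem proj_ι {n : ℕ} (a : ℤ) (x : Mon n) :
    proj k n a (ι x) = if deg x = a then ι x else 0 := by
  simp only [proj, ι, Finsupp.lsum_single]
  split_ifs <;> simp

theorem proj_homog {n : ℕ} {a b : ℤ} {v : Lin k n} (hv : v ∈ homog k n b) :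
    proj k n a v = if b = a then v else 0 := by
  refine homog_induction (p := fun v => proj k n a v = if b = a then v else 0) ?_ ?_ ?_ ?_ hv
  · simp
  · intro v w hv hw
    rw [map_add, hv, hw]
    split_ifs <;> simp
  · intro c v hv
    rw [map_smul, hv]
    split_ifs <;> simp
  · rintro x rfl
    exact proj_ι a x

theorem proj_rel {n : ℕ} (a : ℤ) : relSpan k n ≤ (relSpan k n).comap (proj k n a) := by
  refine Submodule.span_le.2 fun v hv => ?_
  obtain ⟨b, hb⟩ := Rel.homogeneous hv
  simp only [Submodule.comap_coe, Set.mem_preimage, SetLike.mem_coe, proj_homog hb]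
  split_ifs
  · exact Submodule.subset_span hv
  · exact zero_mem _

/-- Arity `n` of the presented operad. -/
def Quo (k : Type u) [Field k] (n : ℕ) : Type u := Lin k n ⧸ relSpan k n

noncomputable instance (n : ℕ) : AddCommGroup (Quo k n) :=
  Submodule.Quotient.addCommGroup (relSpan k n)

noncomputable instance (n : ℕ) : Module k (Quo k n) :=
  Submodule.Quotient.module (relSpan k n)

/-- The class of a linear combination. -/
noncomputable def mk (k : Type u) [Field k] (n : ℕ) : Lin k n →ₗ[k] Quo k n :=
  (relSpan k n).mkQ

theorem mk_surjective (n : ℕ) : Function.Surjective (mk k n) :=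
  (relSpan k n).mkQ_surjective

theorem mk_eq_zero {n : ℕ} {v : Lin k n} : mk k n v = 0 ↔ v ∈ relSpan k n :=
  Submodule.Quotient.mk_eq_zero _

/-- Descent of linear maps to the quotient. -/
noncomputable def lift {n : ℕ} {V : Type w} [AddCommGroup V] [Module k V] (f : Lin k n →ₗ[k] V)
    (hf : ∀ v ∈ relSpan k n, f v = 0) : Quo k n →ₗ[k] V :=
  (relSpan k n).liftQ f hf

theorem lift_mk {n : ℕ} {V : Type w} [AddCommGroup V] [Module k V] (f : Lin k n →ₗ[k] V)
    (hf : ∀ v ∈ relSpan k n, f v = 0) (v : Lin k n) : lift f hf (mk k n v) = f v := rfl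

/-- The grading of the presented operad. -/
noncomputable def grading (k : Type u) [Field k] (n : ℕ) (a : ℤ) : Submodule k (Quo k n) :=
  (homog k n a).map (mk k n)

theorem grading_internal (k : Type u) [Field k] (n : ℕ) :
    DirectSum.IsInternal (grading k n) := by
  obtain ⟨π, hπ⟩ : ∃ π : ℤ → Quo k n →ₗ[k] Quo k n,
      ∀ a v, π a (mk k n v) = mk k n (proj k n a v) :=
    ⟨fun a => lift (mk k n ∘ₗ proj k n a) fun v hv => mk_eq_zero.2 (proj_rel a hv),
      fun a v => lift_mk _ _ v⟩
  have hproj : ∀ {a b : ℤ} {x : Quo k n}, x ∈ grading k n b →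
      π a x = if b = a then x else 0 := by
    rintro a b _ ⟨v, hv, rfl⟩
    rw [hπ, proj_homog hv]
    split_ifs
    · rfl
    · exact map_zero _
  rw [DirectSum.isInternal_submodule_iff_iSupIndep_and_iSup_eq_top]
  constructor
  · intro a
    rw [Submodule.disjoint_def]
    intro x hx hx'
    have h1 := hproj (a := a) hx
    rw [if_pos rfl] at h1
    have h2 : (⨆ (j : ℤ) (_ : j ≠ a), grading k n j) ≤ LinearMap.ker (π a) := by
      refine iSup₂_le fun j hj y hy => ?_
      rw [LinearMap.mem_ker, hproj hy, if_neg hj]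
    rw [← h1]
    exact h2 hx'
  · rw [eq_top_iff]
    rintro x -
    obtain ⟨v, rfl⟩ := mk_surjective n x
    induction v using lin_induction with
    | zero =>
      rw [map_zero]
      exact zero_mem _
    | add v w hv hw =>
      rw [map_add]
      exact add_mem hv hw
    | smul c v hv =>
      rw [map_smul]
      exact Submodule.smul_mem _ c hv
    | basis x =>
      exact Submodule.mem_iSup_of_mem (deg x) ⟨_, ι_mem_homog x, rfl⟩

/-- Partial composition in the presented operad. -/
noncomputable def circQ {m n l : ℕ} (h : l + 1 = m + n) (i : Fin m) :
    Quo k m →ₗ[k] Quo k n →ₗ[k] Quo k l :=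
  lift
    (LinearMap.flip
      (lift ((circL h i).compr₂ (mk k l)).flip fun w hw => LinearMap.ext fun v =>
        mk_eq_zero.2 (circL_rel_right h i v hw)))
    (fun v hv => LinearMap.ext fun w => by
      obtain ⟨w, rfl⟩ := mk_surjective n w
      exact mk_eq_zero.2 (circL_rel_left h i hv w))

theorem circQ_mk {m n l : ℕ} (h : l + 1 = m + n) (i : Fin m) (v : Lin k m) (w : Lin k n) :
    circQ h i (mk k m v) (mk k n w) = mk k l (circL h i v w) := rfl

/-- The class of a monomial. -/
noncomputable def cls (k : Type u) [Field k] {n : ℕ} (x : Mon n) : Quo k n :=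
  mk k n (ι x)

theorem circQ_cls {m n l : ℕ} (h : l + 1 = m + n) (i : Fin m) (x : Mon m) (y : Mon n) :
    circQ h i (cls k x) (cls k y) = cls k (circ h i x y) := by
  rw [cls, cls, circQ_mk, circL_ι, cls]

theorem quo_induction {n : ℕ} {p : Quo k n → Prop} (zero : p 0)
    (add : ∀ v w, p v → p w → p (v + w)) (smul : ∀ (c : k) v, p v → p (c • v))
    (basis : ∀ x, p (cls k x)) (v : Quo k n) : p v := by
  obtain ⟨v, rfl⟩ := mk_surjective n v
  induction v using lin_induction with
  | zero =>
    rw [map_zero]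
    exact zero
  | add v w hv hw =>
    rw [map_add]
    exact add _ _ hv hw
  | smul c v hv =>
    rw [map_smul]
    exact smul c _ hv
  | basis x => exact basis x

theorem grading_induction {n : ℕ} {a : ℤ} {p : Quo k n → Prop} (zero : p 0)
    (add : ∀ v w, p v → p w → p (v + w)) (smul : ∀ (c : k) v, p v → p (c • v))
    (basis : ∀ x, deg x = a → p (cls k x)) {v : Quo k n} (hv : v ∈ grading k n a) : p v := by
  obtain ⟨v, hv, rfl⟩ := hv
  refine homog_induction (p := fun v => p (mk k n v)) ?_ ?_ ?_ basis hv
  · rw [map_zero]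
    exact zero
  · intro v w hv hw
    rw [map_add]
    exact add _ _ hv hw
  · intro c v hv
    rw [map_smul]
    exact smul c _ hv

theorem mk_rel {n : ℕ} {v : Lin k n} (hv : Rel k n v) : mk k n v = 0 :=
  mk_eq_zero.2 (Submodule.subset_span hv)

theorem cls_eq {n : ℕ} {x y : Mon n} (hv : Rel k n (ι x - ι y)) : cls k x = cls k y := by
  have := mk_rel hv
  rwa [map_sub, sub_eq_zero] at this

theorem map_sign {V W : Type*} [AddCommGroup V] [Module k V] [AddCommGroup W] [Module k W]
    (f : V →ₗ[k] W) (e : ℤˣ) (x : V) : f (e • x) = e • f x := by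
  rcases Int.units_eq_one_or e with rfl | rfl <;> simp [Units.neg_smul]

theorem sign_comm {V : Type*} [AddCommGroup V] [Module k V] (e : ℤˣ) (c : k) (x : V) :
    e • c • x = c • e • x := by
  rcases Int.units_eq_one_or e with rfl | rfl <;> simp [Units.neg_smul]

/-- Relabelling in the presented operad. -/
noncomputable def permQ {n : ℕ} (σ : Equiv.Perm (Fin n)) : Quo k n →ₗ[k] Quo k n :=
  lift (mk k n ∘ₗ permL σ) fun _ hv => mk_eq_zero.2 (permL_rel σ hv)

/-- The differential of the presented operad. -/
noncomputable def diffQ {n : ℕ} : Quo k n →ₗ[k] Quo k n :=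
  lift (mk k n ∘ₗ diffL) fun _ hv => mk_eq_zero.2 (diffL_rel hv)

theorem permQ_cls {n : ℕ} (σ : Equiv.Perm (Fin n)) (x : Mon n) :
    permQ σ (cls k x) = cls k (perm σ x) := by
  rw [cls, cls, permQ, lift_mk, LinearMap.comp_apply, permL_ι]

theorem diffQ_cls {n : ℕ} (x : Mon n) : diffQ (cls k x) = cls k (diff x) := by
  rw [cls, cls, diffQ, lift_mk, LinearMap.comp_apply, diffL_ι]

theorem permQ_one {n : ℕ} : (permQ 1 : Quo k n →ₗ[k] Quo k n) = 1 := by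
  refine LinearMap.ext fun x => ?_
  induction x using quo_induction with
  | zero => simp
  | add v w hv hw => rw [map_add, map_add, hv, hw]
  | smul c v hv => rw [map_smul, map_smul, hv]
  | basis x =>
    rw [permQ_cls]
    exact cls_eq (Rel.perm_one x)

theorem permQ_mul {n : ℕ} (σ τ : Equiv.Perm (Fin n)) :
    (permQ (σ * τ) : Quo k n →ₗ[k] Quo k n) = permQ σ * permQ τ := by
  refine LinearMap.ext fun x => ?_
  induction x using quo_induction with
  | zero => simp
  | add v w hv hw => rw [map_add, map_add, hv, hw]
  | smul c v hv => rw [map_smul, map_smul, hv]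
  | basis x =>
    rw [Module.End.mul_apply, permQ_cls, permQ_cls, permQ_cls]
    exact cls_eq (Rel.perm_mul σ τ x)

theorem one_mem_grading : cls k one ∈ grading k 1 0 :=
  ⟨ι one, ι_mem_homog' one (by simp only [deg]), rfl⟩

theorem permQ_mem {n : ℕ} {a : ℤ} (σ : Equiv.Perm (Fin n)) {x : Quo k n}
    (hx : x ∈ grading k n a) : permQ σ x ∈ grading k n a := by
  obtain ⟨v, hv, rfl⟩ := hx
  exact ⟨permL σ v, permL_homog σ hv, rfl⟩

theorem diffQ_mem {n : ℕ} {a : ℤ} {x : Quo k n}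
    (hx : x ∈ grading k n a) : diffQ x ∈ grading k n (a + 1) := by
  obtain ⟨v, hv, rfl⟩ := hx
  exact ⟨diffL v, diffL_homog hv, rfl⟩

theorem circQ_mem {m n l : ℕ} (h : l + 1 = m + n) (i : Fin m) {a b : ℤ} {x : Quo k m}
    {y : Quo k n} (hx : x ∈ grading k m a) (hy : y ∈ grading k n b) :
    circQ h i x y ∈ grading k l (a + b) := by
  obtain ⟨v, hv, rfl⟩ := hx
  obtain ⟨w, hw, rfl⟩ := hy
  exact ⟨circL h i v w, circL_homog h i hv hw, rfl⟩

theorem circQ_one {m : ℕ} (i : Fin m) (x : Quo k m) :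
    circQ (n := 1) rfl i x (cls k one) = x := by
  induction x using quo_induction with
  | zero => simp
  | add v w hv hw => rw [map_add, LinearMap.add_apply, hv, hw]
  | smul c v hv => rw [map_smul, LinearMap.smul_apply, hv]
  | basis x =>
    rw [circQ_cls]
    exact cls_eq (Rel.circ_one i x)

theorem one_circQ {n : ℕ} (h : n + 1 = 1 + n) (x : Quo k n) : circQ h 0 (cls k one) x = x := by
  induction x using quo_induction with
  | zero => simp
  | add v w hv hw => rw [map_add, hv, hw]
  | smul c v hv => rw [map_smul, hv]
  | basis x =>
    rw [circQ_cls]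
    exact cls_eq (Rel.one_circ h x)

theorem circQ_seq {m n p l q r : ℕ} (h₁ : l + 1 = m + n) (h₂ : q + 1 = l + p)
    (h₃ : r + 1 = n + p) (h₄ : q + 1 = m + r) (i : Fin m) (j : Fin n) (x : Quo k m)
    (y : Quo k n) (z : Quo k p) :
    circQ h₂ (innerIdx h₁ i j) (circQ h₁ i x y) z = circQ h₄ i x (circQ h₃ j y z) := by
  induction x using quo_induction with
  | zero => simp
  | add v w hv hw => simp only [map_add, LinearMap.add_apply, hv, hw]
  | smul c v hv => simp only [map_smul, LinearMap.smul_apply, hv]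
  | basis x =>
  induction y using quo_induction with
  | zero => simp
  | add v w hv hw => simp only [map_add, LinearMap.add_apply, hv, hw]
  | smul c v hv => simp only [map_smul, LinearMap.smul_apply, hv]
  | basis y =>
  induction z using quo_induction with
  | zero => simp
  | add v w hv hw => simp only [map_add, hv, hw]
  | smul c v hv => simp only [map_smul, hv]
  | basis z =>
    simp only [circQ_cls]
    exact cls_eq (Rel.circ_seq h₁ h₂ h₃ h₄ i j x y z)

theorem circQ_par {m n p l l' q : ℕ} (h₁ : l + 1 = m + n) (h₂ : q + 1 = l + p)
    (h₃ : l' + 1 = m + p) (h₄ : q + 1 = l' + n) (i j : Fin m) (hij : j ≠ i) {b c : ℤ}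
    (x : Quo k m) (y : Quo k n) (z : Quo k p) (hy : y ∈ grading k n b)
    (hz : z ∈ grading k p c) :
    circQ h₂ (outerIdx h₁ i j hij) (circQ h₁ i x y) z =
      (b * c).negOnePow • circQ h₄ (outerIdx h₃ j i hij.symm) (circQ h₃ j x z) y := by
  induction x using quo_induction with
  | zero => simp
  | add v w hv hw => simp only [map_add, LinearMap.add_apply, hv, hw, smul_add]
  | smul c v hv => simp only [map_smul, LinearMap.smul_apply, hv, sign_comm]
  | basis x =>
  refine grading_induction (p := fun y => circQ h₂ (outerIdx h₁ i j hij)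
    (circQ h₁ i (cls k x) y) z = (b * c).negOnePow •
      circQ h₄ (outerIdx h₃ j i hij.symm) (circQ h₃ j (cls k x) z) y) ?_ ?_ ?_ ?_ hy
  · simp
  · intro v w hv hw
    simp only [map_add, LinearMap.add_apply, hv, hw, smul_add]
  · intro c v hv
    simp only [map_smul, LinearMap.smul_apply, hv, sign_comm]
  rintro y rfl
  refine grading_induction (p := fun z => circQ h₂ (outerIdx h₁ i j hij)
    (circQ h₁ i (cls k x) (cls k y)) z = (deg y * c).negOnePow •
      circQ h₄ (outerIdx h₃ j i hij.symm) (circQ h₃ j (cls k x) z) (cls k y)) ?_ ?_ ?_ ?_ hz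
  · simp
  · intro v w hv hw
    simp only [map_add, LinearMap.add_apply, hv, hw, smul_add]
  · intro c v hv
    simp only [map_smul, LinearMap.smul_apply, hv, sign_comm]
  rintro z rfl
  simp only [circQ_cls]
  have := mk_rel (Rel.circ_par (k := k) h₁ h₂ h₃ h₄ i j hij x y z)
  rwa [map_sub, sub_eq_zero, map_sign] at this

theorem circQ_perm {m n l : ℕ} (h : l + 1 = m + n) (i : Fin m) (σ : Equiv.Perm (Fin m))
    (τ : Equiv.Perm (Fin n)) (x : Quo k m) (y : Quo k n) :
    circQ h (σ i) (permQ σ x) (permQ τ y) = permQ (blockPerm h i σ τ) (circQ h i x y) := by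
  induction x using quo_induction with
  | zero => simp
  | add v w hv hw => simp only [map_add, LinearMap.add_apply, hv, hw]
  | smul c v hv => simp only [map_smul, LinearMap.smul_apply, hv]
  | basis x =>
  induction y using quo_induction with
  | zero => simp
  | add v w hv hw => simp only [map_add, hv, hw]
  | smul c v hv => simp only [map_smul, hv]
  | basis y =>
    simp only [permQ_cls, circQ_cls]
    exact cls_eq (Rel.circ_perm h i σ τ x y)

theorem diffQ_diffQ {n : ℕ} (x : Quo k n) : diffQ (diffQ x) = 0 := by
  induction x using quo_induction with
  | zero => simp
  | add v w hv hw => simp only [map_add, hv, hw, add_zero]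
  | smul c v hv => simp only [map_smul, hv, smul_zero]
  | basis x =>
    simp only [diffQ_cls]
    exact mk_rel (Rel.diff_diff x)

theorem diffQ_perm {n : ℕ} (σ : Equiv.Perm (Fin n)) (x : Quo k n) :
    diffQ (permQ σ x) = permQ σ (diffQ x) := by
  induction x using quo_induction with
  | zero => simp
  | add v w hv hw => simp only [map_add, hv, hw]
  | smul c v hv => simp only [map_smul, hv]
  | basis x =>
    simp only [permQ_cls, diffQ_cls]
    exact cls_eq (Rel.diff_perm σ x)

theorem diffQ_circ {m n l : ℕ} (h : l + 1 = m + n) (i : Fin m) {a : ℤ} (x : Quo k m)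
    (y : Quo k n) (hx : x ∈ grading k m a) :
    diffQ (circQ h i x y) = circQ h i (diffQ x) y + a.negOnePow • circQ h i x (diffQ y) := by
  induction y using quo_induction with
  | zero => simp
  | add v w hv hw =>
    simp only [map_add, hv, hw, smul_add]
    abel
  | smul c v hv => simp only [map_smul, hv, smul_add, sign_comm]
  | basis y =>
  refine grading_induction (p := fun x => diffQ (circQ h i x (cls k y)) =
    circQ h i (diffQ x) (cls k y) + a.negOnePow • circQ h i x (diffQ (cls k y))) ?_ ?_ ?_ ?_ hx
  · simp
  · intro v w hv hw
    simp only [map_add, LinearMap.add_apply, hv, hw, smul_add]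
    abel
  · intro c v hv
    simp only [map_smul, LinearMap.smul_apply, hv, smul_add, sign_comm]
  rintro x rfl
  simp only [diffQ_cls, circQ_cls]
  have := mk_rel (Rel.diff_circ (k := k) h i x y)
  rwa [map_sub, sub_eq_zero, map_add, map_sign] at this

end Mon

/-- The dg operad of strictly unital `A∞`-algebras (Burke's model of `Ass₊`): the dg operad
presented by the generators and relations above. -/
noncomputable def BurkeOperad (k : Type u) [Field k] : DGOperad.{u, u} k where
  X n := Mon.Quo k n
  gr n := Mon.grading k n
  internal n := Mon.grading_internal k n
  one := Mon.cls k Mon.one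
  one_mem := Mon.one_mem_grading
  perm _ :=
    { toFun := Mon.permQ
      map_one' := Mon.permQ_one
      map_mul' := Mon.permQ_mul }
  perm_mem := Mon.permQ_mem
  circ := Mon.circQ
  circ_mem := Mon.circQ_mem
  circ_one := Mon.circQ_one
  one_circ := Mon.one_circQ
  circ_seq := Mon.circQ_seq
  circ_par := Mon.circQ_par
  circ_perm := Mon.circQ_perm
  d _ := Mon.diffQ
  d_mem := Mon.diffQ_mem
  d_d := Mon.diffQ_diffQ
  d_perm := Mon.diffQ_perm
  d_circ := Mon.diffQ_circ

/-- The strict unit, an operation of arity `0`. -/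
noncomputable def BurkeOperad.unit (k : Type u) [Field k] : (BurkeOperad k).X 0 :=
  Mon.cls k Mon.unit

/-- The operation `m_{n+2}`. -/
noncomputable def BurkeOperad.mul (k : Type u) [Field k] (n : ℕ) : (BurkeOperad k).X (n + 2) :=
  Mon.cls k (Mon.mul n)

/-- The unit of `Ass₊`. -/
noncomputable def AssPlus.unit (k : Type u) [Field k] : (AssPlus k).X 0 :=
  Finsupp.single Word.empty 1

/-- The product `x₀ x₁` of `Ass₊`. -/
noncomputable def AssPlus.mul (k : Type u) [Field k] : (AssPlus k).X 2 :=
  Finsupp.single Word.two 1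

/-! ### Algebras over an operad with chosen operations -/

/-- The strictly unital `A∞`-structure `S` on (the graded vector space underlying) `A` consists of
the differential of `A` and of the operations by which `e ∈ P(0)` and `μ n ∈ P(n + 2)` act on the
`P`-algebra `A`. -/
structure OperadAlgebra.Realizes {k : Type u} [Field k] {P : DGOperad.{u, v} k}
    {A : Cochain.{u, w} k} (α : OperadAlgebra P A) (e : P.X 0) (μ : ∀ n, P.X (n + 2))
    (S : StrictlyUnitalAInfinity A.gr) : Prop where
  d_eq : ∀ x, S.m 1 ![x] = A.d x
  unit_eq : S.unit = α.act 0 e ![]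
  m_eq : ∀ n, S.m (n + 2) = α.act (n + 2) (μ n)

end StrictUnits

/-!
The operad `suA∞` is given by generators and relations, so that nothing about its size is visible
from its definition. It is made explicit by letting it act on a concrete algebra. The planar trees
with leaves labelled by natural numbers form a basis of the free `A∞`-algebra on `ℕ`, in which `mₙ`
joins `n` trees at a new root; making the leaf `0` a strict unit by decree turns this space into a
strictly unital `A∞`-algebra. In the bar construction the signs `(-1)^(r + s t)` disappear, and the
Stasheff relations say that the differential `Pl.D`, which splits the vertices of trees in all
possible ways, squares to zero.

*Freeness.* Any monomial in the `μₙ` can be rewritten, by the operad axioms and up to sign, as a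
relabelling of a normal form (`Tm.exists_planar`), and normal forms are determined by their trees
(`Tm.Planar.tree_injective`). Hence two monomials with the same tree agree up to a sign in every
operad, and this sign is the one that is read off from the action on trees. Evaluation at the
labels `1, …, n` is therefore injective on `suA∞(n)` for `n ≥ 1` (`BurkeOperad.toTrees_injective`),
which shows at the same time that the positive arity part of `suA∞` is free as a graded operad
(`BurkeOperad.isFreeUnitary`) and identifies `suA∞(n)` with a complex of trees.

*Cohomology.* Detaching the first leaf of a tree and attaching it again at the root is homotopic to
the identity (`Pl.homotopy_spec`). By induction on the number of leaves, each cocycle is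
cohomologous to a combination of right combs, one for each order of the labels (`Pl.exists_comb`).
These correspond to the basis of `Ass₊(n)`, so that the augmentation is a quasi-isomorphism
(`BurkeOperad.quasiIsoOn_augmentation`) and a Sullivan minimal model
(`BurkeOperad.isSullivanMinimalModel_augmentation`).

*Uniqueness.* Let `ρ : P → Ass₊` be a Sullivan minimal model. The augmentation lifts along `ρ`
generator by generator (`exists_lift_augmentation`). The image of `μₙ`, `n ≥ 3`, must solve the
Stasheff equation and also have zero restrictions. For the second condition, composition with the
image of `μ₂` provides degeneracies which split the restrictions, as in the normalisation of
simplicial modules; a solution of the first equation can be corrected by these, without changing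
its boundary (`exists_normalized`). A morphism of minimal models over `Ass₊` is bijective by
induction on the arity: the boundaries in arity `n + 1` lie in the suboperads generated in smaller
arities, where bijectivity is known, and both operads have the same cohomology
(`bijective_of_augmentation`).

*Algebras.* Sign conventions aside, the relations of `suA∞` in an endomorphism operad are the
axioms of a strictly unital `A∞`-algebra (`stasheff_eq`). Operations satisfying them extend to an
action of all of `suA∞`, and this extension is unique as the `μₙ` and `u` generate; the same
argument applies to morphisms (`OperadAlgebra.existsUnique_structure`,
`OperadAlgebra.existsUnique_algebra`, `algebra_morphism_iff`).
-/

namespace StrictUnits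

/-! ### Inserting a tuple into a tuple -/

section Plug

variable {m n p l l' q r : ℕ}

theorem plug_self {V : Type w} (h : l + 1 = m + n) (i : Fin m) (g : (Fin n → V) → V)
    (a : Fin l → V) : plug h i g a i = g fun t => a (innerIdx h i t) := by
  simp [plug]

theorem plug_of_ne {V : Type w} (h : l + 1 = m + n) (i : Fin m) (g : (Fin n → V) → V)
    (a : Fin l → V) {j : Fin m} (hj : j ≠ i) : plug h i g a j = a (outerIdx h i j hj) := by
  simp [plug, hj]

theorem outerIdx_ne_innerIdx (h : l + 1 = m + n) (i : Fin m) {j : Fin m} (hj : j ≠ i)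
    (t : Fin n) : outerIdx h i j hj ≠ innerIdx h i t := fun e => by
  have := (slot_bijective h i).1 (a₁ := Sum.inl ⟨j, hj⟩) (a₂ := Sum.inr t) e
  cases this

theorem outerIdx_injective (h : l + 1 = m + n) (i : Fin m) {j j' : Fin m} {hj : j ≠ i}
    {hj' : j' ≠ i} (e : outerIdx h i j hj = outerIdx h i j' hj') : j = j' := by
  have := (slot_bijective h i).1 (a₁ := Sum.inl ⟨j, hj⟩) (a₂ := Sum.inl ⟨j', hj'⟩) e
  simpa using this

/-- The inputs of `x ∘ᵢ y` are the inputs of `x` other than `i` and the inputs of `y`. -/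
theorem slot_cases (h : l + 1 = m + n) (i : Fin m) (s : Fin l) :
    (∃ j, ∃ hj : j ≠ i, s = outerIdx h i j hj) ∨ ∃ t, s = innerIdx h i t := by
  obtain ⟨j | t, rfl⟩ := (slot_bijective h i).2 s
  · exact Or.inl ⟨j.1, j.2, rfl⟩
  · exact Or.inr ⟨t, rfl⟩

theorem plug_update_outer {V : Type w} (h : l + 1 = m + n) (i : Fin m) (g : (Fin n → V) → V)
    (a : Fin l → V) (j : Fin m) (hj : j ≠ i) (x : V) :
    plug h i g (Function.update a (outerIdx h i j hj) x) =
      Function.update (plug h i g a) j x := by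
  funext s
  by_cases hs : s = i
  · subst hs
    rw [plug_self, Function.update_of_ne hj.symm, plug_self]
    congr 1
    funext t
    rw [Function.update_of_ne (outerIdx_ne_innerIdx h s hj t).symm]
  · rw [plug_of_ne h i g _ hs]
    by_cases hsj : s = j
    · subst hsj
      rw [Function.update_self, Function.update_self]
    · rw [Function.update_of_ne hsj, plug_of_ne h i g _ hs,
        Function.update_of_ne fun e => hsj (outerIdx_injective h i e)]

theorem plug_update_inner {V : Type w} (h : l + 1 = m + n) (i : Fin m) (g : (Fin n → V) → V)
    (a : Fin l → V) (t : Fin n) (x : V) :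
    plug h i g (Function.update a (innerIdx h i t) x) =
      Function.update (plug h i g a) i
        (g (Function.update (fun t => a (innerIdx h i t)) t x)) := by
  funext s
  by_cases hs : s = i
  · subst hs
    rw [plug_self, Function.update_self]
    congr 1
    funext t'
    by_cases ht : t' = t
    · subst ht
      rw [Function.update_self, Function.update_self]
    · rw [Function.update_of_ne ht,
        Function.update_of_ne fun e => ht (innerIdx_injective h s e)]
  · rw [plug_of_ne h i g _ hs, Function.update_of_ne hs, plug_of_ne h i g _ hs,
      Function.update_of_ne (outerIdx_ne_innerIdx h i hs t)]

/-- The form in which the sequential associativity of partial compositions enters for multilinear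
operations. -/
theorem plug_plug_seq {V : Type w} (h₁ : l + 1 = m + n) (h₂ : q + 1 = l + p)
    (h₃ : r + 1 = n + p) (h₄ : q + 1 = m + r) (i : Fin m) (j : Fin n)
    (Y : (Fin n → V) → V) (Z : (Fin p → V) → V) (a : Fin q → V) :
    plug h₁ i Y (plug h₂ (innerIdx h₁ i j) Z a) =
      plug h₄ i (fun c => Y (plug h₃ j Z c)) a := by
  funext s
  by_cases hs : s = i
  · subst hs
    rw [plug_self, plug_self]
    congr 1
    funext t
    by_cases ht : t = j
    · subst ht
      rw [plug_self, plug_self]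
      congr 1
      funext t'
      congr 1
      apply Fin.ext
      simp only [innerIdx]
      omega
    · rw [plug_of_ne h₃ j Z _ ht, plug_of_ne h₂ _ Z _
        fun e => ht (innerIdx_injective h₁ s e)]
      congr 1
      have := Fin.val_ne_of_ne ht
      apply Fin.ext
      simp only [innerIdx, outerIdx, add_lt_add_iff_left]
      split_ifs <;> omega
  · have hs' := outerIdx_ne_innerIdx h₁ i hs j
    rw [plug_of_ne _ _ _ _ hs, plug_of_ne _ _ _ _ hs', plug_of_ne _ _ _ _ hs]
    congr 1
    have := Fin.val_ne_of_ne hs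
    apply Fin.ext
    simp only [innerIdx, outerIdx]
    split_ifs <;> omega

/-- The form in which the parallel associativity of partial compositions enters for multilinear
operations. -/
theorem plug_plug_par {V : Type w} (h₁ : l + 1 = m + n) (h₂ : q + 1 = l + p)
    (h₃ : l' + 1 = m + p) (h₄ : q + 1 = l' + n) (i j : Fin m) (hij : j ≠ i)
    (Y : (Fin n → V) → V) (Z : (Fin p → V) → V) (a : Fin q → V) :
    plug h₁ i Y (plug h₂ (outerIdx h₁ i j hij) Z a) =
      plug h₃ j Z (plug h₄ (outerIdx h₃ j i hij.symm) Y a) := by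
  have hij' := Fin.val_ne_of_ne hij
  funext s
  by_cases hs : s = i
  · subst hs
    rw [plug_self, plug_of_ne _ _ _ _ hij.symm, plug_self]
    congr 1
    funext t
    rw [plug_of_ne _ _ _ _ (outerIdx_ne_innerIdx h₁ s hij t).symm]
    congr 1
    apply Fin.ext
    simp only [innerIdx, outerIdx]
    split_ifs <;> omega
  · by_cases hs' : s = j
    · subst hs'
      rw [plug_self, plug_of_ne _ _ _ _ hij, plug_self]
      congr 1
      funext t
      rw [plug_of_ne _ _ _ _ (outerIdx_ne_innerIdx h₃ s hij.symm t).symm]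
      congr 1
      apply Fin.ext
      simp only [innerIdx, outerIdx]
      split_ifs <;> omega
    · rw [plug_of_ne _ _ _ _ hs, plug_of_ne _ _ _ _ hs',
        plug_of_ne _ _ _ _ fun e => hs' (outerIdx_injective h₁ i e),
        plug_of_ne _ _ _ _ fun e => hs (outerIdx_injective h₃ j e)]
      congr 1
      have h1 := Fin.val_ne_of_ne hs
      have h2 := Fin.val_ne_of_ne hs'
      apply Fin.ext
      simp only [outerIdx]
      split_ifs <;> omega

theorem plug_comp_blockPerm {V : Type w} (h : l + 1 = m + n) (i : Fin m)
    (σ : Equiv.Perm (Fin m)) (τ : Equiv.Perm (Fin n)) (Y : (Fin n → V) → V) (a : Fin l → V) :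
    plug h i Y (fun s => a (blockPerm h i σ τ s)) =
      fun s => plug h (σ i) (fun c => Y fun t => c (τ t)) a (σ s) := by
  funext s
  by_cases hs : s = i
  · subst hs
    simp only [plug_self, blockPerm_inner]
  · rw [plug_of_ne _ _ _ _ hs, plug_of_ne _ _ _ _ fun e => hs (σ.injective e),
      blockPerm_outer]

@[to_additive]
theorem prod_slot {M : Type w} [CommMonoid M] (h : l + 1 = m + n) (i : Fin m) (F : Fin l → M) :
    ∏ s, F s = ∏ j : Fin m,
      if hj : j = i then ∏ t, F (innerIdx h i t) else F (outerIdx h i j hj) := by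
  rw [← (slotEquiv h i).prod_comp, Fintype.prod_sum_type]
  rw [← Finset.prod_erase_mul _ _ (Finset.mem_univ i), dif_pos rfl,
    Finset.prod_subtype (p := fun j => j ≠ i) _ (by simp)]
  congr 1
  refine Finset.prod_congr rfl fun j _ => ?_
  rw [dif_neg j.2]
  rfl

end Plug

/-! ### Koszul signs -/

section Koszul

theorem degBefore_add {m n l : ℕ} (h : l + 1 = m + n) (i : Fin m) (deg : Fin l → ℤ) {j : ℕ}
    (hj : j ≤ n) :
    degBefore deg (i.val + j) =
      degBefore deg i.val + degBefore (fun t => deg (innerIdx h i t)) j := by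
  simp only [degBefore]
  rw [sum_slot h i, sum_slot h i]
  rw [← Finset.sum_erase_add _ _ (Finset.mem_univ i), ← Finset.sum_erase_add _ _ (Finset.mem_univ i),
    dif_pos rfl, dif_pos rfl, add_assoc]
  congr 1
  · refine Finset.sum_congr rfl fun s hs => ?_
    have hs := Finset.ne_of_mem_erase hs
    rw [dif_neg hs, dif_neg hs]
    have := Fin.val_ne_of_ne hs
    simp only [outerIdx]
    congr 1
    split_ifs <;> simp <;> omega
  · rw [← Finset.sum_add_distrib]
    refine Finset.sum_congr rfl fun t _ => ?_
    simp [innerIdx]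

/-- The degrees of the entries of `plug h i g v` in terms of those of `v`, where `g` has degree
`b`. -/
def plugDeg {m n l : ℕ} (h : l + 1 = m + n) (i : Fin m) (b : ℤ) (deg : Fin l → ℤ) : Fin m → ℤ :=
  plug h i (fun c => b + ∑ t, c t) deg

theorem sum_plugDeg {m n l : ℕ} (h : l + 1 = m + n) (i : Fin m) (b : ℤ) (deg : Fin l → ℤ) :
    ∑ j, plugDeg h i b deg j = b + ∑ s, deg s := by
  rw [sum_slot h i, ← Finset.sum_erase_add _ _ (Finset.mem_univ i),
    ← Finset.sum_erase_add _ _ (Finset.mem_univ i), dif_pos rfl, plugDeg, plug_self]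
  rw [Finset.sum_congr rfl (g := fun j => if hj : j = i then ∑ t, deg (innerIdx h i t) else
    deg (outerIdx h i j hj))]
  · ring
  · intro j hj
    have hj := Finset.ne_of_mem_erase hj
    rw [plug_of_ne _ _ _ _ hj, dif_neg hj]

theorem degBefore_plugDeg_of_le {m n l : ℕ} (h : l + 1 = m + n) (i : Fin m) (b : ℤ)
    (deg : Fin l → ℤ) {r : ℕ} (hr : r ≤ i.val) :
    degBefore (plugDeg h i b deg) r = degBefore deg r := by
  simp only [degBefore]
  rw [sum_slot h i]
  refine Finset.sum_congr rfl fun j _ => ?_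
  by_cases hj : j = i
  · subst hj
    rw [dif_pos rfl, if_neg (by omega)]
    symm
    refine Finset.sum_eq_zero fun t _ => ?_
    rw [if_neg]
    simp only [innerIdx]
    omega
  · have := Fin.val_ne_of_ne hj
    rw [dif_neg hj, plugDeg, plug_of_ne _ _ _ _ hj]
    congr 1
    simp only [outerIdx, eq_iff_iff]
    split_ifs <;> omega

theorem degBefore_plugDeg_of_lt {m n l : ℕ} (h : l + 1 = m + n) (i : Fin m) (b : ℤ)
    (deg : Fin l → ℤ) {r : ℕ} (hr : i.val < r) :
    degBefore (plugDeg h i b deg) r = b + degBefore deg (r + n - 1) := by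
  simp only [degBefore]
  rw [sum_slot h i, ← Finset.sum_erase_add _ _ (Finset.mem_univ i),
    ← Finset.sum_erase_add _ _ (Finset.mem_univ i), dif_pos rfl, if_pos hr, plugDeg, plug_self]
  rw [Finset.sum_congr rfl (g := fun j => if hj : j = i then ∑ t, (if (innerIdx h i t).val <
    r + n - 1 then deg (innerIdx h i t) else 0) else
    if (outerIdx h i j hj).val < r + n - 1 then deg (outerIdx h i j hj) else 0)]
  · rw [Finset.sum_congr rfl (g := fun t => deg (innerIdx h i t))
      (s₁ := Finset.univ (α := Fin n))]
    · ring
    · intro t _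
      rw [if_pos]
      simp only [innerIdx]
      omega
  · intro j hj
    have hj := Finset.ne_of_mem_erase hj
    have := Fin.val_ne_of_ne hj
    rw [plug_of_ne _ _ _ _ hj, dif_neg hj]
    congr 1
    simp only [outerIdx, eq_iff_iff]
    split_ifs <;> omega

theorem negOnePow_sum {κ : Type*} (s : Finset κ) (F : κ → ℤ) :
    (∑ j ∈ s, F j).negOnePow = ∏ j ∈ s, (F j).negOnePow := by
  classical
  induction s using Finset.induction_on with
  | empty => simp
  | insert a s ha ih => rw [Finset.sum_insert ha, Finset.prod_insert ha, Int.negOnePow_add, ih]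

/-- The Koszul sign of passing from the order of an index set induced by `f` to the order induced
by `g`: a product over the pairs on which the two orders disagree. -/
def orderSign {ι α β : Type*} [Fintype ι] [LinearOrder α] [LinearOrder β] (f : ι → α) (g : ι → β)
    (deg : ι → ℤ) : ℤˣ :=
  ∏ a, ∏ b, if f a < f b ∧ g b < g a then (deg a * deg b).negOnePow else 1

section orderSign

variable {ι α β γ : Type*} [Fintype ι] [LinearOrder α] [LinearOrder β] [LinearOrder γ]

/-- A product over ordered pairs, collected over the pairs on which `f` is increasing. -/
@[to_additive]
theorem prod_pairs {M : Type*} [CommMonoid M] {f : ι → α} (hf : f.Injective) (F : ι → ι → M)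
    (hF : ∀ a, F a a = 1) :
    ∏ a, ∏ b, F a b = ∏ a, ∏ b, if f a < f b then F a b * F b a else 1 := by
  have h1 : ∀ a b, F a b = (if f a < f b then F a b else 1) * (if f b < f a then F a b else 1) := by
    intro a b
    rcases lt_trichotomy (f a) (f b) with h | h | h
    · simp [h, h.le]
    · simp [hf h, hF]
    · simp [h, h.le]
  have h2 : ∏ a, ∏ b, (if f b < f a then F a b else 1) =
      ∏ a, ∏ b, (if f a < f b then F b a else 1) := Finset.prod_comm
  simp_rw [ite_mul_one]
  rw [Finset.prod_congr rfl fun a _ => Finset.prod_congr rfl fun b _ => h1 a b]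
  simp_rw [Finset.prod_mul_distrib]
  rw [h2]

theorem orderSign_trans {f : ι → α} {g : ι → β} {e : ι → γ} (hf : f.Injective)
    (hg : g.Injective) (he : e.Injective) (deg : ι → ℤ) :
    orderSign f g deg * orderSign g e deg = orderSign f e deg := by
  simp only [orderSign]
  rw [prod_pairs hf, prod_pairs hf (fun a b => if g a < g b ∧ e b < e a then _ else 1),
    prod_pairs hf (fun a b => if f a < f b ∧ e b < e a then _ else 1)]
  · simp_rw [← Finset.prod_mul_distrib]
    refine Finset.prod_congr rfl fun a _ => Finset.prod_congr rfl fun b _ => ?_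
    by_cases hab : f a < f b
    · have hne : a ≠ b := fun h => by simp [h] at hab
      have hs : (deg a * deg b).negOnePow * (deg a * deg b).negOnePow = 1 :=
        Int.units_mul_self _
      rw [mul_comm (deg b) (deg a)]
      rcases lt_or_gt_of_ne (hg.ne hne) with h1 | h1 <;>
        rcases lt_or_gt_of_ne (he.ne hne) with h2 | h2 <;>
        simp [hab, h1, h2, not_lt_of_gt h1, not_lt_of_gt h2,
          not_lt_of_gt hab, hs]
    · simp [hab]
  all_goals simp

theorem orderSign_self (f : ι → α) (deg : ι → ℤ) : orderSign f f deg = 1 := by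
  refine Finset.prod_eq_one fun a _ => Finset.prod_eq_one fun b _ => ?_
  rw [if_neg]
  rintro ⟨h1, h2⟩
  exact absurd h1 (not_lt_of_gt h2)

theorem orderSign_comp {κ : Type*} [Fintype κ] (e : κ ≃ ι) (f : ι → α) (g : ι → β)
    (deg : ι → ℤ) :
    orderSign (fun a => f (e a)) (fun a => g (e a)) (fun a => deg (e a)) =
      orderSign f g deg := by
  simp only [orderSign]
  rw [← e.prod_comp]
  exact Finset.prod_congr rfl fun a _ =>
    e.prod_comp fun b => if f (e a) < f b ∧ g b < g (e a) then
      (deg (e a) * deg b).negOnePow else 1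

/-- When the degree of `i` grows by `b`, the sign changes by `b` times the degrees of the elements
which are below `i` in exactly one of the two orders. -/
theorem orderSign_update [DecidableEq ι] {f : ι → α} {g : ι → β} (hf : f.Injective)
    (hg : g.Injective) (deg : ι → ℤ) (i : ι) (b : ℤ) :
    orderSign f g (Function.update deg i (b + deg i)) = orderSign f g deg *
      ((b * ∑ j, if f j < f i then Function.update deg i 0 j else 0).negOnePow *
        (b * ∑ j, if g j < g i then Function.update deg i 0 j else 0).negOnePow) := by
  have h1 : ∀ (P : ι → Prop) [DecidablePred P],
      (b * ∑ j, if P j then Function.update deg i 0 j else 0).negOnePow =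
        ∏ j, if P j then (b * Function.update deg i 0 j).negOnePow else 1 := by
    intro P _
    rw [Finset.mul_sum, negOnePow_sum]
    refine Finset.prod_congr rfl fun j _ => ?_
    split_ifs <;> simp
  rw [h1, h1, ← Finset.prod_mul_distrib]
  simp only [orderSign]
  rw [prod_pairs hf, prod_pairs hf (fun a c => if f a < f c ∧ g c < g a then
    (deg a * deg c).negOnePow else 1)]
  · have h2 : ∀ F : ι → ℤˣ, F i = 1 → ∏ j, F j =
        ∏ a, ∏ c, if f a < f c then (if a = i then F c else 1) * (if c = i then F a else 1)
          else 1 := by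
      intro F hF
      rw [← prod_pairs hf (fun a c => if a = i then F c else 1)]
      · simp
      · intro a
        split_ifs with h
        · rw [h, hF]
        · rfl
    rw [h2 (fun j => (if f j < f i then (b * Function.update deg i 0 j).negOnePow else 1) *
      if g j < g i then (b * Function.update deg i 0 j).negOnePow else 1) (by simp)]
    simp_rw [← Finset.prod_mul_distrib]
    refine Finset.prod_congr rfl fun a _ => Finset.prod_congr rfl fun c _ => ?_
    by_cases hac : f a < f c
    · have hne : a ≠ c := fun h => by simp [h] at hac
      have hs : ∀ x y z : ℤ, (x * (y + z)).negOnePow = (x * y).negOnePow * (x * z).negOnePow := by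
        intro x y z
        rw [mul_add, Int.negOnePow_add]
      have hs' : ∀ x y z : ℤ, ((y + z) * x).negOnePow = (y * x).negOnePow * (z * x).negOnePow := by
        intro x y z
        rw [add_mul, Int.negOnePow_add]
      simp only [hac, not_lt_of_gt hac, if_true, true_and, false_and, if_false, mul_one]
      by_cases ha : a = i
      · subst ha
        rcases lt_or_gt_of_ne (hg.ne hne) with h1 | h1
        · simp [hne.symm, not_lt_of_gt h1, not_lt_of_gt hac]
        · simp [hne.symm, h1, not_lt_of_gt hac, hs', mul_comm (b * deg c).negOnePow]
      · by_cases hc : c = i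
        · subst hc
          rcases lt_or_gt_of_ne (hg.ne hne) with h1 | h1
          · simp [hne, h1.not_ge, hac, not_lt_of_gt h1]
          · simp [hne, h1, not_lt_of_gt h1, hac, hs, mul_comm]
        · simp [ha, hc]
    · simp [hac]
  all_goals simp

end orderSign

/-- Written as a comparison of two orders, the Koszul sign is visibly multiplicative. -/
theorem koszulSign_eq {n : ℕ} (σ : Equiv.Perm (Fin n)) (deg : Fin n → ℤ) :
    koszulSign σ deg = orderSign id σ.symm deg := by
  rw [← orderSign_comp σ, orderSign, Finset.prod_comm]
  refine Finset.prod_congr rfl fun a _ => Finset.prod_congr rfl fun b _ => ?_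
  simp only [Equiv.symm_apply_apply, id]
  exact if_congr and_comm (by rw [mul_comm]) rfl

theorem koszulSign_one {n : ℕ} (deg : Fin n → ℤ) : koszulSign 1 deg = 1 := by
  rw [koszulSign_eq]
  exact orderSign_self id deg

theorem koszulSign_mul {n : ℕ} (σ τ : Equiv.Perm (Fin n)) (deg : Fin n → ℤ) :
    koszulSign (σ * τ) deg = koszulSign σ deg * koszulSign τ (fun j => deg (σ j)) := by
  rw [koszulSign_eq, koszulSign_eq, koszulSign_eq,
    ← orderSign_trans Function.injective_id σ.symm.injective (σ * τ).symm.injective]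
  congr 1
  rw [← orderSign_comp σ]
  congr 1
  all_goals
    funext a
    simp [Equiv.Perm.mul_def]

/-- The case of `koszulSign_blockPerm` in which the inserted operation has degree zero. -/
theorem koszulSign_blockPerm_aux {m n l : ℕ} (h : l + 1 = m + n) (i : Fin m)
    (σ : Equiv.Perm (Fin m)) (τ : Equiv.Perm (Fin n)) (deg : Fin l → ℤ) :
    koszulSign (blockPerm h i σ τ) deg = koszulSign σ (plugDeg h (σ i) 0 deg) *
      koszulSign τ (fun t => deg (innerIdx h (σ i) t)) := by
  have hin : ∀ t, (blockPerm h i σ τ).symm (innerIdx h (σ i) t) = innerIdx h i (τ.symm t) := by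
    intro t
    rw [Equiv.symm_apply_eq, blockPerm_inner, Equiv.apply_symm_apply]
  have hout : ∀ j (hj : j ≠ σ i), (blockPerm h i σ τ).symm (outerIdx h (σ i) j hj) =
      outerIdx h i (σ.symm j) (fun e => hj (by rw [← e, Equiv.apply_symm_apply])) := by
    intro j hj
    rw [Equiv.symm_apply_eq, blockPerm_outer]
    simp
  have ne_symm : ∀ {j}, j ≠ σ i → σ.symm j ≠ i := fun hj e => hj (by
    rw [← e, Equiv.apply_symm_apply])
  -- comparison of positions in `x ∘ᵢ y`
  have oo : ∀ (i : Fin m) {j j' : Fin m} (hj : j ≠ i) (hj' : j' ≠ i),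
      outerIdx h i j hj < outerIdx h i j' hj' ↔ j < j' := by
    intro i j j' hj hj'
    have h1 := Fin.val_ne_of_ne hj
    have h2 := Fin.val_ne_of_ne hj'
    simp only [outerIdx, Fin.lt_def]
    split_ifs <;> omega
  have oi : ∀ (i : Fin m) {j : Fin m} (hj : j ≠ i) (t : Fin n),
      outerIdx h i j hj < innerIdx h i t ↔ j < i := by
    intro i j hj t
    have h1 := Fin.val_ne_of_ne hj
    simp only [outerIdx, innerIdx, Fin.lt_def]
    split_ifs <;> omega
  have io : ∀ (i : Fin m) {j : Fin m} (hj : j ≠ i) (t : Fin n),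
      innerIdx h i t < outerIdx h i j hj ↔ i < j := by
    intro i j hj t
    have h1 := Fin.val_ne_of_ne hj
    simp only [outerIdx, innerIdx, Fin.lt_def]
    split_ifs <;> omega
  have ii : ∀ (i : Fin m) (t t' : Fin n), innerIdx h i t < innerIdx h i t' ↔ t < t' := by
    intro i t t'
    simp only [innerIdx, Fin.lt_def, add_lt_add_iff_left]
  -- a pair of inputs of the composite consists of two inputs of `x`, of two inputs of `y`, or of
  -- one of each; the mixed pairs make up the comparisons of `i` with the other inputs of `x`
  simp only [koszulSign_eq, orderSign]
  rw [prod_slot h (σ i), ← Finset.prod_erase_mul _ _ (Finset.mem_univ (σ i)), dif_pos rfl,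
    ← Finset.prod_erase_mul (Finset.univ : Finset (Fin m)) _ (Finset.mem_univ (σ i)), mul_assoc]
  congr 1
  · refine Finset.prod_congr rfl fun a ha => ?_
    have ha := Finset.ne_of_mem_erase ha
    rw [dif_neg ha, prod_slot h (σ i)]
    refine Finset.prod_congr rfl fun b _ => ?_
    by_cases hb : b = σ i
    · subst hb
      simp only [dif_pos, hin, hout, id, oi, io, plugDeg, plug_of_ne _ _ _ _ ha, plug_self,
        zero_add, Equiv.symm_apply_apply]
      rw [Finset.mul_sum, negOnePow_sum]
      split_ifs <;> simp
    · simp only [dif_neg hb, hout, id, oo, plugDeg, plug_of_ne _ _ _ _ ha, plug_of_ne _ _ _ _ hb]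
  · have h1 : ∀ t, (∏ b, if id (innerIdx h (σ i) t) < id b ∧
        (blockPerm h i σ τ).symm b < (blockPerm h i σ τ).symm (innerIdx h (σ i) t) then
          (deg (innerIdx h (σ i) t) * deg b).negOnePow else 1) =
        (∏ b ∈ Finset.univ.erase (σ i), if σ i < b ∧ σ.symm b < i then
          (deg (innerIdx h (σ i) t) * plugDeg h (σ i) 0 deg b).negOnePow else 1) *
        ∏ t', if t < t' ∧ τ.symm t' < τ.symm t then
          (deg (innerIdx h (σ i) t) * deg (innerIdx h (σ i) t')).negOnePow else 1 := by
      intro t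
      rw [prod_slot h (σ i), ← Finset.prod_erase_mul _ _ (Finset.mem_univ (σ i)), dif_pos rfl]
      congr 1
      · refine Finset.prod_congr rfl fun b hb => ?_
        have hb := Finset.ne_of_mem_erase hb
        simp only [dif_neg hb, hin, hout, id, oi, io, plugDeg, plug_of_ne _ _ _ _ hb]
      · simp only [hin, ii, id]
    rw [Finset.prod_congr rfl fun t _ => h1 t, Finset.prod_mul_distrib]
    congr 1
    rw [Finset.prod_comm, ← Finset.prod_erase_mul (Finset.univ : Finset (Fin m)) _
      (Finset.mem_univ (σ i)), if_neg (by simp), mul_one]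
    refine Finset.prod_congr rfl fun b hb => ?_
    rw [id, id, Equiv.symm_apply_apply]
    have e : plugDeg h (σ i) 0 deg (σ i) = ∑ t, deg (innerIdx h (σ i) t) := by
      rw [plugDeg, plug_self, zero_add]
    rw [e, Finset.sum_mul, negOnePow_sum]
    split_ifs <;> simp

/-- The sign identity behind the equivariance of partial compositions in an endomorphism
operad. -/
theorem koszulSign_blockPerm {m n l : ℕ} (h : l + 1 = m + n) (i : Fin m)
    (σ : Equiv.Perm (Fin m)) (τ : Equiv.Perm (Fin n)) (b : ℤ) (deg : Fin l → ℤ) :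
    (b * degBefore deg (σ i).val).negOnePow * (koszulSign σ (plugDeg h (σ i) b deg) *
      koszulSign τ (fun t => deg (innerIdx h (σ i) t))) =
    koszulSign (blockPerm h i σ τ) deg *
      (b * degBefore (fun s => deg (blockPerm h i σ τ s)) i.val).negOnePow := by
  -- only the degree of the input `i` of `x` depends on the degree `b` of the inserted operation
  have e1 : plugDeg h (σ i) b deg = Function.update (plugDeg h (σ i) 0 deg) (σ i)
      (b + plugDeg h (σ i) 0 deg (σ i)) := by
    funext j
    by_cases hj : j = σ i
    · subst hj
      rw [Function.update_self, plugDeg, plugDeg, plug_self, plug_self, zero_add]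
    · rw [Function.update_of_ne hj, plugDeg, plugDeg, plug_of_ne _ _ _ _ hj,
        plug_of_ne _ _ _ _ hj]
  have e2 : ∀ (i : Fin m) (deg : Fin l → ℤ), degBefore deg i.val =
      ∑ j, if j < i then Function.update (plugDeg h i 0 deg) i 0 j else 0 := by
    intro i deg
    rw [← degBefore_plugDeg_of_le h i 0 deg le_rfl, degBefore]
    refine Finset.sum_congr rfl fun j _ => ?_
    by_cases hj : j = i
    · subst hj
      simp
    · rw [Function.update_of_ne hj]
      rfl
  have e3 : ∑ j, (if j < i then Function.update (plugDeg h i 0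
        (fun s => deg (blockPerm h i σ τ s))) i 0 j else 0) =
      ∑ j, if σ.symm j < σ.symm (σ i) then
        Function.update (plugDeg h (σ i) 0 deg) (σ i) 0 j else 0 := by
    rw [← Equiv.sum_comp σ fun j => if σ.symm j < σ.symm (σ i) then
      Function.update (plugDeg h (σ i) 0 deg) (σ i) 0 j else 0]
    refine Finset.sum_congr rfl fun j _ => ?_
    rw [Equiv.symm_apply_apply, Equiv.symm_apply_apply]
    by_cases hj : j = i
    · subst hj
      simp
    · have hj' : σ j ≠ σ i := fun e => hj (σ.injective e)
      rw [Function.update_of_ne hj, Function.update_of_ne hj', plugDeg, plugDeg,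
        plug_of_ne _ _ _ _ hj, plug_of_ne _ _ _ _ hj', blockPerm_outer]
  rw [koszulSign_blockPerm_aux, e1, koszulSign_eq σ, koszulSign_eq σ,
    orderSign_update Function.injective_id σ.symm.injective, e2 (σ i), e2 i, e3]
  simp only [id]
  have key : ∀ a x b c : ℤˣ, a * (x * (a * b) * c) = x * c * b := by decide
  exact key _ _ _ _

end Koszul


/-! ### Homogeneous multilinear maps and their partial compositions -/

section Multilinear

variable {k : Type u} [Field k] {V : Type w} [AddCommGroup V] [Module k V]

/-- The multilinear operations in `n` variables on `V`. -/
abbrev Op (k : Type u) [Field k] (V : Type w) [AddCommGroup V] [Module k V] (n : ℕ) : Type _ :=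
  MultilinearMap k (fun _ : Fin n => V) V

theorem Op.map_update_sign {n : ℕ} (f : Op k V n) (v : Fin n → V) (i : Fin n) (e : ℤˣ) (x : V) :
    f (Function.update v i (e • x)) = e • f (Function.update v i x) := by
  rcases Int.units_eq_one_or e with rfl | rfl
  · simp
  · rw [Units.neg_smul, Units.neg_smul, one_smul, one_smul, MultilinearMap.map_update_neg]

omit [AddCommGroup V] in
theorem plug_eq_update {m n l : ℕ} (h : l + 1 = m + n) (i : Fin m) (g g' : (Fin n → V) → V)
    (a : Fin l → V) :
    plug h i g a = Function.update (plug h i g' a) i (g fun t => a (innerIdx h i t)) := by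
  funext j
  by_cases hj : j = i
  · subst hj
    rw [Function.update_self, plug_self]
  · rw [Function.update_of_ne hj, plug_of_ne _ _ _ _ hj, plug_of_ne _ _ _ _ hj]

/-- A sign on the inserted value can be moved out. -/
theorem Op.map_plug_sign {m n l : ℕ} (f : Op k V m) (h : l + 1 = m + n) (i : Fin m)
    (g g' : (Fin n → V) → V) (a : Fin l → V) (e : ℤˣ)
    (hg : g (fun t => a (innerIdx h i t)) = e • g' fun t => a (innerIdx h i t)) :
    f (plug h i g a) = e • f (plug h i g' a) := by
  rw [plug_eq_update h i g g', hg, map_update_sign, ← plug_eq_update]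

theorem multilinear_ext_homogeneous {gr : ℤ → Submodule k V} (hgr : DirectSum.IsInternal gr)
    {W : Type*} [AddCommGroup W] [Module k W] {n : ℕ}
    {f g : MultilinearMap k (fun _ : Fin n => V) W}
    (H : ∀ (deg : Fin n → ℤ) (v : Fin n → V), (∀ j, v j ∈ gr (deg j)) → f v = g v) : f = g := by
  let e := LinearEquiv.ofBijective (DirectSum.coeLinearMap gr) hgr
  have : f.compLinearMap (fun _ => e.toLinearMap) = g.compLinearMap (fun _ => e.toLinearMap) := by
    refine MultilinearMap.directSum_ext fun p => MultilinearMap.ext fun v => ?_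
    simp only [MultilinearMap.compLinearMap_apply]
    refine H p _ fun j => ?_
    have : e.toLinearMap (DirectSum.lof k ℤ (fun i => gr i) (p j) (v j)) = v j :=
      DirectSum.coeLinearMap_lof gr (p j) (v j)
    rw [this]
    exact (v j).2
  ext v
  have := congrArg (fun F => F fun j => e.symm (v j)) this
  simpa [e] using this

/-- The sign makes sense on arbitrary arguments, by decomposing them into homogeneous components.
-/
theorem exists_twist {gr : ℤ → Submodule k V} (hgr : DirectSum.IsInternal gr) {n : ℕ}
    (c : (Fin n → ℤ) → ℤˣ) (f : Op k V n) : ∃ g : Op k V n,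
      ∀ (deg : Fin n → ℤ) (v : Fin n → V), (∀ j, v j ∈ gr (deg j)) → g v = c deg • f v := by
  let e := LinearEquiv.ofBijective (DirectSum.coeLinearMap gr) hgr
  have he : ∀ {a} {x : V} (hx : x ∈ gr a),
      e.symm x = DirectSum.lof k ℤ (fun i => gr i) a ⟨x, hx⟩ := by
    intro a x hx
    rw [LinearEquiv.symm_apply_eq]
    exact (DirectSum.coeLinearMap_lof gr a ⟨x, hx⟩).symm
  refine ⟨(MultilinearMap.fromDirectSumEquiv fun p : Fin n → ℤ =>
    (((c p : ℤ) : k)) • f.compLinearMap fun j => (gr (p j)).subtype).compLinearMap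
      fun _ => e.symm.toLinearMap, fun deg v hv => ?_⟩
  rw [MultilinearMap.compLinearMap_apply]
  have : (fun j => e.symm.toLinearMap (v j)) =
      fun j => DirectSum.lof k ℤ (fun i => gr i) (deg j) ⟨v j, hv j⟩ :=
    funext fun j => he (hv j)
  rw [this, MultilinearMap.fromDirectSumEquiv_lof]
  rcases Int.units_eq_one_or (c deg) with h | h <;> simp [h]

variable {gr : ℤ → Submodule k V} (hgr : DirectSum.IsInternal gr)

/-- Multiplication of a multilinear operation with a sign which depends on the degrees of the
arguments. -/
noncomputable def twist {n : ℕ} (c : (Fin n → ℤ) → ℤˣ) : Op k V n →ₗ[k] Op k V n where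
  toFun f := (exists_twist hgr c f).choose
  map_add' f g := multilinear_ext_homogeneous hgr fun deg v hv => by
    rw [add_apply, (exists_twist hgr c _).choose_spec deg v hv,
      (exists_twist hgr c _).choose_spec deg v hv, (exists_twist hgr c _).choose_spec deg v hv,
      add_apply, smul_add]
  map_smul' a f := multilinear_ext_homogeneous hgr fun deg v hv => by
    rw [RingHom.id_apply, smul_apply, (exists_twist hgr c _).choose_spec deg v hv,
      (exists_twist hgr c _).choose_spec deg v hv, smul_apply, Mon.sign_comm]

theorem twist_apply {n : ℕ} (c : (Fin n → ℤ) → ℤˣ) (f : Op k V n) {deg : Fin n → ℤ}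
    {v : Fin n → V} (hv : ∀ j, v j ∈ gr (deg j)) : twist hgr c f v = c deg • f v :=
  (exists_twist hgr c f).choose_spec deg v hv

/-- Insertion of the operation `g` into the argument `i` of the operation `f`, without Koszul
sign. -/
def insertOp {m n l : ℕ} (h : l + 1 = m + n) (i : Fin m) (f : Op k V m) (g : Op k V n) :
    Op k V l where
  toFun v := f (plug h i g v)
  map_update_add' {dec} v s x y := by
    have : dec = instDecidableEqFin l := Subsingleton.elim _ _
    subst this
    rcases slot_cases h i s with ⟨j, hj, rfl⟩ | ⟨t, rfl⟩
    · simp only [plug_update_outer, MultilinearMap.map_update_add]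
    · simp only [plug_update_inner, MultilinearMap.map_update_add]
  map_update_smul' {dec} v s c x := by
    have : dec = instDecidableEqFin l := Subsingleton.elim _ _
    subst this
    rcases slot_cases h i s with ⟨j, hj, rfl⟩ | ⟨t, rfl⟩
    · simp only [plug_update_outer, MultilinearMap.map_update_smul]
    · simp only [plug_update_inner, MultilinearMap.map_update_smul]

theorem insertOp_apply {m n l : ℕ} (h : l + 1 = m + n) (i : Fin m) (f : Op k V m) (g : Op k V n)
    (v : Fin l → V) : insertOp h i f g v = f (plug h i g v) := rfl

theorem insertOp_eq_update {m n l : ℕ} (h : l + 1 = m + n) (i : Fin m) (f : Op k V m)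
    (g : Op k V n) (v : Fin l → V) : insertOp h i f g v =
      f (Function.update (plug h i 0 v) i (g fun t => v (innerIdx h i t))) := by
  rw [insertOp_apply, plug_eq_update h i g 0]

/-- Partial composition in the endomorphism operad, where `b` is the degree of the inserted
operation. -/
noncomputable def circOp {m n l : ℕ} (b : ℤ) (h : l + 1 = m + n) (i : Fin m) :
    Op k V m →ₗ[k] Op k V n →ₗ[k] Op k V l :=
  LinearMap.compr₂ (LinearMap.mk₂ k (insertOp h i)
    (fun f f' g => by
      ext v
      simp [insertOp_apply])
    (fun c f g => by
      ext v
      simp [insertOp_apply])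
    (fun f g g' => by
      ext v
      simp [insertOp_eq_update])
    (fun c f g => by
      ext v
      simp [insertOp_eq_update])) (twist hgr fun deg => (b * degBefore deg i.val).negOnePow)

theorem circOp_apply {m n l : ℕ} (b : ℤ) (h : l + 1 = m + n) (i : Fin m) (f : Op k V m)
    (g : Op k V n) {deg : Fin l → ℤ} {v : Fin l → V} (hv : ∀ j, v j ∈ gr (deg j)) :
    circOp hgr b h i f g v = (b * degBefore deg i.val).negOnePow • f (plug h i g v) :=
  twist_apply hgr _ _ hv

/-- Permutation of the arguments, with Koszul sign. -/
noncomputable def permOp {n : ℕ} (σ : Equiv.Perm (Fin n)) : Op k V n →ₗ[k] Op k V n :=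
  twist hgr (koszulSign σ) ∘ₗ (MultilinearMap.domDomCongrLinearEquiv k k V V σ).toLinearMap

theorem permOp_apply {n : ℕ} (σ : Equiv.Perm (Fin n)) (f : Op k V n) {deg : Fin n → ℤ}
    {v : Fin n → V} (hv : ∀ j, v j ∈ gr (deg j)) :
    permOp hgr σ f v = koszulSign σ deg • f fun j => v (σ j) :=
  twist_apply hgr _ _ hv

/-- A linear endomorphism, as an operation in one variable. -/
def unaryOp (f : V →ₗ[k] V) : Op k V 1 := MultilinearMap.ofSubsingleton k V V (0 : Fin 1) f

@[simp]
theorem unaryOp_apply (f : V →ₗ[k] V) (v : Fin 1 → V) : unaryOp f v = f (v 0) := rfl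

/-- An element, as an operation without variables. -/
def constOp (e : V) : Op k V 0 := MultilinearMap.constOfIsEmpty k _ e

@[simp]
theorem constOp_apply (e : V) (v : Fin 0 → V) : (constOp e : Op k V 0) v = e := rfl

/-- The differential of the endomorphism operad, on operations of degree `a`: the graded commutator
with `d`, which is regarded as an operation of degree `1`. -/
noncomputable def diffOp (d : V →ₗ[k] V) {n : ℕ} (a : ℤ) : Op k V n →ₗ[k] Op k V n :=
  circOp hgr a (add_comm n 1) 0 (unaryOp d) -
    a.negOnePow • ∑ i : Fin n, (circOp hgr 1 rfl i).flip (unaryOp d)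

/-- Multilinear operations of degree `a`. -/
def IsHomogOp (gr : ℤ → Submodule k V) {n : ℕ} (f : Op k V n) (a : ℤ) : Prop :=
  ∀ ⦃deg : Fin n → ℤ⦄ ⦃v : Fin n → V⦄, (∀ j, v j ∈ gr (deg j)) → f v ∈ gr (a + ∑ j, deg j)

theorem plug_mem {m n l : ℕ} {h : l + 1 = m + n} {i : Fin m} {g : Op k V n} {b : ℤ}
    (hg : IsHomogOp gr g b) {deg : Fin l → ℤ} {v : Fin l → V} (hv : ∀ j, v j ∈ gr (deg j))
    (j : Fin m) : plug h i g v j ∈ gr (plugDeg h i b deg j) := by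
  by_cases hj : j = i
  · subst hj
    rw [plug_self, plugDeg, plug_self]
    exact hg fun t => hv _
  · rw [plug_of_ne _ _ _ _ hj, plugDeg, plug_of_ne _ _ _ _ hj]
    exact hv _

include hgr

theorem IsHomogOp.circOp {m n l : ℕ} {h : l + 1 = m + n} {i : Fin m} {f : Op k V m}
    {g : Op k V n} {a b : ℤ} (hf : IsHomogOp gr f a) (hg : IsHomogOp gr g b) :
    IsHomogOp gr (circOp hgr b h i f g) (a + b) := by
  intro deg v hv
  rw [circOp_apply hgr b h i f g hv]
  refine Mon.sign_smul_mem _ _ ?_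
  have := hf (plug_mem (h := h) (i := i) hg hv)
  rwa [sum_plugDeg, ← add_assoc] at this

theorem IsHomogOp.permOp {n : ℕ} {f : Op k V n} {a : ℤ} (hf : IsHomogOp gr f a)
    (σ : Equiv.Perm (Fin n)) : IsHomogOp gr (permOp hgr σ f) a := by
  intro deg v hv
  rw [permOp_apply hgr σ f hv, ← Equiv.sum_comp σ]
  exact Mon.sign_smul_mem _ _ (hf fun j => hv (σ j))

theorem permOp_one {n : ℕ} (f : Op k V n) : permOp hgr 1 f = f :=
  multilinear_ext_homogeneous hgr fun deg v hv => by
    rw [permOp_apply hgr 1 f hv, koszulSign_one, one_smul]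
    rfl

theorem permOp_mul {n : ℕ} (σ τ : Equiv.Perm (Fin n)) (f : Op k V n) :
    permOp hgr (σ * τ) f = permOp hgr σ (permOp hgr τ f) :=
  multilinear_ext_homogeneous hgr fun deg v hv => by
    rw [permOp_apply hgr _ _ hv, permOp_apply hgr _ _ hv, permOp_apply hgr _ _ fun j => hv (σ j),
      koszulSign_mul, smul_smul]
    rfl

theorem circOp_one {m : ℕ} (i : Fin m) (f : Op k V m) :
    circOp hgr 0 rfl i f (unaryOp LinearMap.id) = f :=
  multilinear_ext_homogeneous hgr fun deg v hv => by
    rw [circOp_apply hgr 0 rfl i f _ hv, zero_mul, Int.negOnePow_zero, one_smul]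
    congr 1
    funext j
    by_cases hj : j = i
    · subst hj
      rw [plug_self]
      rfl
    · have := Fin.val_ne_of_ne hj
      rw [plug_of_ne _ _ _ _ hj]
      congr 1
      apply Fin.ext
      simp [outerIdx]

theorem unaryOp_circOp {n : ℕ} (h : n + 1 = 1 + n) (a : ℤ) (d : V →ₗ[k] V) (f : Op k V n)
    (v : Fin n → V) : circOp hgr a h 0 (unaryOp d) f v = d (f v) := by
  have : circOp hgr a h 0 (unaryOp d) f = d.compMultilinearMap f :=
    multilinear_ext_homogeneous hgr fun deg v hv => by
      rw [circOp_apply hgr a h 0 _ f hv]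
      have : degBefore deg (0 : Fin 1).val = 0 := by simp [degBefore]
      rw [this, mul_zero, Int.negOnePow_zero, one_smul, unaryOp_apply, plug_self]
      simp only [LinearMap.compMultilinearMap_apply]
      congr 2
      funext t
      congr 1
      apply Fin.ext
      simp [innerIdx]
  rw [this]
  rfl

theorem circOp_seq {m n p l q r : ℕ} (h₁ : l + 1 = m + n) (h₂ : q + 1 = l + p)
    (h₃ : r + 1 = n + p) (h₄ : q + 1 = m + r) (i : Fin m) (j : Fin n) {b c : ℤ} (x : Op k V m)
    (y : Op k V n) (z : Op k V p) (hz : IsHomogOp gr z c) :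
    circOp hgr c h₂ (innerIdx h₁ i j) (circOp hgr b h₁ i x y) z =
      circOp hgr (b + c) h₄ i x (circOp hgr c h₃ j y z) :=
  multilinear_ext_homogeneous hgr fun deg v hv => by
    rw [circOp_apply hgr _ _ _ _ _ hv, circOp_apply hgr _ _ _ _ _ (plug_mem hz hv),
      circOp_apply hgr _ _ _ _ _ hv, plug_plug_seq h₁ h₂ h₃ h₄,
      Op.map_plug_sign x h₄ i _ (fun c => y (plug h₃ j z c)) v _
        (circOp_apply hgr _ _ _ _ _ fun t => hv _), smul_smul, smul_smul,
      ← Int.negOnePow_add, ← Int.negOnePow_add,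
      degBefore_plugDeg_of_le _ _ _ _ (by simp [innerIdx])]
    congr 2
    have e : (innerIdx h₁ i j).val = i.val + j.val := rfl
    rw [e, degBefore_add h₄ i deg (by omega)]
    ring

/-- By symmetry it suffices to insert from the left to the right. -/
theorem circOp_par_aux {m n p l l' q : ℕ} (h₁ : l + 1 = m + n) (h₂ : q + 1 = l + p)
    (h₃ : l' + 1 = m + p) (h₄ : q + 1 = l' + n) (i j : Fin m) (hij : i < j) {b c : ℤ}
    (x : Op k V m) (y : Op k V n) (z : Op k V p) (hy : IsHomogOp gr y b)
    (hz : IsHomogOp gr z c) :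
    circOp hgr c h₂ (outerIdx h₁ i j hij.ne') (circOp hgr b h₁ i x y) z =
      (b * c).negOnePow • circOp hgr b h₄ (outerIdx h₃ j i hij.ne)
        (circOp hgr c h₃ j x z) y :=
  multilinear_ext_homogeneous hgr fun deg v hv => by
    rw [smul_apply,
      circOp_apply hgr _ _ _ _ _ hv, circOp_apply hgr _ _ _ _ _ (plug_mem hz hv),
      circOp_apply hgr _ _ _ _ _ hv, circOp_apply hgr _ _ _ _ _ (plug_mem hy hv),
      plug_plug_par h₁ h₂ h₃ h₄ i j hij.ne', smul_smul, smul_smul, smul_smul,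
      ← Int.negOnePow_add, ← Int.negOnePow_add, ← Int.negOnePow_add]
    congr 1
    have e1 : (outerIdx h₁ i j hij.ne').val = j.val + n - 1 := by
      simp only [outerIdx]
      rw [if_neg (by omega)]
    have e2 : (outerIdx h₃ j i hij.ne).val = i.val := by
      simp only [outerIdx]
      rw [if_pos (by omega)]
    rw [degBefore_plugDeg_of_le _ _ _ _ (by omega),
      degBefore_plugDeg_of_lt _ _ _ _ (by omega), e1, e2, Int.negOnePow_eq_iff]
    refine ⟨-(b * c), ?_⟩
    ring

theorem circOp_par {m n p l l' q : ℕ} (h₁ : l + 1 = m + n) (h₂ : q + 1 = l + p)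
    (h₃ : l' + 1 = m + p) (h₄ : q + 1 = l' + n) (i j : Fin m) (hij : j ≠ i) {b c : ℤ}
    (x : Op k V m) (y : Op k V n) (z : Op k V p) (hy : IsHomogOp gr y b)
    (hz : IsHomogOp gr z c) :
    circOp hgr c h₂ (outerIdx h₁ i j hij) (circOp hgr b h₁ i x y) z =
      (b * c).negOnePow • circOp hgr b h₄ (outerIdx h₃ j i hij.symm)
        (circOp hgr c h₃ j x z) y := by
  rcases lt_or_gt_of_ne hij with h | h
  · rw [circOp_par_aux hgr h₃ h₄ h₁ h₂ j i h x z y hz hy, smul_smul, mul_comm c b,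
      Int.units_mul_self, one_smul]
  · exact circOp_par_aux hgr h₁ h₂ h₃ h₄ i j h x y z hy hz

theorem circOp_perm {m n l : ℕ} (h : l + 1 = m + n) (i : Fin m) (σ : Equiv.Perm (Fin m))
    (τ : Equiv.Perm (Fin n)) {b : ℤ} (x : Op k V m) (y : Op k V n) (hy : IsHomogOp gr y b) :
    circOp hgr b h (σ i) (permOp hgr σ x) (permOp hgr τ y) =
      permOp hgr (blockPerm h i σ τ) (circOp hgr b h i x y) :=
  multilinear_ext_homogeneous hgr fun deg v hv => by
    rw [circOp_apply hgr _ _ _ _ _ hv, permOp_apply hgr _ _ hv,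
      circOp_apply hgr _ _ _ _ _ fun t => hv _,
      permOp_apply hgr _ _ (plug_mem (hy.permOp hgr τ) hv), smul_smul, smul_smul,
      ← koszulSign_blockPerm, plug_comp_blockPerm, ← smul_smul, ← smul_smul, ← smul_smul]
    congr 2
    rw [plug_eq_update h (σ i) (permOp hgr τ y) (fun c => y fun t => c (τ t)),
      permOp_apply hgr _ _ fun t => hv _]
    have : (fun j => Function.update (plug h (σ i) (fun c => y fun t => c (τ t)) v) (σ i)
        (koszulSign τ (fun t => deg (innerIdx h (σ i) t)) •
          y fun t => v (innerIdx h (σ i) (τ t))) (σ j)) =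
        Function.update (fun j => plug h (σ i) (fun c => y fun t => c (τ t)) v (σ j)) i
          (koszulSign τ (fun t => deg (innerIdx h (σ i) t)) •
            y fun t => v (innerIdx h (σ i) (τ t))) := by
      funext j
      by_cases hj : j = i
      · subst hj
        simp
      · rw [Function.update_of_ne hj, Function.update_of_ne fun e => hj (σ.injective e)]
    rw [this, Op.map_update_sign]
    congr 2
    rw [Function.update_eq_self_iff, plug_self]

end Multilinear


/-! ### The differential of the endomorphism operad -/

section DiffOp

variable {k : Type u} [Field k] {V : Type w} [AddCommGroup V] [Module k V]
  {gr : ℤ → Submodule k V} (hgr : DirectSum.IsInternal gr)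

theorem innerIdx_zero_one {n : ℕ} (h : n + 1 = 1 + n) (j : Fin n) : innerIdx h 0 j = j :=
  Fin.ext (by simp [innerIdx])

theorem innerIdx_one {m : ℕ} (i : Fin m) (j : Fin 1) : innerIdx (l := m) rfl i j = i :=
  Fin.ext (by simp [innerIdx])

theorem outerIdx_one {m : ℕ} (i j : Fin m) (hj : j ≠ i) :
    outerIdx (n := 1) (l := m) rfl i j hj = j :=
  Fin.ext (by simp [outerIdx])

theorem blockPerm_one_left {n : ℕ} (h : n + 1 = 1 + n) (σ : Equiv.Perm (Fin n)) :
    blockPerm h 0 1 σ = σ := by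
  ext s
  have := blockPerm_inner h 0 1 σ s
  rw [innerIdx_zero_one] at this
  rw [this, Equiv.Perm.one_apply, innerIdx_zero_one]

theorem blockPerm_one_right {m : ℕ} (i : Fin m) (σ : Equiv.Perm (Fin m)) :
    blockPerm (n := 1) (l := m) rfl i σ 1 = σ := by
  ext s
  by_cases hs : s = i
  · subst hs
    have := blockPerm_inner (n := 1) (l := m) rfl s σ 1 0
    rw [innerIdx_one] at this
    rw [this, innerIdx_one]
  · have := blockPerm_outer (n := 1) (l := m) rfl i σ 1 s hs
    rw [outerIdx_one] at this
    rw [this, outerIdx_one]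

theorem plug_unary {V : Type*} {m : ℕ} (i : Fin m) (g : (Fin 1 → V) → V) (v : Fin m → V) :
    plug (n := 1) (l := m) rfl i g v = Function.update v i (g fun _ => v i) := by
  funext j
  by_cases hj : j = i
  · subst hj
    rw [plug_self, Function.update_self]
    congr 1
    funext t
    rw [innerIdx_one]
  · rw [plug_of_ne _ _ _ _ hj, Function.update_of_ne hj, outerIdx_one]

theorem isHomogOp_unaryOp {f : V →ₗ[k] V} {b : ℤ}
    (hf : ∀ ⦃a : ℤ⦄ ⦃x : V⦄, x ∈ gr a → f x ∈ gr (a + b)) : IsHomogOp gr (unaryOp f) b := by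
  intro deg v hv
  rw [unaryOp_apply, Fin.sum_univ_one, add_comm]
  exact hf (hv 0)

variable {d : V →ₗ[k] V}

theorem diffOp_apply {n : ℕ} (a : ℤ) (f : Op k V n) {deg : Fin n → ℤ} {v : Fin n → V}
    (hv : ∀ j, v j ∈ gr (deg j)) :
    diffOp hgr d a f v = d (f v) - a.negOnePow • ∑ i : Fin n, (degBefore deg i.val).negOnePow •
      f (Function.update v i (d (v i))) := by
  rw [diffOp, LinearMap.sub_apply, sub_apply, unaryOp_circOp,
    LinearMap.smul_apply, smul_apply, LinearMap.sum_apply, sum_apply]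
  congr 2
  refine Finset.sum_congr rfl fun i _ => ?_
  rw [LinearMap.flip_apply, circOp_apply hgr _ _ _ _ _ hv, one_mul, plug_unary]
  rfl

theorem diffOp_eq {n : ℕ} (a : ℤ) (f : Op k V n) :
    diffOp hgr d a f = circOp hgr a (add_comm n 1) 0 (unaryOp d) f -
      a.negOnePow • ∑ i : Fin n, circOp hgr 1 rfl i f (unaryOp d) := by
  rw [diffOp, LinearMap.sub_apply, LinearMap.smul_apply, LinearMap.sum_apply]
  rfl

variable (hd : ∀ ⦃a : ℤ⦄ ⦃x : V⦄, x ∈ gr a → d x ∈ gr (a + 1))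

include hd

theorem IsHomogOp.diffOp {n : ℕ} {a : ℤ} {f : Op k V n} (hf : IsHomogOp gr f a) :
    IsHomogOp gr (diffOp hgr d a f) (a + 1) := by
  have h1 := isHomogOp_unaryOp hd
  intro deg v hv
  rw [diffOp_eq, sub_apply, smul_apply, sum_apply]
  refine sub_mem ?_ (Mon.sign_smul_mem _ _ (Submodule.sum_mem _ fun i _ => ?_))
  · have := (IsHomogOp.circOp hgr (h := add_comm n 1) (i := 0) h1 hf) hv
    rwa [add_comm 1 a] at this
  · exact (IsHomogOp.circOp hgr (h := rfl) (i := i) hf h1) hv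

theorem diffOp_permOp {n : ℕ} (σ : Equiv.Perm (Fin n)) {a : ℤ} {f : Op k V n}
    (hf : IsHomogOp gr f a) :
    diffOp hgr d a (permOp hgr σ f) = permOp hgr σ (diffOp hgr d a f) := by
  have h1 := isHomogOp_unaryOp hd
  rw [diffOp_eq, diffOp_eq, map_sub, Mon.map_sign, map_sum]
  refine congrArg₂ (· - a.negOnePow • ·) ?_ ?_
  · have := circOp_perm hgr (add_comm n 1) 0 1 σ (unaryOp d) f hf
    rwa [permOp_one, blockPerm_one_left] at this
  · rw [← Equiv.sum_comp σ]
    refine Finset.sum_congr rfl fun i _ => ?_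
    have := circOp_perm hgr (n := 1) (l := n) rfl i σ 1 f (unaryOp d) h1
    rwa [permOp_one, blockPerm_one_right] at this

/-- The Leibniz rule. -/
theorem diffOp_circOp {m n l : ℕ} (h : l + 1 = m + n) (i : Fin m) {a b : ℤ} (x : Op k V m)
    {y : Op k V n} (hy : IsHomogOp gr y b) :
    diffOp hgr d (a + b) (circOp hgr b h i x y) = circOp hgr b h i (diffOp hgr d a x) y +
      a.negOnePow • circOp hgr (b + 1) h i x (diffOp hgr d b y) := by
  have h1 := isHomogOp_unaryOp hd
  have e1 : circOp hgr (a + b) (add_comm l 1) 0 (unaryOp d) (circOp hgr b h i x y) =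
      circOp hgr b h i (circOp hgr a (add_comm m 1) 0 (unaryOp d) x) y := by
    have := circOp_seq hgr (add_comm m 1) h h (add_comm l 1) 0 i (b := a) (unaryOp d) x y hy
    rw [innerIdx_zero_one] at this
    exact this.symm
  have e2 : ∀ t, circOp hgr 1 rfl (innerIdx h i t) (circOp hgr b h i x y) (unaryOp d) =
      circOp hgr (b + 1) h i x (circOp hgr 1 rfl t y (unaryOp d)) := fun t =>
    circOp_seq hgr h rfl rfl h i t x y (unaryOp d) h1
  have e3 : ∀ j (hj : j ≠ i), circOp hgr 1 rfl (outerIdx h i j hj) (circOp hgr b h i x y)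
      (unaryOp d) = b.negOnePow • circOp hgr b h i (circOp hgr 1 rfl j x (unaryOp d)) y := by
    intro j hj
    have := circOp_par hgr h rfl rfl h i j hj x y (unaryOp d) hy h1
    rwa [outerIdx_one, mul_one] at this
  -- `d` applied to the value of `y`, which is inserted into `x`, occurs on both sides with
  -- opposite signs
  have e4 : circOp hgr b h i (circOp hgr 1 rfl i x (unaryOp d)) y =
      circOp hgr (b + 1) h i x (circOp hgr b (add_comm n 1) 0 (unaryOp d) y) := by
    have := circOp_seq hgr (m := m) (n := 1) rfl h (add_comm n 1) h i 0 (b := 1) x (unaryOp d) y hy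
    rwa [innerIdx_one, add_comm 1 b] at this
  have e5 : b.negOnePow • b.negOnePow • circOp hgr b h i (circOp hgr 1 rfl i x (unaryOp d)) y =
      circOp hgr b h i (circOp hgr 1 rfl i x (unaryOp d)) y := by
    rw [smul_smul, Int.units_mul_self, one_smul]
  rw [diffOp_eq, diffOp_eq, diffOp_eq, e1, sum_slot h i]
  have e6 : ∀ j, (if hj : j = i then ∑ t, circOp hgr 1 rfl (innerIdx h i t)
        (circOp hgr b h i x y) (unaryOp d) else
        circOp hgr 1 rfl (outerIdx h i j hj) (circOp hgr b h i x y) (unaryOp d)) =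
      b.negOnePow • circOp hgr b h i (circOp hgr 1 rfl j x (unaryOp d)) y +
        if j = i then (∑ t, circOp hgr (b + 1) h i x (circOp hgr 1 rfl t y (unaryOp d)) -
          b.negOnePow • circOp hgr b h i (circOp hgr 1 rfl i x (unaryOp d)) y) else 0 := by
    intro j
    by_cases hj : j = i
    · subst hj
      simp only [dif_pos, if_pos, e2]
      abel
    · rw [dif_neg hj, if_neg hj, e3, add_zero]
  rw [Finset.sum_congr rfl fun j _ => e6 j, Finset.sum_add_distrib, Finset.sum_ite_eq',
    if_pos (Finset.mem_univ i), map_sub, LinearMap.sub_apply, Mon.map_sign, map_sub,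
    Mon.map_sign, map_sum, map_sum, ← e4, ← Finset.smul_sum]
  have e7 : ((a.negOnePow • circOp hgr b h i) (∑ j, circOp hgr 1 rfl j x (unaryOp d))) y =
      a.negOnePow • ∑ j, circOp hgr b h i (circOp hgr 1 rfl j x (unaryOp d)) y := by
    rw [LinearMap.smul_apply, LinearMap.smul_apply, map_sum, LinearMap.sum_apply]
  rw [Int.negOnePow_add]
  simp only [smul_add, smul_sub, mul_smul, e5, LinearMap.smul_apply, LinearMap.sum_apply]
  have e8 : ∀ z : Op k V l, b.negOnePow • b.negOnePow • z = z := fun z => by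
    rw [smul_smul, Int.units_mul_self, one_smul]
  simp only [e8]
  abel

theorem diffOp_diffOp (hdd : ∀ x, d (d x) = 0) {n : ℕ} (a : ℤ) (f : Op k V n) :
    diffOp hgr d (a + 1) (diffOp hgr d a f) = 0 := by
  have h1 := isHomogOp_unaryOp hd
  have e0 : circOp hgr 1 (add_comm 1 1) 0 (unaryOp d) (unaryOp d) = 0 := by
    ext v
    rw [unaryOp_circOp]
    exact hdd _
  have e1 : circOp hgr (a + 1) (add_comm n 1) 0 (unaryOp d)
      (circOp hgr a (add_comm n 1) 0 (unaryOp d) f) = 0 := by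
    ext v
    rw [unaryOp_circOp, unaryOp_circOp]
    exact hdd _
  have e2 : ∀ i, circOp hgr 1 rfl i (circOp hgr a (add_comm n 1) 0 (unaryOp d) f) (unaryOp d) =
      circOp hgr (a + 1) (add_comm n 1) 0 (unaryOp d) (circOp hgr 1 rfl i f (unaryOp d)) := by
    intro i
    have := circOp_seq hgr (add_comm n 1) rfl rfl (add_comm n 1) 0 i (b := a) (unaryOp d) f
      (unaryOp d) h1
    rwa [innerIdx_zero_one] at this
  -- applications of `d` to two different inputs anticommute
  have e3 : ∑ i, ∑ j, circOp hgr 1 rfl i (circOp hgr 1 rfl j f (unaryOp d)) (unaryOp d) = 0 := by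
    rw [sum_pairs Function.injective_id]
    · refine Finset.sum_eq_zero fun i _ => Finset.sum_eq_zero fun j _ => ?_
      split_ifs with hij
      · have := circOp_par hgr (n := 1) (p := 1) rfl rfl rfl rfl i j (Fin.ne_of_gt hij) f
          (unaryOp d) (unaryOp d) h1 h1
        rw [outerIdx_one, outerIdx_one, mul_one, Int.negOnePow_one, Units.neg_smul,
          one_smul] at this
        rw [this, add_neg_cancel]
      · rfl
    · intro i
      have := circOp_seq hgr (m := n) (n := 1) (p := 1) rfl rfl (add_comm 1 1) rfl i 0 (b := 1) f
        (unaryOp d) (unaryOp d) h1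
      rw [innerIdx_one] at this
      rw [this, e0, map_zero]
  rw [diffOp_eq, diffOp_eq]
  simp only [map_sub, e1, Mon.map_sign, LinearMap.sub_apply, e2, map_sum,
    Finset.sum_sub_distrib, LinearMap.smul_apply, LinearMap.sum_apply, ← Finset.smul_sum,
    e3, smul_zero, sub_zero, zero_sub]
  rw [Int.negOnePow_succ, Units.neg_smul, sub_neg_eq_add, neg_add_cancel]

end DiffOp

/-! ### Evaluation of operadic monomials on multilinear operations -/

section EvalOp

variable {k : Type u} [Field k] {V : Type w} [AddCommGroup V] [Module k V]
  {gr : ℤ → Submodule k V} (hgr : DirectSum.IsInternal gr) (d : V →ₗ[k] V) (e : V)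
  (μ : ∀ n, Op k V (n + 2))

/-- The operation represented by a monomial when the unit and the generators are interpreted as
`e` and `μ`. -/
noncomputable def Mon.evalOp : ∀ {n : ℕ}, Mon n → Op k V n
  | _, .unit => constOp e
  | _, .mul n => μ n
  | _, .one => unaryOp LinearMap.id
  | _, .perm σ x => permOp hgr σ (evalOp x)
  | _, .circ h i x y => circOp hgr (deg y) h i (evalOp x) (evalOp y)
  | _, .diff x => diffOp hgr d (deg x) (evalOp x)

variable {d e μ}

/-- The linear extension of `Mon.evalOp`. -/
noncomputable def Mon.evalOpL {n : ℕ} (hgr : DirectSum.IsInternal gr) (d : V →ₗ[k] V) (e : V)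
  (μ : ∀ n, Op k V (n + 2)) : Mon.Lin k n →ₗ[k] Op k V n :=
  Finsupp.linearCombination k (Mon.evalOp hgr d e μ)

theorem Mon.evalOpL_ι {n : ℕ} (x : Mon n) :
    Mon.evalOpL hgr d e μ (Mon.ι x) = Mon.evalOp hgr d e μ x := by
  simp [Mon.evalOpL, Mon.ι]

/-- The conditions on a unit and operations that make them a strictly unital `A∞`-structure with
first operation `d`, in terms of the endomorphism operad. -/
structure IsUnitalData (hgr : DirectSum.IsInternal gr) (d : V →ₗ[k] V) (e : V)
    (μ : ∀ n, Op k V (n + 2)) : Prop where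
  d_mem : ∀ ⦃a : ℤ⦄ ⦃x : V⦄, x ∈ gr a → d x ∈ gr (a + 1)
  d_d : ∀ x, d (d x) = 0
  unit_mem : e ∈ gr 0
  d_unit : d e = 0
  mul_mem : ∀ n, IsHomogOp gr (μ n) (-(n : ℤ))
  d_mul : ∀ N : ℕ, diffOp hgr d (-(N : ℤ)) (μ N) + Mon.evalOpL hgr d e μ (Mon.stasheffSum k N) = 0
  mul_two_unit : ∀ i : Fin 2, circOp hgr 0 (n := 0) rfl i (μ 0) (constOp e) = unaryOp LinearMap.id
  mul_unit : ∀ n (i : Fin (n + 1 + 2)),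
    circOp hgr 0 (n := 0) (l := n + 2) rfl i (μ (n + 1)) (constOp e) = 0

variable (H : IsUnitalData hgr d e μ)

include H

theorem Mon.evalOp_homog {n : ℕ} (x : Mon n) : IsHomogOp gr (Mon.evalOp hgr d e μ x) x.deg := by
  induction x with
  | unit =>
    intro deg v _
    simpa [Mon.evalOp, Mon.deg] using H.unit_mem
  | mul n => exact H.mul_mem n
  | one => exact isHomogOp_unaryOp fun a x hx => by simpa [Mon.deg] using hx
  | perm σ x ih => exact ih.permOp hgr σ
  | circ h i x y ihx ihy => exact ihx.circOp hgr ihy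
  | diff x ih => exact ih.diffOp hgr H.d_mem

omit H in
theorem Mon.evalOpL_permL {n : ℕ} (σ : Equiv.Perm (Fin n)) (v : Mon.Lin k n) :
    Mon.evalOpL hgr d e μ (Mon.permL σ v) = permOp hgr σ (Mon.evalOpL hgr d e μ v) := by
  induction v using Mon.lin_induction with
  | zero => simp
  | add v w hv hw => simp only [map_add, hv, hw]
  | smul c v hv => simp only [map_smul, hv]
  | basis x =>
    rw [Mon.permL_ι, Mon.evalOpL_ι, Mon.evalOpL_ι]
    rfl

omit H in
theorem Mon.evalOpL_diffL {n : ℕ} {a : ℤ} {v : Mon.Lin k n} (hv : v ∈ Mon.homog k n a) :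
    Mon.evalOpL hgr d e μ (Mon.diffL v) = diffOp hgr d a (Mon.evalOpL hgr d e μ v) := by
  refine Mon.homog_induction (p := fun v => Mon.evalOpL hgr d e μ (Mon.diffL v) =
    diffOp hgr d a (Mon.evalOpL hgr d e μ v)) ?_ ?_ ?_ ?_ hv
  · simp
  · intro v w hv hw
    simp only [map_add, hv, hw]
  · intro c v hv
    simp only [map_smul, hv]
  · rintro x rfl
    rw [Mon.diffL_ι, Mon.evalOpL_ι, Mon.evalOpL_ι]
    rfl

omit H in
theorem Mon.evalOpL_circL {m n l : ℕ} (h : l + 1 = m + n) (i : Fin m) (v : Mon.Lin k m)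
    {b : ℤ} {w : Mon.Lin k n} (hw : w ∈ Mon.homog k n b) :
    Mon.evalOpL hgr d e μ (Mon.circL h i v w) =
      circOp hgr b h i (Mon.evalOpL hgr d e μ v) (Mon.evalOpL hgr d e μ w) := by
  induction v using Mon.lin_induction with
  | zero => simp
  | add v w hv hw => simp only [map_add, LinearMap.add_apply, hv, hw]
  | smul c v hv => simp only [map_smul, LinearMap.smul_apply, hv]
  | basis x =>
  refine Mon.homog_induction (p := fun w => Mon.evalOpL hgr d e μ (Mon.circL h i (Mon.ι x) w) =
    circOp hgr b h i (Mon.evalOpL hgr d e μ (Mon.ι x)) (Mon.evalOpL hgr d e μ w)) ?_ ?_ ?_ ?_ hw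
  · simp
  · intro v w hv hw
    simp only [map_add, hv, hw]
  · intro c v hv
    simp only [map_smul, hv]
  · rintro y rfl
    rw [Mon.circL_ι, Mon.evalOpL_ι, Mon.evalOpL_ι, Mon.evalOpL_ι]
    rfl

/-- A strictly unital `A∞`-structure satisfies all relations of the presented operad. -/
theorem Mon.evalOpL_rel {n : ℕ} {v : Mon.Lin k n} (hv : Mon.Rel k n v) :
    Mon.evalOpL hgr d e μ v = 0 := by
  have hom := fun {n} (x : Mon n) => Mon.evalOp_homog hgr H x
  induction hv with
  | perm_one x =>
    simp only [map_sub, Mon.evalOpL_ι, Mon.evalOp]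
    rw [permOp_one, sub_self]
  | perm_mul σ τ x =>
    simp only [map_sub, Mon.evalOpL_ι, Mon.evalOp]
    rw [permOp_mul, sub_self]
  | circ_one i x =>
    simp only [map_sub, Mon.evalOpL_ι, Mon.evalOp, Mon.deg]
    rw [circOp_one, sub_self]
  | one_circ h x =>
    simp only [map_sub, Mon.evalOpL_ι, Mon.evalOp]
    rw [sub_eq_zero]
    ext v
    rw [unaryOp_circOp]
    rfl
  | circ_seq h₁ h₂ h₃ h₄ i j x y z =>
    simp only [map_sub, Mon.evalOpL_ι, Mon.evalOp, Mon.deg]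
    rw [circOp_seq hgr h₁ h₂ h₃ h₄ i j _ _ _ (hom z), sub_self]
  | circ_par h₁ h₂ h₃ h₄ i j hij x y z =>
    simp only [map_sub, Mon.map_sign, Mon.evalOpL_ι, Mon.evalOp]
    rw [circOp_par hgr h₁ h₂ h₃ h₄ i j hij _ _ _ (hom y) (hom z), sub_self]
  | circ_perm h i σ τ x y =>
    simp only [map_sub, Mon.evalOpL_ι, Mon.evalOp, Mon.deg]
    rw [circOp_perm hgr h i σ τ _ _ (hom y), sub_self]
  | diff_diff x =>
    simp only [Mon.evalOpL_ι, Mon.evalOp, Mon.deg]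
    rw [diffOp_diffOp hgr H.d_mem H.d_d]
  | diff_perm σ x =>
    simp only [map_sub, Mon.evalOpL_ι, Mon.evalOp, Mon.deg]
    rw [diffOp_permOp hgr H.d_mem σ (hom x), sub_self]
  | diff_circ h i x y =>
    simp only [map_sub, map_add, Mon.map_sign, Mon.evalOpL_ι, Mon.evalOp, Mon.deg]
    rw [diffOp_circOp hgr H.d_mem h i _ (hom y), sub_self]
  | diff_unit =>
    rw [Mon.evalOpL_ι, Mon.evalOp, Mon.evalOp, diffOp_eq]
    ext v
    rw [sub_apply, unaryOp_circOp]
    simp [H.d_unit]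
  | diff_mul N =>
    rw [map_add, Mon.evalOpL_ι]
    exact H.d_mul N
  | mul_two_unit i =>
    simp only [map_sub, Mon.evalOpL_ι, Mon.evalOp, Mon.deg]
    rw [H.mul_two_unit, sub_self]
  | mul_unit n i =>
    simp only [Mon.evalOpL_ι, Mon.evalOp, Mon.deg]
    rw [H.mul_unit]
  | perm σ _ ih => rw [Mon.evalOpL_permL, ih, map_zero]
  | diff hv ih =>
    obtain ⟨a, ha⟩ := Mon.Rel.homogeneous hv
    rw [Mon.evalOpL_diffL hgr ha, ih, map_zero]
  | circ_left h i y hv ih =>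
    rw [Mon.evalOpL_circL hgr h i _ (Mon.ι_mem_homog y), ih, map_zero, LinearMap.zero_apply]
  | circ_right h i x hv ih =>
    obtain ⟨a, ha⟩ := Mon.Rel.homogeneous hv
    rw [Mon.evalOpL_circL hgr h i _ ha, ih, map_zero]

end EvalOp

/-! ### Induction on the presented operad -/

namespace BurkeOperad

variable (k : Type u) [Field k]

/-- The class of a monomial. -/
noncomputable def cls {n : ℕ} (x : Mon n) : (BurkeOperad k).X n := Mon.cls k x

variable {k}

theorem induction {n : ℕ} {p : (BurkeOperad k).X n → Prop} (zero : p 0)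
    (add : ∀ v w, p v → p w → p (v + w)) (smul : ∀ (c : k) v, p v → p (c • v))
    (basis : ∀ x, p (cls k x)) (v : (BurkeOperad k).X n) : p v :=
  Mon.quo_induction (p := p) zero add smul basis v

/-- The relations are homogeneous, so the part of degree `a` is spanned by the monomials of degree
`a`. -/
theorem gr_induction {n : ℕ} {a : ℤ} {p : (BurkeOperad k).X n → Prop} (zero : p 0)
    (add : ∀ v w, p v → p w → p (v + w)) (smul : ∀ (c : k) v, p v → p (c • v))
    (basis : ∀ x, Mon.deg x = a → p (cls k x)) {v : (BurkeOperad k).X n}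
    (hv : v ∈ (BurkeOperad k).gr n a) : p v :=
  Mon.grading_induction (p := p) zero add smul basis hv

theorem circ_cls {m n l : ℕ} (h : l + 1 = m + n) (i : Fin m) (x : Mon m) (y : Mon n) :
    (BurkeOperad k).circ h i (cls k x) (cls k y) = cls k (.circ h i x y) :=
  Mon.circQ_cls h i x y

theorem perm_cls {n : ℕ} (σ : Equiv.Perm (Fin n)) (x : Mon n) :
    (BurkeOperad k).perm n σ (cls k x) = cls k (.perm σ x) :=
  Mon.permQ_cls σ x

theorem d_cls {n : ℕ} (x : Mon n) : (BurkeOperad k).d n (cls k x) = cls k (.diff x) :=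
  Mon.diffQ_cls x

theorem one_eq : (BurkeOperad k).one = cls k .one := rfl

/-- Linear maps out of the presented operad, given by a map on monomials which is compatible with
the relations. -/
theorem exists_linearMap {W : ℕ → Type w} [∀ n, AddCommGroup (W n)] [∀ n, Module k (W n)]
    (F : ∀ n, Mon n → W n)
    (hF : ∀ {n} {v : Mon.Lin k n}, Mon.Rel k n v → Finsupp.linearCombination k (F n) v = 0) :
    ∃ Φ : ∀ n, (BurkeOperad k).X n →ₗ[k] W n, ∀ n x, Φ n (cls k x) = F n x :=
  ⟨fun n => Mon.lift (Finsupp.linearCombination k (F n)) fun _ hv =>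
    (Submodule.span_le (p := LinearMap.ker (Finsupp.linearCombination k (F n)))).2
      (fun _ hv => LinearMap.mem_ker.2 (hF hv)) hv, fun n x => by
    have : Finsupp.linearCombination k (F n) (Mon.ι x) = F n x := by simp [Mon.ι]
    exact this⟩

/-- The formula for `∂μ_{N+2}`: the inner operation has arity `s + 2`, and its first input is the
input `r`. -/
theorem d_mul (N : ℕ) : (BurkeOperad k).d (N + 2) (mul k N) =
    -∑ s : Fin N, ∑ r : Fin (N - s.val - 1 + 2),
      ((r.val : ℤ) + ((s.val : ℤ) + 2) * ((N : ℤ) - s.val - r.val)).negOnePow •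
        (BurkeOperad k).circ (m := N - s.val - 1 + 2) (n := s.val + 2) (by omega) r
          (mul k (N - s.val - 1)) (mul k s.val) := by
  have h := Mon.mk_rel (Mon.Rel.diff_mul (k := k) N)
  rw [map_add] at h
  have h' : Mon.mk k (N + 2) (Mon.stasheffSum k N) =
      ∑ s : Fin N, ∑ r : Fin (N - s.val - 1 + 2),
        ((r.val : ℤ) + ((s.val : ℤ) + 2) * ((N : ℤ) - s.val - r.val)).negOnePow •
          Mon.cls k (.circ (m := N - s.val - 1 + 2) (n := s.val + 2) (by omega) r
            (.mul (N - s.val - 1)) (.mul s.val)) := by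
    simp only [Mon.stasheffSum, map_sum, Mon.map_sign]
    rfl
  rw [h'] at h
  have h1 : (BurkeOperad k).d (N + 2) (mul k N) = cls k (.diff (.mul N)) := d_cls _
  rw [h1]
  refine (eq_neg_of_add_eq_zero_left h).trans ?_
  refine congrArg Neg.neg (Finset.sum_congr rfl fun s _ => Finset.sum_congr rfl fun r _ => ?_)
  exact congrArg _ (circ_cls _ r (.mul (N - s.val - 1)) (.mul s.val)).symm

theorem d_unit : (BurkeOperad k).d 0 (unit k) = 0 :=
  (d_cls (k := k) .unit).trans (Mon.mk_rel (v := Mon.ι (.diff .unit)) Mon.Rel.diff_unit)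

theorem mul_two_unit (i : Fin 2) :
    (BurkeOperad k).circ (n := 0) (l := 1) rfl i (mul k 0) (unit k) = (BurkeOperad k).one :=
  (circ_cls (k := k) (m := 2) (n := 0) (l := 1) rfl i (.mul 0) .unit).trans
    (Mon.cls_eq (Mon.Rel.mul_two_unit i))

theorem mul_unit (n : ℕ) (i : Fin (n + 1 + 2)) :
    (BurkeOperad k).circ (n := 0) (l := n + 2) rfl i (mul k (n + 1)) (unit k) = 0 :=
  (circ_cls (k := k) (n := 0) (l := n + 2) rfl i (.mul (n + 1)) .unit).trans
    (Mon.mk_rel (v := Mon.ι (.circ (n := 0) (l := n + 2) rfl i (.mul (n + 1)) .unit))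
      (Mon.Rel.mul_unit n i))

theorem unit_mem : unit k ∈ (BurkeOperad k).gr 0 0 :=
  ⟨Mon.ι .unit, Mon.ι_mem_homog' _ rfl, rfl⟩

theorem mul_mem (n : ℕ) : mul k n ∈ (BurkeOperad k).gr (n + 2) (-(n : ℤ)) :=
  ⟨Mon.ι (.mul n), Mon.ι_mem_homog' _ rfl, rfl⟩

end BurkeOperad

/-! ### Algebras from strictly unital structures -/

section Algebra

variable {k : Type u} [Field k]

/-- A strictly unital `A∞`-structure defines an algebra over the presented operad, in which monomials
act as prescribed by `Mon.evalOp`. -/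
theorem IsUnitalData.exists_algebra {A : Cochain.{u, w} k} {e : A.carrier}
    {μ : ∀ n, Op k A.carrier (n + 2)} (H : IsUnitalData A.internal A.d e μ) :
    ∃ α : OperadAlgebra (BurkeOperad k) A, ∀ n (x : Mon n),
      α.act n (BurkeOperad.cls k x) = Mon.evalOp A.internal A.d e μ x := by
  obtain ⟨act, hact⟩ := BurkeOperad.exists_linearMap (k := k)
    (fun n x => Mon.evalOp A.internal A.d e μ x) fun hv => Mon.evalOpL_rel A.internal H hv
  refine ⟨
  { act := act
    act_mem {n a deg x v} hx hv := ?_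
    act_one v := ?_
    act_perm {n deg} σ x v hv := ?_
    act_circ {m n l} h i {b deg} x y v hy hv := ?_
    act_d {n a deg} x v hx hv := ?_ }, hact⟩
  · refine BurkeOperad.gr_induction (p := fun x => act n x v ∈ A.gr (a + ∑ j, deg j))
      ?_ ?_ ?_ ?_ hx
    · simp
    · intro x y hx hy
      rw [map_add, add_apply]
      exact add_mem hx hy
    · intro c x hx
      rw [map_smul, smul_apply]
      exact Submodule.smul_mem _ _ hx
    · rintro x rfl
      rw [hact]
      exact Mon.evalOp_homog A.internal H x hv
  · rw [BurkeOperad.one_eq, hact]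
    rfl
  · induction x using BurkeOperad.induction with
    | zero => simp
    | add x y hx hy => simp only [map_add, add_apply, hx, hy, smul_add]
    | smul c x hx => simp only [map_smul, smul_apply, hx, Mon.sign_comm]
    | basis x =>
      rw [BurkeOperad.perm_cls, hact, hact]
      exact permOp_apply A.internal σ _ hv
  · induction x using BurkeOperad.induction with
    | zero => simp
    | add x x' hx hx' => simp only [map_add, LinearMap.add_apply, add_apply, hx, hx', smul_add]
    | smul c x hx => simp only [map_smul, LinearMap.smul_apply, smul_apply, hx, Mon.sign_comm]
    | basis x =>
    refine BurkeOperad.gr_induction (p := fun y => act l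
      ((BurkeOperad k).circ h i (BurkeOperad.cls k x) y) v =
        (b * degBefore deg i.val).negOnePow •
          act m (BurkeOperad.cls k x) (plug h i (act n y) v)) ?_ ?_ ?_ ?_ hy
    · simp only [map_zero]
      rw [plug_eq_update h i _ 0]
      simp
    · intro y y' hy hy'
      simp only [map_add, add_apply, hy, hy']
      rw [plug_eq_update h i _ 0, plug_eq_update h i (act n y') 0,
        plug_eq_update h i (⇑(act n y + act n y')) 0, add_apply,
        MultilinearMap.map_update_add, smul_add]
    · intro c y hy
      simp only [map_smul, smul_apply, hy]
      rw [plug_eq_update h i _ 0, plug_eq_update h i (⇑(c • act n y)) 0,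
        smul_apply, MultilinearMap.map_update_smul, Mon.sign_comm]
    · rintro y rfl
      rw [BurkeOperad.circ_cls, hact, hact, hact]
      exact circOp_apply A.internal _ h i _ _ hv
  · refine BurkeOperad.gr_induction (p := fun x => A.d (act n x v) =
      act n ((BurkeOperad k).d n x) v +
        a.negOnePow • ∑ i : Fin n, (degBefore deg i.val).negOnePow •
          act n x (Function.update v i (A.d (v i)))) ?_ ?_ ?_ ?_ hx
    · simp
    · intro x y hx hy
      simp only [map_add, add_apply, hx, hy, smul_add, Finset.sum_add_distrib]
      abel
    · intro c x hx
      simp only [map_smul, smul_apply, hx, smul_add, Mon.sign_comm, Finset.smul_sum]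
    · rintro x rfl
      rw [BurkeOperad.d_cls, hact, hact, Mon.evalOp,
        diffOp_apply A.internal _ _ hv, sub_add_cancel]

end Algebra


/-! ### Homogeneous components -/

section Component

variable {k : Type u} [Field k] {V : Type v} [AddCommGroup V] [Module k V]
  {gr : ℤ → Submodule k V} (hgr : DirectSum.IsInternal gr)

/-- The decomposition of a graded vector space. -/
noncomputable def gradingEquiv : (⨁ a, gr a) ≃ₗ[k] V :=
  LinearEquiv.ofBijective (DirectSum.coeLinearMap gr) (show Function.Bijective _ from hgr)

theorem gradingEquiv_symm_of_mem {a : ℤ} {x : V} (hx : x ∈ gr a) :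
    (gradingEquiv hgr).symm x = DirectSum.lof k ℤ (fun a => gr a) a ⟨x, hx⟩ :=
  (LinearEquiv.symm_apply_eq _).2
    (DirectSum.coeLinearMap_lof (R := k) gr a (⟨x, hx⟩ : gr a)).symm

/-- The projection to the component of degree `a`. -/
noncomputable def homComp (a : ℤ) : V →ₗ[k] V :=
  (gr a).subtype ∘ₗ DirectSum.component k ℤ (fun a => gr a) a ∘ₗ
    (gradingEquiv hgr).symm.toLinearMap

theorem homComp_mem (a : ℤ) (x : V) : homComp hgr a x ∈ gr a := by
  simp only [homComp, LinearMap.comp_apply]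
  exact Submodule.coe_mem _

theorem homComp_of_mem {a : ℤ} {x : V} (hx : x ∈ gr a) : homComp hgr a x = x := by
  simp only [homComp, LinearMap.comp_apply, LinearEquiv.coe_coe]
  rw [gradingEquiv_symm_of_mem hgr hx, DirectSum.component.lof_self]
  rfl

theorem homComp_of_mem_ne {a b : ℤ} {x : V} (hx : x ∈ gr a) (hab : a ≠ b) :
    homComp hgr b x = 0 := by
  simp only [homComp, LinearMap.comp_apply, LinearEquiv.coe_coe]
  rw [gradingEquiv_symm_of_mem hgr hx, DirectSum.component.of, dif_neg hab, map_zero]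

include hgr in
/-- Additive properties may be checked on homogeneous elements. -/
theorem homogeneous_induction {p : V → Prop} (zero : p 0) (add : ∀ x y, p x → p y → p (x + y))
    (hom : ∀ a, ∀ x ∈ gr a, p x) (x : V) : p x := by
  have hx : x ∈ ⨆ a, gr a := by
    rw [hgr.submodule_iSup_eq_top]
    exact Submodule.mem_top
  exact Submodule.iSup_induction gr (motive := p) hx hom zero add

variable {W : Type w} [AddCommGroup W] [Module k W] {gr' : ℤ → Submodule k W}
  (hgr' : DirectSum.IsInternal gr')

theorem map_homComp {f : V →ₗ[k] W} {c : ℤ} (hf : ∀ a, ∀ x ∈ gr a, f x ∈ gr' (a + c)) (a : ℤ)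
    (x : V) : f (homComp hgr a x) = homComp hgr' (a + c) (f x) := by
  induction x using homogeneous_induction hgr with
  | zero => simp
  | add x y hx hy => simp only [map_add, hx, hy]
  | hom b x hx =>
    by_cases hab : b = a
    · subst hab
      rw [homComp_of_mem hgr hx, homComp_of_mem hgr' (hf b x hx)]
    · rw [homComp_of_mem_ne hgr hx hab, map_zero,
        homComp_of_mem_ne hgr' (hf b x hx) fun e => hab (add_right_cancel e)]

include hgr hgr' in
/-- An injective map of graded vector spaces reflects degrees. -/
theorem mem_gr_of_injective {f : V →ₗ[k] W} (hf : ∀ a, ∀ x ∈ gr a, f x ∈ gr' a)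
    (inj : Function.Injective f) {a : ℤ} {x : V} (hx : f x ∈ gr' a) : x ∈ gr a := by
  have := map_homComp hgr hgr' (c := 0) (fun a x hx => by rw [add_zero]; exact hf a x hx) a x
  rw [add_zero, homComp_of_mem hgr' hx] at this
  rw [← inj this]
  exact homComp_mem hgr a x

end Component

/-! ### Morphisms of dg operads -/

section Hom

variable {k : Type u} [Field k] {P Q R : DGOperad.{u, v} k}

theorem DGOperad.Hom.mem_of_injective (φ : DGOperad.Hom P Q) {n : ℕ}
    (inj : Function.Injective (φ.app n)) {a : ℤ} {x : P.X n} (hx : φ.app n x ∈ Q.gr n a) :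
    x ∈ P.gr n a :=
  mem_gr_of_injective (P.internal n) (Q.internal n) (fun _ _ hx => φ.app_mem hx) inj hx

/-- A bijective morphism of dg operads, in one arity. -/
noncomputable def DGOperad.Hom.equiv (φ : DGOperad.Hom P Q)
    (hφ : ∀ n, Function.Bijective (φ.app n)) (n : ℕ) : P.X n ≃ₗ[k] Q.X n :=
  LinearEquiv.ofBijective (φ.app n) (hφ n)

theorem DGOperad.Hom.app_equiv_symm (φ : DGOperad.Hom P Q)
    (hφ : ∀ n, Function.Bijective (φ.app n)) {n : ℕ} (x : Q.X n) :
    φ.app n ((φ.equiv hφ n).symm x) = x := (φ.equiv hφ n).apply_symm_apply x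

/-- The inverse of a bijective morphism of dg operads. -/
noncomputable def DGOperad.Hom.symm (φ : DGOperad.Hom P Q)
    (hφ : ∀ n, Function.Bijective (φ.app n)) : DGOperad.Hom Q P where
  app n := (φ.equiv hφ n).symm.toLinearMap
  app_mem {n a x} hx := φ.mem_of_injective (hφ n).1 (by
    rwa [LinearEquiv.coe_coe, φ.app_equiv_symm hφ])
  app_one := (hφ 1).1 (by rw [LinearEquiv.coe_coe, φ.app_equiv_symm hφ, φ.app_one])
  app_perm {n} σ x := (hφ n).1 (by
    simp only [LinearEquiv.coe_coe, φ.app_perm, φ.app_equiv_symm hφ])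
  app_circ {m n l} h i x y := (hφ l).1 (by
    simp only [LinearEquiv.coe_coe, φ.app_circ, φ.app_equiv_symm hφ])
  app_d {n} x := (hφ n).1 (by
    simp only [LinearEquiv.coe_coe, φ.app_d, φ.app_equiv_symm hφ])

theorem DGOperad.Hom.symm_app_app (φ : DGOperad.Hom P Q)
    (hφ : ∀ n, Function.Bijective (φ.app n)) {n : ℕ} (x : P.X n) :
    (φ.symm hφ).app n (φ.app n x) = x :=
  (φ.equiv hφ n).symm_apply_apply x

theorem DGOperad.Hom.app_symm_app (φ : DGOperad.Hom P Q)
    (hφ : ∀ n, Function.Bijective (φ.app n)) {n : ℕ} (x : Q.X n) :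
    φ.app n ((φ.symm hφ).app n x) = x := φ.app_equiv_symm hφ x

/-- Restriction of algebra structures along a morphism of dg operads. -/
def OperadAlgebra.comap {A : Cochain.{u, w} k} (φ : DGOperad.Hom P Q) (α : OperadAlgebra Q A) :
    OperadAlgebra P A where
  act n := α.act n ∘ₗ φ.app n
  act_mem hx hv := α.act_mem (φ.app_mem hx) hv
  act_one v := by
    rw [LinearMap.comp_apply, φ.app_one]
    exact α.act_one v
  act_perm σ x v hv := by
    rw [LinearMap.comp_apply, φ.app_perm]
    exact α.act_perm σ _ v hv
  act_circ {_ _ _} h i {_ _} x y v hy hv := by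
    rw [LinearMap.comp_apply, φ.app_circ]
    exact α.act_circ h i _ _ v (φ.app_mem hy) hv
  act_d x v hx hv := by
    simp only [LinearMap.comp_apply, φ.app_d]
    exact α.act_d _ v (φ.app_mem hx) hv

variable {A : Cochain.{u, w} k} (α : OperadAlgebra P A)

theorem OperadAlgebra.isHomogOp_act {n : ℕ} {a : ℤ} {x : P.X n} (hx : x ∈ P.gr n a) :
    IsHomogOp A.gr (α.act n x) a := fun _ _ hv => α.act_mem hx hv

theorem OperadAlgebra.act_one_eq : α.act 1 P.one = unaryOp LinearMap.id := by
  ext v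
  exact α.act_one v

theorem OperadAlgebra.act_perm_eq {n : ℕ} (σ : Equiv.Perm (Fin n)) (x : P.X n) :
    α.act n (P.perm n σ x) = permOp A.internal σ (α.act n x) :=
  multilinear_ext_homogeneous A.internal fun _ v hv => by
    rw [permOp_apply A.internal _ _ hv, α.act_perm σ x v hv]

theorem OperadAlgebra.act_circ_eq {m n l : ℕ} (h : l + 1 = m + n) (i : Fin m) {b : ℤ} (x : P.X m)
    {y : P.X n} (hy : y ∈ P.gr n b) :
    α.act l (P.circ h i x y) = circOp A.internal b h i (α.act m x) (α.act n y) :=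
  multilinear_ext_homogeneous A.internal fun _ v hv => by
    rw [circOp_apply A.internal _ _ _ _ _ hv, α.act_circ h i x y v hy hv]

theorem OperadAlgebra.act_d_eq {n : ℕ} {a : ℤ} {x : P.X n} (hx : x ∈ P.gr n a) :
    α.act n (P.d n x) = diffOp A.internal A.d a (α.act n x) :=
  multilinear_ext_homogeneous A.internal fun _ v hv => by
    rw [diffOp_apply A.internal _ _ hv, α.act_d x v hx hv, add_sub_cancel_right]

end Hom

/-! ### Strictly unital `A∞`-structures in terms of the endomorphism operad -/

section Stasheff

variable {k : Type u} [Field k] {V : Type w} [AddCommGroup V] [Module k V]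
  {gr : ℤ → Submodule k V} (hgr : DirectSum.IsInternal gr) {d : V →ₗ[k] V}

theorem plug_opZero {m l : ℕ} (h : l + 1 = m + 0) (i : Fin m) (e : V) (v : Fin l → V) :
    plug h i (constOp e : Op k V 0) v i = e := plug_self _ _ _ _

/-- The Stasheff relation in arity `N + 2` says that the sum of the boundary of `m_{N+2}` and of
the terms which involve only the operations of arity at least `2` vanishes. -/
theorem stasheff_eq {m : ∀ n, Op k V n} (h1 : m 1 = unaryOp d) (e : V) (N : ℕ)
    {deg : Fin (N + 2) → ℤ} {v : Fin (N + 2) → V} (hv : ∀ j, v j ∈ gr (deg j)) :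
    ∑ s : Fin (N + 2), ∑ r : Fin (N + 2 - s.val),
      (((r.val : ℤ) + ((s.val : ℤ) + 1) * (((N + 2 : ℕ) : ℤ) - s.val - 1 - r.val)) +
          (1 - (s.val : ℤ)) * degBefore deg r.val).negOnePow •
        m (N + 2 - s.val) (plug (n := s.val + 1) (by omega) r (m (s.val + 1)) v) =
    (diffOp hgr d (-(N : ℤ)) (m (N + 2)) +
      Mon.evalOpL hgr d e (fun n => m (n + 2)) (Mon.stasheffSum k N)) v := by
  -- the arity of the outer operation may be replaced by a number equal to it
  have key : ∀ (s p p' : ℕ) (c : ℕ → ℤ) (hp : p = p') (h : N + 2 + 1 = p + (s + 1)),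
      ∑ r : Fin p, (c r.val).negOnePow • m p (plug h r (m (s + 1)) v) =
      ∑ r : Fin p', (c r.val).negOnePow • m p' (plug (hp ▸ h) r (m (s + 1)) v) := by
    rintro s p _ c rfl h
    rfl
  -- the terms in which both operations have arity at least two
  have mid : ∀ s : Fin N, ∑ r : Fin (N + 2 - (s.val + 1)),
      (((r.val : ℤ) + (((s.val + 1 : ℕ) : ℤ) + 1) *
        (((N + 2 : ℕ) : ℤ) - (s.val + 1 : ℕ) - 1 - r.val)) +
          (1 - ((s.val + 1 : ℕ) : ℤ)) * degBefore deg r.val).negOnePow •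
        m (N + 2 - (s.val + 1)) (plug (n := s.val + 1 + 1) (by omega) r (m (s.val + 1 + 1)) v) =
      ∑ r : Fin (N - s.val - 1 + 2),
      ((r.val : ℤ) + ((s.val : ℤ) + 2) * ((N : ℤ) - s.val - r.val)).negOnePow •
        circOp hgr (-(s.val : ℤ)) (m := N - s.val - 1 + 2) (n := s.val + 2) (by omega) r
          (m (N - s.val - 1 + 2)) (m (s.val + 2)) v := by
    intro s
    rw [key (s.val + 1) (N + 2 - (s.val + 1)) (N - s.val - 1 + 2)
      (fun r => ((r : ℤ) + (((s.val + 1 : ℕ) : ℤ) + 1) *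
        (((N + 2 : ℕ) : ℤ) - (s.val + 1 : ℕ) - 1 - r)) +
          (1 - ((s.val + 1 : ℕ) : ℤ)) * degBefore deg r) (by omega) (by omega)]
    refine Finset.sum_congr rfl fun r _ => ?_
    rw [circOp_apply hgr _ _ _ _ _ hv, smul_smul, ← Int.negOnePow_add]
    congr 2
    push_cast
    ring
  have deg0 : degBefore deg 0 = 0 := by simp [degBefore]
  -- the term in which `m 1` is applied to the result
  have last : ∑ r : Fin 1,
      ((r : ℤ) + (((N + 1 : ℕ) : ℤ) + 1) * (((N + 2 : ℕ) : ℤ) - (N + 1 : ℕ) - 1 - r) +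
          (1 - ((N + 1 : ℕ) : ℤ)) * degBefore deg r).negOnePow •
        m 1 (plug (add_comm (N + 2) 1) r (m (N + 2)) v) = d (m (N + 2) v) := by
    have sgn : ((0 : ℤ) + (((N + 1 : ℕ) : ℤ) + 1) * (((N + 2 : ℕ) : ℤ) - (N + 1 : ℕ) - 1 - 0) +
        (1 - ((N + 1 : ℕ) : ℤ)) * degBefore deg 0).negOnePow = 1 := by
      rw [deg0]
      push_cast
      ring_nf
      simp
    rw [Fin.sum_univ_one, Fin.val_zero, Nat.cast_zero, sgn, one_smul, h1, unaryOp_apply, plug_self]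
    simp only [innerIdx_zero_one]
  -- the terms in which `m 1` is applied to an argument
  have first : ∑ r : Fin (N + 2), ((r.val : ℤ) + (((0 : ℕ) : ℤ) + 1) *
        (((N + 2 : ℕ) : ℤ) - (0 : ℕ) - 1 - r.val) +
          (1 - ((0 : ℕ) : ℤ)) * degBefore deg r.val).negOnePow •
        m (N + 2) (plug (n := 1) rfl r (m 1) v) =
      -((-(N : ℤ)).negOnePow • ∑ r : Fin (N + 2), (degBefore deg r.val).negOnePow •
        m (N + 2) (Function.update v r (d (v r)))) := by
    rw [Finset.smul_sum, ← Finset.sum_neg_distrib]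
    refine Finset.sum_congr rfl fun r _ => ?_
    have : (r.val : ℤ) + (((0 : ℕ) : ℤ) + 1) * (((N + 2 : ℕ) : ℤ) - (0 : ℕ) - 1 - r.val) +
        (1 - ((0 : ℕ) : ℤ)) * degBefore deg r.val = (N : ℤ) + degBefore deg r.val + 1 := by
      push_cast
      ring
    rw [this, Int.negOnePow_succ, Int.negOnePow_add, ← Int.negOnePow_neg (N : ℤ), plug_unary, h1,
      Units.neg_smul, mul_smul]
    rfl
  have ev : Mon.evalOpL hgr d e (fun n => m (n + 2)) (Mon.stasheffSum k N) v =
      ∑ s : Fin N, ∑ r : Fin (N - s.val - 1 + 2),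
        ((r.val : ℤ) + ((s.val : ℤ) + 2) * ((N : ℤ) - s.val - r.val)).negOnePow •
        circOp hgr (-(s.val : ℤ)) (m := N - s.val - 1 + 2) (n := s.val + 2) (by omega) r
          (m (N - s.val - 1 + 2)) (m (s.val + 2)) v := by
    simp only [Mon.stasheffSum, map_sum, Mon.map_sign, Mon.evalOpL_ι, sum_apply, smul_apply]
    rfl
  rw [add_apply, diffOp_apply hgr _ _ hv, ev, Fin.sum_univ_succ, Fin.sum_univ_castSucc]
  refine (congrArg₂ (· + ·) (first) (congrArg₂ (· + ·)
    (Finset.sum_congr rfl fun s _ => mid s) ((key (N + 1) (N + 2 - (N + 1)) 1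
    (fun r => ((r : ℤ) + (((N + 1 : ℕ) : ℤ) + 1) * (((N + 2 : ℕ) : ℤ) - (N + 1 : ℕ) - 1 - r)) +
          (1 - ((N + 1 : ℕ) : ℤ)) * degBefore deg r) (by omega) (by omega)).trans last))).trans ?_
  abel

end Stasheff


/-! ### Algebras over the presented operad are strictly unital `A∞`-algebras -/

section Bijection

variable {k : Type u} [Field k]

theorem constOp_zero {V : Type w} [AddCommGroup V] [Module k V] (f : Op k V 0) :
    constOp (f ![]) = f := by
  ext v
  rw [constOp_apply, Subsingleton.elim v ![]]

theorem circOp_constOp_left {V : Type w} [AddCommGroup V] [Module k V] {gr : ℤ → Submodule k V}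
    (hgr : DirectSum.IsInternal gr) (f : Op k V 2) (e : V) (v : Fin 1 → V) :
    circOp hgr 0 (n := 0) (l := 1) rfl 0 f (constOp e) v = f ![e, v 0] := by
  have : circOp hgr 0 (n := 0) (l := 1) rfl 0 f (constOp e) =
      insertOp (n := 0) (l := 1) rfl 0 f (constOp e) :=
    multilinear_ext_homogeneous hgr fun deg v hv => by
      rw [circOp_apply hgr _ _ _ _ _ hv, zero_mul, Int.negOnePow_zero, one_smul, insertOp_apply]
  rw [this, insertOp_apply]
  congr 1
  funext j
  fin_cases j
  · exact plug_self _ _ _ _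
  · exact plug_of_ne _ _ _ _ (by decide)

theorem circOp_constOp_right {V : Type w} [AddCommGroup V] [Module k V] {gr : ℤ → Submodule k V}
    (hgr : DirectSum.IsInternal gr) (f : Op k V 2) (e : V) (v : Fin 1 → V) :
    circOp hgr 0 (n := 0) (l := 1) rfl 1 f (constOp e) v = f ![v 0, e] := by
  have : circOp hgr 0 (n := 0) (l := 1) rfl 1 f (constOp e) =
      insertOp (n := 0) (l := 1) rfl 1 f (constOp e) :=
    multilinear_ext_homogeneous hgr fun deg v hv => by
      rw [circOp_apply hgr _ _ _ _ _ hv, zero_mul, Int.negOnePow_zero, one_smul, insertOp_apply]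
  rw [this, insertOp_apply]
  congr 1
  funext j
  fin_cases j
  · exact plug_of_ne _ _ _ _ (by decide)
  · exact plug_self _ _ _ _

theorem outerIdx_succAbove {n : ℕ} (i : Fin (n + 1)) (s : Fin n) :
    outerIdx (n := 0) (l := n) rfl i (i.succAbove s) (i.succAbove_ne s) = s := by
  apply Fin.ext
  simp only [outerIdx]
  rcases lt_or_ge s.castSucc i with h | h
  · rw [Fin.succAbove_of_castSucc_lt _ _ h]
    have : s.val < i.val := h
    simp [this]
  · rw [Fin.succAbove_of_le_castSucc _ _ h]
    have : i.val ≤ s.val := h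
    simp only [Fin.val_succ]
    split_ifs <;> omega

theorem plug_succAbove {V : Type w} {n : ℕ} (i : Fin (n + 1)) {g : (Fin 0 → V) → V}
    {v : Fin (n + 1) → V} (hv : ∀ c, g c = v i) :
    plug (n := 0) (l := n) rfl i g (fun s => v (i.succAbove s)) = v := by
  funext j
  by_cases hj : j = i
  · subst hj
    rw [plug_self, hv]
  · rw [plug_of_ne _ _ _ _ hj]
    obtain ⟨s, rfl⟩ := Fin.exists_succAbove_eq hj
    rw [outerIdx_succAbove]

variable {A : Cochain.{u, w} k}

theorem StrictlyUnitalAInfinity.m_one_eq {S : StrictlyUnitalAInfinity A.gr}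
    (hS : ∀ x, S.m 1 ![x] = A.d x) : S.m 1 = unaryOp A.d := by
  ext v
  rw [unaryOp_apply, ← hS]
  congr 1
  funext j
  rw [Subsingleton.elim j 0]
  rfl

/-- Passage from strictly unital `A∞`-structures to the endomorphism operad; the Stasheff relations
turn into the formula for `∂μ_n` by `stasheff_eq`. -/
theorem StrictlyUnitalAInfinity.isUnitalData (S : StrictlyUnitalAInfinity A.gr)
    (hS : ∀ x, S.m 1 ![x] = A.d x) :
    IsUnitalData A.internal A.d S.unit (fun n => S.m (n + 2)) where
  d_mem _ _ hx := A.d_mem hx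
  d_d := A.d_d
  unit_mem := S.unit_mem
  d_unit := (hS _).symm.trans S.m_one_unit
  mul_mem n deg v hv := by
    have := S.m_mem (n := n + 2) hv
    rwa [show (2 : ℤ) - ((n + 2 : ℕ) : ℤ) = -(n : ℤ) by push_cast; ring] at this
  d_mul N := multilinear_ext_homogeneous A.internal fun deg v hv => by
    rw [← stasheff_eq A.internal (StrictlyUnitalAInfinity.m_one_eq hS) S.unit N hv]
    exact S.stasheff v hv
  mul_two_unit i := by
    ext v
    rw [unaryOp_apply]
    fin_cases i
    · exact (circOp_constOp_left A.internal _ _ v).trans (S.unit_mul _)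
    · exact (circOp_constOp_right A.internal _ _ v).trans (S.mul_unit _)
  mul_unit n i := multilinear_ext_homogeneous A.internal fun deg v hv => by
    rw [circOp_apply A.internal _ _ _ _ _ hv, S.m_unit (by omega) _ i (plug_opZero _ _ _ _),
      smul_zero]
    rfl

/-- The family of operations consisting of `d` in arity `1` and of `μ n` in arity `n + 2`. -/
def opFamily {V : Type w} [AddCommGroup V] [Module k V] (d : V →ₗ[k] V)
    (μ : ∀ n, Op k V (n + 2)) : ∀ n, Op k V n
  | 0 => 0
  | 1 => unaryOp d
  | n + 2 => μ n

/-- The strictly unital `A∞`-structure given by operations in the endomorphism operad. -/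
def IsUnitalData.structure {e : A.carrier} {μ : ∀ n, Op k A.carrier (n + 2)}
    (H : IsUnitalData A.internal A.d e μ) : StrictlyUnitalAInfinity A.gr where
  m := opFamily A.d μ
  m_zero := rfl
  m_mem {n deg v} hv := by
    match n with
    | 0 => exact zero_mem _
    | 1 =>
      have := A.d_mem (hv 0)
      rw [Fin.sum_univ_one]
      rwa [show (2 : ℤ) - ((1 : ℕ) : ℤ) + deg 0 = deg 0 + 1 by push_cast; ring]
    | n + 2 =>
      have := H.mul_mem n hv
      rwa [show (2 : ℤ) - ((n + 2 : ℕ) : ℤ) = -(n : ℤ) by push_cast; ring]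
  stasheff {n deg} v hv := by
    match n with
    | 0 => exact Finset.sum_empty
    | 1 =>
      rw [Fin.sum_univ_one]
      refine (Fin.sum_univ_one _).trans ?_
      have : opFamily A.d μ 1 (plug (n := 1) (l := 1) rfl 0 (opFamily A.d μ 1) v) = 0 := by
        rw [plug_unary]
        simp [opFamily, unaryOp_apply, H.d_d]
      exact (congrArg _ this).trans (smul_zero _)
    | n + 2 =>
      rw [stasheff_eq A.internal (m := opFamily A.d μ) rfl e n hv]
      have := H.d_mul n
      exact congrArg (fun f : Op k A.carrier (n + 2) => f v) this
  unit := e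
  unit_mem := H.unit_mem
  m_one_unit := H.d_unit
  unit_mul x := by
    have := circOp_constOp_left A.internal (μ 0) e ![x]
    rw [H.mul_two_unit] at this
    exact this.symm
  mul_unit x := by
    have := circOp_constOp_right A.internal (μ 0) e ![x]
    rw [H.mul_two_unit] at this
    exact this.symm
  m_unit {n} hn v i hv := by
    obtain ⟨n, rfl⟩ := Nat.exists_eq_add_of_le' hn
    have key : insertOp (n := 0) (l := n + 2) rfl i (μ (n + 1)) (constOp e) = 0 := by
      rw [← H.mul_unit n i]
      exact multilinear_ext_homogeneous A.internal fun deg v hv => by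
        rw [circOp_apply A.internal _ _ _ _ _ hv, zero_mul, Int.negOnePow_zero, one_smul,
          insertOp_apply]
    have := congrArg (fun f : Op k A.carrier (n + 2) => f fun s => v (i.succAbove s)) key
    rwa [insertOp_apply, plug_succAbove (g := constOp e) i fun _ => hv.symm] at this

/-- The generators of the presented operad act on every algebra by a strictly unital
`A∞`-structure. -/
theorem OperadAlgebra.isUnitalData (α : OperadAlgebra (BurkeOperad k) A) :
    IsUnitalData A.internal A.d (α.act 0 (BurkeOperad.unit k) ![])
      (fun n => α.act (n + 2) (BurkeOperad.mul k n)) where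
  d_mem _ _ hx := A.d_mem hx
  d_d := A.d_d
  unit_mem := by
    have := α.act_mem (deg := fun _ => 0) (v := ![]) (BurkeOperad.unit_mem (k := k))
      (fun j => j.elim0)
    simpa using this
  d_unit := by
    have := α.act_d (deg := fun _ => 0) (BurkeOperad.unit k) ![] BurkeOperad.unit_mem
      (fun j => j.elim0)
    rw [this, BurkeOperad.d_unit]
    simp
  mul_mem n := α.isHomogOp_act (BurkeOperad.mul_mem n)
  d_mul N := by
    rw [← α.act_d_eq (BurkeOperad.mul_mem N), BurkeOperad.d_mul, map_neg, neg_add_eq_zero, map_sum,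
      Mon.stasheffSum, map_sum]
    refine Finset.sum_congr rfl fun s _ => ?_
    rw [map_sum, map_sum]
    refine Finset.sum_congr rfl fun r _ => ?_
    rw [Mon.map_sign, Mon.map_sign, Mon.evalOpL_ι, Mon.evalOp,
      α.act_circ_eq _ _ _ (BurkeOperad.mul_mem s.val)]
    rfl
  mul_two_unit i := by
    rw [constOp_zero, ← α.act_circ_eq _ _ _ BurkeOperad.unit_mem, BurkeOperad.mul_two_unit,
      α.act_one_eq]
  mul_unit n i := by
    rw [constOp_zero, ← α.act_circ_eq _ _ _ BurkeOperad.unit_mem, BurkeOperad.mul_unit, map_zero]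

theorem BurkeOperad.cls_mem {n : ℕ} (x : Mon n) :
    BurkeOperad.cls k x ∈ (BurkeOperad k).gr n x.deg :=
  ⟨Mon.ι x, Mon.ι_mem_homog x, rfl⟩

theorem OperadAlgebra.act_cls (α : OperadAlgebra (BurkeOperad k) A) {n : ℕ} (x : Mon n) :
    α.act n (BurkeOperad.cls k x) = Mon.evalOp A.internal A.d (α.act 0 (BurkeOperad.unit k) ![])
      (fun n => α.act (n + 2) (BurkeOperad.mul k n)) x := by
  induction x with
  | unit => exact (constOp_zero _).symm
  | mul n => rfl
  | one => exact α.act_one_eq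
  | perm σ x ih => rw [← BurkeOperad.perm_cls, α.act_perm_eq, ih, Mon.evalOp]
  | circ h i x y ihx ihy =>
    rw [← BurkeOperad.circ_cls, α.act_circ_eq h i _ (BurkeOperad.cls_mem y), ihx, ihy, Mon.evalOp]
  | diff x ih => rw [← BurkeOperad.d_cls, α.act_d_eq (BurkeOperad.cls_mem x), ih, Mon.evalOp]

/-- An algebra over the presented operad is determined by the action of the generators. -/
theorem OperadAlgebra.burke_ext {α α' : OperadAlgebra (BurkeOperad k) A}
    (h0 : α.act 0 (BurkeOperad.unit k) ![] = α'.act 0 (BurkeOperad.unit k) ![])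
    (h2 : ∀ n, α.act (n + 2) (BurkeOperad.mul k n) = α'.act (n + 2) (BurkeOperad.mul k n)) :
    α = α' := by
  refine OperadAlgebra.ext (funext fun n => LinearMap.ext fun x => ?_)
  induction x using BurkeOperad.induction with
  | zero => simp
  | add x y hx hy => rw [map_add, map_add, hx, hy]
  | smul c x hx => rw [map_smul, map_smul, hx]
  | basis x => rw [α.act_cls, α'.act_cls, h0, funext h2]

variable {P : DGOperad.{u, u} k} (φ : DGOperad.Hom (BurkeOperad k) P)

/-- An algebra over an operad which receives a morphism from the presented operad carries exactly
one strictly unital `A∞`-structure formed by the images of the generators. -/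
theorem OperadAlgebra.existsUnique_structure (α : OperadAlgebra P A) :
    ∃! S : StrictlyUnitalAInfinity A.gr, α.Realizes (φ.app 0 (BurkeOperad.unit k))
      (fun n => φ.app (n + 2) (BurkeOperad.mul k n)) S := by
  refine ⟨(α.comap φ).isUnitalData.structure, ⟨fun x => rfl, rfl, fun n => rfl⟩, ?_⟩
  rintro S ⟨h1, h2, h3⟩
  refine StrictlyUnitalAInfinity.ext (funext fun n => ?_) h2
  match n with
  | 0 => exact S.m_zero
  | 1 => exact S.m_one_eq h1
  | n + 2 => exact h3 n

/-- Strictly unital `A∞`-structures extend uniquely to algebras over every operad isomorphic to the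
presented one. -/
theorem OperadAlgebra.existsUnique_algebra (hφ : ∀ n, Function.Bijective (φ.app n))
    (S : StrictlyUnitalAInfinity A.gr) (hS : ∀ x, S.m 1 ![x] = A.d x) :
    ∃! α : OperadAlgebra P A, α.Realizes (φ.app 0 (BurkeOperad.unit k))
      (fun n => φ.app (n + 2) (BurkeOperad.mul k n)) S := by
  obtain ⟨α, hα⟩ := (S.isUnitalData hS).exists_algebra
  refine ⟨α.comap (φ.symm hφ), ⟨hS, ?_, fun n => ?_⟩, ?_⟩
  · refine Eq.trans ?_ (congrArg (fun x => α.act 0 x ![]) (φ.symm_app_app hφ _).symm)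
    exact (congrArg (fun f : Op k A.carrier 0 => f ![]) (hα 0 .unit)).symm
  · refine Eq.trans ?_ (congrArg (fun x => α.act (n + 2) x) (φ.symm_app_app hφ _).symm)
    exact (hα (n + 2) (.mul n)).symm
  · rintro α' ⟨_, h2, h3⟩
    have key : α'.comap φ = α := by
      refine OperadAlgebra.burke_ext ?_ fun n => ?_
      · exact h2.symm.trans (congrArg (fun f : Op k A.carrier 0 => f ![]) (hα 0 .unit)).symm
      · exact (h3 n).symm.trans (hα (n + 2) (.mul n)).symm
    refine OperadAlgebra.ext (funext fun n => LinearMap.ext fun x => ?_)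
    have := congrArg (fun a : OperadAlgebra (BurkeOperad k) A =>
      a.act n ((φ.symm hφ).app n x)) key
    refine Eq.trans ?_ this
    exact congrArg (α'.act n) (φ.app_symm_app hφ x).symm

end Bijection

/-! ### Morphisms -/

section Morphisms

variable {k : Type u} [Field k]

theorem map_plug {V : Type v} {W : Type w} {m n l : ℕ} (h : l + 1 = m + n) (i : Fin m)
    (f : V → W) {g : (Fin n → V) → V} {g' : (Fin n → W) → W}
    (hg : ∀ v, f (g v) = g' fun j => f (v j)) (v : Fin l → V) :
    (fun j => f (plug h i g v j)) = plug h i g' fun j => f (v j) := by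
  funext j
  by_cases hj : j = i
  · subst hj
    rw [plug_self, plug_self, hg]
  · rw [plug_of_ne _ _ _ _ hj, plug_of_ne _ _ _ _ hj]

variable {A B : Cochain.{u, w} k} {f : A.carrier →ₗ[k] B.carrier}

theorem commutes_ext {n : ℕ} {g : Op k A.carrier n} {g' : Op k B.carrier n}
    (H : ∀ (deg : Fin n → ℤ) (v : Fin n → A.carrier), (∀ j, v j ∈ A.gr (deg j)) →
      f (g v) = g' fun j => f (v j)) (v : Fin n → A.carrier) : f (g v) = g' fun j => f (v j) := by
  have : f.compMultilinearMap g = g'.compLinearMap fun _ => f :=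
    multilinear_ext_homogeneous A.internal H
  exact congrArg (fun h : MultilinearMap k (fun _ : Fin n => A.carrier) B.carrier => h v) this

/-- A map of graded vector spaces commutes with all operations of algebras over the presented
operad as soon as it commutes with the differentials and with the generators. -/
theorem map_act_cls (hf : ∀ a, ∀ x ∈ A.gr a, f x ∈ B.gr a) (hd : ∀ x, f (A.d x) = B.d (f x))
    {α : OperadAlgebra (BurkeOperad k) A} {α' : OperadAlgebra (BurkeOperad k) B}
    (h0 : f (α.act 0 (BurkeOperad.unit k) ![]) = α'.act 0 (BurkeOperad.unit k) ![])
    (h2 : ∀ n v, f (α.act (n + 2) (BurkeOperad.mul k n) v) =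
      α'.act (n + 2) (BurkeOperad.mul k n) fun j => f (v j)) {n : ℕ} (x : Mon n)
    (v : Fin n → A.carrier) : f (α.act n (BurkeOperad.cls k x) v) =
      α'.act n (BurkeOperad.cls k x) fun j => f (v j) := by
  induction x with
  | unit =>
    rw [Subsingleton.elim v ![], Subsingleton.elim (fun j : Fin 0 => f (![] j)) ![]]
    exact h0
  | mul n => exact h2 n v
  | one =>
    rw [← BurkeOperad.one_eq, α.act_one, α'.act_one]
  | perm σ x ih =>
    refine commutes_ext (fun deg v hv => ?_) v
    rw [← BurkeOperad.perm_cls, α.act_perm σ _ v hv, Mon.map_sign, ih,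
      α'.act_perm σ _ _ fun j => hf _ _ (hv j)]
  | circ h i x y ihx ihy =>
    refine commutes_ext (fun deg v hv => ?_) v
    rw [← BurkeOperad.circ_cls, α.act_circ h i _ _ v (BurkeOperad.cls_mem y) hv, Mon.map_sign, ihx,
      α'.act_circ h i _ _ _ (BurkeOperad.cls_mem y) fun j => hf _ _ (hv j), map_plug h i f ihy]
  | diff x ih =>
    refine commutes_ext (fun deg v hv => ?_) v
    have e1 := α.act_d _ v (BurkeOperad.cls_mem x) hv
    have e2 := α'.act_d _ (fun j => f (v j)) (BurkeOperad.cls_mem x) fun j => hf _ _ (hv j)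
    rw [← BurkeOperad.d_cls, ← sub_eq_iff_eq_add.2 e1, ← sub_eq_iff_eq_add.2 e2, map_sub, hd, ih,
      Mon.map_sign, map_sum]
    refine congrArg (fun z => _ - x.deg.negOnePow • z) (Finset.sum_congr rfl fun i _ => ?_)
    rw [Mon.map_sign, ih]
    congr 2
    funext j
    by_cases hj : j = i
    · subst hj
      rw [Function.update_self, Function.update_self, hd]
    · rw [Function.update_of_ne hj, Function.update_of_ne hj]

variable {P : DGOperad.{u, u} k} {φ : DGOperad.Hom (BurkeOperad k) P}

/-- Morphisms of algebras are the maps which commute with the generators; they commute with the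
differential because it is the operation `m 1`. -/
theorem algebra_morphism_iff (hφ : ∀ n, Function.Bijective (φ.app n)) {α : OperadAlgebra P A}
    {α' : OperadAlgebra P B} {S : StrictlyUnitalAInfinity A.gr} {S' : StrictlyUnitalAInfinity B.gr}
    (hS : α.Realizes (φ.app 0 (BurkeOperad.unit k))
      (fun n => φ.app (n + 2) (BurkeOperad.mul k n)) S)
    (hS' : α'.Realizes (φ.app 0 (BurkeOperad.unit k))
      (fun n => φ.app (n + 2) (BurkeOperad.mul k n)) S')
    (hf : ∀ a, ∀ x ∈ A.gr a, f x ∈ B.gr a) :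
    ((∀ x, f (A.d x) = B.d (f x)) ∧ (∀ (n : ℕ) (p : P.X n) (v : Fin n → A.carrier),
        f (α.act n p v) = α'.act n p (fun j => f (v j)))) ↔
      f S.unit = S'.unit ∧ ∀ (n : ℕ) (v : Fin n → A.carrier),
        f (S.m n v) = S'.m n (fun j => f (v j)) := by
  constructor
  · rintro ⟨hd, h⟩
    refine ⟨?_, fun n v => ?_⟩
    · rw [hS.unit_eq, hS'.unit_eq, h, Subsingleton.elim (fun j : Fin 0 => f (![] j)) ![]]
    · match n with
      | 0 => rw [S.m_zero, S'.m_zero]; simp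
      | 1 =>
        rw [S.m_one_eq hS.d_eq, S'.m_one_eq hS'.d_eq]
        exact hd _
      | n + 2 => rw [hS.m_eq, hS'.m_eq, h]
  · rintro ⟨h0, h⟩
    have hd : ∀ x, f (A.d x) = B.d (f x) := by
      intro x
      have := h 1 ![x]
      rwa [S.m_one_eq hS.d_eq, S'.m_one_eq hS'.d_eq] at this
    refine ⟨hd, fun n p v => ?_⟩
    obtain ⟨x, rfl⟩ := (hφ n).2 p
    induction x using BurkeOperad.induction with
    | zero => simp
    | add x y hx hy => simp only [map_add, add_apply, hx, hy]
    | smul c x hx => simp only [map_smul, smul_apply, hx]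
    | basis x =>
      refine map_act_cls (α := α.comap φ) (α' := α'.comap φ) hf hd ?_ (fun n v => ?_) x v
      · exact (congrArg f hS.unit_eq.symm).trans (h0.trans hS'.unit_eq)
      · have := h (n + 2) v
        rw [hS.m_eq, hS'.m_eq] at this
        exact this

end Morphisms


/-! ### Vector spaces graded by a degree function on a basis -/

section BasisGrading

variable (k : Type u) [Field k] {I B : Type*} (deg : B → I)

/-- The subspace spanned by the basis elements of degree `a`. -/
def basisGrading (a : I) : Submodule k (B →₀ k) := Finsupp.supported k k {x | deg x = a}

theorem basisGrading_internal [DecidableEq I] : DirectSum.IsInternal (basisGrading k deg) := by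
  rw [DirectSum.isInternal_submodule_iff_iSupIndep_and_iSup_eq_top]
  constructor
  · intro a
    have : (⨆ (b : I) (_ : b ≠ a), basisGrading k deg b) ≤
        Finsupp.supported k k {x | deg x ≠ a} :=
      iSup₂_le fun b hb => Finsupp.supported_mono fun x hx => by
        rw [Set.mem_ofPred_eq] at hx ⊢
        rwa [hx]
    refine Disjoint.mono_right this (Finsupp.disjoint_supported_supported ?_)
    exact Set.disjoint_left.2 fun x hx hx' => hx' hx
  · rw [eq_top_iff]
    intro x _
    induction x using Finsupp.induction_linear with
    | zero => exact zero_mem _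
    | add x y hx hy => exact add_mem (hx trivial) (hy trivial)
    | single x c =>
      exact Submodule.mem_iSup_of_mem (deg x) (Finsupp.single_mem_supported k c rfl)

variable {k deg}

theorem single_mem_basisGrading (x : B) (c : k) :
    Finsupp.single x c ∈ basisGrading k deg (deg x) :=
  Finsupp.single_mem_supported k c rfl

theorem single_mem_basisGrading' {x : B} {a : I} (h : deg x = a) (c : k) :
    Finsupp.single x c ∈ basisGrading k deg a := h ▸ single_mem_basisGrading x c

theorem basisGrading_induction {a : I} {p : (B →₀ k) → Prop} (zero : p 0)
    (add : ∀ x y, p x → p y → p (x + y)) (smul : ∀ (c : k) x, p x → p (c • x))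
    (single : ∀ x, deg x = a → p (Finsupp.single x 1)) {v : B →₀ k}
    (hv : v ∈ basisGrading k deg a) : p v := by
  rw [basisGrading, Finsupp.supported_eq_span_single] at hv
  refine Submodule.span_induction (p := fun v _ => p v) ?_ zero (fun x y _ _ => add x y)
    (fun c x _ => smul c x) hv
  rintro _ ⟨x, hx, rfl⟩
  exact single x hx

end BasisGrading

/-! ### Planar trees and forests -/

/-- Planar rooted trees with leaves labelled by natural numbers (`Pl true`) and nonempty planar
forests (`Pl false`).  Every inner vertex has at least two children: `node t f` has the first
child `t` and the further children `f`. -/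
inductive Pl : Bool → Type
  | leaf (a : ℕ) : Pl true
  | node (t : Pl true) (f : Pl false) : Pl true
  | one (t : Pl true) : Pl false
  | cons (t : Pl true) (f : Pl false) : Pl false

namespace Pl

/-- The degree in the bar construction: a tree with vertices of valences `k₁, k₂, …` is an
iterated operation of degree `∑ (2 - kᵢ)`, and its degree in the bar construction is one less. -/
def sdeg : ∀ {b : Bool}, Pl b → ℤ
  | _, leaf _ => -1
  | _, node t f => sdeg t + sdeg f + 1
  | _, one t => sdeg t
  | _, cons t f => sdeg t + sdeg f

theorem forest_induction {p : Pl false → Prop} (one : ∀ t, p (one t))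
    (cons : ∀ t f, p f → p (cons t f)) : ∀ f, p f
  | .one t => one t
  | .cons t f => cons t f (forest_induction one cons f)

/-- The sum of `G f' f''` over all ways to cut a forest `f` into two nonempty forests `f'`
and `f''`. -/
def splits {M : Type*} [AddCommMonoid M] : ∀ {b : Bool}, Pl b → (Pl false → Pl false → M) → M
  | _, leaf _, _ => 0
  | _, node _ _, _ => 0
  | _, one _, _ => 0
  | _, cons t f, G => G (one t) f + splits f fun a b => G (cons t a) b

section Splits

variable {M : Type*} [AddCommMonoid M]

theorem splits_one (t : Pl true) (G : Pl false → Pl false → M) : splits (one t) G = 0 := rfl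

theorem splits_cons (t : Pl true) (f : Pl false) (G : Pl false → Pl false → M) :
    splits (cons t f) G = G (one t) f + splits f fun a b => G (cons t a) b := rfl

theorem splits_zero (f : Pl false) : splits f (fun _ _ => (0 : M)) = 0 := by
  induction f using forest_induction with
  | one t => rfl
  | cons t f ih =>
    rw [splits_cons, ih, add_zero]

theorem splits_add (f : Pl false) (G G' : Pl false → Pl false → M) :
    splits f (fun a b => G a b + G' a b) = splits f G + splits f G' := by
  induction f using forest_induction generalizing G G' with
  | one t => exact (add_zero _).symm
  | cons t f ih =>
    rw [splits_cons, splits_cons, splits_cons, ih]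
    exact add_add_add_comm _ _ _ _

theorem map_splits {N F : Type*} [AddCommMonoid N] [FunLike F M N] [AddMonoidHomClass F M N]
    (L : F) (f : Pl false) (G : Pl false → Pl false → M) :
    L (splits f G) = splits f fun a b => L (G a b) := by
  induction f using forest_induction generalizing G with
  | one t => exact map_zero L
  | cons t f ih =>
    rw [splits_cons, splits_cons, map_add, ih]

theorem smul_splits {R : Type*} [Monoid R] [DistribMulAction R M] (c : R) (f : Pl false)
    (G : Pl false → Pl false → M) : c • splits f G = splits f fun a b => c • G a b :=
  map_splits (DistribSMul.toAddMonoidHom M c) f G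

theorem splits_mem {R : Type*} [Semiring R] [Module R M] (N : Submodule R M) {f : Pl false}
    {G : Pl false → Pl false → M}
    (hG : ∀ a b, sdeg a + sdeg b = sdeg f → G a b ∈ N) : splits f G ∈ N := by
  induction f using forest_induction generalizing G with
  | one t => exact zero_mem _
  | cons t f ih =>
    rw [splits_cons]
    refine add_mem (hG _ _ (by simp only [sdeg])) (ih (fun a b hab => hG _ _ ?_))
    simp only [sdeg]
    rw [← hab]
    ring

theorem splits_congr {f : Pl false} {G G' : Pl false → Pl false → M}
    (h : ∀ a b, G a b = G' a b) : splits f G = splits f G' := by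
  rw [funext fun a => funext (h a)]

/-- Cutting a forest into three parts in the two possible ways. -/
theorem splits_splits (f : Pl false) (G : Pl false → Pl false → Pl false → M) :
    splits f (fun a b => splits a fun a₁ a₂ => G a₁ a₂ b) =
      splits f fun a b => splits b fun b₁ b₂ => G a b₁ b₂ := by
  induction f using forest_induction generalizing G with
  | one t => rfl
  | cons t f ih =>
    rw [splits_cons, splits_cons, splits_one, zero_add, ← ih]
    simp only [splits_cons]
    rw [splits_add]

end Splits

variable {k : Type u} [Field k]

/-- Linear combinations of trees or forests. -/
abbrev Lin (k : Type u) [Field k] (b : Bool) : Type u := Pl b →₀ k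

/-- A tree or forest, as a linear combination. -/
noncomputable def ι {b : Bool} (x : Pl b) : Lin k b := Finsupp.single x 1

/-- The bilinear extension of `node`. -/
noncomputable def nodeL : Lin k true →ₗ[k] Lin k false →ₗ[k] Lin k true := linearize₂ k node

/-- The bilinear extension of `cons`. -/
noncomputable def consL : Lin k true →ₗ[k] Lin k false →ₗ[k] Lin k false := linearize₂ k cons

/-- The linear extension of `one`. -/
noncomputable def oneL : Lin k true →ₗ[k] Lin k false := Finsupp.lmapDomain k k one

theorem nodeL_ι (t : Pl true) (f : Pl false) : nodeL (ι t : Lin k true) (ι f) = ι (node t f) := by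
  simp [nodeL, ι]

theorem consL_ι (t : Pl true) (f : Pl false) : consL (ι t : Lin k true) (ι f) = ι (cons t f) := by
  simp [consL, ι]

theorem oneL_ι (t : Pl true) : oneL (ι t : Lin k true) = ι (one t) := by
  simp [oneL, ι]

theorem lin_induction {b : Bool} {p : Lin k b → Prop} (zero : p 0)
    (add : ∀ x y, p x → p y → p (x + y)) (smul : ∀ (c : k) x, p x → p (c • x))
    (basis : ∀ x, p (ι x)) (v : Lin k b) : p v := by
  induction v using Finsupp.induction_linear with
  | zero => exact zero
  | add x y hx hy => exact add _ _ hx hy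
  | single x c =>
    have := smul c _ (basis x)
    rwa [ι, Finsupp.smul_single_one] at this

/-- The degree in the bar construction. -/
abbrev gr (k : Type u) [Field k] (b : Bool) : ℤ → Submodule k (Lin k b) :=
  basisGrading k sdeg

/-- The differential of the free `A∞`-algebra on generators with zero differential, on trees, and
the differential of its bar construction, on forests. -/
noncomputable def D (k : Type u) [Field k] : ∀ {b : Bool}, Pl b → Lin k b
  | _, leaf _ => 0
  | _, one t => oneL (D k t)
  | _, node t f => -(nodeL (D k t) (ι f) + splits f (fun a b => ι (node (node t a) b)) +
      (sdeg t).negOnePow • nodeL (ι t) (D k f))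
  | _, cons t f => consL (D k t) (ι f) + splits f (fun a b => ι (cons (node t a) b)) +
      ι (one (node t f)) + (sdeg t).negOnePow • consL (ι t) (D k f)

theorem D_one (t : Pl true) : D k (one t) = oneL (D k t) := rfl

theorem D_node (t : Pl true) (f : Pl false) : D k (node t f) =
    -(nodeL (D k t) (ι f) + splits f (fun a b => ι (node (node t a) b)) +
      (sdeg t).negOnePow • nodeL (ι t) (D k f)) := rfl

theorem D_cons (t : Pl true) (f : Pl false) : D k (cons t f) =
    consL (D k t) (ι f) + splits f (fun a b => ι (cons (node t a) b)) +
      ι (one (node t f)) + (sdeg t).negOnePow • consL (ι t) (D k f) := rfl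

theorem sign_smul_left {b : Bool} (G : Lin k true →ₗ[k] Lin k false →ₗ[k] Lin k b) (e : ℤˣ)
    (x : Lin k true) (y : Lin k false) : G (e • x) y = e • G x y := by
  rcases Int.units_eq_one_or e with rfl | rfl <;> simp [Units.neg_smul]

/-- The linear extension of `D`. -/
noncomputable def DL {b : Bool} : Lin k b →ₗ[k] Lin k b := Finsupp.linearCombination k (D k)

theorem DL_ι {b : Bool} (x : Pl b) : DL (ι x : Lin k b) = D k x := by
  simp [DL, ι]

theorem ι_mem {b : Bool} {a : ℤ} {x : Pl b} (h : sdeg x = a) : (ι x : Lin k b) ∈ gr k b a :=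
  single_mem_basisGrading' h 1

theorem nodeL_mem {a b : ℤ} {u : Lin k true} {f : Lin k false} (hu : u ∈ gr k true a)
    (hf : f ∈ gr k false b) : nodeL u f ∈ gr k true (a + b + 1) := by
  refine basisGrading_induction (p := fun u => nodeL u f ∈ gr k true (a + b + 1)) ?_ ?_ ?_ ?_ hu
  · simp
  · intro x y hx hy
    rw [map_add, LinearMap.add_apply]
    exact add_mem hx hy
  · intro c x hx
    rw [map_smul, LinearMap.smul_apply]
    exact Submodule.smul_mem _ _ hx
  rintro t rfl
  refine basisGrading_induction (p := fun f => nodeL (ι t) f ∈ gr k true (sdeg t + b + 1))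
    ?_ ?_ ?_ ?_ hf
  · simp
  · intro x y hx hy
    rw [map_add]
    exact add_mem hx hy
  · intro c x hx
    rw [map_smul]
    exact Submodule.smul_mem _ _ hx
  rintro f rfl
  exact (nodeL_ι (k := k) t f).symm ▸ ι_mem rfl

theorem consL_mem {a b : ℤ} {u : Lin k true} {f : Lin k false} (hu : u ∈ gr k true a)
    (hf : f ∈ gr k false b) : consL u f ∈ gr k false (a + b) := by
  refine basisGrading_induction (p := fun u => consL u f ∈ gr k false (a + b)) ?_ ?_ ?_ ?_ hu
  · simp
  · intro x y hx hy
    rw [map_add, LinearMap.add_apply]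
    exact add_mem hx hy
  · intro c x hx
    rw [map_smul, LinearMap.smul_apply]
    exact Submodule.smul_mem _ _ hx
  rintro t rfl
  refine basisGrading_induction (p := fun f => consL (ι t) f ∈ gr k false (sdeg t + b))
    ?_ ?_ ?_ ?_ hf
  · simp
  · intro x y hx hy
    rw [map_add]
    exact add_mem hx hy
  · intro c x hx
    rw [map_smul]
    exact Submodule.smul_mem _ _ hx
  rintro f rfl
  exact (consL_ι (k := k) t f).symm ▸ ι_mem rfl

theorem oneL_mem {a : ℤ} {u : Lin k true} (hu : u ∈ gr k true a) : oneL u ∈ gr k false a := by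
  refine basisGrading_induction (p := fun u => oneL u ∈ gr k false a) ?_ ?_ ?_ ?_ hu
  · simp
  · intro x y hx hy
    rw [map_add]
    exact add_mem hx hy
  · intro c x hx
    rw [map_smul]
    exact Submodule.smul_mem _ _ hx
  rintro t rfl
  exact (oneL_ι (k := k) t).symm ▸ ι_mem rfl

theorem D_mem {b : Bool} (x : Pl b) : D k x ∈ gr k b (sdeg x + 1) := by
  induction x with
  | leaf a => exact zero_mem _
  | one t ih => exact oneL_mem ih
  | node t f iht ihf =>
    rw [D]
    refine neg_mem (add_mem (add_mem ?_ (splits_mem _ fun a b hab => ι_mem ?_))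
      (Mon.sign_smul_mem _ _ ?_))
    · have := nodeL_mem iht (ι_mem (k := k) (x := f) rfl)
      rwa [show sdeg (node t f) + 1 = sdeg t + 1 + sdeg f + 1 by simp only [sdeg]; ring]
    · simp only [sdeg]
      rw [← hab]
      ring
    · have := nodeL_mem (ι_mem (k := k) (x := t) rfl) ihf
      rwa [show sdeg (node t f) + 1 = sdeg t + (sdeg f + 1) + 1 by simp only [sdeg]; ring]
  | cons t f iht ihf =>
    rw [D]
    refine add_mem (add_mem (add_mem ?_ (splits_mem _ fun a b hab => ι_mem ?_)) (ι_mem rfl))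
      (Mon.sign_smul_mem _ _ ?_)
    · have := consL_mem iht (ι_mem (k := k) (x := f) rfl)
      rwa [show sdeg (cons t f) + 1 = sdeg t + 1 + sdeg f by simp only [sdeg]; ring]
    · simp only [sdeg]
      rw [← hab]
      ring
    · have := consL_mem (ι_mem (k := k) (x := t) rfl) ihf
      rwa [show sdeg (cons t f) + 1 = sdeg t + (sdeg f + 1) by simp only [sdeg]; ring]

theorem DL_mem {b : Bool} {a : ℤ} {x : Lin k b} (hx : x ∈ gr k b a) : DL x ∈ gr k b (a + 1) := by
  refine basisGrading_induction (p := fun x => DL x ∈ gr k b (a + 1)) ?_ ?_ ?_ ?_ hx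
  · simp
  · intro x y hx hy
    rw [map_add]
    exact add_mem hx hy
  · intro c x hx
    rw [map_smul]
    exact Submodule.smul_mem _ _ hx
  rintro t rfl
  exact (DL_ι (k := k) t).symm ▸ D_mem t

theorem DL_oneL (u : Lin k true) : DL (oneL u) = oneL (DL u) := by
  induction u using lin_induction with
  | zero => simp
  | add x y hx hy => simp only [map_add, hx, hy]
  | smul c x hx => simp only [map_smul, hx]
  | basis t => rw [oneL_ι, DL_ι, DL_ι, D]

theorem DL_nodeL_left {a : ℤ} {u : Lin k true} (hu : u ∈ gr k true a) (f : Pl false) :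
    DL (nodeL u (ι f)) = -(nodeL (DL u) (ι f) +
      splits f (fun a b => nodeL (nodeL u (ι a)) (ι b)) + a.negOnePow • nodeL u (D k f)) := by
  refine basisGrading_induction (p := fun u => DL (nodeL u (ι f)) = -(nodeL (DL u) (ι f) +
      splits f (fun a b => nodeL (nodeL u (ι a)) (ι b)) + a.negOnePow • nodeL u (D k f)))
      ?_ ?_ ?_ ?_ hu
  · simp [splits_zero]
  · intro x y hx hy
    simp only [map_add, LinearMap.add_apply, splits_add, hx, hy, smul_add]
    abel
  · intro c x hx
    have := map_splits (c • LinearMap.id : Lin k true →ₗ[k] Lin k true) f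
      (fun a b => nodeL (nodeL x (ι a)) (ι b))
    simp only [LinearMap.smul_apply, LinearMap.id_apply] at this
    simp only [map_smul, LinearMap.smul_apply, hx, smul_add, Mon.sign_comm, smul_neg, this]
  rintro t rfl
  change DL (nodeL (ι t) (ι f)) = -(nodeL (DL (ι t)) (ι f) +
      splits f (fun a b => nodeL (nodeL (ι t) (ι a)) (ι b)) + _ • nodeL (ι t) (D k f))
  simp only [nodeL_ι, DL_ι]
  rw [D]

theorem DL_consL_left {a : ℤ} {u : Lin k true} (hu : u ∈ gr k true a) (f : Pl false) :
    DL (consL u (ι f)) = consL (DL u) (ι f) +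
      splits f (fun a b => consL (nodeL u (ι a)) (ι b)) + oneL (nodeL u (ι f)) +
      a.negOnePow • consL u (D k f) := by
  refine basisGrading_induction (p := fun u => DL (consL u (ι f)) = consL (DL u) (ι f) +
      splits f (fun a b => consL (nodeL u (ι a)) (ι b)) + oneL (nodeL u (ι f)) +
      a.negOnePow • consL u (D k f)) ?_ ?_ ?_ ?_ hu
  · simp [splits_zero]
  · intro x y hx hy
    simp only [map_add, LinearMap.add_apply, splits_add, hx, hy, smul_add]
    abel
  · intro c x hx
    have := map_splits (c • LinearMap.id : Lin k false →ₗ[k] Lin k false) f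
      (fun a b => consL (nodeL x (ι a)) (ι b))
    simp only [LinearMap.smul_apply, LinearMap.id_apply] at this
    simp only [map_smul, LinearMap.smul_apply, hx, smul_add, Mon.sign_comm, this]
  rintro t rfl
  change DL (consL (ι t) (ι f)) = consL (DL (ι t)) (ι f) +
      splits f (fun a b => consL (nodeL (ι t) (ι a)) (ι b)) + oneL (nodeL (ι t) (ι f)) +
      _ • consL (ι t) (D k f)
  simp only [nodeL_ι, consL_ι, oneL_ι, DL_ι]
  rw [D]

/-- The linear extension of `splits`. -/
noncomputable def splitsL {M : Type*} [AddCommGroup M] [Module k M]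
    (G : Lin k false →ₗ[k] Lin k false →ₗ[k] M) : Lin k false →ₗ[k] M :=
  Finsupp.linearCombination k fun f => splits f fun a b => G (ι a) (ι b)

theorem splitsL_ι {M : Type*} [AddCommGroup M] [Module k M]
    (G : Lin k false →ₗ[k] Lin k false →ₗ[k] M) (f : Pl false) :
    splitsL G (ι f) = splits f fun a b => G (ι a) (ι b) := by
  simp [splitsL, ι]

theorem splitsL_consL {M : Type*} [AddCommGroup M] [Module k M]
    (G : Lin k false →ₗ[k] Lin k false →ₗ[k] M) (u : Lin k true) (f : Lin k false) :
    splitsL G (consL u f) = G (oneL u) f + splitsL (G ∘ₗ consL u) f := by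
  induction f using lin_induction with
  | zero => simp
  | add x y hx hy => simp only [map_add, hx, hy]; abel
  | smul c x hx => simp only [map_smul, hx, smul_add]
  | basis f =>
  rw [splitsL_ι]
  induction u using lin_induction with
  | zero => simp [splits_zero]
  | add x y hx hy =>
    simp only [map_add, LinearMap.add_apply, LinearMap.comp_apply, splits_add, hx, hy]; abel
  | smul c x hx =>
    have := map_splits (c • LinearMap.id : M →ₗ[k] M) f
      (fun a b => (G ∘ₗ consL x) (ι a) (ι b))
    simp only [LinearMap.smul_apply, LinearMap.id_apply, LinearMap.comp_apply] at this
    simp only [map_smul, LinearMap.smul_apply, LinearMap.comp_apply, hx, smul_add, this]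
  | basis t =>
    rw [consL_ι, splitsL_ι, splits_cons, oneL_ι]
    simp only [LinearMap.comp_apply, consL_ι]

theorem splitsL_oneL {M : Type*} [AddCommGroup M] [Module k M]
    (G : Lin k false →ₗ[k] Lin k false →ₗ[k] M) (u : Lin k true) : splitsL G (oneL u) = 0 := by
  induction u using lin_induction with
  | zero => simp
  | add x y hx hy => simp only [map_add, hx, hy, add_zero]
  | smul c x hx => simp only [map_smul, hx, smul_zero]
  | basis t => rw [oneL_ι, splitsL_ι, splits_one]

/-- Cutting a forest is a map of complexes. -/
theorem splitsL_D {M : Type*} [AddCommGroup M] [Module k M]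
    (G : Lin k false →ₗ[k] Lin k false →ₗ[k] M) (f : Pl false) :
    splitsL G (D k f) =
      splits f fun a b => G (D k a) (ι b) + (sdeg a).negOnePow • G (ι a) (D k b) := by
  induction f using forest_induction generalizing G with
  | one t => rw [splits_one, D, splitsL_oneL]
  | cons t f ih =>
    have h1 := splitsL_consL G (D k t) (ι f)
    have h2 : splitsL G (splits f fun a b => ι (cons (node t a) b)) =
        splits f (fun a b => G (ι (one (node t a))) (ι b)) +
        splits f (fun a b => splits a fun a₁ a₂ => G (ι (cons (node t a₁) a₂)) (ι b)) := by
      rw [splits_splits f fun a b c => G (ι (cons (node t a) b)) (ι c), ← splits_add, map_splits]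
      refine splits_congr fun a b => ?_
      rw [splitsL_ι, splits_cons]
    have h3 : splitsL G (ι (one (node t f))) = 0 := by rw [splitsL_ι, splits_one]
    have h4 := splitsL_consL G (ι t) (D k f)
    have h5 : ∀ a b, G (splits a fun a₁ a₂ => ι (cons (node t a₁) a₂)) (ι b) =
        splits a fun a₁ a₂ => G (ι (cons (node t a₁) a₂)) (ι b) := fun a b =>
      map_splits (G.flip (ι b)) a _
    rw [splitsL_ι] at h1
    rw [ih] at h4
    rw [splits_cons, D, D, map_add, map_add, map_add, Mon.map_sign, h1, h2, h3, h4]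
    have h6 : ∀ a b, G (D k (cons t a)) (ι b) + (sdeg (cons t a)).negOnePow •
        G (ι (cons t a)) (D k b) = (G (consL (D k t) (ι a)) (ι b) +
        G (ι (one (node t a))) (ι b)) +
        (splits a fun a₁ a₂ => G (ι (cons (node t a₁) a₂)) (ι b)) +
        (sdeg t).negOnePow • (G (consL (ι t) (D k a)) (ι b) +
          (sdeg a).negOnePow • G (consL (ι t) (ι a)) (D k b)) := by
      intro a b
      rw [D, map_add, map_add, map_add, LinearMap.add_apply, LinearMap.add_apply,
        LinearMap.add_apply, h5, consL_ι, sdeg, Int.negOnePow_add, mul_smul, smul_add,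
        Mon.map_sign G]
      have : ∀ e : ℤˣ, (e • G (consL (ι t) (D k a))) (ι b) = e • G (consL (ι t) (D k a)) (ι b) :=
        fun e => rfl
      rw [this]
      abel
    rw [splits_congr h6, oneL_ι, sdeg]
    simp only [LinearMap.comp_apply, splits_add, smul_add, smul_splits]
    abel

/-- The two ways to contract twice at the front of a forest. -/
theorem splits_splits_nodeL {M : Type*} [AddCommMonoid M] [Module k M] (u : Lin k true)
    (G : Lin k true →ₗ[k] Lin k false →ₗ[k] M) (f : Pl false) :
    splits f (fun a b => splits b fun b₁ b₂ => G (nodeL (nodeL u (ι a)) (ι b₁)) (ι b₂)) =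
    splits f (fun a b => G (splits a fun a₁ a₂ => nodeL (nodeL u (ι a₁)) (ι a₂)) (ι b)) := by
  rw [← splits_splits f fun a b c => G (nodeL (nodeL u (ι a)) (ι b)) (ι c)]
  exact splits_congr fun a b => (map_splits (G.flip (ι b)) a _).symm

theorem DL_nodeL {a : ℤ} {u : Lin k true} (hu : u ∈ gr k true a) (f : Lin k false) :
    DL (nodeL u f) = -(nodeL (DL u) f + splitsL (nodeL ∘ₗ nodeL u) f +
      a.negOnePow • nodeL u (DL f)) := by
  induction f using lin_induction with
  | zero => simp
  | add x y hx hy => simp only [map_add, hx, hy, smul_add]; abel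
  | smul c x hx => simp only [map_smul, hx, smul_add, smul_neg, Mon.sign_comm]
  | basis f =>
    rw [DL_nodeL_left hu, splitsL_ι, DL_ι]
    rfl

theorem DL_consL {a : ℤ} {u : Lin k true} (hu : u ∈ gr k true a) (f : Lin k false) :
    DL (consL u f) = consL (DL u) f + splitsL (consL ∘ₗ nodeL u) f + oneL (nodeL u f) +
      a.negOnePow • consL u (DL f) := by
  induction f using lin_induction with
  | zero => simp
  | add x y hx hy => simp only [map_add, hx, hy, smul_add]; abel
  | smul c x hx => simp only [map_smul, hx, smul_add, Mon.sign_comm]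
  | basis f =>
    rw [DL_consL_left hu, splitsL_ι, DL_ι]
    rfl

/-- The differential squares to zero: the terms in which two contractions are nested cancel by
`splitsL_D` and `splits_splits_nodeL`, and all others in pairs. -/
theorem DL_D {b : Bool} (x : Pl b) : DL (D k x) = 0 := by
  induction x with
  | leaf a => exact map_zero _
  | one t ih => rw [D, DL_oneL, ih, map_zero]
  | node t f iht ihf =>
    have ht := ι_mem (k := k) (x := t) rfl
    have h1 := DL_nodeL (D_mem (k := k) t) (ι f)
    have h2 : DL (splits f fun a b => ι (node (node t a) b)) =
        -(splits f (fun a b => nodeL (D k (node t a)) (ι b)) +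
          splits f (fun a b => splits b fun b₁ b₂ =>
            nodeL (nodeL (nodeL (ι t) (ι a)) (ι b₁)) (ι b₂)) +
          splits f fun a b => (sdeg t + sdeg a + 1).negOnePow •
            nodeL (nodeL (ι t) (ι a)) (D k b)) := by
      rw [map_splits, ← splits_add, ← splits_add, ← neg_one_zsmul, smul_splits]
      refine splits_congr fun a b => ?_
      rw [DL_ι, D_node, neg_one_zsmul]
      simp only [nodeL_ι, sdeg]
    have h3 := DL_nodeL ht (D k f)
    rw [splits_splits_nodeL (ι t) nodeL f] at h2
    rw [D_node, map_neg, map_add, map_add, Mon.map_sign, h1, h2, h3, iht, ihf, splitsL_D, splitsL_ι,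
      DL_ι, DL_ι]
    have h4 : splits f (fun a b => nodeL (D k (node t a)) (ι b)) =
        -(splits f (fun a b => nodeL (nodeL (D k t) (ι a)) (ι b)) +
          splits f (fun a b => nodeL (splits a fun a₁ a₂ => nodeL (nodeL (ι t) (ι a₁)) (ι a₂))
            (ι b)) +
          (sdeg t).negOnePow • splits f fun a b => nodeL (nodeL (ι t) (D k a)) (ι b)) := by
      rw [smul_splits, ← splits_add, ← splits_add, ← neg_one_zsmul, smul_splits]
      refine splits_congr fun a b => ?_
      rw [D_node, neg_one_zsmul, map_neg, map_add, map_add, LinearMap.neg_apply,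
        LinearMap.add_apply, LinearMap.add_apply, sign_smul_left]
      simp only [nodeL_ι]
    have h5 : splits f (fun a b => (sdeg t + sdeg a + 1).negOnePow •
        nodeL (nodeL (ι t) (ι a)) (D k b)) = -((sdeg t).negOnePow • splits f fun a b =>
          (sdeg a).negOnePow • nodeL (nodeL (ι t) (ι a)) (D k b)) := by
      rw [smul_splits, ← neg_one_zsmul, smul_splits]
      refine splits_congr fun a b => ?_
      rw [Int.negOnePow_succ, Int.negOnePow_add, Units.neg_smul, mul_smul, neg_one_zsmul]
    rw [h4, h5, Int.negOnePow_succ, splits_add]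
    simp only [LinearMap.comp_apply, smul_add, Units.neg_smul, smul_neg, map_zero,
      LinearMap.zero_apply, smul_zero]
    abel
  | cons t f iht ihf =>
    have ht := ι_mem (k := k) (x := t) rfl
    have h1 := DL_consL (D_mem (k := k) t) (ι f)
    have h2 : DL (splits f fun a b => ι (cons (node t a) b)) =
        splits f (fun a b => consL (D k (node t a)) (ι b)) +
          splits f (fun a b => splits b fun b₁ b₂ =>
            consL (nodeL (nodeL (ι t) (ι a)) (ι b₁)) (ι b₂)) +
          splits f (fun a b => ι (one (node (node t a) b))) +
          splits f fun a b => (sdeg t + sdeg a + 1).negOnePow •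
            consL (nodeL (ι t) (ι a)) (D k b) := by
      rw [map_splits, ← splits_add, ← splits_add, ← splits_add]
      refine splits_congr fun a b => ?_
      rw [DL_ι, D_cons]
      simp only [nodeL_ι, consL_ι, sdeg]
    have h3 := DL_consL ht (D k f)
    rw [splits_splits_nodeL (ι t) consL f] at h2
    rw [D_cons, map_add, map_add, map_add, Mon.map_sign, h1, h2, h3, iht, ihf, splitsL_D, splitsL_ι,
      DL_ι, DL_ι, DL_ι]
    have h4 : splits f (fun a b => consL (D k (node t a)) (ι b)) =
        -(splits f (fun a b => consL (nodeL (D k t) (ι a)) (ι b)) +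
          splits f (fun a b => consL (splits a fun a₁ a₂ => nodeL (nodeL (ι t) (ι a₁)) (ι a₂))
            (ι b)) +
          (sdeg t).negOnePow • splits f fun a b => consL (nodeL (ι t) (D k a)) (ι b)) := by
      rw [smul_splits, ← splits_add, ← splits_add, ← neg_one_zsmul, smul_splits]
      refine splits_congr fun a b => ?_
      rw [D_node, neg_one_zsmul, map_neg, map_add, map_add, LinearMap.neg_apply,
        LinearMap.add_apply, LinearMap.add_apply, sign_smul_left]
      simp only [nodeL_ι]
    have h5 : splits f (fun a b => (sdeg t + sdeg a + 1).negOnePow •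
        consL (nodeL (ι t) (ι a)) (D k b)) = -((sdeg t).negOnePow • splits f fun a b =>
          (sdeg a).negOnePow • consL (nodeL (ι t) (ι a)) (D k b)) := by
      rw [smul_splits, ← neg_one_zsmul, smul_splits]
      refine splits_congr fun a b => ?_
      rw [Int.negOnePow_succ, Int.negOnePow_add, Units.neg_smul, mul_smul, neg_one_zsmul]
    have h6 : D k (one (node t f)) = -(oneL (nodeL (D k t) (ι f)) +
        splits f (fun a b => ι (one (node (node t a) b))) +
        (sdeg t).negOnePow • oneL (nodeL (ι t) (D k f))) := by
      rw [D_one, D_node, map_neg, map_add, map_add, Mon.map_sign, map_splits]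
      simp only [oneL_ι]
    rw [h4, h5, h6, Int.negOnePow_succ, splits_add]
    simp only [LinearMap.comp_apply, smul_add, Units.neg_smul, map_zero,
      LinearMap.zero_apply, smul_zero]
    abel

theorem DL_DL {b : Bool} (x : Lin k b) : DL (DL x) = 0 := by
  induction x using lin_induction with
  | zero => simp
  | add x y hx hy => simp only [map_add, hx, hy, add_zero]
  | smul c x hx => simp only [map_smul, hx, smul_zero]
  | basis x => rw [DL_ι, DL_D]

end Pl


/-! ### Forests as lists of trees -/

namespace Pl

variable {k : Type u} [Field k]

/-- The forest with the given trees.  The value on the empty list is irrelevant. -/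
def forest : List (Pl true) → Pl false
  | [] => one (leaf 0)
  | [t] => one t
  | t :: t' :: w => cons t (forest (t' :: w))

theorem forest_cons (t : Pl true) {w : List (Pl true)} (hw : w ≠ []) :
    forest (t :: w) = cons t (forest w) := by
  cases w with
  | nil => exact absurd rfl hw
  | cons => rfl

/-- The tree whose root has the given children.  The value on lists with fewer than two
elements is irrelevant. -/
def corolla : List (Pl true) → Pl true
  | [] => leaf 0
  | t :: w => node t (forest w)

theorem splits_forest {M : Type*} [AddCommMonoid M] (w : List (Pl true))
    (G : Pl false → Pl false → M) : splits (forest w) G =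
      ∑ s ∈ Finset.range (w.length - 1), G (forest (w.take (s + 1))) (forest (w.drop (s + 1))) := by
  induction w generalizing G with
  | nil => rfl
  | cons t w ih =>
    cases w with
    | nil => rfl
    | cons t' w =>
      rw [forest, splits_cons, ih]
      simp only [List.length_cons, Nat.add_sub_cancel]
      rw [Finset.sum_range_succ', add_comm]
      rfl

/-- The linear combination of forests obtained from the list `p ++ u :: q` where `u` is a linear
combination of trees. -/
noncomputable def forestAt : List (Pl true) → Lin k true → List (Pl true) → Lin k false
  | [], u, [] => oneL u
  | [], u, t :: q => consL u (ι (forest (t :: q)))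
  | t :: p, u, q => consL (ι t) (forestAt p u q)

/-- The linear combination of trees with children `p ++ u :: q` where `u` is a linear combination
of trees. -/
noncomputable def corollaAt : List (Pl true) → Lin k true → List (Pl true) → Lin k true
  | [], u, q => nodeL u (ι (forest q))
  | t :: p, u, q => nodeL (ι t) (forestAt p u q)

theorem forestAt_ι (p : List (Pl true)) (t : Pl true) (q : List (Pl true)) :
    forestAt p (ι t) q = (ι (forest (p ++ t :: q)) : Lin k false) := by
  induction p with
  | nil =>
    cases q with
    | nil => exact oneL_ι t
    | cons => exact consL_ι _ _
  | cons t' p ih =>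
    rw [forestAt, ih, consL_ι, List.cons_append, forest_cons _ (by simp)]

theorem corollaAt_ι (p : List (Pl true)) (t : Pl true) (q : List (Pl true)) :
    corollaAt p (ι t) q = (ι (corolla (p ++ t :: q)) : Lin k true) := by
  cases p with
  | nil => exact nodeL_ι _ _
  | cons t' p => rw [corollaAt, forestAt_ι, nodeL_ι]; rfl

theorem forestAt_add (p q : List (Pl true)) (u v : Lin k true) :
    forestAt p (u + v) q = forestAt p u q + forestAt p v q := by
  induction p with
  | nil => cases q <;> simp [forestAt]
  | cons t p ih => rw [forestAt, ih, map_add]; rfl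

theorem forestAt_smul (p q : List (Pl true)) (c : k) (u : Lin k true) :
    forestAt p (c • u) q = c • forestAt p u q := by
  induction p with
  | nil => cases q <;> simp [forestAt]
  | cons t p ih => rw [forestAt, ih, map_smul]; rfl

theorem corollaAt_add (p q : List (Pl true)) (u v : Lin k true) :
    corollaAt p (u + v) q = corollaAt p u q + corollaAt p v q := by
  cases p with
  | nil => simp [corollaAt]
  | cons t p => rw [corollaAt, forestAt_add, map_add]; rfl

theorem corollaAt_smul (p q : List (Pl true)) (c : k) (u : Lin k true) :
    corollaAt p (c • u) q = c • corollaAt p u q := by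
  cases p with
  | nil => simp [corollaAt]
  | cons t p => rw [corollaAt, forestAt_smul, map_smul]; rfl

/-- The value of the operation on the list `w` that enters the differential of the bar
construction. -/
noncomputable def barOp (k : Type u) [Field k] : List (Pl true) → Lin k true
  | [] => 0
  | [t] => D k t
  | t :: t' :: w => ι (corolla (t :: t' :: w))

/-- The sum of the degrees of a list of trees. -/
def degSum (w : List (Pl true)) : ℤ := (w.map sdeg).sum

theorem sum_triangle_succ {M : Type*} [AddCommMonoid M] (m : ℕ) (F : ℕ → ℕ → M) :
    ∑ s ∈ Finset.range (m + 1), ∑ r ∈ Finset.range (m + 1 - s), F s r =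
      ∑ s ∈ Finset.range (m + 1), F s 0 +
        ∑ s ∈ Finset.range m, ∑ r ∈ Finset.range (m - s), F s (r + 1) := by
  have : ∀ s ∈ Finset.range (m + 1), ∑ r ∈ Finset.range (m + 1 - s), F s r =
      F s 0 + ∑ r ∈ Finset.range (m - s), F s (r + 1) := by
    intro s hs
    have hs := Finset.mem_range.1 hs
    rw [show m + 1 - s = m - s + 1 by omega, Finset.sum_range_succ', add_comm]
  rw [Finset.sum_congr rfl this, Finset.sum_add_distrib, Finset.sum_range_succ (fun s =>
    ∑ r ∈ Finset.range (m - s), F s (r + 1)), Nat.sub_self, Finset.sum_range_zero, add_zero]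

/-- On forests, `D` is the differential of the bar construction: the sum, over all `r` and `s`, of the
results of applying the operation of arity `s + 1` to the trees after the first `r`. -/
theorem D_forest (w : List (Pl true)) : D k (forest w) =
    ∑ s ∈ Finset.range w.length, ∑ r ∈ Finset.range (w.length - s),
      (degSum (w.take r)).negOnePow • forestAt (w.take r)
        (barOp k ((w.drop r).take (s + 1))) (w.drop (r + s + 1)) := by
  induction w with
  | nil =>
    rw [forest, D_one, D, map_zero]
    rfl
  | cons t w ih =>
    cases w with
    | nil =>
      simp [forest, D_one, degSum, barOp, forestAt]
    | cons t' w =>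
      rw [List.length_cons, sum_triangle_succ]
      have h0 : ∀ s, (degSum ((t :: t' :: w).take 0)).negOnePow • forestAt ((t :: t' :: w).take 0)
          (barOp k (((t :: t' :: w).drop 0).take (s + 1))) ((t :: t' :: w).drop (0 + s + 1)) =
          forestAt [] (barOp k (t :: (t' :: w).take s)) ((t' :: w).drop s) := by
        intro s
        simp [degSum]
      have h1 : ∀ s r, (degSum ((t :: t' :: w).take (r + 1))).negOnePow •
          forestAt ((t :: t' :: w).take (r + 1))
          (barOp k (((t :: t' :: w).drop (r + 1)).take (s + 1)))
            ((t :: t' :: w).drop (r + 1 + s + 1)) =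
          (sdeg t).negOnePow • consL (ι t) ((degSum ((t' :: w).take r)).negOnePow •
            forestAt ((t' :: w).take r) (barOp k (((t' :: w).drop r).take (s + 1)))
              ((t' :: w).drop (r + s + 1))) := by
        intro s r
        rw [Mon.map_sign, smul_smul, ← Int.negOnePow_add, List.take_succ_cons, List.drop_succ_cons,
          show r + 1 + s + 1 = (r + s + 1) + 1 by ring, List.drop_succ_cons, forestAt, degSum,
          List.map_cons, List.sum_cons, degSum]
      simp only [h0, h1, ← Finset.smul_sum, ← map_sum]
      rw [← ih, forest, D_cons, splits_forest, Finset.sum_range_succ', List.length_cons,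
        Finset.sum_range_succ]
      simp only [Nat.add_sub_cancel]
      have e1 : forestAt [] (barOp k (t :: (t' :: w).take 0)) ((t' :: w).drop 0) =
          consL (D k t) (ι (forest (t' :: w))) := rfl
      have e2 : forestAt [] (barOp k (t :: (t' :: w).take (w.length + 1)))
          ((t' :: w).drop (w.length + 1)) = ι (one (node t (forest (t' :: w)))) := by
        rw [List.take_of_length_le (by simp), List.drop_of_length_le (by simp)]
        exact oneL_ι _
      have e3 : ∀ s ∈ Finset.range w.length,
          forestAt [] (barOp k (t :: (t' :: w).take (s + 1))) ((t' :: w).drop (s + 1)) =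
          ι (cons (node t (forest ((t' :: w).take (s + 1)))) (forest ((t' :: w).drop (s + 1)))) := by
        intro s hs
        have hs := Finset.mem_range.1 hs
        have : (t' :: w).drop (s + 1) ≠ [] := by
          intro e
          have := congrArg List.length e
          simp at this
          omega
        obtain ⟨q, q', hq⟩ := List.exists_cons_of_ne_nil this
        rw [hq]
        exact consL_ι _ _
      rw [e1, e2, Finset.sum_congr rfl e3]
      abel

/-- The boundary of a new vertex is minus the sum of all the ways to apply an operation to some, but
not all, of its children. -/
theorem D_corolla (w : List (Pl true)) (hw : 2 ≤ w.length) : D k (corolla w) =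
    -∑ s ∈ Finset.range (w.length - 1), ∑ r ∈ Finset.range (w.length - s),
      (degSum (w.take r)).negOnePow • corollaAt (w.take r)
        (barOp k ((w.drop r).take (s + 1))) (w.drop (r + s + 1)) := by
  match w with
  | [] => simp at hw
  | [t] => simp at hw
  | t :: t' :: w =>
    have tri := sum_triangle_succ (w.length + 1) fun s r =>
      (degSum ((t :: t' :: w).take r)).negOnePow • corollaAt ((t :: t' :: w).take r)
        (barOp k (((t :: t' :: w).drop r).take (s + 1))) ((t :: t' :: w).drop (r + s + 1))
    rw [Finset.sum_range_succ] at tri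
    have h0 : ∀ s, (degSum ((t :: t' :: w).take 0)).negOnePow • corollaAt ((t :: t' :: w).take 0)
        (barOp k (((t :: t' :: w).drop 0).take (s + 1))) ((t :: t' :: w).drop (0 + s + 1)) =
        nodeL (barOp k (t :: (t' :: w).take s)) (ι (forest ((t' :: w).drop s))) := by
      intro s
      simp [degSum, corollaAt]
    have h1 : ∀ s r, (degSum ((t :: t' :: w).take (r + 1))).negOnePow •
        corollaAt ((t :: t' :: w).take (r + 1))
        (barOp k (((t :: t' :: w).drop (r + 1)).take (s + 1)))
          ((t :: t' :: w).drop (r + 1 + s + 1)) =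
        (sdeg t).negOnePow • nodeL (ι t) ((degSum ((t' :: w).take r)).negOnePow •
          forestAt ((t' :: w).take r) (barOp k (((t' :: w).drop r).take (s + 1)))
            ((t' :: w).drop (r + s + 1))) := by
      intro s r
      rw [Mon.map_sign, smul_smul, ← Int.negOnePow_add, List.take_succ_cons, List.drop_succ_cons,
        show r + 1 + s + 1 = (r + s + 1) + 1 by ring, List.drop_succ_cons, corollaAt, degSum,
        List.map_cons, List.sum_cons, degSum]
    simp only [h0, h1, ← Finset.smul_sum, ← map_sum] at tri
    rw [show w.length + 1 + 1 - (w.length + 1) = 1 by omega, Finset.sum_range_one, h0,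
      Finset.sum_range_succ _ (w.length + 1)] at tri
    have tri := add_right_cancel (tri.trans (add_right_comm _ _ _))
    simp only [List.length_cons, Nat.add_sub_cancel]
    have df := D_forest (k := k) (t' :: w)
    simp only [List.length_cons] at df
    rw [tri, ← df, Finset.sum_range_succ', corolla, D_node, splits_forest]
    simp only [List.length_cons, Nat.add_sub_cancel]
    have e3 : ∀ s ∈ Finset.range w.length,
        nodeL (barOp k (t :: (t' :: w).take (s + 1))) (ι (forest ((t' :: w).drop (s + 1)))) =
        ι (node (node t (forest ((t' :: w).take (s + 1)))) (forest ((t' :: w).drop (s + 1)))) :=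
      fun s hs => nodeL_ι _ _
    rw [Finset.sum_congr rfl e3, add_comm (nodeL _ _)]
    rfl

end Pl

/-! ### Multilinear maps defined on bases -/

section MultiExt

variable {k : Type u} [Field k] {B : Type*} {W : Type*} [AddCommGroup W] [Module k W]

open Classical in
/-- The multilinear map with the given values on tuples of basis elements. -/
noncomputable def multiExt {n : ℕ} (g : (Fin n → B) → W) :
    MultilinearMap k (fun _ : Fin n => B →₀ k) W :=
  (Finsupp.linearCombination k g ∘ₗ
    (PiTensorProduct.ofFinsuppEquiv' (R := k) (κ := fun _ : Fin n => B)).toLinearMap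
      ).compMultilinearMap (PiTensorProduct.tprod k)

open Classical in
theorem multiExt_single {n : ℕ} (g : (Fin n → B) → W) (x : Fin n → B) :
    multiExt (k := k) g (fun j => Finsupp.single (x j) 1) = g x := by
  have := PiTensorProduct.ofFinsuppEquiv'_tprod_single (R := k) x fun _ => 1
  refine (congrArg (Finsupp.linearCombination k g) this).trans ?_
  simp

open Classical in
theorem multiExt_mem {deg : B → ℤ} {n : ℕ} {g : (Fin n → B) → W} (N : Submodule k W)
    {d : Fin n → ℤ} (hg : ∀ x, (∀ j, deg (x j) = d j) → g x ∈ N) {v : Fin n → B →₀ k}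
    (hv : ∀ j, v j ∈ basisGrading k deg (d j)) : multiExt g v ∈ N := by
  rw [multiExt, LinearMap.compMultilinearMap_apply, LinearMap.comp_apply,
    Finsupp.linearCombination_apply]
  refine Submodule.sum_mem N fun x hx => Submodule.smul_mem _ _ (hg x fun j => ?_)
  have hx := Finsupp.mem_support_iff.1 hx
  have e := PiTensorProduct.ofFinsuppEquiv'_apply_apply (R := k) v x
  have hx' : ∏ j, v j (x j) ≠ 0 := fun h => hx (e.trans h)
  exact (Finsupp.mem_supported k _).1 (hv j)
    (Finsupp.mem_support_iff.2 (Finset.prod_ne_zero_iff.1 hx' j (Finset.mem_univ j)))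

theorem multilinear_ext_single {n : ℕ} {f g : MultilinearMap k (fun _ : Fin n => B →₀ k) W}
    (h : ∀ x : Fin n → B, f (fun j => Finsupp.single (x j) 1) =
      g fun j => Finsupp.single (x j) 1) : f = g :=
  Module.Basis.ext_multilinear (fun _ => Finsupp.basisSingleOne) fun x => by simpa using h x

end MultiExt


/-! ### Weights -/

/-- The exponent of the sign that relates the operations `mₙ` to the differential of the bar
construction. -/
def weight {n : ℕ} (deg : Fin n → ℤ) : ℤ := ∑ j : Fin n, ((n : ℤ) - 1 - j.val) * deg j

/-- This identity turns the signs of the Stasheff relations into those of the bar construction. -/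
theorem weight_plugDeg {m n l : ℕ} (h : l + 1 = m + n) (i : Fin m) (b : ℤ) (deg : Fin l → ℤ) :
    weight (plugDeg h i b deg) + weight (fun t => deg (innerIdx h i t)) =
      weight deg + ((m : ℤ) - 1 - i.val) * b + (1 - (n : ℤ)) * degBefore deg i.val := by
  have hl : (l : ℤ) + 1 = m + n := by exact_mod_cast h
  rw [← degBefore_plugDeg_of_le h i b deg le_rfl]
  simp only [weight, degBefore]
  rw [sum_slot h i (fun s => ((l : ℤ) - 1 - s.val) * deg s), Finset.mul_sum, ← sub_eq_zero]
  have key : ∀ j : Fin m, ((m : ℤ) - 1 - j.val) * plugDeg h i b deg j -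
      (if hj : j = i then ∑ t, ((l : ℤ) - 1 - (innerIdx h i t).val) * deg (innerIdx h i t) else
        ((l : ℤ) - 1 - (outerIdx h i j hj).val) * deg (outerIdx h i j hj)) -
      (1 - (n : ℤ)) * (if j.val < i.val then plugDeg h i b deg j else 0) =
      if j = i then ((m : ℤ) - 1 - i.val) * b - ∑ t : Fin n, ((n : ℤ) - 1 - t.val) *
        deg (innerIdx h i t) else 0 := by
    intro j
    by_cases hj : j = i
    · subst hj
      rw [dif_pos rfl, if_pos rfl, if_neg (lt_irrefl _), plugDeg, plug_self, mul_add, Finset.mul_sum,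
        mul_zero, sub_zero, add_sub_assoc, ← Finset.sum_sub_distrib,
        sub_eq_add_neg (((m : ℤ) - 1 - j.val) * b), ← Finset.sum_neg_distrib]
      refine congrArg _ (Finset.sum_congr rfl fun t _ => ?_)
      have : ((innerIdx h j t).val : ℤ) = j.val + t.val := by simp [innerIdx]
      rw [this]
      linear_combination (-(deg (innerIdx h j t))) * hl
    · have hj' := Fin.val_ne_of_ne hj
      rw [dif_neg hj, if_neg hj, plugDeg, plug_of_ne _ _ _ _ hj]
      split_ifs with hlt
      · have : ((outerIdx h i j hj).val : ℤ) = j.val := by simp only [outerIdx, if_pos hlt]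
        rw [this]
        linear_combination (-(deg (outerIdx h i j hj))) * hl
      · have : ((outerIdx h i j hj).val : ℤ) = j.val + n - 1 := by
          simp only [outerIdx, if_neg hlt]
          omega
        rw [this]
        linear_combination (-(deg (outerIdx h i j hj))) * hl
  have := Finset.sum_congr rfl fun j (_ : j ∈ Finset.univ) => key j
  rw [Finset.sum_sub_distrib, Finset.sum_sub_distrib, Finset.sum_ite_eq' Finset.univ i,
    if_pos (Finset.mem_univ i)] at this
  linear_combination this

/-! ### Tuples as lists -/

section OfFn

variable {V : Type*}

theorem take_ofFn_innerIdx {m n l : ℕ} (h : l + 1 = m + n) (i : Fin m) (x : Fin l → V) :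
    ((List.ofFn x).drop i.val).take n = List.ofFn fun t => x (innerIdx h i t) := by
  apply List.ext_getElem
  · simp only [List.length_take, List.length_drop, List.length_ofFn]
    omega
  · intro j h1 h2
    simp [innerIdx]

theorem take_ofFn_plug {m n l : ℕ} (h : l + 1 = m + n) (i : Fin m) (g : (Fin n → V) → V)
    (x : Fin l → V) : (List.ofFn (plug h i g x)).take i.val = (List.ofFn x).take i.val := by
  apply List.ext_getElem
  · simp only [List.length_take, List.length_ofFn]
    omega
  · intro j h1 h2
    have hj : j < i.val := by
      simp only [List.length_take] at h1
      omega
    simp only [List.getElem_take, List.getElem_ofFn]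
    rw [plug_of_ne _ _ _ _ fun e => by
      have := congrArg Fin.val e
      simp only at this
      omega]
    simp [outerIdx, hj]

theorem drop_ofFn_plug {m n l : ℕ} (h : l + 1 = m + n) (i : Fin m) (g : (Fin n → V) → V)
    (x : Fin l → V) :
    (List.ofFn (plug h i g x)).drop (i.val + 1) = (List.ofFn x).drop (i.val + n) := by
  apply List.ext_getElem
  · simp only [List.length_drop, List.length_ofFn]
    omega
  · intro j h1 h2
    simp only [List.getElem_drop, List.getElem_ofFn]
    rw [plug_of_ne _ _ _ _ fun e => by
      have := congrArg Fin.val e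
      simp only at this
      omega]
    congr 1
    apply Fin.ext
    simp only [outerIdx]
    split_ifs <;> omega

theorem ofFn_plug {m n l : ℕ} (h : l + 1 = m + n) (i : Fin m) (g : (Fin n → V) → V)
    (x : Fin l → V) : List.ofFn (plug h i g x) = (List.ofFn x).take i.val ++
      g (fun t => x (innerIdx h i t)) :: (List.ofFn x).drop (i.val + n) := by
  rw [← take_ofFn_plug h i g, ← drop_ofFn_plug h i g]
  have hi : i.val < (List.ofFn (plug h i g x)).length := by simp
  conv_lhs => rw [← List.take_append_drop i.val (List.ofFn (plug h i g x)),
    List.drop_eq_getElem_cons hi]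
  rw [List.getElem_ofFn, Fin.eta, plug_self]

end OfFn

/-! ### The free strictly unital `A∞`-algebra on the natural numbers -/

namespace Pl

variable {k : Type u} [Field k]

/-- The degree of a tree. -/
def deg (t : Pl true) : ℤ := sdeg t + 1

/-- The grading of the space of trees. -/
abbrev treeGr (k : Type u) [Field k] : ℤ → Submodule k (Lin k true) := basisGrading k deg

theorem treeGr_internal : DirectSum.IsInternal (treeGr k) := basisGrading_internal k deg

theorem mem_treeGr {a : ℤ} {u : Lin k true} : u ∈ treeGr k a ↔ u ∈ gr k true (a - 1) := by
  have : {x | deg x = a} = {x : Pl true | sdeg x = a - 1} := by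
    ext x
    simp only [Set.mem_ofPred_eq, deg]
    constructor <;> intro h <;> linarith
  rw [treeGr, gr, basisGrading, basisGrading, this]

theorem ι_mem_treeGr (t : Pl true) : (ι t : Lin k true) ∈ treeGr k (deg t) :=
  single_mem_basisGrading t 1

theorem D_mem_treeGr (t : Pl true) : D k t ∈ treeGr k (deg t + 1) := by
  rw [mem_treeGr]
  have := D_mem (k := k) t
  rwa [show deg t + 1 - 1 = sdeg t + 1 by simp [deg]]

theorem DL_mem_treeGr {a : ℤ} {u : Lin k true} (hu : u ∈ treeGr k a) : DL u ∈ treeGr k (a + 1) := by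
  rw [mem_treeGr] at hu ⊢
  have := DL_mem hu
  rwa [show a - 1 + 1 = a + 1 - 1 by ring] at this

/-- Linear combinations of trees other than the tree `leaf 0`, which serves as the unit. -/
abbrev nonunit (k : Type u) [Field k] : Submodule k (Lin k true) :=
  Finsupp.supported k k {x | x ≠ leaf 0}

theorem nodeL_mem_nonunit (u : Lin k true) (f : Lin k false) : nodeL u f ∈ nonunit k := by
  induction u using lin_induction with
  | zero => simp
  | add x y hx hy => rw [map_add, LinearMap.add_apply]; exact add_mem hx hy
  | smul c x hx => rw [map_smul, LinearMap.smul_apply]; exact Submodule.smul_mem _ _ hx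
  | basis t =>
  induction f using lin_induction with
  | zero => simp
  | add x y hx hy => rw [map_add]; exact add_mem hx hy
  | smul c x hx => rw [map_smul]; exact Submodule.smul_mem _ _ hx
  | basis f =>
    rw [nodeL_ι]
    exact Finsupp.single_mem_supported k _ (by simp)

theorem D_mem_nonunit (t : Pl true) : D k t ∈ nonunit k := by
  cases t with
  | leaf a => exact zero_mem _
  | node t f =>
    rw [D_node]
    exact neg_mem (add_mem (add_mem (nodeL_mem_nonunit _ _) (splits_mem _ fun a b _ =>
      (nodeL_ι (k := k) _ b).symm ▸ nodeL_mem_nonunit _ _))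
      (Mon.sign_smul_mem _ _ (nodeL_mem_nonunit _ _)))

theorem barOp_mem_nonunit (w : List (Pl true)) : barOp k w ∈ nonunit k := by
  match w with
  | [] => exact zero_mem _
  | [t] => exact D_mem_nonunit t
  | t :: t' :: w => exact Finsupp.single_mem_supported k _ (by simp [corolla])

theorem sdeg_forest {w : List (Pl true)} (hw : w ≠ []) : sdeg (forest w) = degSum w := by
  induction w with
  | nil => exact absurd rfl hw
  | cons t w ih =>
    cases w with
    | nil => simp [forest, sdeg, degSum]
    | cons t' w => rw [forest, sdeg, ih (by simp)]; simp [degSum]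

theorem barOp_mem {w : List (Pl true)} (hw : w ≠ []) :
    barOp k w ∈ treeGr k (degSum w + 2) := by
  match w with
  | [t] =>
    have := D_mem_treeGr (k := k) t
    rwa [show deg t + 1 = degSum [t] + 2 by simp [deg, degSum]; ring] at this
  | t :: t' :: w =>
    refine single_mem_basisGrading' ?_ 1
    rw [deg, corolla, sdeg, sdeg_forest (by simp)]
    simp only [degSum, List.map_cons, List.sum_cons]
    ring

theorem degSum_ofFn {n : ℕ} (x : Fin n → Pl true) :
    degSum (List.ofFn x) = ∑ j, deg (x j) - n := by
  rw [degSum, List.map_ofFn, List.sum_ofFn]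
  simp [deg, Finset.sum_add_distrib]

theorem degSum_take_ofFn {n : ℕ} (x : Fin n → Pl true) {r : ℕ} (hr : r ≤ n) :
    degSum ((List.ofFn x).take r) = degBefore (fun j => deg (x j)) r - r := by
  induction n generalizing r with
  | zero =>
    obtain rfl : r = 0 := by omega
    simp [degSum, degBefore]
  | succ n ih =>
    cases r with
    | zero => simp [degSum, degBefore]
    | succ r =>
      have := ih (fun j => x j.succ) (r := r) (by omega)
      rw [List.ofFn_succ, List.take_succ_cons, degSum, List.map_cons, List.sum_cons]
      rw [degSum] at this
      rw [this]
      simp only [degBefore, Fin.sum_univ_succ, Fin.val_zero, Fin.val_succ, Nat.zero_lt_succ,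
        if_true, Nat.add_lt_add_iff_right, deg]
      push_cast
      ring

open Classical in
/-- The operation `m_{N+2}` on trees: joining trees at a new root, with the sign that makes the
differential of the bar construction the one of `D`.  The tree `leaf 0` is a strict unit. -/
noncomputable def treeOpFun (k : Type u) [Field k] : ∀ N : ℕ, (Fin (N + 2) → Pl true) → Lin k true
  | 0, x => if x 0 = leaf 0 then ι (x 1) else if x 1 = leaf 0 then ι (x 0) else
      (weight fun j => deg (x j)).negOnePow • ι (corolla (List.ofFn x))
  | _ + 1, x => if ∀ j, x j ≠ leaf 0 then
      (weight fun j => deg (x j)).negOnePow • ι (corolla (List.ofFn x)) else 0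

/-- The multilinear extension of `treeOpFun`. -/
noncomputable def treeOp (k : Type u) [Field k] (N : ℕ) : Op k (Lin k true) (N + 2) :=
  multiExt (treeOpFun k N)

theorem treeOp_ι' {N : ℕ} (x : Fin (N + 2) → Pl true) :
    treeOp k N (fun j => ι (x j)) = treeOpFun k N x := multiExt_single _ x

theorem treeOp_ι {N : ℕ} {x : Fin (N + 2) → Pl true} (hx : ∀ j, x j ≠ leaf 0) :
    treeOp k N (fun j => ι (x j)) =
      (weight fun j => deg (x j)).negOnePow • ι (corolla (List.ofFn x)) := by
  rw [treeOp_ι']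
  cases N with
  | zero => rw [treeOpFun, if_neg (hx 0), if_neg (hx 1)]
  | succ => rw [treeOpFun, if_pos hx]

theorem deg_corolla {n : ℕ} (x : Fin (n + 2) → Pl true) :
    deg (corolla (List.ofFn x)) = -(n : ℤ) + ∑ j, deg (x j) := by
  have := degSum_ofFn x
  rw [List.ofFn_succ, degSum, List.map_cons, List.sum_cons, ← degSum,
    ← sdeg_forest (by simp)] at this
  rw [List.ofFn_succ, corolla, deg, sdeg]
  push_cast at this
  linarith

theorem treeOp_mem (N : ℕ) : IsHomogOp (treeGr k) (treeOp k N) (-(N : ℤ)) := by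
  intro d v hv
  refine multiExt_mem _ (fun x hx => ?_) hv
  simp only [← hx]
  have hc : (weight fun j => deg (x j)).negOnePow • ι (corolla (List.ofFn x)) ∈
      treeGr k (-(N : ℤ) + ∑ j, deg (x j)) :=
    Mon.sign_smul_mem _ _ (single_mem_basisGrading' (deg_corolla x) 1)
  cases N with
  | zero =>
    rw [treeOpFun]
    split_ifs with h0 h1
    · exact single_mem_basisGrading' (by
        rw [Fin.sum_univ_two, h0]
        simp [deg, sdeg]) 1
    · exact single_mem_basisGrading' (by
        rw [Fin.sum_univ_two, h1]
        simp [deg, sdeg]) 1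
    · exact hc
  | succ =>
    rw [treeOpFun]
    split_ifs with h0
    · exact hc
    · exact zero_mem _

/-- The operation `treeOp` on trees one of which is replaced by a linear combination `u`. -/
theorem treeOp_plug {N n l : ℕ} (h : l + 1 = N + 2 + n) (i : Fin (N + 2)) {x : Fin l → Pl true}
    (hx : ∀ j, x j ≠ leaf 0) {b : ℤ} {u : Lin k true} (hu : u ∈ nonunit k)
    (hb : u ∈ treeGr k (b + ∑ t, deg (x (innerIdx h i t)))) (g : (Fin n → Lin k true) → Lin k true)
    (hg : g (fun t => ι (x (innerIdx h i t))) = u) :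
    treeOp k N (plug h i g fun j => ι (x j)) =
      (weight (plugDeg h i b fun j => deg (x j))).negOnePow •
        corollaAt ((List.ofFn x).take i.val) u ((List.ofFn x).drop (i.val + n)) := by
  rw [plug_eq_update h i g (fun _ => ι (leaf 1)), hg]
  have hmem : u ∈ Finsupp.supported k k {y : Pl true | y ≠ leaf 0 ∧
      deg y = b + ∑ t, deg (x (innerIdx h i t))} := by
    have : {y : Pl true | y ≠ leaf 0 ∧ deg y = b + ∑ t, deg (x (innerIdx h i t))} =
      {y | y ≠ leaf 0} ∩ {y | deg y = b + ∑ t, deg (x (innerIdx h i t))} := rfl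
    rw [this, Finsupp.supported_inter]
    exact ⟨hu, hb⟩
  rw [Finsupp.supported_eq_span_single] at hmem
  clear hg hu hb
  induction hmem using Submodule.span_induction with
  | zero =>
    rw [MultilinearMap.map_update_zero]
    have := corollaAt_smul (k := k) ((List.ofFn x).take i.val) ((List.ofFn x).drop (i.val + n)) 0 0
    rw [zero_smul, zero_smul] at this
    rw [this, smul_zero]
  | add u v _ _ hu hv => rw [MultilinearMap.map_update_add, hu, hv, corollaAt_add, smul_add]
  | smul c u _ hu => rw [MultilinearMap.map_update_smul, hu, corollaAt_smul, Mon.sign_comm]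
  | mem u hu =>
    obtain ⟨y, ⟨hy, hdeg⟩, rfl⟩ := hu
    have e1 : Function.update (plug h i (fun _ => ι (leaf 1)) fun j => ι (x j)) i
        (Finsupp.single y 1) = fun j => (ι (plug h i (fun _ => y) x j) : Lin k true) := by
      funext j
      by_cases hj : j = i
      · subst hj
        rw [Function.update_self, plug_self]
        rfl
      · rw [Function.update_of_ne hj, plug_of_ne _ _ _ _ hj, plug_of_ne _ _ _ _ hj]
    have e2 : (fun j => deg (plug h i (fun _ => y) x j)) =
        plugDeg h i b fun j => deg (x j) := by
      funext j
      by_cases hj : j = i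
      · subst hj
        rw [plugDeg, plug_self, plug_self, hdeg]
      · rw [plugDeg, plug_of_ne _ _ _ _ hj, plug_of_ne _ _ _ _ hj]
    rw [e1, treeOp_ι, e2, ofFn_plug]
    · exact congrArg _ (corollaAt_ι _ _ _).symm
    · intro j
      by_cases hj : j = i
      · subst hj
        rwa [plug_self]
      · rw [plug_of_ne _ _ _ _ hj]
        exact hx _

/-- All operations, including the differential. -/
noncomputable abbrev treeFam (k : Type u) [Field k] : ∀ n, Op k (Lin k true) n :=
  opFamily DL (treeOp k)

theorem treeFam_ι {s : ℕ} {x : Fin (s + 1) → Pl true} (hx : ∀ j, x j ≠ leaf 0) :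
    treeFam k (s + 1) (fun j => ι (x j)) =
      (weight fun j => deg (x j)).negOnePow • barOp k (List.ofFn x) := by
  cases s with
  | zero =>
    have : weight (fun j => deg (x j)) = 0 := by
      rw [weight, Fin.sum_univ_one]
      simp
    rw [this, Int.negOnePow_zero, one_smul]
    exact DL_ι (x 0)
  | succ s =>
    refine (treeOp_ι hx).trans ?_
    rw [List.ofFn_succ, List.ofFn_succ]
    rfl

/-- One term of the Stasheff relation on trees. -/
theorem stasheff_term {l p s : ℕ} (hp : 2 ≤ p) (h : l + 1 = p + (s + 1)) (r : Fin p)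
    {x : Fin l → Pl true} (hx : ∀ j, x j ≠ leaf 0) :
    (((r.val : ℤ) + ((s : ℤ) + 1) * ((l : ℤ) - s - 1 - r.val)) +
        (1 - (s : ℤ)) * degBefore (fun j => deg (x j)) r.val).negOnePow •
      treeFam k p (plug h r (treeFam k (s + 1)) fun j => ι (x j)) =
    (weight fun j => deg (x j)).negOnePow • (degSum ((List.ofFn x).take r.val)).negOnePow •
      corollaAt ((List.ofFn x).take r.val) (barOp k (((List.ofFn x).drop r.val).take (s + 1)))
        ((List.ofFn x).drop (r.val + s + 1)) := by
  obtain ⟨N, rfl⟩ := Nat.exists_eq_add_of_le' hp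
  have hin := take_ofFn_innerIdx h r x
  have hinner := treeFam_ι (k := k) (x := fun t => x (innerIdx h r t)) fun t => hx _
  have hbar : barOp k (((List.ofFn x).drop r.val).take (s + 1)) ∈
      treeGr k ((1 - (s : ℤ)) + ∑ t, deg (x (innerIdx h r t))) := by
    have := barOp_mem (k := k) (w := List.ofFn fun t => x (innerIdx h r t)) (by simp)
    rw [degSum_ofFn] at this
    rw [hin]
    push_cast at this
    rwa [show (1 - (s : ℤ)) + ∑ t, deg (x (innerIdx h r t)) =
      ∑ t, deg (x (innerIdx h r t)) - (s + 1) + 2 by ring]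
  have e1 : treeFam k (N + 2) (plug h r (treeFam k (s + 1)) fun j => ι (x j)) =
      (weight fun t => deg (x (innerIdx h r t))).negOnePow •
      treeFam k (N + 2) (plug h r (fun _ =>
        barOp k (((List.ofFn x).drop r.val).take (s + 1))) fun j => ι (x j)) :=
    Op.map_plug_sign _ h r _ _ _ _ (by rw [hinner, hin])
  have e2 := treeOp_plug h r hx (barOp_mem_nonunit _) hbar
    (fun _ => barOp k (((List.ofFn x).drop r.val).take (s + 1))) rfl
  rw [e1]
  refine (congrArg (fun z => _ • _ • z) e2).trans ?_
  rw [smul_smul, smul_smul, smul_smul, ← Int.negOnePow_add, ← Int.negOnePow_add,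
    ← Int.negOnePow_add, ← add_assoc r.val s 1]
  congr 1
  rw [Int.negOnePow_eq_iff, degSum_take_ofFn _ (by omega)]
  have W := weight_plugDeg h r (1 - (s : ℤ)) fun j => deg (x j)
  have hl : (l : ℤ) + 1 = N + 2 + (s + 1) := by exact_mod_cast h
  refine ⟨r.val + ((l : ℤ) - s - 1 - r.val) - s * degBefore (fun j => deg (x j)) r.val, ?_⟩
  push_cast at W
  have hN : (N : ℤ) = l - s - 2 := by linarith
  rw [hN] at W
  linear_combination W

/-- The Stasheff relation on trees other than the unit: up to signs it is `D_corolla`, the term `m 1`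
applied to the result being the boundary of the corolla. -/
theorem stasheff_tree {N : ℕ} {x : Fin (N + 2) → Pl true} (hx : ∀ j, x j ≠ leaf 0) :
    ∑ s : Fin (N + 2), ∑ r : Fin (N + 2 - s.val),
      (((r.val : ℤ) + ((s.val : ℤ) + 1) * (((N + 2 : ℕ) : ℤ) - s.val - 1 - r.val)) +
          (1 - (s.val : ℤ)) * degBefore (fun j => deg (x j)) r.val).negOnePow •
        treeFam k (N + 2 - s.val) (plug (n := s.val + 1) (by omega) r (treeFam k (s.val + 1))
          fun j => ι (x j)) = 0 := by
  rw [Fin.sum_univ_castSucc]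
  -- the arity of the outer operation may be replaced by a number equal to it
  have key : ∀ s p p' : ℕ, p = p' → ∀ (h : N + 2 + 1 = p + (s + 1)) (h' : N + 2 + 1 = p' + (s + 1)),
      ∑ r : Fin p, (((r.val : ℤ) + ((s : ℤ) + 1) * (((N + 2 : ℕ) : ℤ) - s - 1 - r.val)) +
          (1 - (s : ℤ)) * degBefore (fun j => deg (x j)) r.val).negOnePow •
        treeFam k p (plug h r (treeFam k (s + 1)) fun j => ι (x j)) =
      ∑ r : Fin p', (((r.val : ℤ) + ((s : ℤ) + 1) * (((N + 2 : ℕ) : ℤ) - s - 1 - r.val)) +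
          (1 - (s : ℤ)) * degBefore (fun j => deg (x j)) r.val).negOnePow •
        treeFam k p' (plug h' r (treeFam k (s + 1)) fun j => ι (x j)) := by
    rintro s p _ rfl h h'
    rfl
  -- the differential of the corolla
  have last : ∑ r : Fin 1, (((r.val : ℤ) + (((N + 1 : ℕ) : ℤ) + 1) *
        (((N + 2 : ℕ) : ℤ) - (N + 1 : ℕ) - 1 - r.val)) +
          (1 - ((N + 1 : ℕ) : ℤ)) * degBefore (fun j => deg (x j)) r.val).negOnePow •
        treeFam k 1 (plug (add_comm (N + 2) 1) r (treeFam k (N + 1 + 1)) fun j => ι (x j)) =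
      (weight fun j => deg (x j)).negOnePow • D k (corolla (List.ofFn x)) := by
    have deg0 : degBefore (fun j => deg (x j)) 0 = 0 := by simp [degBefore]
    have sgn : ((((0 : ℕ) : ℤ) + (((N + 1 : ℕ) : ℤ) + 1) *
        (((N + 2 : ℕ) : ℤ) - (N + 1 : ℕ) - 1 - ((0 : ℕ) : ℤ))) +
        (1 - ((N + 1 : ℕ) : ℤ)) * degBefore (fun j => deg (x j)) 0).negOnePow = 1 := by
      rw [deg0]
      push_cast
      ring_nf
      simp
    rw [Fin.sum_univ_one, Fin.val_zero, sgn, one_smul]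
    have : treeFam k 1 (plug (add_comm (N + 2) 1) 0 (treeFam k (N + 1 + 1)) fun j => ι (x j)) =
        DL (treeFam k (N + 1 + 1) fun j => ι (x j)) := by
      refine congrArg DL ((plug_self _ _ _ _).trans ?_)
      simp only [innerIdx_zero_one]
    rw [this, treeFam_ι hx, Mon.map_sign]
    congr 1
    rw [List.ofFn_succ, List.ofFn_succ]
    exact DL_ι _
  -- the other terms, which make up the sum in `D_corolla`
  have first : ∀ s : Fin (N + 1), ∑ r : Fin (N + 2 - s.val),
      (((r.val : ℤ) + ((s.val : ℤ) + 1) * (((N + 2 : ℕ) : ℤ) - s.val - 1 - r.val)) +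
          (1 - (s.val : ℤ)) * degBefore (fun j => deg (x j)) r.val).negOnePow •
        treeFam k (N + 2 - s.val) (plug (n := s.val + 1) (by omega) r (treeFam k (s.val + 1))
          fun j => ι (x j)) = ∑ r ∈ Finset.range (N + 2 - s.val),
      (weight fun j => deg (x j)).negOnePow • (degSum ((List.ofFn x).take r)).negOnePow •
      corollaAt ((List.ofFn x).take r) (barOp k (((List.ofFn x).drop r).take (s.val + 1)))
        ((List.ofFn x).drop (r + s.val + 1)) := by
    intro s
    rw [Finset.sum_range]
    exact Finset.sum_congr rfl fun r _ => stasheff_term (by omega) _ r hx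
  refine (congrArg₂ (· + ·) (Finset.sum_congr rfl fun s _ => first s)
    ((key (N + 1) (N + 2 - (N + 1)) 1 (by omega) (by omega) (by omega)).trans last)).trans ?_
  have dc := D_corolla (k := k) (List.ofFn x) (by simp)
  rw [List.length_ofFn] at dc
  rw [dc, smul_neg, show N + 2 - 1 = N + 1 by omega, Finset.smul_sum, Finset.sum_range]
  simp only [Finset.smul_sum]
  exact add_neg_cancel _

end Pl


/-! ### Strict units of the algebra of trees -/

namespace Pl

variable {k : Type u} [Field k]

/-- The strict unit. -/
noncomputable abbrev treeUnit (k : Type u) [Field k] : Lin k true := ι (leaf 0)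

theorem treeOp_unit {N : ℕ} {v : Fin (N + 3) → Lin k true} (i : Fin (N + 3))
    (hv : v i = treeUnit k) : treeOp k (N + 1) v = 0 := by
  have key : insertOp (n := 0) (l := N + 2) rfl i (treeOp k (N + 1))
      (constOp (treeUnit k)) = 0 := by
    refine multilinear_ext_single fun x => ?_
    rw [insertOp_apply]
    have : plug (n := 0) (l := N + 2) rfl i (constOp (treeUnit k) : Op k (Lin k true) 0)
        (fun j => Finsupp.single (x j) 1) =
        fun j => ι (plug (n := 0) (l := N + 2) rfl i (fun _ => leaf 0) x j) := by
      funext j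
      by_cases hj : j = i
      · subst hj
        rw [plug_self, plug_self]
        rfl
      · rw [plug_of_ne _ _ _ _ hj, plug_of_ne _ _ _ _ hj]
        rfl
    rw [this, treeOp_ι', treeOpFun, if_neg fun h => h i (plug_self _ _ _ _)]
    rfl
  have := congrArg (fun f : Op k (Lin k true) (N + 2) => f fun s => v (i.succAbove s)) key
  rwa [insertOp_apply, plug_succAbove (g := constOp (treeUnit k)) i fun _ => hv.symm] at this

theorem treeOp_unit_left (a : Lin k true) : treeOp k 0 ![treeUnit k, a] = a := by
  have key : insertOp (n := 0) (l := 1) rfl 0 (treeOp k 0) (constOp (treeUnit k)) =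
      unaryOp LinearMap.id := by
    refine multilinear_ext_single fun x => ?_
    rw [insertOp_apply, unaryOp_apply]
    have : plug (n := 0) (l := 1) (m := 2) rfl 0 (constOp (treeUnit k) : Op k (Lin k true) 0)
        (fun j => Finsupp.single (x j) 1) = fun j => ι (![leaf 0, x 0] j) := by
      funext j
      fin_cases j
      · exact plug_self _ _ _ _
      · exact plug_of_ne _ _ _ _ (by decide)
    rw [this, treeOp_ι', treeOpFun]
    exact if_pos rfl
  have := congrArg (fun f : Op k (Lin k true) 1 => f ![a]) key
  rw [insertOp_apply] at this
  refine Eq.trans (congrArg _ ?_) this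
  funext j
  match j with
  | 0 => rfl
  | 1 => rfl

theorem treeOp_unit_right (a : Lin k true) : treeOp k 0 ![a, treeUnit k] = a := by
  have key : insertOp (n := 0) (l := 1) rfl 1 (treeOp k 0) (constOp (treeUnit k)) =
      unaryOp LinearMap.id := by
    refine multilinear_ext_single fun x => ?_
    rw [insertOp_apply, unaryOp_apply]
    have : plug (n := 0) (l := 1) (m := 2) rfl 1 (constOp (treeUnit k) : Op k (Lin k true) 0)
        (fun j => Finsupp.single (x j) 1) = fun j => ι (![x 0, leaf 0] j) := by
      funext j
      fin_cases j
      · exact plug_of_ne _ _ _ _ (by decide)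
      · exact plug_self _ _ _ _
    rw [this, treeOp_ι', treeOpFun]
    by_cases h0 : x 0 = leaf 0
    · refine (if_pos h0).trans ?_
      change ι (leaf 0) = ι (x 0)
      rw [h0]
    · exact (if_neg h0).trans (if_pos rfl)
  have := congrArg (fun f : Op k (Lin k true) 1 => f ![a]) key
  rw [insertOp_apply] at this
  refine Eq.trans (congrArg _ ?_) this
  funext j
  match j with
  | 0 => rfl
  | 1 => rfl

end Pl

/-- Operations, with a differential, which are strictly unital. -/
structure IsStrictlyUnital {k : Type u} [Field k] {V : Type w} [AddCommGroup V] [Module k V]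
    (d : V →ₗ[k] V) (e : V) (μ : ∀ n, Op k V (n + 2)) : Prop where
  d_unit : d e = 0
  unit_left : ∀ a, μ 0 ![e, a] = a
  unit_right : ∀ a, μ 0 ![a, e] = a
  unit : ∀ {n} {v : Fin (n + 3) → V} (i : Fin (n + 3)), v i = e → μ (n + 1) v = 0

section StasheffUnit

variable {k : Type u} [Field k] {V : Type w} [AddCommGroup V] [Module k V]
  {d : V →ₗ[k] V} {e : V} {μ : ∀ n, Op k V (n + 2)} (H : IsStrictlyUnital d e μ)

include H

theorem IsStrictlyUnital.opFamily_eq_zero {n : ℕ} (hn : n ≠ 2) {v : Fin n → V} (i : Fin n)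
    (hi : v i = e) : opFamily d μ n v = 0 := by
  match n with
  | 0 => exact i.elim0
  | 1 =>
    refine Eq.trans (congrArg d ?_) H.d_unit
    rw [← hi, Subsingleton.elim i 0]
  | 2 => exact absurd rfl hn
  | n + 3 => exact H.unit i hi

theorem IsStrictlyUnital.opFamily_two {v : Fin 2 → V} (i : Fin 2) (hi : v i = e) :
    opFamily d μ 2 v = v (i.succAbove 0) := by
  match i with
  | 0 =>
    refine Eq.trans (congrArg (μ 0) ?_) (H.unit_left (v 1))
    funext j
    fin_cases j
    · exact hi
    · rfl
  | 1 =>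
    refine Eq.trans (congrArg (μ 0) ?_) (H.unit_right (v 0))
    funext j
    fin_cases j
    · rfl
    · exact hi

/-- If the unit is among the inputs of an operation of arity at least `3` composed of two
operations, then the result vanishes, unless one of the two operations is the binary product and
the unit is one of its inputs. -/
theorem IsStrictlyUnital.plug_eq {N p q : ℕ} (h : N + 3 + 1 = p + q) (r : Fin p)
    {v : Fin (N + 3) → V} (j₀ : Fin (N + 3)) (hj : v j₀ = e) :
    opFamily d μ p (plug h r (opFamily d μ q) v) =
      if (q = 2 ∧ (r.val = j₀.val ∨ r.val + 1 = j₀.val)) ∨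
        (p = 2 ∧ ((r.val = 1 ∧ j₀.val = 0) ∨ (r.val = 0 ∧ j₀.val = N + 2)))
      then μ N fun s => v (j₀.succAbove s) else 0 := by
  rcases slot_cases h r j₀ with ⟨j, hjr, hj₀⟩ | ⟨t, hj₀⟩
  · have hval : j₀.val = if j.val < r.val then j.val else j.val + q - 1 := by rw [hj₀]; rfl
    have hne := Fin.val_ne_of_ne hjr
    have hplug : plug h r (opFamily d μ q) v j = e := by
      rw [plug_of_ne _ _ _ _ hjr, ← hj₀, hj]
    by_cases hp : p = 2
    · subst hp
      obtain rfl : q = N + 2 := by omega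
      rw [H.opFamily_two j hplug, if_pos]
      · have hjs : j.succAbove 0 = r := by
          apply Fin.ext
          have := Fin.val_ne_of_ne (j.succAbove_ne 0)
          omega
        rw [hjs, plug_self]
        refine congrArg (μ N) (funext fun t => congrArg v ?_)
        apply Fin.ext
        simp only [innerIdx]
        rcases lt_or_ge t.castSucc j₀ with h' | h'
        · rw [Fin.succAbove_of_castSucc_lt _ _ h']
          have : t.val < j₀.val := h'
          simp only [Fin.val_castSucc]
          split_ifs at hval <;> omega
        · rw [Fin.succAbove_of_le_castSucc _ _ h']
          have : j₀.val ≤ t.val := h'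
          simp only [Fin.val_succ]
          split_ifs at hval <;> omega
      · split_ifs at hval <;> omega
    · rw [H.opFamily_eq_zero hp j hplug, if_neg]
      split_ifs at hval <;> omega
  · have hval : j₀.val = r.val + t.val := by rw [hj₀]; rfl
    have hin : (fun t => v (innerIdx h r t)) t = e := by
      change v (innerIdx h r t) = e
      rw [← hj₀, hj]
    by_cases hq : q = 2
    · subst hq
      obtain rfl : p = N + 2 := by omega
      rw [if_pos (Or.inl ⟨rfl, by omega⟩)]
      refine congrArg (μ N) (funext fun s => ?_)
      by_cases hs : s = r
      · subst hs
        rw [plug_self, H.opFamily_two t hin]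
        refine congrArg v ?_
        apply Fin.ext
        have := Fin.val_ne_of_ne (t.succAbove_ne 0)
        simp only [innerIdx]
        rcases lt_or_ge s.castSucc j₀ with h' | h'
        · rw [Fin.succAbove_of_castSucc_lt _ _ h']
          have : s.val < j₀.val := h'
          simp only [Fin.val_castSucc]
          omega
        · rw [Fin.succAbove_of_le_castSucc _ _ h']
          have : j₀.val ≤ s.val := h'
          simp only [Fin.val_succ]
          omega
      · have hs' := Fin.val_ne_of_ne hs
        rw [plug_of_ne _ _ _ _ hs]
        refine congrArg v ?_
        apply Fin.ext
        simp only [outerIdx]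
        rcases lt_or_ge s.castSucc j₀ with h' | h'
        · rw [Fin.succAbove_of_castSucc_lt _ _ h']
          have : s.val < j₀.val := h'
          simp only [Fin.val_castSucc]
          split_ifs <;> omega
        · rw [Fin.succAbove_of_le_castSucc _ _ h']
          have : j₀.val ≤ s.val := h'
          simp only [Fin.val_succ]
          split_ifs <;> omega
    · rw [MultilinearMap.map_coord_zero _ r, if_neg]
      · omega
      · rw [plug_self]
        exact H.opFamily_eq_zero hq t hin

omit H in
theorem sum_fin_ite_val {M : Type*} [AddCommMonoid M] {n : ℕ} (a : ℕ) (F : ℕ → M) :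
    ∑ r : Fin n, (if r.val = a then F r.val else 0) = if a < n then F a else 0 := by
  split_ifs with h
  · rw [Finset.sum_eq_single (⟨a, h⟩ : Fin n)]
    · simp
    · intro b _ hb
      exact if_neg fun e => hb (Fin.ext e)
    · simp
  · exact Finset.sum_eq_zero fun r _ => if_neg (by omega)

/-- The Stasheff relation for a tuple which contains the unit: the nonzero terms are the two in
which the unit is multiplied with one of its neighbours, or one such term and the term in which
the product of all other inputs is multiplied with the unit, and they cancel. -/
theorem IsStrictlyUnital.stasheff {N : ℕ} {deg : Fin (N + 3) → ℤ} {v : Fin (N + 3) → V}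
    (j₀ : Fin (N + 3)) (hj : v j₀ = e) (hdeg : deg j₀ = 0) :
    ∑ s : Fin (N + 3), ∑ r : Fin (N + 3 - s.val),
      (((r.val : ℤ) + ((s.val : ℤ) + 1) * (((N + 3 : ℕ) : ℤ) - s.val - 1 - r.val)) +
          (1 - (s.val : ℤ)) * degBefore deg r.val).negOnePow •
        opFamily d μ (N + 3 - s.val) (plug (n := s.val + 1) (by omega) r
          (opFamily d μ (s.val + 1)) v) = 0 := by
  set Y := μ N fun s => v (j₀.succAbove s)
  have deg0 : degBefore deg 0 = 0 := by simp [degBefore]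
  -- every term, as a sum over the four possible positions of a binary product with the unit
  have key : ∀ (s : Fin (N + 3)) (r : Fin (N + 3 - s.val)),
      (((r.val : ℤ) + ((s.val : ℤ) + 1) * (((N + 3 : ℕ) : ℤ) - s.val - 1 - r.val)) +
          (1 - (s.val : ℤ)) * degBefore deg r.val).negOnePow •
        opFamily d μ (N + 3 - s.val) (plug (n := s.val + 1) (by omega) r
          (opFamily d μ (s.val + 1)) v) =
      (if s.val = 1 then (if r.val = j₀.val then (r.val : ℤ).negOnePow • Y else 0) +
        (if r.val = j₀.val - 1 then (if 0 < j₀.val then (r.val : ℤ).negOnePow • Y else 0) else 0)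
        else 0) +
      (if s.val = N + 1 then (if r.val = 1 then (if j₀.val = 0 then -Y else 0) else 0) +
        (if r.val = 0 then (if j₀.val = N + 2 then (N : ℤ).negOnePow • Y else 0) else 0)
        else 0) := by
    intro s r
    have hr := r.2
    rw [H.plug_eq _ r j₀ hj]
    by_cases h1 : s.val = 1 ∧ (r.val = j₀.val ∨ r.val + 1 = j₀.val)
    · obtain ⟨hs, hr'⟩ := h1
      rw [if_pos (Or.inl ⟨by omega, hr'⟩), if_pos hs]
      have sgn : ((r.val : ℤ) + ((s.val : ℤ) + 1) * (((N + 3 : ℕ) : ℤ) - s.val - 1 - r.val) +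
          (1 - (s.val : ℤ)) * degBefore deg r.val).negOnePow = (r.val : ℤ).negOnePow := by
        have hs' : (s.val : ℤ) = 1 := by exact_mod_cast hs
        rw [Int.negOnePow_eq_iff, hs']
        exact ⟨((N + 3 : ℕ) : ℤ) - 1 - 1 - r.val, by push_cast; ring⟩
      have hz : (if s.val = N + 1 then (if r.val = 1 then (if j₀.val = 0 then -Y else 0) else 0) +
          (if r.val = 0 then (if j₀.val = N + 2 then (N : ℤ).negOnePow • Y else 0) else 0)
          else 0) = 0 := by
        split_ifs <;> first | omega | simp
      rw [sgn, hz, add_zero]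
      rcases hr' with hr' | hr'
      · rw [if_pos hr']
        by_cases h2 : r.val = j₀.val - 1
        · rw [if_pos h2, if_neg (by omega), add_zero]
        · rw [if_neg h2, add_zero]
      · rw [if_neg (by omega), if_pos (by omega), if_pos (by omega), zero_add]
    · by_cases h2 : s.val = N + 1 ∧ ((r.val = 1 ∧ j₀.val = 0) ∨ (r.val = 0 ∧ j₀.val = N + 2))
      · obtain ⟨hs, hr'⟩ := h2
        rw [if_pos (Or.inr ⟨by omega, hr'⟩), if_pos hs]
        have hz : (if s.val = 1 then (if r.val = j₀.val then (r.val : ℤ).negOnePow • Y else 0) +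
            (if r.val = j₀.val - 1 then (if 0 < j₀.val then (r.val : ℤ).negOnePow • Y else 0)
              else 0) else 0) = 0 := by
          split_ifs <;> first | omega | simp
        rw [hz, zero_add]
        rcases hr' with ⟨hr1, hj0⟩ | ⟨hr0, hj0⟩
        · have hj00 : j₀ = 0 := Fin.ext hj0
          have d1 : degBefore deg 1 = 0 := by
            rw [degBefore, Fin.sum_univ_succ]
            subst hj00
            simp [hdeg]
          rw [if_pos hr1, if_pos hj0, if_neg (by omega), add_zero, hr1, d1, hs]
          have : ((1 : ℕ) : ℤ) + (((N + 1 : ℕ) : ℤ) + 1) * (((N + 3 : ℕ) : ℤ) - (N + 1 : ℕ) - 1 -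
              ((1 : ℕ) : ℤ)) + (1 - ((N + 1 : ℕ) : ℤ)) * 0 = 1 := by push_cast; ring
          rw [this, Int.negOnePow_one, Units.neg_smul, one_smul]
        · rw [if_neg (by omega), if_pos hr0, if_pos hj0, zero_add, hr0, deg0, hs]
          congr 1
          rw [Int.negOnePow_eq_iff]
          exact ⟨1, by push_cast; ring⟩
      · rw [if_neg, smul_zero]
        · symm
          split_ifs <;> first | omega | simp
        · omega
  rw [Finset.sum_congr rfl fun s _ => Finset.sum_congr rfl fun r _ => key s r]
  simp only [Finset.sum_add_distrib]
  have s1 : ∑ s : Fin (N + 3), ∑ r : Fin (N + 3 - s.val),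
      (if s.val = 1 then (if r.val = j₀.val then (r.val : ℤ).negOnePow • Y else 0) +
        (if r.val = j₀.val - 1 then (if 0 < j₀.val then (r.val : ℤ).negOnePow • Y else 0) else 0)
        else 0) = (if j₀.val < N + 2 then (j₀.val : ℤ).negOnePow • Y else 0) +
        if 0 < j₀.val then ((j₀.val - 1 : ℕ) : ℤ).negOnePow • Y else 0 := by
    rw [Finset.sum_eq_single (⟨1, by omega⟩ : Fin (N + 3))]
    · simp only [if_true, Finset.sum_add_distrib]
      rw [sum_fin_ite_val j₀.val fun r => (r : ℤ).negOnePow • Y,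
        sum_fin_ite_val (j₀.val - 1) fun r =>
          if 0 < j₀.val then (r : ℤ).negOnePow • Y else 0,
        if_pos (show j₀.val - 1 < N + 3 - 1 by omega)]
      rfl
    · intro s _ hs
      exact Finset.sum_eq_zero fun r _ => if_neg fun e => hs (Fin.ext e)
    · simp
  have s2 : ∑ s : Fin (N + 3), ∑ r : Fin (N + 3 - s.val),
      (if s.val = N + 1 then (if r.val = 1 then (if j₀.val = 0 then -Y else 0) else 0) +
        (if r.val = 0 then (if j₀.val = N + 2 then (N : ℤ).negOnePow • Y else 0) else 0)
        else 0) = (if j₀.val = 0 then -Y else 0) +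
        if j₀.val = N + 2 then (N : ℤ).negOnePow • Y else 0 := by
    rw [Finset.sum_eq_single (⟨N + 1, by omega⟩ : Fin (N + 3))]
    · simp only [if_true, Finset.sum_add_distrib]
      rw [sum_fin_ite_val 1 fun _ => if j₀.val = 0 then -Y else 0,
        sum_fin_ite_val 0 fun _ => if j₀.val = N + 2 then (N : ℤ).negOnePow • Y else 0,
        if_pos (show 1 < N + 3 - (N + 1) by omega), if_pos (show 0 < N + 3 - (N + 1) by omega)]
    · intro s _ hs
      exact Finset.sum_eq_zero fun r _ => if_neg fun e => hs (Fin.ext e)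
    · simp
  have hj₀ := j₀.2
  simp only [← Finset.sum_add_distrib]
  rw [Finset.sum_congr rfl fun s _ => Finset.sum_add_distrib ..]
  rw [Finset.sum_add_distrib, s1, s2]
  -- the unit in the first, in the last, and in any other position
  by_cases h0 : j₀.val = 0
  · rw [if_pos (by omega), if_neg (by omega), if_pos h0, if_neg (by omega), h0]
    simp
  · obtain ⟨j, hj'⟩ := Nat.exists_eq_succ_of_ne_zero h0
    rw [if_pos (show 0 < j₀.val by omega), if_neg h0, zero_add, hj', Nat.succ_eq_add_one,
      Nat.add_sub_cancel]
    by_cases hl : j + 1 = N + 2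
    · obtain rfl : j = N + 1 := by omega
      rw [if_neg (by omega), if_pos (by omega), zero_add, Nat.cast_add_one, Int.negOnePow_succ,
        Units.neg_smul, neg_add_cancel]
    · rw [if_pos (by omega), if_neg (by omega), add_zero, Nat.cast_add_one, Int.negOnePow_succ,
        Units.neg_smul, neg_add_cancel]

end StasheffUnit


/-! ### The algebra of trees -/

section StasheffUnitTwo

variable {k : Type u} [Field k] {V : Type w} [AddCommGroup V] [Module k V]
  {d : V →ₗ[k] V} {e : V} {μ : ∀ n, Op k V (n + 2)}

/-- The Stasheff relation for two arguments one of which is the unit. -/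
theorem IsStrictlyUnital.stasheff_two (H : IsStrictlyUnital d e μ) {deg : Fin 2 → ℤ}
    {v : Fin 2 → V} (j₀ : Fin 2) (hj : v j₀ = e) (hdeg : deg j₀ = 0) :
    ∑ s : Fin 2, ∑ r : Fin (2 - s.val),
      (((r.val : ℤ) + ((s.val : ℤ) + 1) * (((2 : ℕ) : ℤ) - s.val - 1 - r.val)) +
          (1 - (s.val : ℤ)) * degBefore deg r.val).negOnePow •
        opFamily d μ (2 - s.val) (plug (n := s.val + 1) (by omega) r
          (opFamily d μ (s.val + 1)) v) = 0 := by
  rw [Fin.sum_univ_two]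
  refine (congrArg₂ (· + ·) (Fin.sum_univ_two _) (Fin.sum_univ_one _)).trans ?_
  have key : ∀ c₀ c₁ c₂ : ℤ, c₀.negOnePow = -1 → c₁.negOnePow = -(deg 0).negOnePow →
      c₂.negOnePow = 1 →
      (c₀.negOnePow • μ 0 (plug (n := 1) (l := 2) (m := 2) rfl 0 (unaryOp d) v) +
      c₁.negOnePow • μ 0 (plug (n := 1) (l := 2) (m := 2) rfl 1 (unaryOp d) v)) +
      c₂.negOnePow • unaryOp d (plug (n := 2) (l := 2) (m := 1) rfl 0 (μ 0) v) = 0 := by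
    intro c₀ c₁ c₂ h₀ h₁ h₂
    have e2 : plug (n := 2) (l := 2) (m := 1) rfl 0 (μ 0) v 0 = μ 0 v := by
      rw [plug_self]
      simp only [innerIdx_zero_one]
    rw [h₀, h₁, h₂, plug_unary, plug_unary, unaryOp_apply, unaryOp_apply, unaryOp_apply, e2]
    match j₀ with
    | 0 =>
      have a0 : Function.update v 0 (d (v 0)) = ![d e, v 1] := by
        funext j
        match j with
        | 0 => rw [hj]; rfl
        | 1 => rfl
      have a1 : Function.update v 1 (d (v 1)) = ![e, d (v 1)] := by
        funext j
        match j with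
        | 0 => exact hj
        | 1 => rfl
      have a2 : v = ![e, v 1] := by
        funext j
        match j with
        | 0 => exact hj
        | 1 => rfl
      have a3 : μ 0 v = v 1 := (congrArg _ a2).trans (H.unit_left _)
      have a4 : μ 0 ![d e, v 1] = 0 := by
        rw [H.d_unit]
        exact (μ 0).map_coord_zero 0 rfl
      have a5 : (fun _ : Fin 1 => v 0) 0 = v 0 := rfl
      simp only [a0, a1, H.unit_left, a3, a4, hdeg, Int.negOnePow_zero]
      simp
    | 1 =>
      have a0 : Function.update v 0 (d (v 0)) = ![d (v 0), e] := by
        funext j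
        match j with
        | 0 => rfl
        | 1 => exact hj
      have a1 : Function.update v 1 (d (v 1)) = ![v 0, d e] := by
        funext j
        match j with
        | 0 => rfl
        | 1 => rw [hj]; rfl
      have a2 : v = ![v 0, e] := by
        funext j
        match j with
        | 0 => rfl
        | 1 => exact hj
      have a3 : μ 0 v = v 0 := (congrArg _ a2).trans (H.unit_right _)
      have a4 : μ 0 ![v 0, d e] = 0 := by
        rw [H.d_unit]
        exact (μ 0).map_coord_zero 1 rfl
      simp only [a0, a1, H.unit_right, a3, a4]
      simp
  refine key _ _ _ ?_ ?_ ?_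
  · simp [degBefore]
  · have : degBefore deg 1 = deg 0 := by simp [degBefore]
    simp [this, Int.negOnePow_add]
  · simp [degBefore]

theorem IsStrictlyUnital.circOp_two_unit (H : IsStrictlyUnital d e μ) {gr : ℤ → Submodule k V}
    (hgr : DirectSum.IsInternal gr) (i : Fin 2) :
    circOp hgr 0 (n := 0) rfl i (μ 0) (constOp e) = unaryOp LinearMap.id := by
  ext1 v
  rw [unaryOp_apply]
  match i with
  | 0 => exact (circOp_constOp_left hgr _ _ v).trans (H.unit_left _)
  | 1 => exact (circOp_constOp_right hgr _ _ v).trans (H.unit_right _)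

theorem IsStrictlyUnital.circOp_unit (H : IsStrictlyUnital d e μ) {gr : ℤ → Submodule k V}
    (hgr : DirectSum.IsInternal gr) (n : ℕ) (i : Fin (n + 1 + 2)) :
    circOp hgr 0 (n := 0) (l := n + 2) rfl i (μ (n + 1)) (constOp e) = 0 :=
  multilinear_ext_homogeneous hgr fun deg v hv => by
    rw [circOp_apply hgr _ _ _ _ _ hv, H.unit i (plug_opZero _ _ _ _), smul_zero]
    rfl

end StasheffUnitTwo

namespace Pl

variable {k : Type u} [Field k]

theorem isStrictlyUnital : IsStrictlyUnital DL (treeUnit k) (treeOp k) where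
  d_unit := DL_ι (leaf 0)
  unit_left := treeOp_unit_left
  unit_right := treeOp_unit_right
  unit := treeOp_unit

/-- The Stasheff relations in the algebra of trees. On trees other than the unit they hold by
`stasheff_tree`, and in the presence of the unit for formal reasons. -/
theorem diffOp_treeOp (N : ℕ) :
    diffOp (treeGr_internal (k := k)) DL (-(N : ℤ)) (treeOp k N) +
      Mon.evalOpL (treeGr_internal (k := k)) DL (treeUnit k) (treeOp k)
        (Mon.stasheffSum k N) = 0 := by
  refine multilinear_ext_single fun x => ?_
  have hv : ∀ j, (Finsupp.single (x j) 1 : Lin k true) ∈ treeGr k (deg (x j)) := fun j =>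
    ι_mem_treeGr (x j)
  refine (stasheff_eq (treeGr_internal (k := k)) (m := treeFam k) rfl (treeUnit k) N
    hv).symm.trans ?_
  by_cases hx : ∀ j, x j ≠ leaf 0
  · exact stasheff_tree hx
  · push Not at hx
    obtain ⟨j₀, hj⟩ := hx
    have hj' : (Finsupp.single (x j₀) 1 : Lin k true) = treeUnit k := by rw [hj]; rfl
    have hdeg : deg (x j₀) = 0 := by rw [hj]; simp [deg, sdeg]
    cases N with
    | zero => exact isStrictlyUnital.stasheff_two j₀ hj' hdeg
    | succ N => exact isStrictlyUnital.stasheff j₀ hj' hdeg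

theorem isUnitalData :
    IsUnitalData (treeGr_internal (k := k)) DL (treeUnit k) (treeOp k) where
  d_mem _ _ hx := DL_mem_treeGr hx
  d_d := DL_DL
  unit_mem := single_mem_basisGrading' (by simp [deg, sdeg]) 1
  d_unit := isStrictlyUnital.d_unit
  mul_mem := treeOp_mem
  d_mul := diffOp_treeOp
  mul_two_unit := isStrictlyUnital.circOp_two_unit treeGr_internal
  mul_unit := isStrictlyUnital.circOp_unit treeGr_internal

/-- The cochain complex of trees. -/
noncomputable def treeComplex (k : Type u) [Field k] : Cochain.{u, u} k where
  carrier := Lin k true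
  gr := treeGr k
  internal := treeGr_internal
  d := DL
  d_mem := DL_mem_treeGr
  d_d := DL_DL

end Pl

/-- The complex of trees is an algebra over the presented operad. -/
theorem Pl.exists_algebra (k : Type u) [Field k] :
    ∃ α : OperadAlgebra (BurkeOperad k) (Pl.treeComplex k),
      α.act 0 (BurkeOperad.unit k) = constOp (Pl.treeUnit k) ∧
      ∀ n, α.act (n + 2) (BurkeOperad.mul k n) = Pl.treeOp k n := by
  obtain ⟨α, hα⟩ := IsUnitalData.exists_algebra (A := Pl.treeComplex k) Pl.isUnitalData
  exact ⟨α, hα 0 .unit, fun n => hα _ (.mul n)⟩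

/-- The unit acts on the complex of trees as a nonzero element. -/
theorem BurkeOperad.unit_ne_zero (k : Type u) [Field k] : BurkeOperad.unit k ≠ 0 := by
  intro h
  obtain ⟨α, hα, -⟩ := Pl.exists_algebra k
  rw [h, map_zero] at hα
  have := congrArg (fun f : Op k (Pl.Lin k true) 0 => f ![] (Pl.leaf 0)) hα
  have h2 : (0 : k) = 1 := by
    refine this.trans ?_
    exact Finsupp.single_eq_same
  exact zero_ne_one h2


/-! ### Monomials of positive arity -/

/-- Operadic monomials in the generators `mul n`, of arity `n + 2`. -/
inductive Tm : ℕ → Type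
  | one : Tm 1
  | mul (n : ℕ) : Tm (n + 2)
  | perm {n : ℕ} (σ : Equiv.Perm (Fin n)) (x : Tm n) : Tm n
  | circ {m n l : ℕ} (h : l + 1 = m + n) (i : Fin m) (x : Tm m) (y : Tm n) : Tm l

namespace Tm

theorem pos {n : ℕ} (x : Tm n) : 0 < n := by
  induction x with
  | one => exact Nat.one_pos
  | mul n => exact Nat.succ_pos _
  | perm _ _ ih => exact ih
  | circ h i _ _ ihx ihy => omega

/-- The degree of a monomial. -/
def deg : ∀ {n : ℕ}, Tm n → ℤ
  | _, one => 0
  | _, mul n => -(n : ℤ)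
  | _, perm _ x => deg x
  | _, circ _ _ x y => deg x + deg y

/-- All generators in the monomial are of the form `mul n` with `n ∈ G`. -/
def GensIn (G : Set ℕ) : ∀ {n : ℕ}, Tm n → Prop
  | _, one => True
  | _, mul n => n ∈ G
  | _, perm _ x => GensIn G x
  | _, circ _ _ x y => GensIn G x ∧ GensIn G y

variable {k : Type u} [Field k]

/-- The value of a monomial in an operad with chosen operations. -/
def eval (Q : GradedOperad.{u, v} k) (q : ∀ n, Q.X (n + 2)) : ∀ {n : ℕ}, Tm n → Q.X n
  | _, one => Q.one
  | _, mul n => q n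
  | _, perm σ x => Q.perm _ σ (eval Q q x)
  | _, circ h i x y => Q.circ h i (eval Q q x) (eval Q q y)

theorem eval_mem {Q : GradedOperad.{u, v} k} {q : ∀ n, Q.X (n + 2)}
    (hq : ∀ n, q n ∈ Q.gr (n + 2) (-(n : ℤ))) {n : ℕ} (x : Tm n) :
    eval Q q x ∈ Q.gr n x.deg := by
  induction x with
  | one => exact Q.one_mem
  | mul n => exact hq n
  | perm σ x ih => exact Q.perm_mem σ ih
  | circ h i x y ihx ihy => exact Q.circ_mem h i ihx ihy

variable (k) in
/-- In every operad, the values of `x` and `y` agree up to the sign `ε`. -/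
def SignEq (ε : ℤˣ) {n : ℕ} (x y : Tm n) : Prop :=
  ∀ (Q : GradedOperad.{u, v} k) (q : ∀ n, Q.X (n + 2)),
    (∀ n, q n ∈ Q.gr (n + 2) (-(n : ℤ))) → eval Q q x = ε • eval Q q y

theorem SignEq.refl {n : ℕ} (x : Tm n) : SignEq.{u, v} k 1 x x := fun _ _ _ => (one_smul _ _).symm

theorem SignEq.trans {ε δ : ℤˣ} {n : ℕ} {x y z : Tm n} (h : SignEq.{u, v} k ε x y)
    (h' : SignEq.{u, v} k δ y z) : SignEq.{u, v} k (ε * δ) x z := fun Q q hq => by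
  rw [h Q q hq, h' Q q hq, smul_smul]

theorem SignEq.symm {ε : ℤˣ} {n : ℕ} {x y : Tm n} (h : SignEq.{u, v} k ε x y) :
    SignEq.{u, v} k ε y x := fun Q q hq => by
  rw [h Q q hq, smul_smul, Int.units_mul_self, one_smul]

theorem SignEq.perm {ε : ℤˣ} {n : ℕ} {x y : Tm n} (h : SignEq.{u, v} k ε x y)
    (σ : Equiv.Perm (Fin n)) : SignEq.{u, v} k ε (perm σ x) (perm σ y) := fun Q q hq => by
  rw [eval, eval, h Q q hq, Mon.map_sign]

theorem SignEq.circ {ε δ : ℤˣ} {m n l : ℕ} {x x' : Tm m} {y y' : Tm n}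
    (hx : SignEq.{u, v} k ε x x') (hy : SignEq.{u, v} k δ y y') (h : l + 1 = m + n) (i : Fin m) :
    SignEq.{u, v} k (ε * δ) (circ h i x y) (circ h i x' y') := fun Q q hq => by
  rw [eval, eval, hx Q q hq, hy Q q hq, Mon.map_sign, Mon.map_sign, LinearMap.smul_apply,
    smul_smul, mul_comm]

/-! ### Normal forms of monomials -/

/-- Monomials obtained from the identity by grafting generators onto inputs in nondecreasing
positions.  The list is the prefix code of the corresponding planar tree up to the last inner
vertex, where `some k` stands for a vertex with `k + 2` children and `none` for a leaf; thus the
number of leaves in it is the position of the last grafting. -/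
inductive Planar : List (Option ℕ) → ∀ {n : ℕ}, Tm n → Prop
  | one : Planar [] one
  | graft {c : List (Option ℕ)} {m l k : ℕ} (h : l + 1 = m + (k + 2)) (i : Fin m) {x : Tm m}
      (hx : Planar c x) (hi : c.count none ≤ i.val) :
      Planar (c ++ (List.replicate (i.val - c.count none) none ++ [some k])) (circ h i x (mul k))

theorem count_graft {c : List (Option ℕ)} {i : ℕ} (k : ℕ) (hi : c.count none ≤ i) :
    (c ++ (List.replicate (i - c.count none) none ++ [some k])).count none = i := by
  simp [List.count_append]
  omega

/-- Grafting a generator onto a normal form at any position. -/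
theorem Planar.exists_graft {c : List (Option ℕ)} {m : ℕ} {z : Tm m} (hz : Planar c z)
    {l j' : ℕ} (h : l + 1 = m + (j' + 2)) (j : Fin m) :
    ∃ (ε : ℤˣ) (c' : List (Option ℕ)) (w : Tm l), Planar c' w ∧
      c'.count none ≤ max (c.count none + j' + 1) j.val ∧
      SignEq.{u, v} k ε (Tm.circ h j z (mul j')) w := by
  induction hz generalizing l j' with
  | one =>
    exact ⟨1, _, _, .graft h j .one (Nat.zero_le _),
      (count_graft _ (Nat.zero_le _)).le.trans (le_max_right _ _), .refl _⟩
  | @graft c m₀ m k' h' i x hx hi ih =>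
    by_cases hij : i.val ≤ j.val
    · exact ⟨1, _, _, .graft h j (.graft h' i hx hi) ((count_graft _ hi).trans_le hij),
        (count_graft _ ((count_graft _ hi).trans_le hij)).le.trans (le_max_right _ _), .refl _⟩
    · -- the new generator is grafted further to the left: the two graftings commute up to sign
      obtain ⟨j₀, hj₀⟩ : ∃ j₀ : Fin m₀, j₀.val = j.val := ⟨⟨j.val, by omega⟩, rfl⟩
      have hne : j₀ ≠ i := fun e => by
        have := congrArg Fin.val e
        omega
      have hj : j = outerIdx h' i j₀ hne := by
        apply Fin.ext
        simp only [outerIdx]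
        split_ifs <;> omega
      have h₃ : m₀ + j' + 1 + 1 = m₀ + (j' + 2) := by omega
      have h₄ : l + 1 = m₀ + j' + 1 + (k' + 2) := by omega
      have hval : (outerIdx h₃ j₀ i hne.symm).val = i.val + j' + 1 := by
        simp only [outerIdx]
        split_ifs <;> omega
      obtain ⟨ε, c', w, hw, hb, hs⟩ := ih h₃ j₀
      have hb' : c'.count none ≤ (outerIdx h₃ j₀ i hne.symm).val := by omega
      refine ⟨((-(k' : ℤ)) * (-(j' : ℤ))).negOnePow * (ε * 1), _, _,
        .graft h₄ (outerIdx h₃ j₀ i hne.symm) hw hb', ?_, ?_⟩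
      · rw [count_graft _ hb', count_graft _ hi, hval]
        omega
      · refine SignEq.trans ?_ (hs.circ (.refl (mul k')) h₄ (outerIdx h₃ j₀ i hne.symm))
        intro Q q hq
        rw [hj]
        exact Q.circ_par h' h h₃ h₄ i j₀ hne _ _ _ (hq k') (hq j')

/-- Composition of normal forms. -/
theorem Planar.exists_circ {c c' : List (Option ℕ)} {m n : ℕ} {x : Tm m} {y : Tm n}
    (hx : Planar c x) (hy : Planar c' y) {l : ℕ} (h : l + 1 = m + n) (i : Fin m) :
    ∃ (ε : ℤˣ) (c'' : List (Option ℕ)) (w : Tm l), Planar c'' w ∧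
      SignEq.{u, v} k ε (Tm.circ h i x y) w := by
  induction hy generalizing l with
  | one =>
    obtain rfl : l = m := by omega
    refine ⟨1, c, x, hx, fun Q q _ => ?_⟩
    rw [one_smul]
    exact Q.circ_one i _
  -- the last generator of `y` is grafted onto the composition of `x` with the rest of `y`
  | @graft c₀ n₀ n k' h' j y hy hj ih =>
    have h₁ : l - k' - 1 + 1 = m + n₀ := by omega
    have h₂ : l + 1 = l - k' - 1 + (k' + 2) := by omega
    obtain ⟨ε, c₁, w, hw, hs⟩ := ih h₁
    obtain ⟨ε', c₂, w', hw', -, hs'⟩ := hw.exists_graft (k := k) h₂ (innerIdx h₁ i j)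
    refine ⟨_, c₂, w', hw', SignEq.trans (ε := 1) ?_
      ((hs.circ (.refl (mul k')) h₂ (innerIdx h₁ i j)).trans hs')⟩
    intro Q q _
    rw [one_smul]
    exact (Q.circ_seq h₁ h₂ h' h i j _ _ _).symm

/-- In every operad, every monomial is, up to sign, a relabelling of a normal form. -/
theorem exists_planar {n : ℕ} (x : Tm n) :
    ∃ (ε : ℤˣ) (σ : Equiv.Perm (Fin n)) (c : List (Option ℕ)) (y : Tm n), Planar c y ∧
      SignEq.{u, v} k ε x (perm σ y) := by
  induction x with
  | one =>
    refine ⟨1, 1, _, _, .one, fun Q q _ => ?_⟩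
    rw [eval, eval, map_one, one_smul]
    rfl
  | mul n =>
    refine ⟨1, 1, _, _, .graft (show n + 2 + 1 = 1 + (n + 2) by omega) 0 .one (Nat.zero_le _),
      fun Q q _ => ?_⟩
    rw [eval, eval, map_one, one_smul]
    exact (Q.one_circ _ _).symm
  | perm τ x ih =>
    obtain ⟨ε, σ, c, y, hy, hs⟩ := ih
    refine ⟨ε * 1, τ * σ, c, y, hy, (hs.perm τ).trans fun Q q _ => ?_⟩
    rw [eval, eval, eval, map_mul, one_smul]
    rfl
  | circ h i x y ihx ihy =>
    obtain ⟨ε, σ, c, x', hx, hs⟩ := ihx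
    obtain ⟨ε', τ, c', y', hy, hs'⟩ := ihy
    obtain ⟨δ, c'', z, hz, hs''⟩ := hx.exists_circ (k := k) hy h (σ.symm i)
    refine ⟨_, blockPerm h (σ.symm i) σ τ, c'', z, hz,
      (hs.circ hs' h i).trans (SignEq.trans (ε := 1) ?_ (hs''.perm _))⟩
    intro Q q _
    rw [one_smul]
    have := Q.circ_perm h (σ.symm i) σ τ (eval Q q x') (eval Q q y')
    rwa [σ.apply_symm_apply] at this

/-- The code of a normal form does not end with a leaf. -/
theorem Planar.rdropWhile {c : List (Option ℕ)} {n : ℕ} {x : Tm n} (hx : Planar c x) (s : ℕ) :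
    (c ++ List.replicate s none).rdropWhile Option.isNone = c := by
  induction s with
  | zero =>
    rw [List.replicate_zero, List.append_nil]
    cases hx with
    | one => rfl
    | graft h i hx hi =>
      rw [← List.append_assoc]
      exact List.rdropWhile_concat_neg _ _ _ (by simp)
  | succ s ih =>
    rw [List.replicate_succ', ← List.append_assoc, List.rdropWhile_concat_pos _ _ _ (by rfl), ih]

theorem Planar.code_injective {c c' : List (Option ℕ)} {m n : ℕ} {x : Tm m} {y : Tm n}
    (hx : Planar c x) (hy : Planar c' y) {s t : ℕ}
    (h : c ++ List.replicate s none = c' ++ List.replicate t none) : c = c' ∧ s = t := by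
  have hc : c = c' := by rw [← hx.rdropWhile s, h, hy.rdropWhile]
  subst hc
  have := congrArg List.length h
  simp only [List.length_append, List.length_replicate] at this
  exact ⟨rfl, by omega⟩

/-- A normal form is determined by its code. -/
theorem Planar.eq_of_code {c c' : List (Option ℕ)} {m n : ℕ} {x : Tm m} {y : Tm n}
    (hx : Planar c x) (hy : Planar c' y) (hc : c = c') : (⟨m, x⟩ : Σ n, Tm n) = ⟨n, y⟩ := by
  induction hx generalizing n c' with
  | one =>
    cases hy with
    | one => rfl
    | graft => simp at hc
  | @graft c m l k h i x hx hi ih =>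
    cases hy with
    | one => simp at hc
    | @graft c' m' l' k' h' i' y hy hi' =>
      rw [← List.append_assoc, ← List.append_assoc] at hc
      obtain ⟨h1, h2⟩ := List.append_inj' hc rfl
      obtain ⟨rfl, h3⟩ := hx.code_injective hy h1
      have := ih hy rfl
      cases this
      simp only [List.cons.injEq, Option.some.injEq, and_true] at h2
      subst h2
      obtain rfl : l = n := by omega
      obtain rfl : i = i' := Fin.ext (by omega)
      rfl

end Tm


/-! ### The tree of a monomial -/

namespace Tm

/-- Substitution of trees into the tree of a monomial. -/
def tree : ∀ {n : ℕ}, Tm n → (Fin n → Pl true) → Pl true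
  | _, one, a => a 0
  | _, mul _, a => Pl.corolla (List.ofFn a)
  | _, perm σ x, a => tree x fun j => a (σ j)
  | _, circ h i x y, a => tree x (plug h i (tree y) a)

theorem tree_ne_leaf {n : ℕ} (x : Tm n) {a : Fin n → Pl true} (ha : ∀ j, a j ≠ .leaf 0) :
    x.tree a ≠ .leaf 0 := by
  induction x with
  | one => exact ha 0
  | mul n =>
    rw [tree, List.ofFn_succ, Pl.corolla]
    exact fun e => by cases e
  | perm σ x ih => exact ih fun j => ha _
  | circ h i x y ihx ihy =>
    refine ihx fun j => ?_
    by_cases hj : j = i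
    · subst hj
      rw [plug_self]
      exact ihy fun t => ha _
    · rw [plug_of_ne _ _ _ _ hj]
      exact ha _

end Tm

namespace Pl

/-- The number of trees of a forest, minus one. -/
def len : ∀ {b : Bool}, Pl b → ℕ
  | _, leaf _ => 0
  | _, node _ _ => 0
  | _, one _ => 0
  | _, cons _ f => len f + 1

/-- The prefix code of the shape of a tree: `none` for a leaf, and `some k` for a vertex with
`k + 2` children, followed by the codes of its children. -/
def shape : ∀ {b : Bool}, Pl b → List (Option ℕ)
  | _, leaf _ => [none]
  | _, node t f => some (len f) :: (shape t ++ shape f)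
  | _, one t => shape t
  | _, cons t f => shape t ++ shape f

/-- The labels of the leaves, from left to right. -/
def word : ∀ {b : Bool}, Pl b → List ℕ
  | _, leaf a => [a]
  | _, node t f => word t ++ word f
  | _, one t => word t
  | _, cons t f => word t ++ word f

theorem forest_spec {w : List (Pl true)} (hw : w ≠ []) : len (forest w) + 1 = w.length ∧
    shape (forest w) = (w.map shape).flatten ∧ word (forest w) = (w.map word).flatten := by
  induction w with
  | nil => exact absurd rfl hw
  | cons t w ih =>
    cases w with
    | nil => simp [forest, len, shape, word]
    | cons t' w =>
      obtain ⟨h1, h2, h3⟩ := ih (by simp)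
      rw [forest, len, shape, word, h1, h2, h3]
      simp

theorem shape_corolla {n : ℕ} (a : Fin (n + 2) → Pl true) : shape (corolla (List.ofFn a)) =
    some n :: (List.ofFn fun j => shape (a j)).flatten := by
  have hw : List.ofFn (fun i : Fin (n + 1) => a i.succ) ≠ [] := by simp
  obtain ⟨h1, h2, -⟩ := forest_spec hw
  rw [List.ofFn_succ (f := a), corolla, shape, h2, List.map_ofFn,
    List.ofFn_succ (f := fun j => shape (a j)), List.flatten_cons]
  have : len (forest (List.ofFn fun i : Fin (n + 1) => a i.succ)) = n := by simpa using h1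
  rw [this]
  rfl

theorem word_corolla {n : ℕ} (a : Fin (n + 2) → Pl true) : word (corolla (List.ofFn a)) =
    (List.ofFn fun j => word (a j)).flatten := by
  have hw : List.ofFn (fun i : Fin (n + 1) => a i.succ) ≠ [] := by simp
  obtain ⟨-, -, h3⟩ := forest_spec hw
  rw [List.ofFn_succ (f := a), corolla, word, h3, List.map_ofFn,
    List.ofFn_succ (f := fun j => word (a j)), List.flatten_cons]
  rfl

end Pl

/-! ### Codes of normal forms -/

section Fill

variable {α : Type*}

/-- Replacing the leaves in a code by given codes; codes which are left over are appended. -/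
def fill : List (Option ℕ) → List (List (Option ℕ)) → List (Option ℕ)
  | [], W => W.flatten
  | some k :: c, W => some k :: fill c W
  | none :: _, [] => []
  | none :: c, V :: W => V ++ fill c W

theorem fill_append_right (c : List (Option ℕ)) (W W' : List (List (Option ℕ)))
    (h : c.count none ≤ W.length) : fill c (W ++ W') = fill c W ++ W'.flatten := by
  induction c generalizing W with
  | nil => simp [fill]
  | cons a c ih =>
    cases a with
    | some k =>
      rw [fill, fill, ih _ (by simpa using h)]
      rfl
    | none =>
      cases W with
      | nil => simp at h
      | cons V W =>
        rw [List.cons_append, fill, fill, ih _ (by simpa using h), List.append_assoc]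

theorem fill_append_left (c d : List (Option ℕ)) (W W' : List (List (Option ℕ)))
    (h : W.length = c.count none) : fill (c ++ d) (W ++ W') = fill c W ++ fill d W' := by
  induction c generalizing W with
  | nil =>
    obtain rfl : W = [] := by simpa using h
    simp [fill]
  | cons a c ih =>
    cases a with
    | some k =>
      rw [List.cons_append, fill, fill, ih _ (by simpa using h)]
      rfl
    | none =>
      cases W with
      | nil => simp at h
      | cons V W =>
        rw [List.cons_append, List.cons_append, fill, fill, ih _ (by simpa using h),
          List.append_assoc]

theorem fill_replicate (s : ℕ) (W : List (List (Option ℕ))) (h : s ≤ W.length) :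
    fill (List.replicate s none) W = W.flatten := by
  induction s generalizing W with
  | zero => rfl
  | succ s ih =>
    cases W with
    | nil => simp at h
    | cons V W =>
      rw [List.replicate_succ, fill, ih _ (by simpa using h), List.flatten_cons]

theorem fill_append_replicate (c : List (Option ℕ)) (s : ℕ) (W : List (List (Option ℕ)))
    (h : c.count none + s ≤ W.length) : fill (c ++ List.replicate s none) W = fill c W := by
  have hl : (W.take (c.count none)).length = c.count none := by
    rw [List.length_take]
    omega
  have e := List.take_append_drop (c.count none) W
  rw [← e, fill_append_left _ _ _ _ hl, fill_append_right _ _ _ hl.ge,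
    fill_replicate _ _ (by rw [List.length_drop]; omega)]

/-- Filling a code with leaves only appends the missing leaves. -/
theorem fill_leaves (c : List (Option ℕ)) (m : ℕ) (h : c.count none ≤ m) :
    fill c (List.replicate m [none]) = c ++ List.replicate (m - c.count none) none := by
  induction c generalizing m with
  | nil =>
    rw [fill, List.count_nil, Nat.sub_zero, List.nil_append]
    clear h
    induction m with
    | zero => rfl
    | succ m ih => rw [List.replicate_succ, List.flatten_cons, ih, List.replicate_succ]; rfl
  | cons a c ih =>
    cases a with
    | some k =>
      rw [fill, ih _ (by simpa using h)]
      simp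
    | none =>
      cases m with
      | zero => simp at h
      | succ m =>
        rw [List.replicate_succ, fill, ih _ (by simpa using h)]
        simp

end Fill

namespace Tm

theorem Planar.count_lt {c : List (Option ℕ)} {n : ℕ} {x : Tm n} (hx : Planar c x) :
    c.count none < n := by
  cases hx with
  | one => exact Nat.one_pos
  | graft h i hx hi =>
    rw [count_graft _ hi]
    omega

theorem ofFn_map_plug {α V : Type*} {m n l : ℕ} (h : l + 1 = m + n) (i : Fin m) (f : V → α)
    (g : (Fin n → V) → V) (a : Fin l → V) : (List.ofFn fun j => f (plug h i g a j)) =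
      (List.ofFn fun j => f (a j)).take i.val ++ f (g fun t => a (innerIdx h i t)) ::
        (List.ofFn fun j => f (a j)).drop (i.val + n) := by
  have := congrArg (List.map f) (ofFn_plug h i g a)
  rw [List.map_append, List.map_cons, List.map_take, List.map_drop, List.map_ofFn,
    List.map_ofFn] at this
  exact this

/-- The code of a normal form is that of its tree, up to leaves at the end. -/
theorem Planar.shape_tree {c : List (Option ℕ)} {n : ℕ} {x : Tm n} (hx : Planar c x)
    (a : Fin n → Pl true) : (x.tree a).shape = fill c (List.ofFn fun j => (a j).shape) := by
  induction hx with
  | one => simp [tree, fill]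
  | @graft c m l k h i x hx hi ih =>
    have hL : (List.ofFn fun j => (a j).shape).length = l := List.length_ofFn
    have hin := take_ofFn_innerIdx h i fun j => (a j).shape
    set L := List.ofFn fun j => (a j).shape
    have e := List.take_append_drop i.val L
    have e' := List.take_append_drop (k + 2) (L.drop i.val)
    have hl : (L.take i.val).length = i.val := by
      rw [List.length_take]
      omega
    rw [tree, ih, ofFn_map_plug, tree, Pl.shape_corolla, ← hin]
    change fill c (L.take i.val ++ _ :: L.drop (i.val + (k + 2))) = _
    rw [fill_append_right _ _ _ (hi.trans hl.ge), List.flatten_cons]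
    conv_rhs => rw [← e]
    rw [← List.append_assoc c, fill_append_left _ _ _ _ (by
      rw [hl, List.count_append, List.count_replicate_self]
      omega), fill_append_replicate _ _ _ (by omega)]
    congr 1
    rw [fill, fill]
    conv_rhs => rw [← e']
    rw [List.flatten_append, List.drop_drop, List.cons_append]

theorem Planar.word_tree {c : List (Option ℕ)} {n : ℕ} {x : Tm n} (hx : Planar c x)
    (a : Fin n → Pl true) : (x.tree a).word = (List.ofFn fun j => (a j).word).flatten := by
  induction hx with
  | one => simp [tree]
  | @graft c m l k h i x hx hi ih =>
    have hin := take_ofFn_innerIdx h i fun j => (a j).word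
    set L := List.ofFn fun j => (a j).word
    have e := List.take_append_drop i.val L
    have e' := List.take_append_drop (k + 2) (L.drop i.val)
    rw [tree, ih, ofFn_map_plug, List.flatten_append, List.flatten_cons, tree, Pl.word_corolla,
      ← hin]
    conv_rhs => rw [← e, ← e']
    rw [List.flatten_append, List.flatten_append, List.drop_drop]

/-- A normal form and the labels of the inputs are determined by the resulting tree. -/
theorem Planar.tree_injective {c c' : List (Option ℕ)} {n : ℕ} {x y : Tm n} (hx : Planar c x)
    (hy : Planar c' y) {a b : Fin n → ℕ}
    (h : x.tree (fun j => .leaf (a j)) = y.tree fun j => .leaf (b j)) : x = y ∧ a = b := by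
  have h1 := congrArg Pl.shape h
  have h2 := congrArg Pl.word h
  rw [hx.shape_tree, hy.shape_tree] at h1
  rw [hx.word_tree, hy.word_tree] at h2
  have h3 : (List.ofFn fun _ : Fin n => [(none : Option ℕ)]) = List.replicate n [none] := by
    simp
  simp only [Pl.shape] at h1
  rw [h3, fill_leaves _ _ hx.count_lt.le, fill_leaves _ _ hy.count_lt.le] at h1
  have := hx.eq_of_code hy (hx.code_injective hy h1).1
  cases this
  refine ⟨rfl, ?_⟩
  have h4 : ∀ a : Fin n → ℕ, (List.ofFn fun j => (Pl.leaf (a j)).word).flatten = List.ofFn a := by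
    intro a
    have : (List.ofFn fun j => (Pl.leaf (a j)).word) = (List.ofFn a).map fun x => [x] := by
      rw [List.map_ofFn]
      rfl
    rw [this]
    exact List.flatMap_singleton' _
  rw [h4, h4] at h2
  exact List.ofFn_injective h2

end Tm

/-! ### The action of monomials on trees -/

variable {k : Type u} [Field k]

variable (k) in
/-- The action of the presented operad on trees provided by `Pl.exists_algebra`. -/
noncomputable def Pl.treeAlgebra : OperadAlgebra (BurkeOperad k) (Pl.treeComplex k) :=
  (Pl.exists_algebra k).choose

theorem Pl.treeAlgebra_unit :
    (Pl.treeAlgebra k).act 0 (BurkeOperad.unit k) = constOp (Pl.treeUnit k) :=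
  (Pl.exists_algebra k).choose_spec.1

theorem Pl.treeAlgebra_mul (n : ℕ) :
    (Pl.treeAlgebra k).act (n + 2) (BurkeOperad.mul k n) = Pl.treeOp k n :=
  (Pl.exists_algebra k).choose_spec.2 n

variable (k) in
/-- The value of a monomial in the presented operad. -/
noncomputable abbrev BurkeOperad.tm {n : ℕ} (x : Tm n) : (BurkeOperad k).X n :=
  x.eval (BurkeOperad k).toGradedOperad (BurkeOperad.mul k)

theorem BurkeOperad.tm_mem {n : ℕ} (x : Tm n) : BurkeOperad.tm k x ∈ (BurkeOperad k).gr n x.deg :=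
  x.eval_mem BurkeOperad.mul_mem

/-- Up to sign, a monomial acts on trees by substitution. -/
theorem Pl.act_tm {n : ℕ} (x : Tm n) {a : Fin n → Pl true} (ha : ∀ j, a j ≠ leaf 0) :
    ∃ ε : ℤˣ, (Pl.treeAlgebra k).act n (BurkeOperad.tm k x) (fun j => (ι (a j) : Lin k true)) =
      ε • (ι (x.tree a) : Lin k true) := by
  induction x with
  | one => exact ⟨1, ((Pl.treeAlgebra k).act_one _).trans (one_smul _ _).symm⟩
  | mul n =>
    refine ⟨(weight fun j => deg (a j)).negOnePow, ?_⟩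
    change (treeAlgebra k).act (n + 2) (BurkeOperad.mul k n) _ = _
    rw [treeAlgebra_mul]
    exact treeOp_ι ha
  | perm σ x ih =>
    obtain ⟨ε, hε⟩ := ih fun j => ha (σ j)
    refine ⟨koszulSign σ (fun j => deg (a j)) * ε, ?_⟩
    rw [mul_smul]
    exact ((Pl.treeAlgebra k).act_perm σ _ _ fun j => ι_mem_treeGr (a j)).trans
      (congrArg (fun z => _ • z) hε)
  | @circ m n l h i x y ihx ihy =>
    obtain ⟨ε, hε⟩ := ihy fun t => ha (innerIdx h i t)
    have ha' : ∀ j, plug h i y.tree a j ≠ leaf 0 := by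
      intro j
      by_cases hj : j = i
      · subst hj
        rw [plug_self]
        exact y.tree_ne_leaf fun t => ha _
      · rw [plug_of_ne _ _ _ _ hj]
        exact ha _
    obtain ⟨ε', hε'⟩ := ihx ha'
    refine ⟨(y.deg * degBefore (fun j => deg (a j)) i.val).negOnePow * (ε * ε'), ?_⟩
    rw [mul_smul, mul_smul]
    refine ((Pl.treeAlgebra k).act_circ h i _ _ _ (BurkeOperad.tm_mem y)
      fun j => ι_mem_treeGr (a j)).trans (congrArg (fun z => _ • z) ?_)
    refine (Op.map_plug_sign _ h i _
      (fun _ => (ι (y.tree fun t => a (innerIdx h i t)) : Lin k true)) _ ε hε).trans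
      (congrArg (fun z => ε • z) ?_)
    refine Eq.trans (congrArg _ ?_) hε'
    funext j
    by_cases hj : j = i
    · subst hj
      rw [plug_self, plug_self]
    · rw [plug_of_ne _ _ _ _ hj, plug_of_ne _ _ _ _ hj]

theorem Pl.sign_ι_injective {ε δ : ℤˣ} {t t' : Pl true}
    (h : ε • (ι t : Lin k true) = δ • (ι t' : Lin k true)) : t = t' := by
  by_contra hne
  have h1 := congrArg (fun f : Lin k true => f t) h
  have h2 : (δ • (ι t' : Lin k true)) t = 0 := by
    rcases Int.units_eq_one_or δ with rfl | rfl <;> simp [ι, Units.neg_smul, Ne.symm hne]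
  have h3 : (ε • (ι t : Lin k true)) t ≠ 0 := by
    rcases Int.units_eq_one_or ε with rfl | rfl <;> simp [ι, Units.neg_smul]
  exact h3 (h1.trans h2)

/-- Signs which agree on a tree agree on every vector, in whatever characteristic. -/
theorem Pl.sign_smul_eq {ε δ : ℤˣ} {t : Pl true}
    (h : ε • (ι t : Lin k true) = δ • (ι t : Lin k true)) {V : Type w} [AddCommGroup V]
    [Module k V] (z : V) : ε • z = δ • z := by
  have h1 := congrArg (fun f : Lin k true => f t) h
  have aux : ∀ (ε : ℤˣ) (z : V), ε • z = (ε • (ι t : Lin k true)) t • z := by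
    intro ε z
    rcases Int.units_eq_one_or ε with rfl | rfl <;> simp [ι, Units.neg_smul]
  rw [aux, h1, ← aux]


/-! ### Freeness of the presented operad -/

section Freeness

variable {k : Type u} [Field k]

theorem d_one (Q : DGOperad.{u, v} k) : Q.d 1 Q.one = 0 := by
  have h := Q.d_circ (n := 1) rfl 0 Q.one Q.one Q.one_mem
  rw [Q.circ_one, Q.circ_one, Int.negOnePow_zero, one_smul, Q.one_circ] at h
  exact left_eq_add.1 h

theorem perm_zero {Q : GradedOperad.{u, v} k} (σ : Equiv.Perm (Fin 0)) (x : Q.X 0) :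
    Q.perm 0 σ x = x := by
  rw [Subsingleton.elim σ 1, map_one]
  rfl

namespace BurkeOperad

/-- The inputs of the operations, as trees. -/
def letters (n : ℕ) (j : Fin n) : Pl true := .leaf (j.val + 1)

theorem letters_ne {n : ℕ} (j : Fin n) : letters n j ≠ .leaf 0 := by simp [letters]

variable (k) in
/-- Evaluation of an operation on distinct generators of the algebra of trees. -/
noncomputable def toTrees (n : ℕ) : (BurkeOperad k).X n →ₗ[k] Pl.Lin k true where
  toFun x := (Pl.treeAlgebra k).act n x fun j => Pl.ι (letters n j)
  map_add' x y := by rw [map_add]; rfl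
  map_smul' c x := by rw [map_smul]; rfl

theorem toTrees_tm {n : ℕ} (x : Tm n) :
    ∃ ε : ℤˣ, toTrees k n (tm k x) = ε • (Pl.ι (x.tree (letters n)) : Pl.Lin k true) :=
  Pl.act_tm x letters_ne

/-- The tree of a monomial is the tree of a normal form with permuted leaves. -/
theorem exists_planar_tree {n : ℕ} (x : Tm n) :
    ∃ (ε : ℤˣ) (σ : Equiv.Perm (Fin n)) (c : List (Option ℕ)) (z : Tm n),
      Tm.Planar c z ∧ Tm.SignEq.{u, u} k ε x (.perm σ z) ∧
        x.tree (letters n) = z.tree fun j => .leaf ((σ j).val + 1) := by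
  obtain ⟨ε, σ, c, z, hz, hs⟩ := x.exists_planar (k := k)
  refine ⟨ε, σ, c, z, hz, hs, ?_⟩
  obtain ⟨δ, hδ⟩ := toTrees_tm (k := k) x
  obtain ⟨δ', hδ'⟩ := toTrees_tm (k := k) (.perm σ z)
  have := congrArg (toTrees k n) (hs _ _ mul_mem)
  rw [Mon.map_sign, hδ, hδ', smul_smul] at this
  exact Pl.sign_ι_injective this

/-- Monomials with the same tree agree, up to sign, in every operad. -/
theorem signEq_of_tree {n : ℕ} {x y : Tm n} (h : x.tree (letters n) = y.tree (letters n)) :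
    ∃ ε, Tm.SignEq.{u, u} k ε x y := by
  obtain ⟨ε, σ, c, z, hz, hs, ht⟩ := exists_planar_tree (k := k) x
  obtain ⟨ε', σ', c', z', hz', hs', ht'⟩ := exists_planar_tree (k := k) y
  obtain ⟨rfl, hσ⟩ := hz.tree_injective hz' (ht.symm.trans (h.trans ht'))
  have : σ = σ' := Equiv.ext fun j => Fin.ext (by simpa using congrFun hσ j)
  subst this
  exact ⟨_, hs.trans hs'.symm⟩

/-- The values of monomials in any operad factor through their values on trees. -/
theorem exists_fromTrees (Q : GradedOperad.{u, u} k) {q : ∀ n, Q.X (n + 2)}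
    (hq : ∀ n, q n ∈ Q.gr (n + 2) (-(n : ℤ))) (n : ℕ) :
    ∃ R : Pl.Lin k true →ₗ[k] Q.X n, ∀ x : Tm n, R (toTrees k n (tm k x)) = x.eval Q q := by
  classical
  choose ε hε using fun x : Tm n => toTrees_tm (k := k) x
  let r : Pl true → Q.X n := fun t =>
    if h : ∃ x : Tm n, x.tree (letters n) = t then ε h.choose • h.choose.eval Q q else 0
  refine ⟨Finsupp.linearCombination k r, fun x => ?_⟩
  have hx : ∃ y : Tm n, y.tree (letters n) = x.tree (letters n) := ⟨x, rfl⟩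
  have h1 : Finsupp.linearCombination k r (Pl.ι (x.tree (letters n))) =
      ε hx.choose • hx.choose.eval Q q := by
    rw [Pl.ι, Finsupp.linearCombination_single, one_smul]
    exact dif_pos hx
  rw [hε, Mon.map_sign, h1]
  have hy := hx.choose_spec
  set y := hx.choose
  -- the sign `δ` is found in the presented operad itself and is the same in `Q`
  obtain ⟨δ, hδ⟩ := signEq_of_tree (k := k) hy.symm
  have h2 := congrArg (toTrees k n) (hδ _ _ mul_mem)
  rw [Mon.map_sign, hε x, hε y, hy, smul_smul] at h2
  rw [Pl.sign_smul_eq h2, smul_smul, mul_assoc, Int.units_mul_self, mul_one]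
  exact (hδ Q q hq).symm

/-- The unit, and the monomials of positive arity all of whose generators are in `G`. -/
inductive IsMonomial (G : Set ℕ) : ∀ {n : ℕ}, (BurkeOperad k).X n → Prop
  | unit : IsMonomial G (unit k)
  | tm {n : ℕ} (x : Tm n) (hx : x.GensIn G) : IsMonomial G (tm k x)

variable (k) in
/-- The suboperad generated by the unit and the generators in `G`. -/
noncomputable def gen (G : Set ℕ) (n : ℕ) : Submodule k ((BurkeOperad k).X n) :=
  Submodule.span k {x | IsMonomial G x}

variable {G : Set ℕ}

theorem unit_mem_gen : unit k ∈ gen k G 0 := Submodule.subset_span .unit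

theorem tm_mem_gen {n : ℕ} {x : Tm n} (hx : x.GensIn G) : tm k x ∈ gen k G n :=
  Submodule.subset_span (.tm x hx)

theorem gen_induction {n : ℕ} {p : (BurkeOperad k).X n → Prop}
    (zero : p 0) (add : ∀ v w, p v → p w → p (v + w)) (smul : ∀ (c : k) v, p v → p (c • v))
    (unit : ∀ z : (BurkeOperad k).X n, n = 0 → z ≍ BurkeOperad.unit k → p z)
    (tm : ∀ x : Tm n, x.GensIn G → p (tm k x))
    {v : (BurkeOperad k).X n} (hv : v ∈ gen k G n) : p v := by
  induction hv using Submodule.span_induction with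
  | zero => exact zero
  | add v w _ _ hv hw => exact add _ _ hv hw
  | smul c v _ hv => exact smul _ _ hv
  | mem v hv =>
    cases hv with
    | unit => exact unit _ rfl .rfl
    | tm x hx => exact tm x hx

theorem perm_mem_gen {n : ℕ} (σ : Equiv.Perm (Fin n)) {x : (BurkeOperad k).X n}
    (hx : x ∈ gen k G n) : (BurkeOperad k).perm n σ x ∈ gen k G n := by
  refine gen_induction (p := fun x => (BurkeOperad k).perm n σ x ∈ gen k G n)
    ?_ ?_ ?_ ?_ ?_ hx
  · rw [map_zero]
    exact zero_mem _
  · intro v w hv hw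
    rw [map_add]
    exact add_mem hv hw
  · intro c v hv
    rw [map_smul]
    exact Submodule.smul_mem _ c hv
  · rintro z rfl hz
    obtain rfl := eq_of_heq hz
    rw [perm_zero]
    exact unit_mem_gen
  · intro x hx
    exact tm_mem_gen (x := .perm σ x) hx

theorem circ_tm_mem_gen {m n l : ℕ} (h : l + 1 = m + n) (i : Fin m) {x : (BurkeOperad k).X m}
    (hx : x ∈ gen k G m) {y : Tm n} (hy : y.GensIn G) :
    (BurkeOperad k).circ h i x (tm k y) ∈ gen k G l := by
  refine gen_induction (p := fun x => (BurkeOperad k).circ h i x (tm k y) ∈ gen k G l)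
    ?_ ?_ ?_ ?_ ?_ hx
  · rw [map_zero]
    exact zero_mem _
  · intro v w hv hw
    rw [map_add]
    exact add_mem hv hw
  · intro c v hv
    rw [map_smul]
    exact Submodule.smul_mem _ c hv
  · rintro z rfl hz
    obtain rfl := eq_of_heq hz
    exact i.elim0
  · intro x hx
    exact tm_mem_gen (x := .circ h i x y) ⟨hx, hy⟩

theorem tm_circ_mem_gen {m : ℕ} {x : Tm m} (hx : x.GensIn G)
    (hu : ∀ {l : ℕ} (h : l + 1 = m + 0) (i : Fin m),
      (BurkeOperad k).circ h i (tm k x) (unit k) ∈ gen k G l)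
    {n l : ℕ} (h : l + 1 = m + n) (i : Fin m) {y : (BurkeOperad k).X n} (hy : y ∈ gen k G n) :
    (BurkeOperad k).circ h i (tm k x) y ∈ gen k G l := by
  refine gen_induction (p := fun y => (BurkeOperad k).circ h i (tm k x) y ∈ gen k G l)
    ?_ ?_ ?_ ?_ ?_ hy
  · rw [map_zero]
    exact zero_mem _
  · intro v w hv hw
    rw [map_add]
    exact add_mem hv hw
  · intro c v hv
    rw [map_smul]
    exact Submodule.smul_mem _ c hv
  · rintro z rfl hz
    obtain rfl := eq_of_heq hz
    exact hu h i
  · intro y hy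
    exact tm_mem_gen (x := .circ h i x y) ⟨hx, hy⟩

/-- The restriction of a monomial is a multiple of a monomial in the same generators, because the
restrictions of the generators are `id` or zero. -/
theorem tm_circ_unit_mem_gen {m : ℕ} {x : Tm m} (hx : x.GensIn G) {l : ℕ} (h : l + 1 = m + 0)
    (i : Fin m) : (BurkeOperad k).circ h i (tm k x) (unit k) ∈ gen k G l := by
  induction x generalizing l with
  | one =>
    obtain rfl : l = 0 := by omega
    rw [Subsingleton.elim i 0]
    have e : (BurkeOperad k).circ h 0 (tm k .one) (unit k) = unit k := (BurkeOperad k).one_circ h _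
    rw [e]
    exact unit_mem_gen
  | mul n =>
    obtain rfl : l = n + 1 := by omega
    cases n with
    | zero => exact (mul_two_unit (k := k) i).symm ▸ tm_mem_gen (x := .one) trivial
    | succ n => exact (mul_unit (k := k) n i).symm ▸ zero_mem _
  | @perm n σ x ih =>
    have := (BurkeOperad k).circ_perm h (σ.symm i) σ 1 (tm k x) (unit k)
    rw [σ.apply_symm_apply, perm_zero] at this
    exact this ▸ perm_mem_gen _ (ih hx h (σ.symm i))
  | @circ m n l' h' i' x y ihx ihy =>
    rcases slot_cases h' i' i with ⟨j, hj, rfl⟩ | ⟨t, rfl⟩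
    · obtain ⟨p, hp⟩ : ∃ p, p + 1 = m + 0 := ⟨m - 1, by have := x.pos; omega⟩
      have h₄ : l + 1 = p + n := by omega
      have := (BurkeOperad k).circ_par h' h hp h₄ i' j hj (tm k x) (tm k y) (unit k) (tm_mem y)
        unit_mem
      exact this ▸ Mon.sign_smul_mem _ _ (circ_tm_mem_gen _ _ (ihx hx.1 hp j) hx.2)
    · obtain ⟨r, hr⟩ : ∃ r, r + 1 = n + 0 := ⟨n - 1, by have := y.pos; omega⟩
      have h₄ : l + 1 = m + r := by omega
      have := (BurkeOperad k).circ_seq h' h hr h₄ i' t (tm k x) (tm k y) (unit k)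
      exact this ▸ tm_circ_mem_gen hx.1 (ihx hx.1) h₄ i' (ihy hx.2 hr t)

theorem circ_mem_gen {m n l : ℕ} (h : l + 1 = m + n) (i : Fin m) {x : (BurkeOperad k).X m}
    (hx : x ∈ gen k G m) {y : (BurkeOperad k).X n} (hy : y ∈ gen k G n) :
    (BurkeOperad k).circ h i x y ∈ gen k G l := by
  refine gen_induction (p := fun x => (BurkeOperad k).circ h i x y ∈ gen k G l)
    ?_ ?_ ?_ ?_ ?_ hx
  · rw [map_zero]
    exact zero_mem _
  · intro v w hv hw
    rw [map_add]
    exact add_mem hv hw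
  · intro c v hv
    rw [map_smul]
    exact Submodule.smul_mem _ c hv
  · rintro z rfl hz
    obtain rfl := eq_of_heq hz
    exact i.elim0
  · intro x hx
    exact tm_circ_mem_gen hx (tm_circ_unit_mem_gen hx) h i hy

/-- The boundary of a generator involves only generators of smaller arity. -/
theorem d_mem_gen (hG : IsLowerSet G) {n : ℕ} {x : (BurkeOperad k).X n} (hx : x ∈ gen k G n) :
    (BurkeOperad k).d n x ∈ gen k G n := by
  refine gen_induction (p := fun x => (BurkeOperad k).d n x ∈ gen k G n) ?_ ?_ ?_ ?_ ?_ hx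
  · rw [map_zero]
    exact zero_mem _
  · intro v w hv hw
    rw [map_add]
    exact add_mem hv hw
  · intro c v hv
    rw [map_smul]
    exact Submodule.smul_mem _ c hv
  · rintro z rfl hz
    obtain rfl := eq_of_heq hz
    exact (d_unit (k := k)).symm ▸ zero_mem _
  · intro x hx
    clear * - hx hG
    induction x with
    | one => exact (d_one (BurkeOperad k)).symm ▸ zero_mem _
    | mul n =>
      refine (d_mul (k := k) n).symm ▸ neg_mem (sum_mem fun s _ => sum_mem fun r _ =>
        Mon.sign_smul_mem _ _ (circ_mem_gen _ r
          (tm_mem_gen (x := .mul (n - s.val - 1)) (hG (a := n) ?_ hx))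
          (tm_mem_gen (x := .mul s.val) (hG (a := n) ?_ hx)))) <;> omega
    | perm σ x ih =>
      exact ((BurkeOperad k).d_perm σ (tm k x)).symm ▸ perm_mem_gen σ (ih hx)
    | circ h i x y ihx ihy =>
      exact ((BurkeOperad k).d_circ h i (tm k x) (tm k y) (tm_mem x)).symm ▸
        add_mem (circ_mem_gen h i (ihx hx.1) (tm_mem_gen hx.2))
          (Mon.sign_smul_mem _ _ (circ_mem_gen h i (tm_mem_gen hx.1) (ihy hx.2)))

theorem gen_univ (n : ℕ) : gen k Set.univ n = ⊤ := by
  rw [eq_top_iff]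
  rintro z -
  have huniv : ∀ {n : ℕ} (x : Tm n), x.GensIn Set.univ := by
    intro n x
    induction x with
    | one => trivial
    | mul n => trivial
    | perm σ x ih => exact ih
    | circ h i x y ihx ihy => exact ⟨ihx, ihy⟩
  refine induction (p := fun x => x ∈ gen k Set.univ n) (zero_mem _) (fun _ _ => add_mem)
    (fun c _ => Submodule.smul_mem _ c) (fun x => ?_) z
  clear z
  induction x with
  | unit => exact unit_mem_gen
  | mul n => exact tm_mem_gen (huniv (.mul n))
  | one => exact tm_mem_gen (huniv .one)
  | perm σ x ih => exact perm_cls (k := k) σ x ▸ perm_mem_gen σ ih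
  | circ h i x y ihx ihy => exact circ_cls (k := k) h i x y ▸ circ_mem_gen h i ihx ihy
  | diff x ih => exact d_cls (k := k) x ▸ d_mem_gen isLowerSet_univ ih

/-- Operations of positive arity are determined by their values on distinct generators of the
algebra of trees: monomials with the same tree agree up to sign already as a consequence of the
axioms of an operad. -/
theorem toTrees_injective {n : ℕ} (hn : 0 < n) : Function.Injective (toTrees k n) := by
  obtain ⟨R, hR⟩ := exists_fromTrees (BurkeOperad k).toGradedOperad (mul_mem (k := k)) n
  refine Function.LeftInverse.injective (g := R) fun x => ?_
  have hx : x ∈ gen k Set.univ n := gen_univ (k := k) n ▸ Submodule.mem_top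
  refine gen_induction (p := fun x => R (toTrees k n x) = x) ?_ ?_ ?_ ?_ ?_ hx
  · simp
  · intro v w hv hw
    rw [map_add, map_add, hv, hw]
  · intro c v hv
    rw [map_smul, map_smul, hv]
  · rintro z rfl hz
    obtain rfl := eq_of_heq hz
    exact absurd hn (lt_irrefl 0)
  · intro x _
    exact hR x

variable (k) in
/-- The dg suboperad generated by the unit and the generators in a lower set `G`. -/
noncomputable def sub (G : Set ℕ) (hG : IsLowerSet G) : DGSuboperad (BurkeOperad k) where
  carrier := gen k G
  graded n := by
    refine Submodule.span_le.2 fun x hx => ?_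
    cases hx with
    | unit => exact Submodule.mem_iSup_of_mem 0 ⟨unit_mem_gen, unit_mem⟩
    | tm x hx => exact Submodule.mem_iSup_of_mem x.deg ⟨tm_mem_gen hx, tm_mem x⟩
  one_mem := tm_mem_gen (x := .one) trivial
  perm_mem σ _ hx := perm_mem_gen σ hx
  circ_mem h i _ _ hx hy := circ_mem_gen h i hx hy
  d_mem hx := d_mem_gen hG hx

end BurkeOperad

end Freeness


/-! ### Morphisms out of the presented operad -/

section Lift

variable {k : Type u} [Field k]

theorem Tm.eval_congr {Q : GradedOperad.{u, v} k} {q q' : ∀ n, Q.X (n + 2)} {G : Set ℕ}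
    (h : ∀ n ∈ G, q n = q' n) {n : ℕ} {x : Tm n} (hx : x.GensIn G) :
    x.eval Q q = x.eval Q q' := by
  induction x with
  | one => rfl
  | mul n => exact h n hx
  | perm σ x ih => rw [eval, eval, ih hx]
  | circ i h x y ihx ihy => rw [eval, eval, ihx hx.1, ihy hx.2]

theorem DGOperad.Hom.app_eval {P Q : DGOperad.{u, v} k} (φ : DGOperad.Hom P Q)
    (q : ∀ n, P.X (n + 2)) {n : ℕ} (x : Tm n) : φ.app n (x.eval P.toGradedOperad q) =
      x.eval Q.toGradedOperad fun n => φ.app (n + 2) (q n) := by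
  induction x with
  | one => exact φ.app_one
  | mul n => rfl
  | perm σ x ih => rw [Tm.eval, Tm.eval, φ.app_perm, ih]
  | circ i h x y ihx ihy => rw [Tm.eval, Tm.eval, φ.app_circ, ihx, ihy]

namespace BurkeOperad

/-- The linear extension of the evaluation of monomials in a graded operad with a chosen operation
`e` of arity `0` and chosen operations `q n` of arity `n + 2`.  It is compatible with all
compositions in positive arities. -/
structure Lift (Q : GradedOperad.{u, u} k) (e : Q.X 0) (q : ∀ n, Q.X (n + 2)) where
  app : ∀ n, (BurkeOperad k).X n →ₗ[k] Q.X n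
  app_unit : app 0 (unit k) = e
  app_tm : ∀ {n : ℕ} (x : Tm n), app n (tm k x) = x.eval Q q

theorem exists_lift (Q : GradedOperad.{u, u} k) (e : Q.X 0) {q : ∀ n, Q.X (n + 2)}
    (hq : ∀ n, q n ∈ Q.gr (n + 2) (-(n : ℤ))) : Nonempty (Lift Q e q) := by
  choose R hR using exists_fromTrees Q hq
  refine ⟨⟨fun n => match n with
    | 0 => (LinearMap.toSpanSingleton k _ e) ∘ₗ Finsupp.lapply (Pl.leaf 0) ∘ₗ toTrees k 0
    | n + 1 => R (n + 1) ∘ₗ toTrees k (n + 1), ?_, ?_⟩⟩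
  · have : toTrees k 0 (unit k) = Pl.treeUnit k :=
      congrArg (fun f : Op k (Pl.Lin k true) 0 => f fun j => Pl.ι (letters 0 j)) Pl.treeAlgebra_unit
    have h2 : (Pl.treeUnit k) (Pl.leaf 0) = 1 := Finsupp.single_eq_same
    change (toTrees k 0 (unit k)) (Pl.leaf 0) • e = e
    rw [this, h2, one_smul]
  · intro n x
    match n with
    | 0 => exact absurd x.pos (lt_irrefl 0)
    | n + 1 => exact hR _ x

/-- The operation `e` is a strict unit for the operations `q n` with `n ∈ G`. -/
structure IsUnitFor (Q : GradedOperad.{u, v} k) (e : Q.X 0) (q : ∀ n, Q.X (n + 2))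
    (G : Set ℕ) : Prop where
  two : 0 ∈ G → ∀ i : Fin 2, Q.circ (n := 0) (l := 1) rfl i (q 0) e = Q.one
  add_three : ∀ n, n + 1 ∈ G → ∀ i : Fin (n + 1 + 2),
    Q.circ (n := 0) (l := n + 2) rfl i (q (n + 1)) e = 0

namespace Lift

variable {Q : GradedOperad.{u, u} k} {e : Q.X 0} {q : ∀ n, Q.X (n + 2)} (L : Lift Q e q)

include L in
theorem induction {G : Set ℕ} {n : ℕ} {p : (BurkeOperad k).X n → Q.X n → Prop} (zero : p 0 0)
    (add : ∀ v w, p v (L.app n v) → p w (L.app n w) → p (v + w) (L.app n v + L.app n w))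
    (smul : ∀ (c : k) v, p v (L.app n v) → p (c • v) (c • L.app n v))
    (unit : ∀ (z : (BurkeOperad k).X n) (z' : Q.X n), n = 0 → z ≍ BurkeOperad.unit k → z' ≍ e →
      p z z')
    (tm : ∀ x : Tm n, x.GensIn G → p (tm k x) (x.eval Q q))
    {v : (BurkeOperad k).X n} (hv : v ∈ gen k G n) : p v (L.app n v) := by
  refine gen_induction (p := fun v => p v (L.app n v)) ?_ ?_ ?_ ?_ ?_ hv
  · rw [map_zero]
    exact zero
  · intro v w hv hw
    rw [map_add]
    exact add v w hv hw
  · intro c v hv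
    rw [map_smul]
    exact smul c v hv
  · rintro z rfl hz
    exact unit _ _ rfl hz (by rw [eq_of_heq hz, L.app_unit])
  · intro x hx
    rw [L.app_tm]
    exact tm x hx

theorem mem_gen_univ {n : ℕ} (x : (BurkeOperad k).X n) : x ∈ gen k Set.univ n :=
  gen_univ (k := k) n ▸ Submodule.mem_top

theorem app_one : L.app 1 (BurkeOperad k).one = Q.one := L.app_tm .one

theorem app_perm {n : ℕ} (σ : Equiv.Perm (Fin n)) (x : (BurkeOperad k).X n) :
    L.app n ((BurkeOperad k).perm n σ x) = Q.perm n σ (L.app n x) := by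
  refine L.induction (p := fun x y => L.app n ((BurkeOperad k).perm n σ x) = Q.perm n σ y)
    ?_ ?_ ?_ ?_ ?_ (mem_gen_univ x)
  · simp
  · intro v w hv hw
    rw [map_add, map_add, map_add, hv, hw]
  · intro c v hv
    rw [map_smul, map_smul, map_smul, hv]
  · rintro z z' rfl hz hz'
    rw [eq_of_heq hz, eq_of_heq hz', perm_zero, perm_zero, L.app_unit]
  · intro x _
    exact L.app_tm (.perm σ x)

theorem app_mem (he : e ∈ Q.gr 0 0) (hq : ∀ n, q n ∈ Q.gr (n + 2) (-(n : ℤ))) {n : ℕ} {a : ℤ}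
    {x : (BurkeOperad k).X n} (hx : x ∈ (BurkeOperad k).gr n a) : L.app n x ∈ Q.gr n a := by
  have key : ∀ x : (BurkeOperad k).X n,
      L.app n (homComp ((BurkeOperad k).internal n) a x) ∈ Q.gr n a := by
    intro x
    have hom : ∀ {b : ℤ} {z : (BurkeOperad k).X n}, z ∈ (BurkeOperad k).gr n b →
        L.app n z ∈ Q.gr n b → L.app n (homComp ((BurkeOperad k).internal n) a z) ∈ Q.gr n a := by
      intro b z hz hz'
      by_cases hab : b = a
      · subst hab
        rwa [homComp_of_mem _ hz]
      · rw [homComp_of_mem_ne _ hz hab, map_zero]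
        exact zero_mem _
    refine gen_induction (p := fun x => L.app n (homComp ((BurkeOperad k).internal n) a x) ∈
      Q.gr n a) ?_ ?_ ?_ ?_ ?_ (mem_gen_univ x)
    · simp
    · intro v w hv hw
      rw [map_add, map_add]
      exact add_mem hv hw
    · intro c v hv
      rw [map_smul, map_smul]
      exact Submodule.smul_mem _ c hv
    · rintro z rfl hz
      obtain rfl := eq_of_heq hz
      exact hom unit_mem (by rw [L.app_unit]; exact he)
    · intro x _
      exact hom (tm_mem x) (by rw [L.app_tm]; exact x.eval_mem hq)
  have := key x
  rwa [homComp_of_mem _ hx] at this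

/-- A lift is compatible with compositions, provided `e` is a strict unit for the generators that
occur in the outer operation. -/
theorem app_circ_tm {m n l : ℕ} (h : l + 1 = m + n) (i : Fin m) (x : (BurkeOperad k).X m)
    (y : Tm n) : L.app l ((BurkeOperad k).circ h i x (tm k y)) =
      Q.circ h i (L.app m x) (y.eval Q q) := by
  refine L.induction (p := fun x z => L.app l ((BurkeOperad k).circ h i x (tm k y)) =
    Q.circ h i z (y.eval Q q)) ?_ ?_ ?_ ?_ ?_ (mem_gen_univ x)
  · simp
  · intro v w hv hw
    simp only [map_add, LinearMap.add_apply, hv, hw]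
  · intro c v hv
    simp only [map_smul, LinearMap.smul_apply, hv]
  · rintro z z' rfl hz hz'
    exact i.elim0
  · intro x _
    exact L.app_tm (.circ h i x y)

theorem app_tm_circ {m : ℕ} {x : Tm m} (hu : ∀ {l : ℕ} (h : l + 1 = m + 0) (i : Fin m),
      L.app l ((BurkeOperad k).circ h i (tm k x) (unit k)) = Q.circ h i (x.eval Q q) e)
    {n l : ℕ} (h : l + 1 = m + n) (i : Fin m) (y : (BurkeOperad k).X n) :
    L.app l ((BurkeOperad k).circ h i (tm k x) y) = Q.circ h i (x.eval Q q) (L.app n y) := by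
  refine L.induction (p := fun y z => L.app l ((BurkeOperad k).circ h i (tm k x) y) =
    Q.circ h i (x.eval Q q) z) ?_ ?_ ?_ ?_ ?_ (mem_gen_univ y)
  · simp
  · intro v w hv hw
    simp only [map_add, hv, hw]
  · intro c v hv
    simp only [map_smul, hv]
  · rintro z z' rfl hz hz'
    rw [eq_of_heq hz, eq_of_heq hz']
    exact hu h i
  · intro y _
    exact L.app_tm (.circ h i x y)

variable {G : Set ℕ} (he : e ∈ Q.gr 0 0) (hq : ∀ n, q n ∈ Q.gr (n + 2) (-(n : ℤ)))
  (hu : IsUnitFor Q e q G)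

include he hq hu

/-- Compatibility with restrictions, provided `e` is a strict unit for the generators that occur.
-/
theorem app_tm_circ_unit {m : ℕ} {x : Tm m} (hx : x.GensIn G) {l : ℕ} (h : l + 1 = m + 0)
    (i : Fin m) : L.app l ((BurkeOperad k).circ h i (tm k x) (unit k)) =
      Q.circ h i (x.eval Q q) e := by
  induction x generalizing l with
  | one =>
    obtain rfl : l = 0 := by omega
    have e1 : (BurkeOperad k).circ h 0 (tm k .one) (unit k) = unit k := (BurkeOperad k).one_circ h _
    rw [Subsingleton.elim i 0, e1, L.app_unit]
    exact (Q.one_circ h e).symm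
  | mul n =>
    obtain rfl : l = n + 1 := by omega
    cases n with
    | zero =>
      exact (congrArg _ (mul_two_unit (k := k) i)).trans (L.app_one.trans (hu.two hx i).symm)
    | succ n =>
      exact (congrArg _ (mul_unit (k := k) n i)).trans
        ((map_zero _).trans (hu.add_three n hx i).symm)
  | @perm n σ x ih =>
    have h1 := (BurkeOperad k).circ_perm h (σ.symm i) σ 1 (tm k x) (unit k)
    have h2 := Q.circ_perm h (σ.symm i) σ 1 (x.eval Q q) e
    rw [σ.apply_symm_apply, perm_zero] at h1 h2
    exact (congrArg _ h1).trans ((L.app_perm _ _).trans ((congrArg _ (ih hx h _)).trans h2.symm))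
  | @circ m n l' h' i' x y ihx ihy =>
    rcases slot_cases h' i' i with ⟨j, hj, rfl⟩ | ⟨t, rfl⟩
    · obtain ⟨p, hp⟩ : ∃ p, p + 1 = m + 0 := ⟨m - 1, by have := x.pos; omega⟩
      have h₄ : l + 1 = p + n := by omega
      have h1 := (BurkeOperad k).circ_par h' h hp h₄ i' j hj (tm k x) (tm k y) (unit k) (tm_mem y)
        unit_mem
      have h2 := Q.circ_par h' h hp h₄ i' j hj (x.eval Q q) (y.eval Q q) e (y.eval_mem hq) he
      rw [← ihx hx.1 hp j, ← L.app_circ_tm] at h2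
      exact (congrArg _ h1).trans ((Mon.map_sign _ _ _).trans h2.symm)
    · obtain ⟨r, hr⟩ : ∃ r, r + 1 = n + 0 := ⟨n - 1, by have := y.pos; omega⟩
      have h₄ : l + 1 = m + r := by omega
      have h1 := (BurkeOperad k).circ_seq h' h hr h₄ i' t (tm k x) (tm k y) (unit k)
      have h2 := Q.circ_seq h' h hr h₄ i' t (x.eval Q q) (y.eval Q q) e
      rw [← ihy hx.2 hr t, ← L.app_tm_circ (ihx hx.1)] at h2
      exact (congrArg _ h1).trans h2.symm

theorem app_circ {m n l : ℕ} (h : l + 1 = m + n) (i : Fin m) {x : (BurkeOperad k).X m}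
    (hx : x ∈ gen k G m) (y : (BurkeOperad k).X n) :
    L.app l ((BurkeOperad k).circ h i x y) = Q.circ h i (L.app m x) (L.app n y) := by
  refine L.induction (p := fun x z => L.app l ((BurkeOperad k).circ h i x y) =
    Q.circ h i z (L.app n y)) ?_ ?_ ?_ ?_ ?_ hx
  · simp
  · intro v w hv hw
    simp only [map_add, LinearMap.add_apply, hv, hw]
  · intro c v hv
    simp only [map_smul, LinearMap.smul_apply, hv]
  · rintro z z' rfl hz hz'
    exact i.elim0
  · intro x hx
    exact L.app_tm_circ (L.app_tm_circ_unit he hq hu hx) h i y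

end Lift

theorem Lift.app_circ_of_pos {Q : GradedOperad.{u, u} k} {e : Q.X 0} {q : ∀ n, Q.X (n + 2)}
    (L : Lift Q e q) {m n l : ℕ} (hn : 0 < n) (h : l + 1 = m + n) (i : Fin m)
    (y : (BurkeOperad k).X m) (x : (BurkeOperad k).X n) :
    L.app l ((BurkeOperad k).circ h i y x) = Q.circ h i (L.app m y) (L.app n x) := by
  refine L.induction (p := fun x z => L.app l ((BurkeOperad k).circ h i y x) =
    Q.circ h i (L.app m y) z) ?_ ?_ ?_ ?_ ?_ (Lift.mem_gen_univ x)
  · simp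
  · intro v w hv hw
    simp only [map_add, hv, hw]
  · intro c v hv
    simp only [map_smul, hv]
  · rintro z z' rfl hz hz'
    exact absurd hn (lt_irrefl 0)
  · intro x _
    exact L.app_circ_tm h i y x

/-- A lift is compatible with the differential as soon as it is so on generators. -/
theorem Lift.app_d {Q : DGOperad.{u, u} k} {e : Q.X 0} {q : ∀ n, Q.X (n + 2)}
    (L : Lift Q.toGradedOperad e q) (hq : ∀ n, q n ∈ Q.gr (n + 2) (-(n : ℤ))) {G : Set ℕ}
    (he : Q.d 0 e = 0)
    (hd : ∀ n ∈ G, L.app (n + 2) ((BurkeOperad k).d (n + 2) (mul k n)) = Q.d (n + 2) (q n))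
    {n : ℕ} {x : (BurkeOperad k).X n} (hx : x ∈ gen k G n) :
    L.app n ((BurkeOperad k).d n x) = Q.d n (L.app n x) := by
  refine L.induction (p := fun x z => L.app n ((BurkeOperad k).d n x) = Q.d n z)
    ?_ ?_ ?_ ?_ ?_ hx
  · simp
  · intro v w hv hw
    simp only [map_add, hv, hw]
  · intro c v hv
    simp only [map_smul, hv]
  · rintro z z' rfl hz hz'
    rw [eq_of_heq hz, eq_of_heq hz', he]
    exact (congrArg _ d_unit).trans (map_zero _)
  · intro x hx
    clear * - hx hd hq
    induction x with
    | one => exact (congrArg _ (d_one _)).trans ((map_zero _).trans (d_one Q).symm)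
    | mul n => exact hd n hx
    | perm σ x ih =>
      exact (congrArg _ ((BurkeOperad k).d_perm σ (tm k x))).trans ((L.app_perm _ _).trans
        ((congrArg _ (ih hx)).trans (Q.d_perm σ _).symm))
    | circ h i x y ihx ihy =>
      have h1 := (BurkeOperad k).d_circ h i (tm k x) (tm k y) (tm_mem x)
      have h2 := Q.d_circ h i (x.eval Q.toGradedOperad q) (y.eval Q.toGradedOperad q)
        (x.eval_mem hq)
      refine (congrArg _ h1).trans ((map_add _ _ _).trans
        (Eq.trans (congrArg₂ (· + ·) ?_ ?_) h2.symm))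
      · exact (L.app_circ_tm h i _ y).trans (by rw [ihx hx.1])
      · exact (Mon.map_sign _ _ _).trans (congrArg _ ((L.app_circ_of_pos y.pos h i _ _).trans
          (by rw [L.app_tm, ihy hx.2])))

/-- Morphisms of dg operads out of the presented operad. -/
def Lift.hom {Q : DGOperad.{u, u} k} {e : Q.X 0} {q : ∀ n, Q.X (n + 2)}
    (L : Lift Q.toGradedOperad e q) (he : e ∈ Q.gr 0 0)
    (hq : ∀ n, q n ∈ Q.gr (n + 2) (-(n : ℤ))) (hu : IsUnitFor Q.toGradedOperad e q Set.univ)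
    (he' : Q.d 0 e = 0)
    (hd : ∀ n, L.app (n + 2) ((BurkeOperad k).d (n + 2) (mul k n)) = Q.d (n + 2) (q n)) :
    DGOperad.Hom (BurkeOperad k) Q where
  app := L.app
  app_mem := L.app_mem he hq
  app_one := L.app_one
  app_perm := L.app_perm
  app_circ h i x y := L.app_circ he hq hu h i (mem_gen_univ x) y
  app_d x := L.app_d hq (G := Set.univ) he' (fun n _ => hd n) (mem_gen_univ x)

/-- A morphism of dg operads is the lift of its values. -/
def lift {Q : DGOperad.{u, u} k} (φ : DGOperad.Hom (BurkeOperad k) Q) :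
    Lift Q.toGradedOperad (φ.app 0 (unit k)) fun n => φ.app (n + 2) (mul k n) where
  app := φ.app
  app_unit := rfl
  app_tm x := φ.app_eval _ x

/-- A lift is determined by its values on the generators that occur. -/
theorem Lift.app_eq {Q : GradedOperad.{u, u} k} {e e' : Q.X 0} {q q' : ∀ n, Q.X (n + 2)}
    (L : Lift Q e q) (L' : Lift Q e' q') {G : Set ℕ} (he : e = e') (hq : ∀ n ∈ G, q n = q' n)
    {n : ℕ} {x : (BurkeOperad k).X n} (hx : x ∈ gen k G n) : L.app n x = L'.app n x := by
  refine L.induction (p := fun x z => z = L'.app n x) ?_ ?_ ?_ ?_ ?_ hx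
  · simp
  · intro v w hv hw
    rw [map_add, hv, hw]
  · intro c v hv
    rw [map_smul, hv]
  · rintro z z' rfl hz hz'
    rw [eq_of_heq hz, eq_of_heq hz', L'.app_unit, he]
  · intro x hx
    rw [L'.app_tm, Tm.eval_congr hq hx]

end BurkeOperad

/-! ### The morphism to the unitary associative operad -/

variable (k) in
/-- The images of the generators in `Ass₊`. -/
noncomputable def AssPlus.gens : ∀ n, (AssPlus k).X (n + 2)
  | 0 => AssPlus.mul k
  | _ + 1 => 0

theorem AssPlus.eq_zero {n : ℕ} {a : ℤ} (ha : a ≠ 0) {x : (AssPlus k).X n}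
    (hx : x ∈ (AssPlus k).gr n a) : x = 0 := eq_zero_of_mem_trivialGrading hx ha

theorem AssPlus.mem_gr_zero {n : ℕ} (x : (AssPlus k).X n) : x ∈ (AssPlus k).gr n 0 :=
  trivialGrading_zero k x

theorem AssPlus.gens_mem (n : ℕ) : AssPlus.gens k n ∈ (AssPlus k).gr (n + 2) (-(n : ℤ)) := by
  cases n with
  | zero => exact trivialGrading_zero k _
  | succ n => exact zero_mem _

theorem AssPlus.circ_single {m n l : ℕ} (h : l + 1 = m + n) (i : Fin m) (x : Word m) (y : Word n) :
    (AssPlus k).circ h i (Finsupp.single x 1) (Finsupp.single y 1) =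
      Finsupp.single (Word.circ h i x y) 1 :=
  (linearize₂_single _ _ _ _ _).trans (by rw [mul_one])

theorem AssPlus.isUnitFor : BurkeOperad.IsUnitFor (AssPlus k).toGradedOperad (AssPlus.unit k)
    (AssPlus.gens k) Set.univ where
  two _ i := by
    refine (AssPlus.circ_single _ i Word.two Word.empty).trans (congrArg (Finsupp.single · 1) ?_)
    apply Subtype.ext
    fin_cases i <;> rfl
  add_three n _ i := by
    change (AssPlus k).circ _ i 0 _ = 0
    rw [map_zero]
    rfl

theorem AssPlus.mul_assoc :
    (AssPlus k).circ (m := 2) (n := 2) (l := 3) rfl 0 (AssPlus.mul k) (AssPlus.mul k) =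
    (AssPlus k).circ (m := 2) (n := 2) (l := 3) rfl 1 (AssPlus.mul k) (AssPlus.mul k) := by
  refine (AssPlus.circ_single _ _ _ _).trans
    (Eq.trans (congrArg (Finsupp.single · 1) ?_) (AssPlus.circ_single _ _ _ _).symm)
  apply Subtype.ext
  rfl

/-- The morphism from the presented operad to `Ass₊`; it is compatible with the differential because
`Ass₊` is associative and concentrated in degree zero. -/
theorem exists_augmentation (k : Type u) [Field k] :
    ∃ β : DGOperad.Hom (BurkeOperad k) (AssPlus k),
      β.app 0 (BurkeOperad.unit k) = AssPlus.unit k ∧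
      ∀ n, β.app (n + 2) (BurkeOperad.mul k n) = AssPlus.gens k n := by
  obtain ⟨L⟩ := BurkeOperad.exists_lift (AssPlus k).toGradedOperad (AssPlus.unit k)
    AssPlus.gens_mem
  refine ⟨L.hom (AssPlus.mem_gr_zero _) AssPlus.gens_mem AssPlus.isUnitFor rfl fun n => ?_,
    L.app_unit, fun n => L.app_tm (.mul n)⟩
  have hmem := L.app_mem (AssPlus.mem_gr_zero _) AssPlus.gens_mem
    ((BurkeOperad k).d_mem (BurkeOperad.mul_mem (k := k) n))
  by_cases hn : n = 1
  · -- in this arity the relation is associativity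
    subst hn
    have key : ∀ c₀ c₁ : ℤ, c₀.negOnePow = 1 → c₁.negOnePow = -1 → L.app 3 (-(c₀.negOnePow •
        BurkeOperad.tm k (.circ (m := 2) (n := 2) (l := 3) rfl 0 (.mul 0) (.mul 0)) +
        c₁.negOnePow •
          BurkeOperad.tm k (.circ (m := 2) (n := 2) (l := 3) rfl 1 (.mul 0) (.mul 0)))) = 0 := by
      intro c₀ c₁ h₀ h₁
      rw [h₀, h₁, map_neg, map_add, Mon.map_sign, Mon.map_sign, L.app_tm, L.app_tm, one_smul,
        Units.neg_smul, one_smul, neg_eq_zero, ← sub_eq_add_neg, sub_eq_zero]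
      exact AssPlus.mul_assoc
    refine (congrArg (L.app 3) ((BurkeOperad.d_mul (k := k) 1).trans (congrArg Neg.neg
      ((Fin.sum_univ_one _).trans (Fin.sum_univ_two _))))).trans (key _ _ ?_ ?_)
    · simp [Int.negOnePow_even 2 even_two]
    · simp
  · exact (AssPlus.eq_zero (by omega) hmem).trans rfl

end Lift


/-! ### Contracting the complex of trees onto right combs -/

namespace Pl

variable {k : Type u} [Field k]

/-- Removal of the first leaf of a tree, where this leaf is one of two children of its vertex; all
other trees are sent to zero. -/
noncomputable def delta (k : Type u) [Field k] : ∀ {b : Bool}, Pl b → Lin k true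
  | _, leaf _ => 0
  | _, node (leaf _) (one t) => ι t
  | _, node (leaf _) (cons _ _) => 0
  | _, node (node t g) f => nodeL (delta k (node t g)) (ι f)
  | _, one _ => 0
  | _, cons _ _ => 0

/-- A homotopy between the identity and the operator that removes the first leaf and attaches
it again at the root.  The parameter `x` is the label of the first leaf. -/
noncomputable def homotopy (k : Type u) [Field k] (x : ℕ) : ∀ {b : Bool}, Pl b → Lin k true
  | _, leaf _ => 0
  | _, node (leaf _) _ => 0
  | _, node (node t g) f => -(nodeL (homotopy k x (node t g)) (ι f) +
      nodeL (ι (leaf x)) (consL (delta k (node t g)) (ι f)))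
  | _, one _ => 0
  | _, cons _ _ => 0

/-- The linear extension of `delta`. -/
noncomputable def deltaL : Lin k true →ₗ[k] Lin k true := Finsupp.linearCombination k (delta k)

/-- The linear extension of `homotopy`. -/
noncomputable def homotopyL (x : ℕ) : Lin k true →ₗ[k] Lin k true :=
  Finsupp.linearCombination k (homotopy k x)

theorem deltaL_ι (t : Pl true) : deltaL (ι t : Lin k true) = delta k t := by simp [deltaL, ι]

theorem homotopyL_ι (x : ℕ) (t : Pl true) : homotopyL x (ι t : Lin k true) = homotopy k x t := by
  simp [homotopyL, ι]

/-- Linear combinations of trees with a vertex at the root. -/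
noncomputable def nodes (k : Type u) [Field k] : Submodule k (Lin k true) :=
  Submodule.span k {u | ∃ t f, u = ι (node t f)}

theorem ι_mem_nodes (t : Pl true) (f : Pl false) : (ι (node t f) : Lin k true) ∈ nodes k :=
  Submodule.subset_span ⟨t, f, rfl⟩

theorem nodeL_mem_nodes (u : Lin k true) (f : Lin k false) : nodeL u f ∈ nodes k := by
  induction u using lin_induction with
  | zero => simp
  | add x y hx hy => rw [map_add, LinearMap.add_apply]; exact add_mem hx hy
  | smul c x hx => rw [map_smul, LinearMap.smul_apply]; exact Submodule.smul_mem _ _ hx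
  | basis t =>
  induction f using lin_induction with
  | zero => simp
  | add x y hx hy => rw [map_add]; exact add_mem hx hy
  | smul c x hx => rw [map_smul]; exact Submodule.smul_mem _ _ hx
  | basis f => exact (nodeL_ι (k := k) t f).symm ▸ ι_mem_nodes t f

theorem splits_mem' {b : Bool} (S : Submodule k (Lin k b)) (f : Pl false)
    {G : Pl false → Pl false → Lin k b} (hG : ∀ a b, G a b ∈ S) : splits f G ∈ S := by
  induction f using forest_induction generalizing G with
  | one t => exact zero_mem _
  | cons t f ih => exact add_mem (hG _ _) (ih fun a b => hG _ _)

theorem D_mem_nodes (t : Pl true) (f : Pl false) : D k (node t f) ∈ nodes k :=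
  neg_mem (add_mem (add_mem (nodeL_mem_nodes _ _) (splits_mem' _ _ fun _ _ => ι_mem_nodes _ _))
    (Mon.sign_smul_mem _ _ (nodeL_mem_nodes _ _)))

theorem deltaL_nodeL {u : Lin k true} (hu : u ∈ nodes k) (f : Lin k false) :
    deltaL (nodeL u f) = nodeL (deltaL u) f := by
  induction hu using Submodule.span_induction with
  | zero => simp
  | add x y _ _ hx hy => simp only [map_add, LinearMap.add_apply, hx, hy]
  | smul c x _ hx => simp only [map_smul, LinearMap.smul_apply, hx]
  | mem u hu =>
  obtain ⟨t, g, rfl⟩ := hu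
  induction f using lin_induction with
  | zero => simp
  | add x y hx hy => simp only [map_add, hx, hy]
  | smul c x hx => simp only [map_smul, hx]
  | basis f => rw [nodeL_ι, deltaL_ι, deltaL_ι, delta]

theorem homotopyL_nodeL (x : ℕ) {u : Lin k true} (hu : u ∈ nodes k) (f : Lin k false) :
    homotopyL x (nodeL u f) = -(nodeL (homotopyL x u) f +
      nodeL (ι (leaf x)) (consL (deltaL u) f)) := by
  induction hu using Submodule.span_induction with
  | zero => simp
  | add x y _ _ hx hy => simp only [map_add, LinearMap.add_apply, hx, hy]; abel
  | smul c x _ hx => simp only [map_smul, LinearMap.smul_apply, hx, smul_neg, smul_add]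
  | mem u hu =>
  obtain ⟨t, g, rfl⟩ := hu
  induction f using lin_induction with
  | zero => simp
  | add x y hx hy => simp only [map_add, hx, hy]; abel
  | smul c x hx => simp only [map_smul, hx, smul_neg, smul_add]
  | basis f => rw [nodeL_ι, homotopyL_ι, homotopyL_ι, deltaL_ι, homotopy]

theorem deltaL_leaf_oneL (x : ℕ) (u : Lin k true) :
    deltaL (nodeL (ι (leaf x)) (oneL u)) = u := by
  induction u using lin_induction with
  | zero => simp
  | add x y hx hy => simp only [map_add, hx, hy]
  | smul c x hx => simp only [map_smul, hx]
  | basis t => rw [oneL_ι, nodeL_ι, deltaL_ι, delta]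

theorem deltaL_leaf_consL (x : ℕ) (u : Lin k true) (f : Lin k false) :
    deltaL (nodeL (ι (leaf x)) (consL u f)) = 0 := by
  induction u using lin_induction with
  | zero => simp
  | add x y hx hy => simp only [map_add, LinearMap.add_apply, hx, hy, add_zero]
  | smul c x hx => simp only [map_smul, LinearMap.smul_apply, hx, smul_zero]
  | basis t =>
  induction f using lin_induction with
  | zero => simp
  | add x y hx hy => simp only [map_add, hx, hy, add_zero]
  | smul c x hx => simp only [map_smul, hx, smul_zero]
  | basis f => rw [consL_ι, nodeL_ι, deltaL_ι, delta]

theorem homotopyL_leaf (x y : ℕ) (f : Lin k false) : homotopyL x (nodeL (ι (leaf y)) f) = 0 := by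
  induction f using lin_induction with
  | zero => simp
  | add x y hx hy => simp only [map_add, hx, hy, add_zero]
  | smul c x hx => simp only [map_smul, hx, smul_zero]
  | basis f => rw [nodeL_ι, homotopyL_ι, homotopy]

theorem delta_mem_gr (t : Pl true) : delta k t ∈ gr k true (sdeg t) := by
  match t with
  | leaf _ => exact zero_mem _
  | node (leaf _) (one t) => exact ι_mem (by simp [sdeg])
  | node (leaf _) (cons _ _) => exact zero_mem _
  | node (node t g) f => exact nodeL_mem (delta_mem_gr (node t g)) (ι_mem rfl)

theorem homotopy_mem_gr (x : ℕ) (t : Pl true) : homotopy k x t ∈ gr k true (sdeg t - 1) := by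
  match t with
  | leaf _ => exact zero_mem _
  | node (leaf _) f => exact zero_mem _
  | node (node t g) f =>
    rw [homotopy]
    refine neg_mem (add_mem ?_ ?_)
    · have := nodeL_mem (homotopy_mem_gr x (node t g)) (ι_mem (k := k) (x := f) rfl)
      rwa [show sdeg (node (node t g) f) - 1 = sdeg (node t g) - 1 + sdeg f + 1 by
        simp only [sdeg]; ring]
    · have := nodeL_mem (ι_mem (k := k) (x := leaf x) rfl)
        (consL_mem (delta_mem_gr (k := k) (node t g)) (ι_mem (k := k) (x := f) rfl))
      rwa [show sdeg (node (node t g) f) - 1 = sdeg (leaf x) + (sdeg (node t g) + sdeg f) + 1 by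
        simp only [sdeg]; ring]

theorem sign_sdeg_leaf (x : ℕ) : (sdeg (leaf x)).negOnePow = -1 := by
  rw [sdeg, Int.negOnePow_neg, Int.negOnePow_one]

/-- `delta` is compatible with the differential on trees that are not leaves. -/
theorem deltaL_D (t : Pl true) (f : Pl false) :
    deltaL (D k (node t f)) = DL (delta k (node t f)) := by
  match t, f with
  | leaf x, one t =>
    rw [D_node, splits_one, D_one, sign_sdeg_leaf, delta, DL_ι, Units.neg_smul, one_smul, map_neg,
      map_add, map_neg, deltaL_leaf_oneL]
    simp [D]
  | leaf x, cons t f =>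
    have h1 : deltaL (splits (cons t f) fun a b => (ι (node (node (leaf x) a) b) : Lin k true)) =
        ι (node t f) := by
      rw [map_splits, splits_cons]
      have : ∀ a b, deltaL (ι (node (node (leaf x) (cons t a)) b) : Lin k true) = 0 := by
        intro a b
        rw [deltaL_ι, delta, delta]
        simp
      rw [splits_congr fun a b => this a b, splits_zero, add_zero, deltaL_ι, delta, delta, nodeL_ι]
    have h2 : deltaL (nodeL (ι (leaf x)) (D k (cons t f))) = ι (node t f) := by
      have h3 : ∀ a b, deltaL (nodeL (ι (leaf x)) (ι (cons (node t a) b)) : Lin k true) = 0 := by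
        intro a b
        rw [nodeL_ι, deltaL_ι, delta]
      rw [D_cons, map_add, map_add, map_add, map_add, map_add, map_add, deltaL_leaf_consL,
        Mon.map_sign, Mon.map_sign, deltaL_leaf_consL, map_splits, map_splits,
        splits_congr fun a b => h3 a b, splits_zero, nodeL_ι, deltaL_ι, delta, smul_zero]
      abel
    rw [D_node, map_neg, map_add, map_add, Mon.map_sign, h1, h2, sign_sdeg_leaf, Units.neg_smul,
      one_smul, delta, map_zero]
    simp [D]
  | node t g, f =>
    have h1 : ∀ a b, deltaL (ι (node (node (node t g) a) b) : Lin k true) =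
        nodeL (nodeL (delta k (node t g)) (ι a)) (ι b) := by
      intro a b
      rw [deltaL_ι, delta, delta]
    rw [D_node (node t g) f, map_neg, map_add, map_add, Mon.map_sign,
      deltaL_nodeL (D_mem_nodes t g), deltaL_nodeL (ι_mem_nodes t g), deltaL_D t g, map_splits,
      splits_congr fun a b => h1 a b, deltaL_ι, delta, DL_nodeL_left (delta_mem_gr (node t g))]

/-- The label of the first leaf. -/
def head : ∀ {b : Bool}, Pl b → ℕ
  | _, leaf a => a
  | _, node t _ => head t
  | _, one t => head t
  | _, cons t _ => head t

/-- The homotopy formula, by induction along the path from the root to the first leaf. -/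
theorem homotopy_spec (x : ℕ) (t : Pl true) (f : Pl false) (hx : head t = x) :
    DL (homotopy k x (node t f)) + homotopyL x (D k (node t f)) =
      ι (node t f) - nodeL (ι (leaf x)) (oneL (delta k (node t f))) := by
  match t, f with
  | leaf y, one t =>
    obtain rfl : y = x := hx
    rw [D_node, splits_one, homotopy, delta, map_zero, map_neg, map_add, Mon.map_sign,
      homotopyL_leaf, oneL_ι, nodeL_ι, sub_self]
    simp [D]
  | leaf y, cons t f =>
    obtain rfl : y = x := hx
    have h1 : ∀ a b, homotopyL y (ι (node (node (leaf y) (cons t a)) b) : Lin k true) = 0 := by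
      intro a b
      rw [homotopyL_ι, homotopy, homotopy, delta]
      simp
    rw [D_node, homotopy, delta, map_zero, map_zero, map_zero, map_neg, map_add, map_add,
      Mon.map_sign, homotopyL_leaf, map_splits, splits_cons, splits_congr fun a b => h1 a b,
      splits_zero, homotopyL_ι, homotopy, homotopy, delta, consL_ι, nodeL_ι]
    simp [D]
  | node t g, f =>
    have ih := homotopy_spec x t g hx
    set s := node t g with hs
    have hD : D k s ∈ nodes k := D_mem_nodes t g
    have hι : (ι s : Lin k true) ∈ nodes k := ι_mem_nodes t g
    have h1 : ∀ a b, homotopyL x (ι (node (node s a) b) : Lin k true) =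
        nodeL (nodeL (homotopy k x s) (ι a)) (ι b) +
          nodeL (nodeL (ι (leaf x)) (consL (delta k s) (ι a))) (ι b) -
          nodeL (ι (leaf x)) (consL (nodeL (delta k s) (ι a)) (ι b)) := by
      intro a b
      have e : (ι (node (node s a) b) : Lin k true) = nodeL (nodeL (ι s) (ι a)) (ι b) := by
        rw [nodeL_ι, nodeL_ι]
      rw [e, homotopyL_nodeL x (nodeL_mem_nodes _ _), homotopyL_nodeL x hι, deltaL_nodeL hι,
        deltaL_ι, homotopyL_ι, map_neg, map_add, LinearMap.neg_apply, LinearMap.add_apply]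
      abel
    have h2 : homotopy k x (node s f) = -(nodeL (homotopy k x s) (ι f) +
      nodeL (ι (leaf x)) (consL (delta k s) (ι f))) := rfl
    have h3 : delta k (node s f) = nodeL (delta k s) (ι f) := rfl
    have h4 := DL_nodeL_left (homotopy_mem_gr (k := k) x s) f
    have h5 := DL_nodeL (ι_mem (k := k) (x := leaf x) rfl) (consL (delta k s) (ι f))
    rw [splitsL_consL, splitsL_ι, DL_consL_left (delta_mem_gr s), sign_sdeg_leaf, DL_ι, D,
      map_zero, LinearMap.zero_apply] at h5
    have h6 : homotopyL x (D k s) = ι s - nodeL (ι (leaf x)) (oneL (delta k s)) -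
      DL (homotopy k x s) := by rw [← ih]; abel
    have h7 : (sdeg s - 1).negOnePow = -(sdeg s).negOnePow := by
      rw [Int.negOnePow_sub, Int.negOnePow_one, mul_neg, mul_one]
    rw [h7] at h4
    rw [h2, h3, D_node, map_neg, map_add, map_neg, map_add, map_add, Mon.map_sign,
      homotopyL_nodeL x hD, homotopyL_nodeL x hι, map_splits, splits_congr fun a b => h1 a b,
      h4, h5, h6, deltaL_D t g, ← hs, homotopyL_ι, deltaL_ι]
    have h8 : ∀ G : Pl false → Pl false → Lin k true,
        splits f (fun a b => -G a b) = -splits f G := fun G =>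
      (map_splits (-LinearMap.id : Lin k true →ₗ[k] Lin k true) f G).symm
    simp only [sub_eq_add_neg, splits_add, h8, map_add, LinearMap.add_apply, map_neg,
      LinearMap.neg_apply, LinearMap.comp_apply, nodeL_ι, Mon.map_sign, Units.neg_smul, one_smul,
      smul_neg, smul_add, map_splits]
    abel

end Pl


/-! ### The cohomology of the complex of trees -/

namespace Pl

variable {k : Type u} [Field k]

/-- Linear combinations of trees or forests whose leaves spell a given word. -/
abbrev wordGr (k : Type u) [Field k] (b : Bool) : List ℕ → Submodule k (Lin k b) :=
  basisGrading k word

theorem ι_mem_wordGr {b : Bool} {x : Pl b} {W : List ℕ} (h : word x = W) :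
    (ι x : Lin k b) ∈ wordGr k b W := single_mem_basisGrading' h 1

theorem bilin_mem_wordGr {b : Bool} (G : Lin k true →ₗ[k] Lin k false →ₗ[k] Lin k b)
    {W W' V : List ℕ} (hG : ∀ t f, word t = W → word f = W' → G (ι t) (ι f) ∈ wordGr k b V)
    {u : Lin k true} {f : Lin k false} (hu : u ∈ wordGr k true W) (hf : f ∈ wordGr k false W') :
    G u f ∈ wordGr k b V := by
  refine basisGrading_induction (p := fun u => G u f ∈ wordGr k b V) ?_ ?_ ?_ ?_ hu
  · simp
  · intro x y hx hy
    rw [map_add, LinearMap.add_apply]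
    exact add_mem hx hy
  · intro c x hx
    rw [map_smul, LinearMap.smul_apply]
    exact Submodule.smul_mem _ _ hx
  intro t ht
  refine basisGrading_induction (p := fun f => G (ι t) f ∈ wordGr k b V) ?_ ?_ ?_ ?_ hf
  · simp
  · intro x y hx hy
    rw [map_add]
    exact add_mem hx hy
  · intro c x hx
    rw [map_smul]
    exact Submodule.smul_mem _ _ hx
  intro f hf
  exact hG t f ht hf

theorem nodeL_mem_wordGr {W W' : List ℕ} {u : Lin k true} {f : Lin k false}
    (hu : u ∈ wordGr k true W) (hf : f ∈ wordGr k false W') : nodeL u f ∈ wordGr k true (W ++ W') :=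
  bilin_mem_wordGr nodeL (fun t f ht hf => nodeL_ι (k := k) t f ▸
    ι_mem_wordGr (by rw [word, ht, hf])) hu hf

theorem consL_mem_wordGr {W W' : List ℕ} {u : Lin k true} {f : Lin k false}
    (hu : u ∈ wordGr k true W) (hf : f ∈ wordGr k false W') :
    consL u f ∈ wordGr k false (W ++ W') :=
  bilin_mem_wordGr consL (fun t f ht hf => consL_ι (k := k) t f ▸
    ι_mem_wordGr (by rw [word, ht, hf])) hu hf

theorem oneL_mem_wordGr {W : List ℕ} {u : Lin k true} (hu : u ∈ wordGr k true W) :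
    oneL u ∈ wordGr k false W := by
  refine basisGrading_induction (p := fun u => oneL u ∈ wordGr k false W) ?_ ?_ ?_ ?_ hu
  · simp
  · intro x y hx hy
    rw [map_add]
    exact add_mem hx hy
  · intro c x hx
    rw [map_smul]
    exact Submodule.smul_mem _ _ hx
  intro t ht
  exact (oneL_ι (k := k) t).symm ▸ ι_mem_wordGr ht

theorem splits_mem_of_word {M : Type*} [AddCommGroup M] [Module k M] (N : Submodule k M)
    {f : Pl false} {G : Pl false → Pl false → M}
    (hG : ∀ a b, word a ++ word b = word f → G a b ∈ N) : splits f G ∈ N := by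
  induction f using forest_induction generalizing G with
  | one t => exact zero_mem _
  | cons t f ih =>
    refine add_mem (hG _ _ rfl) (ih fun a b hab => hG _ _ ?_)
    rw [word, word, List.append_assoc, hab]

theorem D_mem_wordGr {b : Bool} (x : Pl b) : D k x ∈ wordGr k b (word x) := by
  induction x with
  | leaf a => exact zero_mem _
  | one t ih => exact oneL_mem_wordGr ih
  | node t f iht ihf =>
    refine neg_mem (add_mem (add_mem ?_ (splits_mem_of_word _ fun a b hab => ι_mem_wordGr ?_))
      (Mon.sign_smul_mem _ _ ?_))
    · exact nodeL_mem_wordGr iht (ι_mem_wordGr rfl)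
    · rw [word, word, List.append_assoc, hab, word]
    · exact nodeL_mem_wordGr (ι_mem_wordGr rfl) ihf
  | cons t f iht ihf =>
    refine add_mem (add_mem (add_mem ?_ (splits_mem_of_word _ fun a b hab => ι_mem_wordGr ?_))
      (ι_mem_wordGr rfl)) (Mon.sign_smul_mem _ _ ?_)
    · exact consL_mem_wordGr iht (ι_mem_wordGr rfl)
    · rw [word, word, List.append_assoc, hab, word]
    · exact consL_mem_wordGr (ι_mem_wordGr rfl) ihf

theorem word_eq_cons {b : Bool} (t : Pl b) : ∃ W, word t = head t :: W := by
  induction t with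
  | leaf a => exact ⟨[], rfl⟩
  | one t ih => exact ih
  | node t f iht _ =>
    obtain ⟨W, hW⟩ := iht
    exact ⟨W ++ word f, by rw [word, hW]; rfl⟩
  | cons t f iht _ =>
    obtain ⟨W, hW⟩ := iht
    exact ⟨W ++ word f, by rw [word, hW]; rfl⟩

theorem delta_mem_wordGr {x : ℕ} {W : List ℕ} (t : Pl true) (ht : word t = x :: W) :
    delta k t ∈ wordGr k true W := by
  match t with
  | leaf _ => exact zero_mem _
  | node (leaf _) (one t) => exact ι_mem_wordGr (List.cons.inj ht).2
  | node (leaf _) (cons _ _) => exact zero_mem _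
  | node (node t g) f =>
    obtain ⟨V, hV⟩ := word_eq_cons (node t g)
    have h1 : word (node t g) ++ word f = x :: W := ht
    rw [hV] at h1
    rw [← (List.cons.inj h1).2]
    exact nodeL_mem_wordGr (delta_mem_wordGr (node t g) hV) (ι_mem_wordGr rfl)

theorem homotopy_mem_wordGr {x : ℕ} {W : List ℕ} (t : Pl true) (ht : word t = x :: W) :
    homotopy k x t ∈ wordGr k true (x :: W) := by
  match t with
  | leaf _ => exact zero_mem _
  | node (leaf _) _ => exact zero_mem _
  | node (node t g) f =>
    obtain ⟨V, hV⟩ := word_eq_cons (node t g)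
    have h1 : word (node t g) ++ word f = x :: W := ht
    rw [hV] at h1
    obtain ⟨h2, h3⟩ := List.cons.inj h1
    rw [h2] at hV
    rw [← h3]
    refine neg_mem (add_mem ?_ ?_)
    · exact nodeL_mem_wordGr (homotopy_mem_wordGr (node t g) hV) (ι_mem_wordGr rfl)
    · exact nodeL_mem_wordGr (W := [x]) (ι_mem_wordGr rfl)
        (consL_mem_wordGr (delta_mem_wordGr (node t g) hV) (ι_mem_wordGr rfl))

/-- The right comb: the tree of the iterated product `x₁ (x₂ (x₃ ⋯))`. -/
def comb : List ℕ → Pl true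
  | [] => leaf 0
  | [a] => leaf a
  | a :: b :: W => node (leaf a) (one (comb (b :: W)))

theorem D_comb (W : List ℕ) : D k (comb W) = 0 := by
  match W with
  | [] => rfl
  | [a] => rfl
  | a :: b :: W =>
    rw [comb, D_node, D_one, D_comb (b :: W), splits_one]
    simp [D]

theorem DL_leaf_oneL (x : ℕ) (u : Lin k true) :
    DL (nodeL (ι (leaf x)) (oneL u)) = nodeL (ι (leaf x)) (oneL (DL u)) := by
  rw [DL_nodeL (ι_mem (k := k) (x := leaf x) rfl), splitsL_oneL, DL_ι, DL_oneL, sign_sdeg_leaf]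
  simp [D, Units.neg_smul]

theorem exists_node {t : Pl true} {x y : ℕ} {W : List ℕ} (ht : word t = x :: y :: W) :
    ∃ s f, t = node s f := by
  cases t with
  | leaf a => exact absurd (congrArg List.length ht) (by simp [word])
  | node s f => exact ⟨s, f, rfl⟩

/-- In the part of the complex of trees spelled by a nonempty word, the cohomology is spanned by
the class of the right comb. -/
theorem exists_comb (x : ℕ) (W : List ℕ) {v : Lin k true} (hv : v ∈ wordGr k true (x :: W))
    (hd : DL v = 0) :
    ∃ c : k, ∃ v' ∈ wordGr k true (x :: W), v = c • ι (comb (x :: W)) + DL v' := by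
  induction W generalizing x v with
  | nil =>
    have : ∃ c : k, v = c • ι (leaf x) := by
      refine basisGrading_induction (p := fun v => ∃ c : k, v = c • ι (leaf x)) ?_ ?_ ?_ ?_ hv
      · exact ⟨0, (zero_smul _ _).symm⟩
      · rintro _ _ ⟨c, rfl⟩ ⟨c', rfl⟩
        exact ⟨c + c', (add_smul _ _ _).symm⟩
      · rintro c _ ⟨c', rfl⟩
        exact ⟨c * c', smul_smul _ _ _⟩
      · intro t ht
        cases t with
        | leaf a => exact ⟨1, by rw [one_smul, (List.cons.inj ht).1]; rfl⟩
        | node t f =>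
          obtain ⟨V, hV⟩ := word_eq_cons t
          obtain ⟨V', hV'⟩ := word_eq_cons f
          rw [word, hV, hV'] at ht
          exact absurd (congrArg List.length ht) (by simp)
    obtain ⟨c, rfl⟩ := this
    exact ⟨c, 0, zero_mem _, by rw [map_zero, add_zero]; rfl⟩
  | cons y W ih =>
    have h1 : DL (homotopyL x v) + homotopyL x (DL v) =
        v - nodeL (ι (leaf x)) (oneL (deltaL v)) := by
      refine basisGrading_induction (p := fun v => DL (homotopyL x v) + homotopyL x (DL v) =
        v - nodeL (ι (leaf x)) (oneL (deltaL v))) ?_ ?_ ?_ ?_ hv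
      · simp
      · intro a b ha hb
        rw [map_add, map_add, map_add, map_add, map_add, map_add, map_add, add_add_add_comm, ha, hb]
        abel
      · intro c a ha
        simp only [map_smul, ← smul_add, ha, smul_sub]
      · intro t ht
        obtain ⟨s, f, rfl⟩ := exists_node ht
        obtain ⟨V, hV⟩ := word_eq_cons (node s f)
        have h := homotopy_spec (k := k) x s f (List.cons.inj (hV.symm.trans ht)).1
        rwa [← homotopyL_ι, ← DL_ι, ← deltaL_ι] at h
    have h2 : deltaL (DL v) = DL (deltaL v) := by
      refine basisGrading_induction (p := fun v => deltaL (DL v) = DL (deltaL v)) ?_ ?_ ?_ ?_ hv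
      · simp
      · intro a b ha hb
        simp only [map_add, ha, hb]
      · intro c a ha
        simp only [map_smul, ha]
      · intro t ht
        obtain ⟨s, f, rfl⟩ := exists_node ht
        have h := deltaL_D (k := k) s f
        rwa [← DL_ι, ← deltaL_ι] at h
    have h3 : deltaL v ∈ wordGr k true (y :: W) := by
      refine basisGrading_induction (p := fun v => deltaL v ∈ wordGr k true (y :: W)) ?_ ?_ ?_ ?_ hv
      · simp
      · intro a b ha hb
        rw [map_add]
        exact add_mem ha hb
      · intro c a ha
        rw [map_smul]
        exact Submodule.smul_mem _ _ ha
      · intro t ht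
        exact (deltaL_ι (k := k) t).symm ▸ delta_mem_wordGr t ht
    have h4 : homotopyL x v ∈ wordGr k true (x :: y :: W) := by
      refine basisGrading_induction (p := fun v => homotopyL x v ∈ wordGr k true (x :: y :: W))
        ?_ ?_ ?_ ?_ hv
      · simp
      · intro a b ha hb
        rw [map_add]
        exact add_mem ha hb
      · intro c a ha
        rw [map_smul]
        exact Submodule.smul_mem _ _ ha
      · intro t ht
        exact (homotopyL_ι (k := k) x t).symm ▸ homotopy_mem_wordGr t ht
    rw [hd, map_zero] at h2
    -- `v` is cohomologous to `x (delta v)`, and the induction hypothesis applies to `delta v`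
    obtain ⟨c, u, hu, hc⟩ := ih y h3 h2.symm
    refine ⟨c, nodeL (ι (leaf x)) (oneL u) + homotopyL x v, add_mem
      (nodeL_mem_wordGr (W := [x]) (ι_mem_wordGr rfl) (oneL_mem_wordGr hu)) h4, ?_⟩
    rw [hd, map_zero, add_zero] at h1
    rw [map_add, h1, DL_leaf_oneL, hc, map_add, map_add, map_smul, map_smul, oneL_ι, nodeL_ι, comb]
    abel

theorem filter_word_mem (W : List ℕ) (v : Lin k true) :
    v.filter (fun t => word t = W) ∈ wordGr k true W := by
  refine (Finsupp.mem_supported _ _).2 fun t ht => ?_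
  have := (Finsupp.mem_support_iff.1 ht)
  by_contra h
  exact this (Finsupp.filter_apply_neg _ _ h)

/-- The differential preserves the words spelled by the leaves. -/
theorem DL_filter_word (W : List ℕ) (v : Lin k true) :
    DL (v.filter fun t => word t = W) = (DL v).filter fun t => word t = W := by
  induction v using lin_induction with
  | zero => simp [Finsupp.filter_zero]
  | add x y hx hy => rw [Finsupp.filter_add, map_add, map_add, hx, hy, Finsupp.filter_add]
  | smul c x hx => rw [Finsupp.filter_smul, map_smul, map_smul, hx, Finsupp.filter_smul]
  | basis t =>
    have hD := (Finsupp.mem_supported' _ _).1 (D_mem_wordGr (k := k) t)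
    by_cases h : word t = W
    · rw [ι, Finsupp.filter_single_of_pos (fun t => word t = W) h, ← ι, DL_ι, eq_comm,
        Finsupp.filter_eq_self_iff]
      intro s hs
      by_contra hs'
      exact hs (hD s fun e => hs' (e.trans h))
    · rw [ι, Finsupp.filter_single_of_neg (fun t => word t = W) h, ← ι, DL_ι, map_zero, eq_comm,
        Finsupp.filter_eq_zero_iff]
      intro s hs
      exact hD s fun e => h (e.symm.trans hs)

/-! ### Every tree is the tree of a monomial -/

/-- The list of trees of a forest; a tree is regarded as a forest with one tree. -/
def trees : ∀ {b : Bool}, Pl b → List (Pl true)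
  | true, t => [t]
  | _, one t => [t]
  | _, cons t f => t :: trees f

theorem trees_ne_nil {b : Bool} (f : Pl b) : trees f ≠ [] := by
  cases f <;> simp [trees]

theorem forest_trees (f : Pl false) : forest (trees f) = f := by
  induction f using forest_induction with
  | one t => rfl
  | cons t f ih => rw [trees, forest_cons t (trees_ne_nil f), ih]

/-- The tree `t` arises from some monomial by substituting the trees in the list `L`. -/
def Arises (L : List (Pl true)) (t : Pl true) : Prop :=
  ∃ (n : ℕ) (z : Tm n) (a : Fin n → Pl true), List.ofFn a = L ∧ z.tree a = t

theorem Arises.graft {p q V : List (Pl true)} {t : Pl true} (hV : 2 ≤ V.length)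
    (h : Arises (p ++ corolla V :: q) t) : Arises (p ++ V ++ q) t := by
  obtain ⟨n, z, a, ha, rfl⟩ := h
  obtain ⟨s, hs⟩ : ∃ s, V.length = s + 2 := ⟨V.length - 2, by omega⟩
  have hn : n = p.length + q.length + 1 := by
    have := congrArg List.length ha
    simp only [List.length_ofFn, List.length_append, List.length_cons] at this
    omega
  have hl : (p ++ V ++ q).length + 1 = n + (s + 2) := by
    simp only [List.length_append]
    omega
  let b : Fin (p ++ V ++ q).length → Pl true := (p ++ V ++ q).get
  have hb : List.ofFn b = p ++ V ++ q := List.ofFn_get _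
  have hi : p.length < n := by omega
  have hin := take_ofFn_innerIdx hl ⟨p.length, hi⟩ b
  have hpl := ofFn_plug hl ⟨p.length, hi⟩ (Tm.tree (.mul s)) b
  refine ⟨_, .circ hl ⟨p.length, hi⟩ z (.mul s), b, hb, ?_⟩
  rw [Tm.tree]
  congr 1
  apply List.ofFn_injective
  rw [hpl, ha, Tm.tree, ← hin, hb]
  simp [hs.symm, ← List.drop_drop]

theorem Arises.leaves {b : Bool} (f : Pl b) {p q : List (Pl true)} {t : Pl true}
    (h : Arises (p ++ trees f ++ q) t) : Arises (p ++ (word f).map leaf ++ q) t := by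
  induction f generalizing p q with
  | leaf a => exact h
  | one s ih => exact ih (by simpa [trees] using h)
  | node s f ihs ihf =>
    have h1 : corolla (s :: trees f) = node s f := by rw [corolla, forest_trees]
    have h2 : Arises (p ++ (s :: trees f) ++ q) t := by
      refine Arises.graft ?_ ?_
      · have := List.length_pos_iff.2 (trees_ne_nil f)
        simp only [List.length_cons]
        omega
      · rw [h1]
        simpa [trees] using h
    have h3 := ihs (p := p) (q := trees f ++ q) (by simpa [trees] using h2)
    have h4 := ihf (p := p ++ (word s).map leaf) (q := q) (by simpa using h3)
    simpa [word] using h4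
  | cons s f ihs ihf =>
    have h3 := ihs (p := p) (q := trees f ++ q) (by simpa [trees] using h)
    have h4 := ihf (p := p ++ (word s).map leaf) (q := q) (by simpa using h3)
    simpa [word] using h4

/-- Every tree is obtained from a monomial by substituting leaves. -/
theorem exists_tm {n : ℕ} {t : Pl true} {a : Fin n → ℕ} (ht : word t = List.ofFn a) :
    ∃ x : Tm n, x.tree (fun j => leaf (a j)) = t := by
  have h : Arises ([] ++ trees t ++ []) t :=
    ⟨1, .one, fun _ => t, by cases t <;> simp [trees], rfl⟩
  obtain ⟨m, z, b, hb, hz⟩ := h.leaves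
  rw [ht, List.nil_append, List.append_nil, List.map_ofFn] at hb
  obtain rfl : m = n := by simpa using congrArg List.length hb
  obtain rfl := List.ofFn_injective hb
  exact ⟨z, hz⟩

end Pl


/-! ### The augmentation is a quasi-isomorphism -/

section QuasiIso

variable {k : Type u} [Field k]

namespace BurkeOperad

theorem toTrees_unit : toTrees k 0 (unit k) = Pl.treeUnit k :=
  congrArg (fun f : Op k (Pl.Lin k true) 0 => f fun j => Pl.ι (letters 0 j)) Pl.treeAlgebra_unit

/-- The leaves of the algebra of trees are cocycles, so evaluation on them is compatible with the
differentials. -/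
theorem toTrees_d {n : ℕ} (x : (BurkeOperad k).X n) :
    toTrees k n ((BurkeOperad k).d n x) = Pl.DL (toTrees k n x) := by
  refine gen_induction (p := fun x => toTrees k n ((BurkeOperad k).d n x) =
    Pl.DL (toTrees k n x)) ?_ ?_ ?_ ?_ ?_ (Lift.mem_gen_univ x)
  · simp
  · intro v w hv hw
    simp only [map_add, hv, hw]
  · intro c v hv
    simp only [map_smul, hv]
  · rintro z rfl hz
    obtain rfl := eq_of_heq hz
    rw [toTrees_unit]
    refine (congrArg _ d_unit).trans ((map_zero _).trans ?_)
    exact (Pl.DL_ι (k := k) (Pl.leaf 0)).symm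
  · intro x _
    have h := (Pl.treeAlgebra k).act_d (tm k x) (fun j => Pl.ι (letters n j)) (tm_mem x)
      fun j => Pl.ι_mem_treeGr (letters n j)
    refine Eq.trans ?_ h.symm
    have h0 : ∀ j, (Pl.treeComplex k).d (Pl.ι (letters n j)) = 0 := fun j => Pl.DL_ι (k := k) _
    rw [Finset.sum_eq_zero, smul_zero, add_zero]
    · rfl
    · intro i _
      rw [h0]
      exact (congrArg _ (MultilinearMap.map_update_zero _ _ _)).trans (smul_zero _)

/-- The word spelled by the inputs in the order given by a permutation. -/
def permWord {n : ℕ} (σ : Equiv.Perm (Fin n)) : List ℕ := List.ofFn fun j => (σ j).val + 1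

theorem permWord_injective {n : ℕ} : Function.Injective (permWord (n := n)) := fun σ τ h =>
  Equiv.ext fun j => Fin.ext (by simpa using congrFun (List.ofFn_injective h) j)

/-- The labels of the tree of a monomial are those of its inputs, in some order. -/
theorem exists_word_tree {n : ℕ} (x : Tm n) :
    ∃ σ : Equiv.Perm (Fin n), (x.tree (letters n)).word = permWord σ := by
  obtain ⟨_, σ, _, z, hz, _, ht⟩ := exists_planar_tree (k := ℚ) x
  refine ⟨σ, ?_⟩
  rw [ht, hz.word_tree, permWord]
  have : (List.ofFn fun j => (Pl.leaf ((σ j).val + 1)).word) =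
      (List.ofFn fun j => (σ j).val + 1).map fun x => [x] := by
    rw [List.map_ofFn]
    rfl
  rw [this]
  exact List.flatMap_singleton' _

theorem sum_filter_toTrees {n : ℕ} (hn : 0 < n) (x : (BurkeOperad k).X n) :
    ∑ σ : Equiv.Perm (Fin n), (toTrees k n x).filter (fun t => t.word = permWord σ) =
      toTrees k n x := by
  refine gen_induction (p := fun x => ∑ σ : Equiv.Perm (Fin n),
    (toTrees k n x).filter (fun t => t.word = permWord σ) = toTrees k n x)
    ?_ ?_ ?_ ?_ ?_ (Lift.mem_gen_univ x)
  · simp [Finsupp.filter_zero]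
  · intro v w hv hw
    rw [map_add]
    simp only [Finsupp.filter_add, Finset.sum_add_distrib, hv, hw]
  · intro c v hv
    rw [map_smul]
    simp only [Finsupp.filter_smul, ← Finset.smul_sum, hv]
  · rintro z rfl -
    exact absurd hn (lt_irrefl 0)
  · intro x _
    obtain ⟨τ, hτ⟩ := exists_word_tree x
    have key : ∑ σ : Equiv.Perm (Fin n), (Pl.ι (x.tree (letters n)) : Pl.Lin k true).filter
        (fun t => t.word = permWord σ) = Pl.ι (x.tree (letters n)) := by
      rw [Finset.sum_eq_single τ]
      · exact Finsupp.filter_single_of_pos (fun t : Pl true => t.word = permWord τ) hτ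
      · intro σ _ hσ
        exact Finsupp.filter_single_of_neg (fun t : Pl true => t.word = permWord σ)
          fun e => hσ (permWord_injective (e.symm.trans hτ))
      · exact fun h => absurd (Finset.mem_univ _) h
    obtain ⟨ε, hε⟩ := toTrees_tm (k := k) x
    rw [hε]
    rcases Int.units_eq_one_or ε with rfl | rfl
    · simp only [one_smul]
      exact key
    · have h1 : ∀ v : Pl.Lin k true, (-1 : ℤˣ) • v = (-1 : k) • v := by
        intro v
        rw [Units.neg_smul, one_smul, neg_one_smul]
      simp only [h1, Finsupp.filter_smul, ← Finset.smul_sum, key]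

/-- Every combination of trees whose leaves spell a permutation of the inputs comes from the
operad. -/
theorem exists_toTrees {n : ℕ} {σ : Equiv.Perm (Fin n)} {v : Pl.Lin k true}
    (hv : v ∈ Pl.wordGr k true (permWord σ)) : ∃ y, toTrees k n y = v := by
  refine basisGrading_induction (p := fun v => ∃ y, toTrees k n y = v) ?_ ?_ ?_ ?_ hv
  · exact ⟨0, map_zero _⟩
  · rintro _ _ ⟨x, rfl⟩ ⟨y, rfl⟩
    exact ⟨x + y, map_add _ _ _⟩
  · rintro c _ ⟨x, rfl⟩
    exact ⟨c • x, map_smul _ _ _⟩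
  · intro t ht
    obtain ⟨x, rfl⟩ := Pl.exists_tm ht
    obtain ⟨ε, hε⟩ := toTrees_tm (k := k) (.perm σ x)
    refine ⟨ε • tm k (.perm σ x), ?_⟩
    rw [Mon.map_sign, hε, smul_smul, Int.units_mul_self, one_smul]
    rfl

/-- The iterated product `x₁ (x₂ (x₃ ⋯))`. -/
def rightComb : ∀ n, Tm (n + 1)
  | 0 => .one
  | n + 1 => .circ (m := 2) (n := n + 1) (by omega) 1 (.mul 0) (rightComb n)

theorem tree_rightComb (n : ℕ) (a : Fin (n + 1) → ℕ) :
    (rightComb n).tree (fun j => .leaf (a j)) = Pl.comb (List.ofFn a) := by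
  induction n with
  | zero => rw [List.ofFn_succ, List.ofFn_zero]; rfl
  | succ n ih =>
    have h : n + 1 + 1 + 1 = 2 + (n + 1) := by omega
    have e : (rightComb (n + 1)).tree (fun j => .leaf (a j)) =
        Pl.corolla (List.ofFn (plug h 1 (rightComb n).tree fun j => .leaf (a j))) := rfl
    have hi : (fun t : Fin (n + 1) => Pl.leaf (a (innerIdx h (1 : Fin 2) t))) =
        fun t => Pl.leaf (a t.succ) := by
      funext t
      congr 2
      apply Fin.ext
      simp [innerIdx, add_comm]
    rw [e, ofFn_plug, hi, ih fun t => a t.succ,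
      List.drop_of_length_le (by
        rw [List.length_ofFn]; exact (show n + 2 ≤ 1 + (n + 1) by omega)),
      List.ofFn_succ, List.ofFn_succ (f := a), List.ofFn_succ (f := fun t : Fin (n + 1) => a t.succ)]
    rfl

theorem toTrees_rightComb {n : ℕ} (σ : Equiv.Perm (Fin (n + 1))) : ∃ ε : ℤˣ,
    toTrees k (n + 1) ((BurkeOperad k).perm (n + 1) σ (tm k (rightComb n))) =
      ε • Pl.ι (Pl.comb (permWord σ)) := by
  obtain ⟨ε, hε⟩ := toTrees_tm (k := k) (.perm σ (rightComb n))
  refine ⟨ε, hε.trans ?_⟩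
  rw [Tm.tree]
  exact congrArg (fun t => ε • (Pl.ι t : Pl.Lin k true))
    (tree_rightComb n fun j => (σ j).val + 1)

theorem d_rightComb (n : ℕ) (σ : Equiv.Perm (Fin (n + 1))) : (BurkeOperad k).d (n + 1)
    ((BurkeOperad k).perm (n + 1) σ (tm k (rightComb n))) = 0 := by
  apply toTrees_injective (k := k) n.succ_pos
  obtain ⟨ε, hε⟩ := toTrees_rightComb (k := k) σ
  rw [toTrees_d, hε, Mon.map_sign, Pl.DL_ι, Pl.D_comb, smul_zero, map_zero]

/-- In positive arity, the cohomology is spanned by the relabellings of the iterated product. -/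
theorem exists_rightComb {n : ℕ} {z : (BurkeOperad k).X (n + 1)}
    (hz : (BurkeOperad k).d (n + 1) z = 0) : ∃ (c : Equiv.Perm (Fin (n + 1)) → k) (y : _),
      z = ∑ σ, c σ • (BurkeOperad k).perm (n + 1) σ (tm k (rightComb n)) +
        (BurkeOperad k).d (n + 1) y := by
  have h : ∀ σ : Equiv.Perm (Fin (n + 1)), ∃ (c : k) (y : (BurkeOperad k).X (n + 1)),
      (toTrees k (n + 1) z).filter (fun t => t.word = permWord σ) = toTrees k (n + 1)
        (c • (BurkeOperad k).perm (n + 1) σ (tm k (rightComb n)) +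
          (BurkeOperad k).d (n + 1) y) := by
    intro σ
    have h2 := Pl.DL_filter_word (permWord σ) (toTrees k (n + 1) z)
    rw [← toTrees_d, hz, map_zero, Finsupp.filter_zero] at h2
    have e : permWord σ = ((σ 0).val + 1) :: List.ofFn fun j : Fin n => (σ j.succ).val + 1 := by
      rw [permWord, List.ofFn_succ]
    have h1 := Pl.filter_word_mem (permWord σ) (toTrees k (n + 1) z)
    rw [e] at h1 h2
    obtain ⟨c, v, hv, hc⟩ := Pl.exists_comb _ _ h1 h2
    rw [← e] at hv hc
    obtain ⟨y, rfl⟩ := exists_toTrees hv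
    obtain ⟨ε, hε⟩ := toTrees_rightComb (k := k) σ
    rcases Int.units_eq_one_or ε with rfl | rfl
    · refine ⟨c, y, hc.trans ?_⟩
      rw [map_add, map_smul, hε, one_smul, toTrees_d]
    · refine ⟨-c, y, hc.trans ?_⟩
      rw [map_add, map_smul, hε, Units.neg_smul, one_smul, toTrees_d, smul_neg, neg_smul, neg_neg]
  choose c y hcy using h
  refine ⟨c, ∑ σ, y σ, toTrees_injective (k := k) n.succ_pos ?_⟩
  rw [← sum_filter_toTrees n.succ_pos, Finset.sum_congr rfl fun σ _ => hcy σ, ← map_sum,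
    Finset.sum_add_distrib, map_sum]

theorem exists_smul_unit (x : (BurkeOperad k).X 0) : ∃ c : k, x = c • unit k := by
  have hx : x ∈ gen k Set.univ 0 := Lift.mem_gen_univ x
  refine (Submodule.mem_span_singleton.1 (Submodule.span_le.2 ?_ hx)).imp fun _ => Eq.symm
  intro x hx
  cases hx with
  | unit => exact Submodule.mem_span_singleton_self _
  | tm x _ => exact absurd x.pos (lt_irrefl 0)

end BurkeOperad

theorem Word.exists_perm {n : ℕ} (W W' : Word n) : ∃ σ, Word.perm σ W = W' := by
  have hl : ∀ W : Word n, W.1.length = n := fun W => by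
    have := Fintype.card_congr (List.Nodup.getEquivOfForallMemList W.1 W.2.1 W.2.2)
    simpa using this
  let e := List.Nodup.getEquivOfForallMemList W.1 W.2.1 W.2.2
  let e' := List.Nodup.getEquivOfForallMemList W'.1 W'.2.1 W'.2.2
  refine ⟨e.symm.trans ((finCongr ((hl W).trans (hl W').symm)).trans e'), Subtype.ext ?_⟩
  apply List.ext_getElem
  · exact (hl _).trans (hl W').symm
  · intro j h1 h2
    have hj : j < W.1.length := by rw [hl W, ← hl W']; exact h2
    have h3 : e.symm (W.1[j]) = ⟨j, hj⟩ := (Equiv.symm_apply_eq _).2 rfl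
    simp only [Word.perm, List.getElem_map, Equiv.trans_apply, h3]
    rfl

theorem Word.perm_injective {n : ℕ} (W : Word n) :
    Function.Injective fun σ : Equiv.Perm (Fin n) => Word.perm σ W := fun _ _ h =>
  Equiv.ext fun j => List.map_inj_left.1 (congrArg Subtype.val h) j (W.2.2 j)

theorem AssPlus.perm_single {n : ℕ} (σ : Equiv.Perm (Fin n)) (W : Word n) :
    (AssPlus k).perm n σ (Finsupp.single W 1) = Finsupp.single (Word.perm σ W) 1 :=
  Finsupp.mapDomain_single

theorem AssPlus.exists_eval_rightComb (n : ℕ) : ∃ W : Word (n + 1),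
    (BurkeOperad.rightComb n).eval (AssPlus k).toGradedOperad (AssPlus.gens k) =
      Finsupp.single W 1 := by
  induction n with
  | zero => exact ⟨Word.one, rfl⟩
  | succ n ih =>
    obtain ⟨W, hW⟩ := ih
    refine ⟨Word.circ (by omega) 1 Word.two W, ?_⟩
    rw [BurkeOperad.rightComb, Tm.eval, hW]
    exact AssPlus.circ_single _ _ _ _

variable (k) in
/-- The coefficient of a word. -/
noncomputable def AssPlus.coeff {n : ℕ} (W : Word n) : (AssPlus k).X n →ₗ[k] k :=
  Finsupp.lapply W

theorem AssPlus.coeff_single {n : ℕ} (W : Word n) :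
    AssPlus.coeff k W (Finsupp.single W 1 : Word n →₀ k) = 1 := Finsupp.single_eq_same

theorem AssPlus.coeff_single_ne {n : ℕ} {V W : Word n} (h : V ≠ W) :
    AssPlus.coeff k W (Finsupp.single V 1 : Word n →₀ k) = 0 := Finsupp.single_eq_of_ne' h

/-- The augmentation is a quasi-isomorphism: it maps the relabellings of the iterated product, which
span the cohomology, to a basis of `Ass₊`. -/
theorem quasiIsoOn_augmentation {β : DGOperad.Hom (BurkeOperad k) (AssPlus k)}
    (hu : β.app 0 (BurkeOperad.unit k) = AssPlus.unit k)
    (hβ : ∀ n, β.app (n + 2) (BurkeOperad.mul k n) = AssPlus.gens k n) (n : ℕ) :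
    QuasiIsoOn β n ⊤ := by
  have hd : ∀ y : (AssPlus k).X n, (AssPlus k).d n y = 0 := fun _ => rfl
  cases n with
  | zero =>
    constructor
    · rintro x - - ⟨y, hy⟩
      rw [hd] at hy
      obtain ⟨c, rfl⟩ := BurkeOperad.exists_smul_unit x
      rw [map_smul, hu] at hy
      have : c = 0 := by
        have := congrArg (AssPlus.coeff k Word.empty) hy
        rwa [map_smul, AssPlus.unit, AssPlus.coeff_single, map_zero, smul_eq_mul, mul_one] at this
      exact ⟨0, trivial, by rw [this, zero_smul, map_zero]⟩
    · intro y _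
      have hy : ∃ c : k, y = c • AssPlus.unit k := by
        refine ⟨AssPlus.coeff k Word.empty y, Finsupp.ext fun W => ?_⟩
        obtain rfl : W = Word.empty :=
          Subtype.ext (List.eq_nil_iff_forall_not_mem.2 fun j => j.elim0)
        have h1 : AssPlus.coeff k Word.empty y = AssPlus.coeff k Word.empty
            (AssPlus.coeff k Word.empty y • AssPlus.unit k) := by
          rw [map_smul, AssPlus.unit, AssPlus.coeff_single, smul_eq_mul, mul_one]
        exact h1
      obtain ⟨c, rfl⟩ := hy
      refine ⟨c • BurkeOperad.unit k, trivial, ?_, 0, ?_⟩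
      · rw [map_smul]
        exact (congrArg (c • ·) (BurkeOperad.d_unit (k := k))).trans (smul_zero c)
      · rw [map_smul, hu, sub_self, map_zero]
  | succ n =>
    obtain ⟨W, hW⟩ := AssPlus.exists_eval_rightComb (k := k) n
    have hcomb : ∀ σ, β.app (n + 1) ((BurkeOperad k).perm (n + 1) σ
        (BurkeOperad.tm k (BurkeOperad.rightComb n))) =
        (Finsupp.single (Word.perm σ W) 1 : Word (n + 1) →₀ k) := by
      intro σ
      rw [β.app_perm, β.app_eval, funext hβ, hW, AssPlus.perm_single]
    constructor
    · rintro x - hx ⟨y, hy⟩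
      rw [hd] at hy
      obtain ⟨c, z, rfl⟩ := BurkeOperad.exists_rightComb hx
      rw [map_add, β.app_d, hd, add_zero, map_sum] at hy
      have hc : ∀ σ, c σ = 0 := by
        intro τ
        have h1 := congrArg (AssPlus.coeff k (Word.perm τ W)) hy
        rw [map_sum, map_zero, Finset.sum_eq_single τ] at h1
        · rwa [map_smul, map_smul, hcomb, AssPlus.coeff_single, smul_eq_mul, mul_one] at h1
        · intro σ _ hσ
          rw [map_smul, map_smul, hcomb,
            AssPlus.coeff_single_ne ((Word.perm_injective W).ne hσ), smul_zero]
        · exact fun h => absurd (Finset.mem_univ _) h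
      refine ⟨z, trivial, ?_⟩
      rw [Finset.sum_eq_zero fun σ _ => by rw [hc, zero_smul], zero_add]
    · intro y _
      suffices ∃ x, (BurkeOperad k).d (n + 1) x = 0 ∧ β.app (n + 1) x = y by
        obtain ⟨x, hx, rfl⟩ := this
        exact ⟨x, trivial, hx, 0, by rw [sub_self, map_zero]⟩
      induction y using Finsupp.induction_linear with
      | zero => exact ⟨0, map_zero _, map_zero _⟩
      | add y y' hy hy' =>
        obtain ⟨x, hx, rfl⟩ := hy rfl
        obtain ⟨x', hx', rfl⟩ := hy' rfl
        exact ⟨x + x', by rw [map_add, hx, hx', add_zero], map_add _ _ _⟩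
      | single V c =>
        obtain ⟨σ, rfl⟩ := Word.exists_perm W V
        refine ⟨c • (BurkeOperad k).perm (n + 1) σ
          (BurkeOperad.tm k (BurkeOperad.rightComb n)), ?_, ?_⟩
        · rw [map_smul, BurkeOperad.d_rightComb, smul_zero]
        · rw [map_smul, hcomb]
          exact Finsupp.smul_single_one _ _

end QuasiIso


/-! ### The presented operad is a Sullivan minimal model -/

section Sullivan

variable {k : Type u} [Field k]

namespace BurkeOperad

/-- The relabellings of the generators in `G`. -/
inductive IsCorolla (G : Set ℕ) : ∀ {n : ℕ}, (BurkeOperad k).X n → Prop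
  | mk (N : ℕ) (hN : N ∈ G) (σ : Equiv.Perm (Fin (N + 2))) :
    IsCorolla G ((BurkeOperad k).perm (N + 2) σ (mul k N))

variable (k) in
/-- The `Σ`-module spanned by the generators in `G`. -/
noncomputable def corollas (G : Set ℕ) (n : ℕ) : Submodule k ((BurkeOperad k).X n) :=
  Submodule.span k {x | IsCorolla G x}

variable {G : Set ℕ}

theorem corollas_le_gen (n : ℕ) : corollas k G n ≤ gen k G n := by
  refine Submodule.span_le.2 fun x hx => ?_
  cases hx with
  | mk N hN σ => exact tm_mem_gen (x := .perm σ (.mul N)) hN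

theorem corollas_graded (n : ℕ) : IsGradedSubmodule ((BurkeOperad k).gr n) (corollas k G n) := by
  refine Submodule.span_le.2 fun x hx => ?_
  cases hx with
  | mk N hN σ =>
    exact Submodule.mem_iSup_of_mem _ ⟨Submodule.subset_span (.mk N hN σ),
      (BurkeOperad k).perm_mem σ (mul_mem N)⟩

theorem perm_mem_corollas {n : ℕ} (σ : Equiv.Perm (Fin n)) {x : (BurkeOperad k).X n}
    (hx : x ∈ corollas k G n) : (BurkeOperad k).perm n σ x ∈ corollas k G n := by
  induction hx using Submodule.span_induction with
  | zero => rw [map_zero]; exact zero_mem _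
  | add x y _ _ hx hy => rw [map_add]; exact add_mem hx hy
  | smul c x _ hx => rw [map_smul]; exact Submodule.smul_mem _ _ hx
  | mem x hx =>
    cases hx with
    | mk N hN τ =>
      have := IsCorolla.mk (k := k) N hN (σ * τ)
      rw [map_mul] at this
      exact Submodule.subset_span this

theorem corollas_eq_bot {n : ℕ} (h : ∀ N ∈ G, N + 2 ≠ n) : corollas k G n = ⊥ := by
  refine (Submodule.span_eq_bot).2 fun x hx => ?_
  cases hx with
  | mk N hN σ => exact absurd rfl (h N hN)

theorem mul_mem_corollas {N : ℕ} (hN : N ∈ G) : mul k N ∈ corollas k G (N + 2) := by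
  have := IsCorolla.mk (k := k) N hN 1
  rw [map_one] at this
  exact Submodule.subset_span this

theorem corollas_mono {G' : Set ℕ} (h : G ⊆ G') (n : ℕ) : corollas k G n ≤ corollas k G' n := by
  refine Submodule.span_mono fun x hx => ?_
  cases hx with
  | mk N hN σ => exact .mk N (h hN) σ

theorem gen_mono {G' : Set ℕ} (h : G ⊆ G') (n : ℕ) : gen k G n ≤ gen k G' n := by
  refine Submodule.span_mono fun x hx => ?_
  cases hx with
  | unit => exact .unit
  | tm x hx =>
    refine .tm x ?_
    induction x with
    | one => trivial
    | mul n => exact h hx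
    | perm σ x ih => exact ih hx
    | circ i e x y ihx ihy => exact ⟨ihx hx.1, ihy hx.2⟩

theorem gen_zero : gen k G 0 = Submodule.span k {unit k} := by
  refine le_antisymm (fun x _ => ?_) (Submodule.span_le.2 (Set.singleton_subset_iff.2 unit_mem_gen))
  obtain ⟨c, rfl⟩ := exists_smul_unit x
  exact Submodule.smul_mem _ _ (Submodule.mem_span_singleton_self _)

/-- The suboperad generated by a set of generators is free: morphisms out of it are the lifts of
`exists_lift`, with the unit sent to zero. -/
theorem isFreeUnitary (hG : IsLowerSet G) : IsFreeUnitary (sub k G hG) (corollas k G) where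
  le := corollas_le_gen
  graded := corollas_graded
  perm_mem := perm_mem_corollas
  arity_zero := corollas_eq_bot fun _ _ => by omega
  arity_one := corollas_eq_bot fun _ _ => by omega
  unit := ⟨unit k, unit_mem, unit_ne_zero k, gen_zero⟩
  universal Q f hf hperm := by
    classical
    let q : ∀ n, Q.X (n + 2) := fun N =>
      if hN : N ∈ G then f (N + 2) ⟨mul k N, mul_mem_corollas hN⟩ else 0
    have hq : ∀ n, q n ∈ Q.gr (n + 2) (-(n : ℤ)) := by
      intro n
      by_cases hn : n ∈ G
      · rw [show q n = _ from dif_pos hn]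
        exact hf _ (mul_mem n)
      · rw [show q n = _ from dif_neg hn]
        exact zero_mem _
    -- compositions in positive arities do not see the unit, which may be sent to zero
    obtain ⟨L⟩ := exists_lift Q 0 hq
    refine ⟨⟨fun n _ => L.app n ∘ₗ (gen k G n).subtype,
      @fun _ _ _ _ hx => L.app_mem (zero_mem _) hq hx,
      L.app_one, fun _ σ x => L.app_perm σ _, fun _ hn _ h i x y => L.app_circ_of_pos hn h i _ _⟩,
      ?_, ?_⟩
    · rintro n hn ⟨x, hx⟩
      refine Submodule.span_induction (p := fun x hx => L.app n x = f n ⟨x, hx⟩) ?_ ?_ ?_ ?_ hx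
      · intro x hx
        cases hx with
        | mk N hN σ =>
          refine (L.app_tm (.perm σ (.mul N))).trans (Eq.trans ?_
            (hperm σ ⟨mul k N, mul_mem_corollas hN⟩).symm)
          exact congrArg (Q.perm _ σ) (dif_pos hN)
      · exact (map_zero _).trans (map_zero (f n)).symm
      · intro x y hx hy ihx ihy
        exact (map_add _ _ _).trans ((congrArg₂ (· + ·) ihx ihy).trans
          (map_add (f n) ⟨x, hx⟩ ⟨y, hy⟩).symm)
      · intro c x hx ihx
        exact (map_smul _ _ _).trans ((congrArg (c • ·) ihx).trans (map_smul (f n) c ⟨x, hx⟩).symm)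
    · intro φ hφ
      have key : ∀ {n : ℕ} (x : Tm n) (hx : x.GensIn G) (hn : 0 < n),
          φ.app n hn ⟨tm k x, tm_mem_gen hx⟩ = x.eval Q q := by
        intro n x hx
        induction x with
        | one => exact fun _ => φ.app_one
        | mul n =>
          exact fun hn => (hφ _ hn ⟨mul k n, mul_mem_corollas hx⟩).trans
            (show q n = f (n + 2) ⟨mul k n, mul_mem_corollas hx⟩ from dif_pos hx).symm
        | perm σ x ih =>
          exact fun hn => (φ.app_perm hn σ ⟨tm k x, tm_mem_gen hx⟩).trans (congrArg _ (ih hx hn))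
        | circ h i x y ihx ihy =>
          exact fun hn => (φ.app_circ x.pos y.pos hn h i ⟨tm k x, tm_mem_gen hx.1⟩
            ⟨tm k y, tm_mem_gen hx.2⟩).trans (congrArg₂ (fun a b => Q.circ h i a b)
              (ihx hx.1 _) (ihy hx.2 _))
      refine PosHom.ext (funext fun n => funext fun hn => LinearMap.ext ?_)
      rintro ⟨x, hx⟩
      refine Submodule.span_induction (p := fun x hx => φ.app n hn ⟨x, hx⟩ = L.app n x)
        ?_ ?_ ?_ ?_ hx
      · intro x hx
        cases hx with
        | unit => exact absurd hn (lt_irrefl 0)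
        | tm x hx => exact (key x hx hn).trans (L.app_tm x).symm
      · exact (map_zero (φ.app n hn)).trans (map_zero _).symm
      · intro x y hx hy ihx ihy
        exact (map_add (φ.app n hn) ⟨x, hx⟩ ⟨y, hy⟩).trans
          ((congrArg₂ (· + ·) ihx ihy).trans (map_add _ _ _).symm)
      · intro c x hx ihx
        exact (map_smul (φ.app n hn) c ⟨x, hx⟩).trans
          ((congrArg (c • ·) ihx).trans (map_smul _ _ _).symm)

/-- The generators of arity at most `n`. -/
def upTo (n : ℕ) : Set ℕ := {N | N + 2 ≤ n}

theorem isLowerSet_upTo (n : ℕ) : IsLowerSet (upTo n) := fun a b hab ha => by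
  have h1 : a + 2 ≤ n := ha
  exact (show b + 2 ≤ n by omega)

theorem gensIn_upTo {m n : ℕ} (x : Tm m) (h : m ≤ n) : x.GensIn (upTo n) := by
  induction x with
  | one => trivial
  | mul N => exact h
  | perm σ x ih => exact ih h
  | circ e i x y ihx ihy =>
    have := x.pos
    have := y.pos
    exact ⟨ihx (by omega), ihy (by omega)⟩

/-- In arity `m`, only generators of arity at most `m` occur. -/
theorem gen_upTo {m n : ℕ} (h : m ≤ n) : gen k (upTo n) m = ⊤ := by
  rw [eq_top_iff, ← gen_univ (k := k) m]
  refine Submodule.span_mono fun x hx => ?_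
  cases hx with
  | unit => exact .unit
  | tm x _ => exact .tm x (gensIn_upTo x h)

theorem corollas_upTo (n m : ℕ) :
    ⨆ j ∈ Finset.Icc 2 n, corollas k {N | N + 2 = j} m = corollas k (upTo n) m := by
  refine le_antisymm (iSup₂_le fun j hj => corollas_mono (fun N hN => ?_) m)
    (Submodule.span_le.2 fun x hx => ?_)
  · have h1 : N + 2 = j := hN
    exact (show N + 2 ≤ n from h1.trans_le (Finset.mem_Icc.1 hj).2)
  · cases hx with
    | mk N hN σ =>
      exact Submodule.mem_iSup_of_mem (N + 2) (Submodule.mem_iSup_of_mem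
        (Finset.mem_Icc.2 ⟨by omega, hN⟩) (Submodule.subset_span (.mk N (Set.mem_ofPred_eq ▸ rfl) σ)))

theorem corollas_upTo_succ (n m : ℕ) : corollas k (upTo n) m ⊔ corollas k {N | N + 2 = n + 1} m =
    corollas k (upTo (n + 1)) m := by
  refine le_antisymm (sup_le (corollas_mono (fun N hN => ?_) m)
    (corollas_mono (fun N hN => ?_) m)) (Submodule.span_le.2 fun x hx => ?_)
  · have h1 : N + 2 ≤ n := hN
    exact (show N + 2 ≤ n + 1 by omega)
  · have h1 : N + 2 = n + 1 := hN
    exact (show N + 2 ≤ n + 1 by omega)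
  · cases hx with
    | mk N hN σ =>
      have h1 : N + 2 ≤ n + 1 := hN
      rcases h1.lt_or_eq with h2 | h2
      · exact Submodule.mem_sup_left (Submodule.subset_span
          (.mk N (show N + 2 ≤ n by omega) σ))
      · exact Submodule.mem_sup_right (Submodule.subset_span (.mk N h2 σ))

theorem d_mul_mem_gen (N : ℕ) :
    (BurkeOperad k).d (N + 2) (mul k N) ∈ gen k {j | j < N} (N + 2) := by
  refine (d_mul (k := k) N).symm ▸ neg_mem (sum_mem fun s _ => sum_mem fun r _ =>
    Mon.sign_smul_mem _ _ (circ_mem_gen _ r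
      (tm_mem_gen (x := .mul (N - s.val - 1)) (G := {j | j < N}) ?_)
      (tm_mem_gen (x := .mul s.val) (G := {j | j < N}) s.2)))
  exact (show N - s.val - 1 < N by omega)

theorem mul_circ_unit_mem_gen {N l : ℕ} (h : l + 1 = N + 2 + 0) (i : Fin (N + 2)) :
    (BurkeOperad k).circ h i (mul k N) (unit k) ∈ gen k G l := by
  obtain rfl : l = N + 1 := by omega
  cases N with
  | zero => exact (mul_two_unit (k := k) i).symm ▸ tm_mem_gen (x := .one) trivial
  | succ n => exact (mul_unit (k := k) n i).symm ▸ zero_mem _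

/-- The extension by the generator of arity `n + 1`. -/
theorem isUnitaryPrincipalExtension (n : ℕ) (hn : 1 ≤ n) :
    IsUnitaryPrincipalExtension (n + 1) (sub k (upTo n) (isLowerSet_upTo n))
      (sub k (upTo (n + 1)) (isLowerSet_upTo (n + 1))) (corollas k (upTo n))
      (corollas k {N | N + 2 = n + 1}) where
  two_le := by omega
  le := gen_mono fun N hN => by
    have h1 : N + 2 ≤ n := hN
    exact (show N + 2 ≤ n + 1 by omega)
  free := isFreeUnitary _
  arity m hm := corollas_eq_bot fun N hN e => hm (e.symm.trans hN)
  graded := corollas_graded _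
  perm_mem := perm_mem_corollas
  disjoint := by
    have : corollas k (upTo n) (n + 1) = ⊥ := corollas_eq_bot fun N hN => by
      have h1 : N + 2 ≤ n := hN
      omega
    rw [this]
    exact disjoint_bot_left
  free' := by
    rw [funext fun m => corollas_upTo_succ (k := k) n m]
    exact isFreeUnitary _
  d_mem := by
    intro e he
    change (BurkeOperad k).d (n + 1) e ∈ gen k (upTo n) (n + 1)
    induction he using Submodule.span_induction with
    | zero => rw [map_zero]; exact zero_mem _
    | add x y _ _ hx hy => rw [map_add]; exact add_mem hx hy
    | smul c x _ hx => rw [map_smul]; exact Submodule.smul_mem _ _ hx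
    | mem x hx =>
      obtain ⟨N, rfl⟩ : ∃ N, n = N + 1 := ⟨n - 1, by omega⟩
      have aux : ∀ {m : ℕ} {x : (BurkeOperad k).X m}, IsCorolla {M | M + 2 = N + 1 + 1} x →
          (BurkeOperad k).d m x ∈ gen k (upTo (N + 1)) m := by
        rintro _ _ ⟨M, hM, σ⟩
        have h1 : M + 2 = N + 1 + 1 := hM
        rw [(BurkeOperad k).d_perm]
        exact perm_mem_gen σ (gen_mono (fun j (hj : j < M) =>
          show j + 2 ≤ N + 1 by omega) _ (d_mul_mem_gen M))
      exact aux hx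
  restrict_mem := by
    intro l h i e e₀ he he₀
    obtain ⟨c, rfl⟩ := exists_smul_unit e₀
    rw [map_smul]
    refine Submodule.smul_mem _ _ ?_
    change (BurkeOperad k).circ h i e (unit k) ∈ gen k (upTo n) l
    induction he using Submodule.span_induction with
    | zero => rw [map_zero, LinearMap.zero_apply]; exact zero_mem _
    | add x y _ _ hx hy => rw [map_add, LinearMap.add_apply]; exact add_mem hx hy
    | smul c x _ hx => rw [map_smul, LinearMap.smul_apply]; exact Submodule.smul_mem _ _ hx
    | mem x hx =>
      have aux : ∀ {m : ℕ} {x : (BurkeOperad k).X m} (h : l + 1 = m + 0) (i : Fin m),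
          IsCorolla {M | M + 2 = n + 1} x →
          (BurkeOperad k).circ h i x (unit k) ∈ gen k (upTo n) l := by
        rintro _ _ h i ⟨M, hM, σ⟩
        have := (BurkeOperad k).circ_perm h (σ.symm i) σ 1 (mul k M) (unit k)
        rw [σ.apply_symm_apply, perm_zero] at this
        exact this ▸ perm_mem_gen _ (mul_circ_unit_mem_gen h _)
      exact aux h i hx

end BurkeOperad

/-- The augmentation is a Sullivan minimal model. -/
theorem isSullivanMinimalModel_augmentation {β : DGOperad.Hom (BurkeOperad k) (AssPlus k)}
    (hu : β.app 0 (BurkeOperad.unit k) = AssPlus.unit k)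
    (hβ : ∀ n, β.app (n + 2) (BurkeOperad.mul k n) = AssPlus.gens k n) :
    IsSullivanMinimalModel β := by
  refine ⟨quasiIsoOn_augmentation hu hβ,
    fun n => BurkeOperad.sub k (BurkeOperad.upTo n) (BurkeOperad.isLowerSet_upTo n),
    fun j => BurkeOperad.corollas k {N | N + 2 = j}, ?_, ?_, ?_, ?_⟩
  · have h : (fun m => BurkeOperad.corollas k (BurkeOperad.upTo 1) m) = fun _ => ⊥ :=
      funext fun m => BurkeOperad.corollas_eq_bot fun N hN => by
        have h1 : N + 2 ≤ 1 := hN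
        omega
    exact h ▸ BurkeOperad.isFreeUnitary _
  · intro n hn
    rw [funext fun m => BurkeOperad.corollas_upTo (k := k) n m]
    exact BurkeOperad.isUnitaryPrincipalExtension n hn
  · intro m x
    refine ⟨m + 1, by omega, ?_⟩
    change x ∈ BurkeOperad.gen k _ m
    rw [BurkeOperad.gen_upTo (Nat.le_succ m)]
    trivial
  · intro n _ m hm
    change QuasiIsoOn β m (BurkeOperad.gen k _ m)
    rw [BurkeOperad.gen_upTo hm]
    exact quasiIsoOn_augmentation hu hβ m

end Sullivan


/-! ### Generation of free operads -/

section Generation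

variable {k : Type u} [Field k]

theorem isInternal_comap {V : Type v} [AddCommGroup V] [Module k V] {gr : ℤ → Submodule k V}
    (hgr : DirectSum.IsInternal gr) {T : Submodule k V} (hT : IsGradedSubmodule gr T) :
    DirectSum.IsInternal fun a => (gr a).comap T.subtype := by
  rw [DirectSum.isInternal_submodule_iff_iSupIndep_and_iSup_eq_top]
  constructor
  · intro a
    rw [Submodule.disjoint_def]
    intro x hx hx'
    have h1 : (⨆ (b : ℤ) (_ : b ≠ a), (gr b).comap T.subtype) ≤
        (⨆ (b : ℤ) (_ : b ≠ a), gr b).comap T.subtype :=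
      iSup₂_le fun b hb => Submodule.comap_mono (le_iSup₂_of_le b hb le_rfl)
    exact Subtype.ext (Submodule.disjoint_def.1 (hgr.submodule_iSupIndep a) x hx (h1 hx'))
  · apply Submodule.map_injective_of_injective T.injective_subtype
    rw [Submodule.map_iSup, Submodule.map_subtype_top]
    refine le_antisymm (iSup_le fun a => Submodule.map_subtype_le _ _) (hT.trans_eq ?_)
    exact iSup_congr fun a => (Submodule.map_comap_subtype _ _).symm

theorem isGradedSubmodule_top {V : Type v} [AddCommGroup V] [Module k V] {gr : ℤ → Submodule k V}
    (hgr : DirectSum.IsInternal gr) : IsGradedSubmodule gr ⊤ := by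
  rw [IsGradedSubmodule, ← hgr.submodule_iSup_eq_top]
  exact iSup_mono fun a => le_inf (le_iSup gr a) le_rfl

theorem IsGradedSubmodule.sup {V : Type v} [AddCommGroup V] [Module k V] {gr : ℤ → Submodule k V}
    {S T : Submodule k V} (hS : IsGradedSubmodule gr S) (hT : IsGradedSubmodule gr T) :
    IsGradedSubmodule gr (S ⊔ T) :=
  sup_le (hS.trans (iSup_mono fun _ => inf_le_inf_right _ le_sup_left))
    (hT.trans (iSup_mono fun _ => inf_le_inf_right _ le_sup_right))

/-- Graded suboperads. -/
structure IsSuboperad (P : GradedOperad.{u, v} k) (T : ∀ n, Submodule k (P.X n)) : Prop where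
  graded : ∀ n, IsGradedSubmodule (P.gr n) (T n)
  one_mem : P.one ∈ T 1
  perm_mem : ∀ {n : ℕ} (σ : Equiv.Perm (Fin n)) {x : P.X n}, x ∈ T n → P.perm n σ x ∈ T n
  circ_mem : ∀ {m n l : ℕ} (h : l + 1 = m + n) (i : Fin m) {x : P.X m} {y : P.X n},
    x ∈ T m → y ∈ T n → P.circ h i x y ∈ T l

/-- A graded suboperad, as a graded operad. -/
abbrev IsSuboperad.toOperad {P : GradedOperad.{u, v} k} {T : ∀ n, Submodule k (P.X n)}
    (hT : IsSuboperad P T) : GradedOperad.{u, v} k where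
  X n := T n
  gr n a := (P.gr n a).comap (T n).subtype
  internal n := isInternal_comap (P.internal n) (hT.graded n)
  one := ⟨P.one, hT.one_mem⟩
  one_mem := P.one_mem
  perm n :=
    { toFun := fun σ => (P.perm n σ).restrict fun _ hx => hT.perm_mem σ hx
      map_one' := LinearMap.ext fun x => Subtype.ext (by simp)
      map_mul' := fun σ τ => LinearMap.ext fun x => Subtype.ext (by simp) }
  perm_mem σ _ hx := P.perm_mem σ hx
  circ h i := LinearMap.mk₂ k (fun x y => ⟨P.circ h i x y, hT.circ_mem h i x.2 y.2⟩)
    (fun _ _ _ => Subtype.ext (by simp)) (fun _ _ _ => Subtype.ext (by simp))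
    (fun _ _ _ => Subtype.ext (by simp)) (fun _ _ _ => Subtype.ext (by simp))
  circ_mem h i _ _ _ _ hx hy := P.circ_mem h i hx hy
  circ_one i x := Subtype.ext (P.circ_one i x.1)
  one_circ h x := Subtype.ext (P.one_circ h x.1)
  circ_seq h₁ h₂ h₃ h₄ i j x y z := Subtype.ext (P.circ_seq h₁ h₂ h₃ h₄ i j x.1 y.1 z.1)
  circ_par {_ _ _ _ _ q} h₁ h₂ h₃ h₄ i j hij b c x y z hy hz := Subtype.ext
    ((P.circ_par h₁ h₂ h₃ h₄ i j hij x.1 y.1 z.1 hy hz).trans (Mon.map_sign (T q).subtype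
      (b * c).negOnePow ⟨_, hT.circ_mem h₄ _ (hT.circ_mem h₃ j x.2 z.2) y.2⟩).symm)
  circ_perm h i σ τ x y := Subtype.ext (P.circ_perm h i σ τ x.1 y.1)

variable {P : DGOperad.{u, v} k} {S S' : DGSuboperad P} {M E : ∀ n, Submodule k (P.X n)}

theorem DGSuboperad.isSuboperad (S : DGSuboperad P) : IsSuboperad P.toGradedOperad S.carrier :=
  ⟨S.graded, S.one_mem, S.perm_mem, S.circ_mem⟩

/-- A morphism which is the identity on the generators is the identity. -/
theorem IsFreeUnitary.app_eq_self (h : IsFreeUnitary S M) (φ : PosHom S P.toGradedOperad)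
    (hφ : ∀ n hn (x : M n), φ.app n hn ⟨x, h.le n x.2⟩ = x) {n : ℕ} (hn : 0 < n)
    (x : S.carrier n) : φ.app n hn x = x := by
  let ι : PosHom S P.toGradedOperad := ⟨fun n _ => (S.carrier n).subtype,
    @fun _ _ _ _ hx => hx, rfl,
    fun _ _ _ => rfl, fun _ _ _ _ _ _ _ => rfl⟩
  have := (h.universal P.toGradedOperad (fun n => (M n).subtype) (fun _ hx => hx)
    fun _ _ => rfl).unique (y₁ := φ) (y₂ := ι) hφ fun _ _ _ => rfl
  rw [this]
  rfl

/-- A suboperad containing the generators is everything: composed with its inclusion, the morphism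
into it which fixes the generators is the identity. -/
theorem IsFreeUnitary.le_of_isSuboperad (h : IsFreeUnitary S M) {T : ∀ n, Submodule k (P.X n)}
    (hT : IsSuboperad P.toGradedOperad T) (hM : ∀ n, M n ≤ T n) {n : ℕ} (hn : 0 < n) :
    S.carrier n ≤ T n := by
  obtain ⟨ψ, hψ, -⟩ := h.universal hT.toOperad
    (fun n => show M n →ₗ[k] T n from Submodule.inclusion (hM n))
    (fun _ hx => hx) fun _ _ => rfl
  intro x hx
  have := h.app_eq_self ⟨fun n hn => (T n).subtype ∘ₗ ψ.app n hn, @fun _ hn _ x hx =>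
    ψ.app_mem hn x hx, congrArg Subtype.val ψ.app_one, fun hn σ x =>
    congrArg Subtype.val (ψ.app_perm hn σ x), fun hm hn hl h i x y =>
    congrArg Subtype.val (ψ.app_circ hm hn hl h i x y)⟩
    (fun n hn x => congrArg Subtype.val (hψ n hn x)) hn ⟨x, hx⟩
  have hy : (show T n from ψ.app n hn ⟨x, hx⟩).1 = x := this
  exact hy ▸ (show T n from ψ.app n hn ⟨x, hx⟩).2

namespace IsUnitaryPrincipalExtension

variable {N : ℕ} (h : IsUnitaryPrincipalExtension N S S' M E)

include h

theorem perm_mem' {m : ℕ} (σ : Equiv.Perm (Fin m)) {x : P.X m} (hx : x ∈ E m) :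
    P.perm m σ x ∈ E m := by
  by_cases hm : m = N
  · subst hm
    exact h.perm_mem σ hx
  · rw [h.arity m hm, Submodule.mem_bot] at hx
    rw [hx, map_zero]
    exact zero_mem _

theorem graded' (m : ℕ) : IsGradedSubmodule (P.gr m) (E m) := by
  by_cases hm : m = N
  · subst hm
    exact h.graded
  · rw [h.arity m hm]
    exact bot_le

omit h in
/-- The suboperad which contains, in arity one, only the multiples of the identity, and which is
the given one in arities at most `N`. -/
def trunc (N : ℕ) (T : ∀ n, Submodule k (P.X n)) : ∀ m, Submodule k (P.X m)
  | 0 => ⊥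
  | 1 => Submodule.span k {P.one}
  | m + 2 => if m + 2 ≤ N then T (m + 2) else ⊤

theorem isSuboperad_trunc :
    IsSuboperad P.toGradedOperad (trunc N fun m => S.carrier m ⊔ E m) where
  graded m := match m with
    | 0 => bot_le
    | 1 => Submodule.span_le.2 (Set.singleton_subset_iff.2 (Submodule.mem_iSup_of_mem 0
        ⟨Submodule.mem_span_singleton_self _, P.one_mem⟩))
    | m + 2 => by
      rw [trunc]
      split_ifs
      · exact (S.graded _).sup (h.graded' _)
      · exact isGradedSubmodule_top (P.internal _)
  one_mem := Submodule.mem_span_singleton_self _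
  perm_mem {m} σ x hx := match m with
    | 0 => by rwa [perm_zero]
    | 1 => by rwa [Subsingleton.elim σ 1, map_one]
    | m + 2 => by
      rw [trunc] at hx ⊢
      split_ifs at hx ⊢
      · obtain ⟨y, hy, z, hz, rfl⟩ := Submodule.mem_sup.1 hx
        rw [map_add]
        exact add_mem (Submodule.mem_sup_left (S.perm_mem σ hy))
          (Submodule.mem_sup_right (h.perm_mem' σ hz))
      · trivial
  circ_mem {m n l} e i x y hx hy := match m, n with
    | 0, _ => i.elim0
    | m + 1, 0 => by
      rw [(Submodule.mem_bot k).1 hy, map_zero]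
      exact zero_mem _
    | 1, n + 1 => by
      obtain rfl : l = n + 1 := by omega
      obtain ⟨c, rfl⟩ := Submodule.mem_span_singleton.1 hx
      rw [Subsingleton.elim i 0, map_smul, LinearMap.smul_apply, P.one_circ]
      exact Submodule.smul_mem _ _ hy
    | m + 2, 1 => by
      obtain rfl : l = m + 2 := by omega
      obtain ⟨c, rfl⟩ := Submodule.mem_span_singleton.1 hy
      rw [map_smul, P.circ_one]
      exact Submodule.smul_mem _ _ hx
    | m + 2, n + 2 => by
      obtain rfl : l = m + n + 1 + 2 := by omega
      rw [trunc]
      split_ifs with hl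
      · -- both operations have arity less than `N`
        rw [trunc, if_pos (by omega), h.arity _ (by omega), sup_bot_eq] at hx hy
        exact Submodule.mem_sup_left (S.circ_mem e i hx hy)
      · trivial

/-- In arities at most `N`, an extension by generators of arity `N` is the sum of the given operad
and the space of generators. -/
theorem le_trunc {m : ℕ} (hm : 0 < m) :
    S'.carrier m ≤ trunc N (fun m => S.carrier m ⊔ E m) m := by
  refine h.free'.le_of_isSuboperad h.isSuboperad_trunc (fun m => ?_) hm
  match m with
  | 0 => exact h.free'.arity_zero.le
  | 1 => exact h.free'.arity_one.trans_le bot_le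
  | m + 2 =>
    rw [trunc]
    split_ifs
    · exact sup_le_sup_right (h.free.le _) _
    · exact le_top

theorem le_sup {m : ℕ} (hm : 0 < m) (hN : m ≤ N) : S'.carrier m ≤ S.carrier m ⊔ E m := by
  have := h.le_trunc hm
  match m with
  | 1 => exact this.trans (Submodule.span_le.2
      (Set.singleton_subset_iff.2 (Submodule.mem_sup_left S.one_mem)))
  | m + 2 => rwa [trunc, if_pos hN] at this

/-- The differential in arity `n + 1` takes values in the suboperad generated in smaller arities.
-/
theorem d_mem' {x : P.X N} (hx : x ∈ S'.carrier N) : P.d N x ∈ S.carrier N := by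
  have h2 := h.two_le
  obtain ⟨y, hy, z, hz, rfl⟩ := Submodule.mem_sup.1 (h.le_sup (by omega) le_rfl hx)
  rw [map_add]
  exact add_mem (S.d_mem hy) (h.d_mem hz)

end IsUnitaryPrincipalExtension

/-! ### The tower of a minimal model -/

/-- An exhaustive tower of unitary principal extensions, one in each arity. -/
structure IsTower (S : ℕ → DGSuboperad P) (E : ℕ → ∀ m, Submodule k (P.X m)) : Prop where
  ext : ∀ n, 1 ≤ n → IsUnitaryPrincipalExtension (n + 1) (S n) (S (n + 1))
    (fun m => ⨆ j ∈ Finset.Icc 2 n, E j m) (E (n + 1))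
  exhaustive : ∀ m (x : P.X m), ∃ n, 1 ≤ n ∧ x ∈ (S n).carrier m

namespace IsTower

variable {S : ℕ → DGSuboperad P} {E : ℕ → ∀ m, Submodule k (P.X m)} (h : IsTower S E)

include h

theorem generators_eq_bot {n m : ℕ} (hnm : n < m) : ⨆ j ∈ Finset.Icc 2 n, E j m = ⊥ := by
  simp only [iSup_eq_bot]
  intro j hj
  obtain ⟨h1, h2⟩ := Finset.mem_Icc.1 hj
  obtain ⟨j, rfl⟩ : ∃ i, j = i + 1 := ⟨j - 1, by omega⟩
  exact (h.ext j (by omega)).arity m (by omega)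

theorem mono {n n' : ℕ} (hn : 1 ≤ n) (hn' : n ≤ n') (m : ℕ) :
    (S n).carrier m ≤ (S n').carrier m := by
  induction n', hn' using Nat.le_induction with
  | base => exact le_rfl
  | succ n' hn' ih => exact ih.trans ((h.ext n' (hn.trans hn')).le m)

/-- In arity `m`, the tower is constant from stage `m` on. -/
theorem eq_top {n m : ℕ} (hm : 0 < m) (hn : m ≤ n) : (S n).carrier m = ⊤ := by
  have key : ∀ n', n ≤ n' → (S n').carrier m ≤ (S n).carrier m := by
    intro n' hn'
    induction n', hn' using Nat.le_induction with
    | base => exact le_rfl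
    | succ n' hn' ih =>
      have h1 := (h.ext n' (by omega)).le_sup hm (by omega)
      rw [(h.ext n' (by omega)).arity m (by omega), sup_bot_eq] at h1
      exact h1.trans ih
  rw [eq_top_iff]
  intro x _
  obtain ⟨n', h1, hx⟩ := h.exhaustive m x
  rcases le_total n n' with h2 | h2
  · exact key n' h2 hx
  · exact h.mono h1 h2 m hx

theorem d_mem {n : ℕ} (hn : 1 ≤ n) (x : P.X (n + 1)) : P.d (n + 1) x ∈ (S n).carrier (n + 1) :=
  (h.ext n hn).d_mem' (h.eq_top n.succ_pos le_rfl ▸ Submodule.mem_top)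

theorem arity_one (x : P.X 1) : ∃ c : k, x = c • P.one := by
  have hx : x ∈ (S 2).carrier 1 := h.eq_top Nat.one_pos one_le_two ▸ Submodule.mem_top
  exact (Submodule.mem_span_singleton.1 ((h.ext 1 le_rfl).le_trunc Nat.one_pos hx)).imp
    fun _ => Eq.symm

theorem arity_zero : ∃ e ∈ P.gr 0 0, e ≠ 0 ∧ ∀ x : P.X 0, ∃ c : k, x = c • e := by
  obtain ⟨e, he, h0, hS⟩ := (h.ext 1 le_rfl).free.unit
  refine ⟨e, he, h0, fun x => ?_⟩
  obtain ⟨n, hn, hx⟩ := h.exhaustive 0 x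
  obtain ⟨e', -, -, hS'⟩ := (h.ext n hn).free.unit
  have h1 : e ∈ (S n).carrier 0 :=
    h.mono le_rfl hn 0 (hS ▸ Submodule.mem_span_singleton_self e)
  rw [hS', Submodule.mem_span_singleton] at h1 hx
  obtain ⟨a, rfl⟩ := h1
  obtain ⟨b, rfl⟩ := hx
  have ha : a ≠ 0 := fun ha => h0 (by rw [ha, zero_smul])
  exact ⟨b * a⁻¹, by rw [smul_smul, mul_assoc, inv_mul_cancel₀ ha, mul_one]⟩

end IsTower

end Generation


/-! ### Comparison of minimal models -/

section Comparison

variable {k : Type u} [Field k] {P : DGOperad.{u, u} k}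

open BurkeOperad

/-- If a morphism is bijective on the arities of the generators of a free operad `S`, then it
identifies the suboperad generated by the generators of these arities with `S`. -/
theorem IsFreeUnitary.bijOn_gen {S : DGSuboperad P} {M : ∀ n, Submodule k (P.X n)}
    (hS : IsFreeUnitary S M) {φ : DGOperad.Hom (BurkeOperad k) P} {n : ℕ}
    (hM : ∀ m, n < m → M m = ⊥) (hφ : ∀ m, 2 ≤ m → m ≤ n → Function.Bijective (φ.app m))
    (hmul : ∀ N, N + 2 ≤ n → φ.app (N + 2) (mul k N) ∈ S.carrier (N + 2)) {m : ℕ} (hm : 0 < m) :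
    (∀ y ∈ gen k (upTo n) m, φ.app m y = 0 → y = 0) ∧
      ∀ x ∈ S.carrier m, ∃ y ∈ gen k (upTo n) m, φ.app m y = x := by
  have hcase : ∀ m, M m = ⊥ ∨ 2 ≤ m ∧ m ≤ n := by
    intro m
    by_cases h2 : 2 ≤ m
    · by_cases hn : m ≤ n
      · exact Or.inr ⟨h2, hn⟩
      · exact Or.inl (hM m (by omega))
    · interval_cases m
      · exact Or.inl hS.arity_zero
      · exact Or.inl hS.arity_one
  -- the inverse of `φ`, on generators, and its extension `ψ` to a morphism of operads
  have hf : ∀ m, ∃ f : M m →ₗ[k] gen k (upTo n) m, ∀ x, φ.app m (f x) = x := by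
    intro m
    rcases hcase m with h0 | ⟨h2, hn⟩
    · refine ⟨0, fun x => ?_⟩
      have hx : (x : P.X m) = 0 := (Submodule.mem_bot k).1 (h0 ▸ x.2)
      exact (map_zero (φ.app m)).trans hx.symm
    · let e := LinearEquiv.ofBijective (φ.app m) (hφ m h2 hn)
      exact ⟨(e.symm.toLinearMap ∘ₗ (M m).subtype).codRestrict _ fun x =>
        gen_upTo (k := k) hn ▸ Submodule.mem_top, fun x => e.apply_symm_apply x.1⟩
  choose f hf using hf
  have hT : IsSuboperad (BurkeOperad k).toGradedOperad (gen k (upTo n)) :=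
    (sub k (upTo n) (isLowerSet_upTo n)).isSuboperad
  obtain ⟨ψ, hψ, -⟩ := hS.universal hT.toOperad f
    (fun {m a} x hx => by
      rcases hcase m with h0 | ⟨h2, hn⟩
      · obtain rfl : x = 0 := Subtype.ext ((Submodule.mem_bot k).1 (h0 ▸ x.2))
        exact (show f m 0 = 0 from map_zero _).symm ▸ zero_mem _
      · exact φ.mem_of_injective (hφ m h2 hn).1 ((hf m x).symm ▸ hx))
    (fun {m} σ x => by
      rcases hcase m with h0 | ⟨h2, hn⟩
      · obtain rfl : x = 0 := Subtype.ext ((Submodule.mem_bot k).1 (h0 ▸ x.2))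
        have h1 : (⟨P.perm m σ (0 : M m), hS.perm_mem σ (0 : M m).2⟩ : M m) = 0 :=
          Subtype.ext (map_zero _)
        exact (congrArg (f m) h1).trans ((show f m 0 = 0 from map_zero _).trans
          ((congrArg (hT.toOperad.perm m σ) (show f m 0 = 0 from map_zero _)).trans
            (map_zero (hT.toOperad.perm m σ))).symm)
      · refine Subtype.ext ((hφ m h2 hn).1 ((hf m _).trans ?_))
        exact ((φ.app_perm σ _).trans (congrArg _ (hf m x))).symm)
  have hright : ∀ {m : ℕ} (hm : 0 < m) (x : S.carrier m),
      φ.app m (show gen k (upTo n) m from ψ.app m hm x) = x :=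
    hS.app_eq_self ⟨fun m hm => φ.app m ∘ₗ (gen k (upTo n) m).subtype ∘ₗ ψ.app m hm,
      @fun _ hm _ x hx => φ.app_mem (ψ.app_mem hm x hx),
      (congrArg (fun y : gen k (upTo n) 1 => φ.app 1 y) ψ.app_one).trans φ.app_one,
      @fun m hm σ x => (congrArg (fun y : gen k (upTo n) m => φ.app m y)
        (ψ.app_perm hm σ x)).trans (φ.app_perm σ _),
      @fun _ _ l hm hn hl h i x y => (congrArg (fun y : gen k (upTo n) l => φ.app l y)
        (ψ.app_circ hm hn hl h i x y)).trans (φ.app_circ h i _ _)⟩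
      (fun m hm x => (congrArg (fun y : gen k (upTo n) m => φ.app m y) (hψ m hm x)).trans
        (hf m x))
  have htm : ∀ {m : ℕ} {x : Tm m}, x.GensIn (upTo n) → φ.app m (tm k x) ∈ S.carrier m := by
    intro m x hx
    induction x with
    | one => exact φ.app_one ▸ S.one_mem
    | mul N => exact hmul N hx
    | perm σ x ih => exact φ.app_perm σ (tm k x) ▸ S.perm_mem σ (ih hx)
    | circ h i x y ihx ihy =>
      exact φ.app_circ h i (tm k x) (tm k y) ▸ S.circ_mem h i (ihx hx.1) (ihy hx.2)
  have hleft : ∀ {m : ℕ} {x : Tm m} (hx : x.GensIn (upTo n)) (hm : 0 < m),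
      ψ.app m hm ⟨φ.app m (tm k x), htm hx⟩ = (⟨tm k x, tm_mem_gen hx⟩ : gen k (upTo n) m) := by
    intro m x hx hm
    induction x with
    | one => exact (congrArg (ψ.app 1 hm) (Subtype.ext φ.app_one)).trans ψ.app_one
    | mul N => exact Subtype.ext ((hφ _ (by omega) hx).1 (hright hm ⟨_, htm hx⟩))
    | perm σ x ih =>
      exact (congrArg (ψ.app _ hm) (Subtype.ext (φ.app_perm σ (tm k x)))).trans
        ((ψ.app_perm hm σ ⟨_, htm (x := x) hx⟩).trans (congrArg (hT.toOperad.perm _ σ) (ih hx hm)))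
    | circ h i x y ihx ihy =>
      exact (congrArg (ψ.app _ hm) (Subtype.ext (φ.app_circ h i (tm k x) (tm k y)))).trans
        ((ψ.app_circ x.pos y.pos hm h i ⟨_, htm hx.1⟩ ⟨_, htm hx.2⟩).trans
          (congrArg₂ (fun a b => hT.toOperad.circ h i a b) (ihx hx.1 _) (ihy hx.2 _)))
  refine ⟨fun y hy hy0 => ?_, fun x hx => ⟨_, (show gen k (upTo n) m from
    ψ.app m hm ⟨x, hx⟩).2, hright hm ⟨x, hx⟩⟩⟩
  have key : ∃ h : φ.app m y ∈ S.carrier m,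
      (show gen k (upTo n) m from ψ.app m hm ⟨φ.app m y, h⟩).1 = y := by
    refine gen_induction (p := fun y => ∃ h : φ.app m y ∈ S.carrier m,
      (show gen k (upTo n) m from ψ.app m hm ⟨φ.app m y, h⟩).1 = y) ?_ ?_ ?_ ?_ ?_ hy
    · refine ⟨map_zero (φ.app m) ▸ zero_mem _, ?_⟩
      exact congrArg Subtype.val ((congrArg (ψ.app m hm) (Subtype.ext (map_zero _))).trans
        (map_zero (ψ.app m hm)))
    · rintro y z ⟨hy, hy'⟩ ⟨hz, hz'⟩
      refine ⟨map_add (φ.app m) y z ▸ add_mem hy hz, ?_⟩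
      exact (congrArg Subtype.val ((congrArg (ψ.app m hm) (Subtype.ext (map_add _ _ _))).trans
        (map_add (ψ.app m hm) ⟨_, hy⟩ ⟨_, hz⟩))).trans (congrArg₂ (· + ·) hy' hz')
    · rintro c y ⟨hy, hy'⟩
      refine ⟨map_smul (φ.app m) c y ▸ Submodule.smul_mem _ _ hy, ?_⟩
      exact (congrArg Subtype.val ((congrArg (ψ.app m hm) (Subtype.ext (map_smul _ _ _))).trans
        (map_smul (ψ.app m hm) c ⟨_, hy⟩))).trans (congrArg (c • ·) hy')
    · rintro z rfl _
      exact absurd hm (lt_irrefl 0)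
    · exact fun x hx => ⟨htm hx, congrArg Subtype.val (hleft hx hm)⟩
  obtain ⟨h, hy'⟩ := key
  rw [← hy']
  exact congrArg Subtype.val ((congrArg (ψ.app m hm) (Subtype.ext hy0)).trans
    (map_zero (ψ.app m hm)))

/-- A morphism of minimal models over `Ass₊` is bijective.  By induction on the arity: in arity
`n + 1` the boundaries lie in the suboperads generated in smaller arities, which are identified by
the induction hypothesis, and both operads have the same cohomology. -/
theorem bijective_of_augmentation {S : ℕ → DGSuboperad P} {E : ℕ → ∀ m, Submodule k (P.X m)}
    (hT : IsTower S E) {ρ : DGOperad.Hom P (AssPlus k)} (hρ : ∀ n, QuasiIsoOn ρ n ⊤)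
    {β : DGOperad.Hom (BurkeOperad k) (AssPlus k)} (hβ : ∀ n, QuasiIsoOn β n ⊤)
    (hβu : β.app 0 (unit k) ≠ 0) {φ : DGOperad.Hom (BurkeOperad k) P}
    (hφ : ∀ n x, ρ.app n (φ.app n x) = β.app n x) (n : ℕ) : Function.Bijective (φ.app n) := by
  have hd : ∀ {m : ℕ} (y : (AssPlus k).X m), (AssPlus k).d m y = 0 := fun _ => rfl
  have hzero : Function.Bijective (φ.app 0) := by
    obtain ⟨e, -, he, hP⟩ := hT.arity_zero
    obtain ⟨c, hc⟩ := hP (φ.app 0 (unit k))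
    have hc0 : c ≠ 0 := by
      rintro rfl
      rw [zero_smul] at hc
      exact hβu (by rw [← hφ, hc, map_zero])
    constructor
    · refine (injective_iff_map_eq_zero _).2 fun x hx => ?_
      obtain ⟨a, rfl⟩ := exists_smul_unit x
      rw [map_smul, hc, smul_smul, smul_eq_zero_iff_left he] at hx
      rw [(mul_eq_zero.1 hx).resolve_right hc0, zero_smul]
    · intro x
      obtain ⟨a, rfl⟩ := hP x
      exact ⟨(a * c⁻¹) • unit k, by
        rw [map_smul, hc, smul_smul, mul_assoc, inv_mul_cancel₀ hc0, mul_one]⟩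
  have hK : ∀ {n : ℕ}, 1 ≤ n → (∀ m, 2 ≤ m → m ≤ n → Function.Bijective (φ.app m)) →
      ∀ {m : ℕ}, 0 < m → (∀ y ∈ gen k (upTo n) m, φ.app m y = 0 → y = 0) ∧
        ∀ x ∈ (S n).carrier m, ∃ y ∈ gen k (upTo n) m, φ.app m y = x := fun hn h _ hm =>
    (hT.ext _ hn).free.bijOn_gen (fun _ => hT.generators_eq_bot) h
      (fun N hN => hT.eq_top (by omega) hN ▸ Submodule.mem_top) hm
  have key : ∀ n, 1 ≤ n → ∀ m, 1 ≤ m → m ≤ n → Function.Bijective (φ.app m) := by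
    intro n hn
    induction n, hn using Nat.le_induction with
    | base =>
      intro m h1 h2
      obtain rfl : m = 1 := le_antisymm h2 h1
      obtain ⟨h3, h4⟩ := hK le_rfl (fun m h h' => absurd h (by omega)) Nat.one_pos
      rw [gen_upTo le_rfl] at h3 h4
      rw [hT.eq_top Nat.one_pos le_rfl] at h4
      exact ⟨(injective_iff_map_eq_zero _).2 fun y => h3 y trivial,
        fun x => (h4 x trivial).imp fun _ => And.right⟩
    | succ n hn ih =>
      intro m h1 h2
      rcases h2.lt_or_eq with h3 | rfl
      · exact ih m h1 (by omega)
      obtain ⟨hinj, hsurj⟩ := hK hn (fun m h h' => ih m (by omega) h') h1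
      have hdB : ∀ y, (BurkeOperad k).d (n + 1) y ∈ gen k (upTo n) (n + 1) := fun y =>
        (isUnitaryPrincipalExtension n hn).d_mem'
          (show y ∈ gen k (upTo (n + 1)) (n + 1) from gen_upTo (k := k) le_rfl ▸ Submodule.mem_top)
      constructor
      · refine (injective_iff_map_eq_zero _).2 fun y hy => ?_
        have hdy : (BurkeOperad k).d (n + 1) y = 0 :=
          hinj _ (hdB y) (by rw [φ.app_d, hy, map_zero])
        obtain ⟨z, -, rfl⟩ := (hβ (n + 1)).1 y trivial hdy ⟨0, by rw [← hφ, hy, map_zero, hd]⟩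
        exact hinj _ (hdB z) hy
      · intro x
        -- correct `x` until it becomes a coboundary; coboundaries lie in the smaller operad
        obtain ⟨w, -, hw⟩ := hsurj _ (hT.d_mem hn x)
        have hdw : (BurkeOperad k).d (n + 1) w = 0 := by
          refine hinj _ (hdB w) ?_
          rw [φ.app_d, hw, P.d_d]
        obtain ⟨y, -, rfl⟩ := (hβ (n + 1)).1 w trivial hdw ⟨0, by rw [← hφ, hw, ρ.app_d, hd, hd]⟩
        obtain ⟨y', -, hy', v, hv⟩ := (hβ (n + 1)).2 (ρ.app (n + 1) (x - φ.app (n + 1) y)) (hd _)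
        rw [hd, sub_eq_zero] at hv
        obtain ⟨z, -, hz⟩ := (hρ (n + 1)).1 (x - φ.app (n + 1) y - φ.app (n + 1) y') trivial
          (by rw [map_sub, map_sub, ← φ.app_d, ← φ.app_d, hw, hy', map_zero, sub_self, sub_zero])
          ⟨0, by rw [map_sub, hφ, hv, sub_self, hd]⟩
        obtain ⟨w, -, hw⟩ := hsurj _ (hT.d_mem hn z)
        exact ⟨w + y' + y, by rw [map_add, map_add, hw, ← hz]; abel⟩
  rcases Nat.eq_zero_or_pos n with rfl | hn
  · exact hzero
  · exact key n hn n hn le_rfl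

end Comparison


/-! ### Lifting the augmentation to a minimal model -/

section Lifting

variable {k : Type u} [Field k]

/-- A sequence may be constructed recursively, when the condition on its `n`-th entry depends
only on the entries up to the `n`-th. -/
theorem exists_seq {X : ℕ → Type v} [∀ n, Zero (X n)] {R : ℕ → (∀ n, X n) → Prop}
    (hR : ∀ n q q', (∀ j ≤ n, q j = q' j) → R n q → R n q')
    (hext : ∀ n q, (∀ j < n, R j q) → (∀ j, n ≤ j → q j = 0) →
      ∃ v, R n (Function.update q n v)) :
    ∃ q, ∀ n, R n q := by
  let T : ℕ → Type v := fun n => {q : ∀ n, X n // (∀ j < n, R j q) ∧ ∀ j, n ≤ j → q j = 0}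
  have step : ∀ n (q : T n), ∃ q' : T (n + 1), ∀ j < n, q'.1 j = q.1 j := by
    rintro n ⟨q, hq, hq0⟩
    obtain ⟨v, hv⟩ := hext n q hq hq0
    refine ⟨⟨Function.update q n v, fun j hj => ?_, fun j hj => ?_⟩, fun j hj =>
      Function.update_of_ne hj.ne _ _⟩
    · rcases (Nat.lt_succ_iff.1 hj).lt_or_eq with h | rfl
      · exact hR j q _ (fun i hi => (Function.update_of_ne (by omega) _ _).symm) (hq j h)
      · exact hv
    · rw [Function.update_of_ne (by omega)]
      exact hq0 j (by omega)
  choose f hf using step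
  let Q : ∀ n, T n := fun n => Nat.rec ⟨fun _ => 0, fun j hj => absurd hj (Nat.not_lt_zero j),
    fun _ _ => rfl⟩ (fun n q => f n q) n
  have hQ : ∀ n j, j < n → (Q n).1 j = (Q (j + 1)).1 j := by
    intro n j hj
    induction n, hj using Nat.le_induction with
    | base => rfl
    | succ n hn ih => exact (hf n (Q n) j hn).trans ih
  exact ⟨fun j => (Q (j + 1)).1 j, fun n => hR n (Q (n + 1)).1 _
    (fun j hj => hQ (n + 1) j (by omega)) ((Q (n + 1)).2.1 n (Nat.lt_succ_self n))⟩

section Normalize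

variable {P : DGOperad.{u, v} k} {e : P.X 0} {μ : P.X 2} (he : e ∈ P.gr 0 0)
  (hμ : μ ∈ P.gr 2 0) (hdμ : P.d 2 μ = 0)
  (hu : ∀ i : Fin 2, P.circ (n := 0) (l := 1) rfl i μ e = P.one)

include he hμ hdμ hu

/-- Degeneracies: every cocycle `x` is the restriction at the input `i` of a cocycle `y` of larger
arity, in which the input `i` is multiplied with its predecessor.  If a restriction of `x` at an
input not before `i` vanishes, then so does the corresponding one of `y`. -/
theorem exists_degeneracy {n : ℕ} (i : Fin (n + 2)) {b : ℤ} {x : P.X (n + 1)}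
    (hx : x ∈ P.gr (n + 1) b) (hdx : P.d (n + 1) x = 0) :
    ∃ y ∈ P.gr (n + 2) b, P.d (n + 2) y = 0 ∧
      P.circ (n := 0) (l := n + 1) rfl i y e = x ∧
      ∀ j : Fin (n + 1), i < j.succ → P.circ (n := 0) (l := n) rfl j x e = 0 →
        P.circ (n := 0) (l := n + 1) rfl j.succ y e = 0 := by
  refine Fin.cases ?_ (fun s => ?_) i
  · -- a new first input is multiplied with the result
    have h : n + 2 + 1 = 2 + (n + 1) := by omega
    refine ⟨P.circ h 1 μ x, by simpa using P.circ_mem h 1 hμ hx, ?_, ?_, fun j _ hj => ?_⟩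
    · rw [P.d_circ h 1 μ x hμ, hdμ, hdx, map_zero, map_zero, smul_zero, LinearMap.zero_apply,
        add_zero]
    · have h₄ : n + 1 + 1 = 1 + (n + 1) := by omega
      have := P.circ_par (q := n + 1) h rfl (show 1 + 1 = 2 + 0 from rfl) h₄ (1 : Fin 2) 0
        (by decide) μ x e hx he
      have hidx : outerIdx (show 1 + 1 = 2 + 0 from rfl) (0 : Fin 2) 1 (by decide) = (0 : Fin 1) :=
        Subsingleton.elim _ _
      rw [hu, mul_zero, Int.negOnePow_zero, one_smul, hidx, P.one_circ] at this
      have hidx' : outerIdx h (1 : Fin 2) 0 (by decide) = (0 : Fin (n + 2)) :=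
        Fin.ext (by simp [outerIdx])
      rwa [hidx'] at this
    · have h₄ : n + 1 + 1 = 2 + n := by omega
      have := P.circ_seq h (q := n + 1) rfl (r := n) rfl h₄ (1 : Fin 2) j μ x e
      rw [hj, map_zero] at this
      have hidx : innerIdx h (1 : Fin 2) j = j.succ := Fin.ext (by simp [innerIdx, add_comm])
      rwa [hidx] at this
  · -- the input `s` is replaced by the product of itself and the new input
    have h : n + 2 + 1 = n + 1 + 2 := rfl
    refine ⟨P.circ h s x μ, by simpa using P.circ_mem h s hx hμ, ?_, ?_, fun j hsj hj => ?_⟩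
    · rw [P.d_circ h s x μ hx, hdμ, hdx, map_zero, map_zero, smul_zero, LinearMap.zero_apply,
        add_zero]
    · have := P.circ_seq h (q := n + 1) (p := 0) rfl (show 1 + 1 = 2 + 0 from rfl) rfl s 1 x μ e
      rw [hu, P.circ_one] at this
      exact this
    · have hjs : j ≠ s := by
        rintro rfl
        exact lt_irrefl _ hsj
      have := P.circ_par h (q := n + 1) (p := 0) rfl (l' := n) rfl rfl s j hjs x μ e hμ he
      rw [hj, map_zero, LinearMap.zero_apply, smul_zero] at this
      have hidx : outerIdx h s j hjs = j.succ := by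
        have h1 : s.val < j.val := by simpa using hsj
        apply Fin.ext
        simp only [outerIdx, Fin.val_succ]
        split_ifs <;> omega
      rwa [hidx] at this

/-- An operation whose differential has vanishing restrictions may be changed by a cocycle so that
its own restrictions vanish. -/
theorem exists_normalized (hde : P.d 0 e = 0) {n : ℕ} {a : ℤ} {w : P.X (n + 2)}
    (hw : w ∈ P.gr (n + 2) a)
    (hz : ∀ i, P.circ (n := 0) (l := n + 1) rfl i (P.d (n + 2) w) e = 0) :
    ∃ v ∈ P.gr (n + 2) a, P.d (n + 2) v = P.d (n + 2) w ∧
      ∀ i, P.circ (n := 0) (l := n + 1) rfl i v e = 0 := by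
  -- the restrictions are made to vanish one after another, from the last to the first
  have key : ∀ s, ∃ v ∈ P.gr (n + 2) a, P.d (n + 2) v = P.d (n + 2) w ∧
      ∀ i : Fin (n + 2), n + 2 ≤ i.val + s →
        P.circ (n := 0) (l := n + 1) rfl i v e = 0 := by
    intro s
    induction s with
    | zero => exact ⟨w, hw, rfl, fun i hi => absurd i.2 (by omega)⟩
    | succ s ih =>
      obtain ⟨v, hv, hd, hv0⟩ := ih
      by_cases hs : n + 2 ≤ s
      · exact ⟨v, hv, hd, fun i _ => hv0 i (by omega)⟩
      let i₀ : Fin (n + 2) := ⟨n + 1 - s, by omega⟩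
      have hx := P.circ_mem (n := 0) (l := n + 1) rfl i₀ hv he
      rw [add_zero] at hx
      have hdx := P.d_circ (n := 0) (l := n + 1) rfl i₀ v e hv
      rw [hd, hz, hde, map_zero, smul_zero, add_zero] at hdx
      obtain ⟨y, hy, hdy, hyi, hyj⟩ := exists_degeneracy he hμ hdμ hu i₀ hx hdx
      refine ⟨v - y, sub_mem hv hy, by rw [map_sub, hdy, sub_zero, hd], fun i hi => ?_⟩
      rw [map_sub, LinearMap.sub_apply]
      rcases eq_or_ne i i₀ with rfl | hne
      · rw [hyi, sub_self]
      have hlt : i₀.val < i.val := by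
        have h1 := Fin.val_ne_of_ne hne
        have h2 : i₀.val = n + 1 - s := rfl
        omega
      obtain ⟨j, rfl⟩ := Fin.exists_succ_eq.2 (show i ≠ 0 by
        rintro rfl
        exact absurd hlt (Nat.not_lt_zero _))
      have h0 := hv0 j.succ (by
        have h2 : i₀.val = n + 1 - s := rfl
        omega)
      have h1 := P.circ_par (m := n + 2) (n := 0) (l := n + 1) rfl (q := n) (p := 0) rfl
        (l' := n + 1) rfl rfl i₀ j.succ hne v e e he he
      rw [h0, map_zero, LinearMap.zero_apply, smul_zero] at h1
      have hidx : outerIdx (n := 0) (l := n + 1) rfl i₀ j.succ hne = j := by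
        apply Fin.ext
        rw [Fin.val_succ] at hlt
        simp only [outerIdx, Fin.val_succ]
        split_ifs <;> omega
      rw [hidx] at h1
      rw [h0, hyj j hlt h1, sub_zero]
  obtain ⟨v, hv, hd, hv0⟩ := key (n + 2)
  exact ⟨v, hv, hd, fun i => hv0 i (by omega)⟩

end Normalize

open BurkeOperad

variable {P : DGOperad.{u, u} k} {ρ : DGOperad.Hom P (AssPlus k)} (hρ : ∀ n, QuasiIsoOn ρ n ⊤)
  (hone : ∀ x : P.X 1, ∃ c : k, x = c • P.one)
  {β : DGOperad.Hom (BurkeOperad k) (AssPlus k)} (hβu : β.app 0 (unit k) = AssPlus.unit k)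
  (hβ : ∀ n, β.app (n + 2) (mul k n) = AssPlus.gens k n)
  {e : P.X 0} (he : e ∈ P.gr 0 0) (hde : P.d 0 e = 0) (hρe : ρ.app 0 e = AssPlus.unit k)

include hρ hone hρe in
/-- A cocycle over the product of `Ass₊` is strictly unital, because its restrictions are multiples
of the identity which are detected by `ρ`. -/
theorem exists_product : ∃ v ∈ P.gr 2 0, P.d 2 v = 0 ∧
    (∀ i : Fin 2, P.circ (n := 0) (l := 1) rfl i v e = P.one) ∧ ρ.app 2 v = AssPlus.mul k := by
  obtain ⟨x, -, hdx, z, hz⟩ := (hρ 2).2 (AssPlus.mul k) rfl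
  have hx : ρ.app 2 x = AssPlus.mul k := sub_eq_zero.1 hz
  have hρv : ρ.app 2 (homComp (P.internal 2) 0 x) = AssPlus.mul k :=
    (map_homComp (P.internal 2) ((AssPlus k).internal 2) (c := 0)
      (fun a x hx => (add_zero a).symm ▸ ρ.app_mem hx) 0 x).trans
      ((homComp_of_mem _ (AssPlus.mem_gr_zero _)).trans hx)
  refine ⟨homComp (P.internal 2) 0 x, homComp_mem _ _ _, ?_, fun i => ?_, hρv⟩
  · rw [map_homComp (P.internal 2) (P.internal 2) (fun a x hx => P.d_mem hx), hdx, map_zero]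
  · obtain ⟨c, hc⟩ := hone (P.circ (n := 0) (l := 1) rfl i (homComp (P.internal 2) 0 x) e)
    have h := congrArg (ρ.app 1) hc
    rw [ρ.app_circ, hρv, hρe, map_smul, ρ.app_one] at h
    have h1 := congrArg (AssPlus.coeff k Word.one)
      ((AssPlus.isUnitFor (k := k)).two trivial i |>.symm.trans h)
    rw [map_smul] at h1
    have h2 : AssPlus.coeff k Word.one (AssPlus k).one = 1 := AssPlus.coeff_single Word.one
    rw [h2, smul_eq_mul, mul_one] at h1
    rw [hc, ← h1, one_smul]

include hρ hone hβu hβ he hde hρe in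
/-- A lift of the augmentation defined on the generators of arity less than `N + 2` extends to the
generator of arity `N + 2`: the image `z` of its boundary is a cocycle which is null-cohomologous, as
`ρ` is a quasi-isomorphism, and all of whose restrictions vanish; hence it is the boundary of an
operation all of whose restrictions vanish. -/
theorem exists_next {N : ℕ} {q : ∀ n, P.X (n + 2)} (hq : ∀ n, q n ∈ P.gr (n + 2) (-(n : ℤ)))
    (hu : IsUnitFor P.toGradedOperad e q {j | j < N}) (L : Lift P.toGradedOperad e q)
    (hd : ∀ j < N, L.app (j + 2) ((BurkeOperad k).d (j + 2) (mul k j)) = P.d (j + 2) (q j))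
    (hρq : ∀ j < N, ρ.app (j + 2) (q j) = AssPlus.gens k j) :
    ∃ v ∈ P.gr (N + 2) (-(N : ℤ)), IsUnitFor P.toGradedOperad e (Function.update q N v) {N} ∧
      L.app (N + 2) ((BurkeOperad k).d (N + 2) (mul k N)) = P.d (N + 2) v ∧
      ρ.app (N + 2) v = AssPlus.gens k N := by
  cases N with
  | zero =>
    obtain ⟨v, hv, hdv, hve, hρv⟩ := exists_product hρ hone hρe
    refine ⟨v, hv, ⟨fun _ i => ?_, fun n hn => absurd hn (by simp)⟩, ?_, hρv⟩
    · rw [Function.update_self]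
      exact hve i
    · refine Eq.trans (congrArg _ ((d_mul (k := k) 0).trans ?_)) ((map_zero _).trans hdv.symm)
      exact (congrArg Neg.neg (Fin.sum_univ_zero _)).trans neg_zero
  | succ M =>
    have hgen := d_mul_mem_gen (k := k) (M + 1)
    set z := L.app (M + 1 + 2) ((BurkeOperad k).d (M + 1 + 2) (mul k (M + 1))) with hz
    have hzmem : z ∈ P.gr (M + 1 + 2) (-((M + 1 : ℕ) : ℤ) + 1) :=
      L.app_mem he hq ((BurkeOperad k).d_mem (mul_mem (M + 1)))
    have hdz : P.d (M + 1 + 2) z = 0 := by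
      rw [hz, ← L.app_d hq hde (fun j hj => hd j hj) hgen, (BurkeOperad k).d_d, map_zero]
    have hρz : ρ.app (M + 1 + 2) z = 0 := by
      let L' : Lift (AssPlus k).toGradedOperad (ρ.app 0 e) fun n => ρ.app (n + 2) (q n) :=
        ⟨fun n => ρ.app n ∘ₗ L.app n, congrArg _ L.app_unit, fun x =>
          (congrArg _ (L.app_tm x)).trans (ρ.app_eval q x)⟩
      have h1 := L'.app_eq (lift β) (hρe.trans hβu.symm)
        (fun j hj => (hρq j hj).trans (hβ j).symm) hgen
      exact h1.trans (β.app_d _)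
    have hze : ∀ i, P.circ (n := 0) (l := M + 1 + 1) rfl i z e = 0 := by
      intro i
      have h1 := (BurkeOperad k).d_circ (n := 0) (l := M + 2) rfl i (mul k (M + 1)) (unit k)
        (mul_mem (M + 1))
      rw [mul_unit, d_unit, map_zero, map_zero, smul_zero, add_zero] at h1
      have h2 := L.app_circ he hq hu (n := 0) (l := M + 2) rfl i hgen (unit k)
      rw [← h1, map_zero, L.app_unit] at h2
      exact h2.symm
    obtain ⟨w, -, hw⟩ := (hρ (M + 1 + 2)).1 z trivial hdz ⟨0, hρz⟩
    have hdw : P.d (M + 1 + 2) (homComp (P.internal _) (-((M + 1 : ℕ) : ℤ)) w) = z := by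
      rw [map_homComp (P.internal _) (P.internal _) (fun a x hx => P.d_mem hx), ← hw,
        homComp_of_mem _ hzmem]
    have hq0 : q 0 ∈ P.gr 2 0 := hq 0
    have hd0 : P.d 2 (q 0) = 0 := by
      refine (hd 0 (by omega)).symm.trans ((congrArg _ ((d_mul (k := k) 0).trans ?_)).trans
        (map_zero _))
      exact (congrArg Neg.neg (Fin.sum_univ_zero _)).trans neg_zero
    obtain ⟨v, hv, hdv, hve⟩ := exists_normalized he hq0 hd0 (hu.two (Nat.succ_pos M)) hde
      (homComp_mem (P.internal (M + 1 + 2)) (-((M + 1 : ℕ) : ℤ)) w) (fun i => by rw [hdw, hze])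
    refine ⟨v, hv, ⟨fun h => absurd h (by simp), fun n hn i => ?_⟩, (hdv.trans hdw).symm,
      AssPlus.eq_zero (by omega) (ρ.app_mem hv)⟩
    obtain rfl : n = M := by simpa using hn
    rw [Function.update_self]
    exact hve i

include hρ hone hβu hβ he hde hρe in
/-- The augmentation lifts to every operad which is quasi-isomorphic to `Ass₊` and is spanned by
the identity in arity one. -/
theorem exists_lift_augmentation : ∃ φ : DGOperad.Hom (BurkeOperad k) P,
    ∀ n x, ρ.app n (φ.app n x) = β.app n x := by
  let R : ℕ → (∀ n, P.X (n + 2)) → Prop := fun n q =>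
    q n ∈ P.gr (n + 2) (-(n : ℤ)) ∧ IsUnitFor P.toGradedOperad e q {n} ∧
    (∀ q' (L : Lift P.toGradedOperad e q'), (∀ j < n, q' j = q j) →
      L.app (n + 2) ((BurkeOperad k).d (n + 2) (mul k n)) = P.d (n + 2) (q n)) ∧
    ρ.app (n + 2) (q n) = AssPlus.gens k n
  obtain ⟨q, hR⟩ : ∃ q, ∀ n, R n q := by
    refine exists_seq ?_ ?_
    · rintro n q q' hqq ⟨h1, h2, h3, h4⟩
      have hn := hqq n le_rfl
      refine ⟨hn ▸ h1, ⟨fun h i => ?_, fun m h i => ?_⟩, fun q₁ L h => ?_, hn ▸ h4⟩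
      · rw [← hqq 0 (Nat.zero_le n)]
        exact h2.two h i
      · rw [← hqq (m + 1) (le_of_eq h)]
        exact h2.add_three m h i
      · rw [← hn]
        exact h3 q₁ L fun j hj => (h j hj).trans (hqq j hj.le).symm
    · intro N q hR h0
      have hq : ∀ n, q n ∈ P.gr (n + 2) (-(n : ℤ)) := by
        intro n
        rcases lt_or_ge n N with h | h
        · exact (hR n h).1
        · rw [h0 n h]
          exact zero_mem _
      obtain ⟨L⟩ := exists_lift P.toGradedOperad e hq
      obtain ⟨v, hv, hvu, hdv, hρv⟩ := exists_next hρ hone hβu hβ he hde hρe (N := N) hq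
        ⟨fun h => (hR 0 h).2.1.two rfl, fun n h => (hR (n + 1) h).2.1.add_three n rfl⟩ L
        (fun j hj => (hR j hj).2.2.1 q L fun _ _ => rfl) fun j hj => (hR j hj).2.2.2
      refine ⟨v, ?_⟩
      simp only [R, Function.update_self]
      refine ⟨hv, hvu, fun q' L' h => ?_, hρv⟩
      rw [← hdv]
      exact L'.app_eq L rfl (fun j hj => (h j hj).trans (Function.update_of_ne (ne_of_lt hj) _ _))
        (d_mul_mem_gen N)
  have hq := fun n => (hR n).1
  obtain ⟨L⟩ := exists_lift P.toGradedOperad e hq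
  refine ⟨L.hom he hq ⟨fun _ => (hR 0).2.1.two rfl, fun n _ => (hR (n + 1)).2.1.add_three n rfl⟩
    hde fun n => (hR n).2.2.1 q L fun _ _ => rfl, fun n x => ?_⟩
  let L' : Lift (AssPlus k).toGradedOperad (ρ.app 0 e) fun n => ρ.app (n + 2) (q n) :=
    ⟨fun n => ρ.app n ∘ₗ L.app n, congrArg _ L.app_unit, fun x =>
      (congrArg _ (L.app_tm x)).trans (ρ.app_eval q x)⟩
  exact L'.app_eq (lift β) (hρe.trans hβu.symm) (fun j _ => (hR j).2.2.2.trans (hβ j).symm)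
    (Lift.mem_gen_univ x)

end Lifting

end StrictUnits

open StrictUnits in
theorem mainTheorem3 (k : Type u) [Field k] [CharZero k] :
    ∃ β : DGOperad.Hom (BurkeOperad k) (AssPlus k),
      β.app 0 (BurkeOperad.unit k) = AssPlus.unit k ∧
      β.app 2 (BurkeOperad.mul k 0) = AssPlus.mul k ∧
      (∀ n, β.app (n + 1 + 2) (BurkeOperad.mul k (n + 1)) = 0) ∧
      IsSullivanMinimalModel β ∧
      ∀ (P : DGOperad.{u, u} k) (ρ : DGOperad.Hom P (AssPlus k)), IsSullivanMinimalModel ρ →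
        ∃ φ : DGOperad.Hom (BurkeOperad k) P,
          (∀ n, Function.Bijective (φ.app n)) ∧
          (∀ n x, ρ.app n (φ.app n x) = β.app n x) ∧
          (∀ A : Cochain.{u, w} k,
            (∀ α : OperadAlgebra P A, ∃! S : StrictlyUnitalAInfinity A.gr,
              α.Realizes (φ.app 0 (BurkeOperad.unit k))
                (fun n => φ.app (n + 2) (BurkeOperad.mul k n)) S) ∧
            (∀ S : StrictlyUnitalAInfinity A.gr, (∀ x, S.m 1 ![x] = A.d x) →
              ∃! α : OperadAlgebra P A,
                α.Realizes (φ.app 0 (BurkeOperad.unit k))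
                  (fun n => φ.app (n + 2) (BurkeOperad.mul k n)) S)) ∧
          (∀ (A B : Cochain.{u, w} k) (αA : OperadAlgebra P A) (αB : OperadAlgebra P B)
            (SA : StrictlyUnitalAInfinity A.gr) (SB : StrictlyUnitalAInfinity B.gr),
            αA.Realizes (φ.app 0 (BurkeOperad.unit k))
              (fun n => φ.app (n + 2) (BurkeOperad.mul k n)) SA →
            αB.Realizes (φ.app 0 (BurkeOperad.unit k))
              (fun n => φ.app (n + 2) (BurkeOperad.mul k n)) SB →
            ∀ f : A.carrier →ₗ[k] B.carrier, (∀ a, ∀ x ∈ A.gr a, f x ∈ B.gr a) →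
              ((∀ x, f (A.d x) = B.d (f x)) ∧
                  (∀ (n : ℕ) (p : P.X n) (v : Fin n → A.carrier),
                    f (αA.act n p v) = αB.act n p (fun j => f (v j))) ↔
                f SA.unit = SB.unit ∧
                  ∀ (n : ℕ) (v : Fin n → A.carrier),
                    f (SA.m n v) = SB.m n (fun j => f (v j)))) := by
  obtain ⟨β, hu, hβ⟩ := exists_augmentation k
  refine ⟨β, hu, hβ 0, fun n => hβ (n + 1), isSullivanMinimalModel_augmentation hu hβ, ?_⟩
  rintro P ρ ⟨hρ, S, E, -, hext, hexh, -⟩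
  have hT : IsTower S E := ⟨hext, hexh⟩
  -- the unit of `P` is the class of `P 0` over the unit of `Ass₊`
  obtain ⟨e, -, hde, z, hz⟩ := (hρ 0).2 (AssPlus.unit k) rfl
  have hρe : ρ.app 0 e = AssPlus.unit k := sub_eq_zero.1 hz
  have he : e ∈ P.gr 0 0 := by
    obtain ⟨e', he', -, h⟩ := hT.arity_zero
    obtain ⟨c, rfl⟩ := h e
    exact Submodule.smul_mem _ c he'
  obtain ⟨φ, hφ⟩ := exists_lift_augmentation hρ hT.arity_one hu hβ he hde hρe
  have hβu : β.app 0 (BurkeOperad.unit k) ≠ 0 := by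
    rw [hu]
    exact Finsupp.single_ne_zero.2 one_ne_zero
  have hbij := bijective_of_augmentation hT hρ (quasiIsoOn_augmentation hu hβ) hβu hφ
  exact ⟨φ, hbij, hφ, fun A => ⟨fun α => OperadAlgebra.existsUnique_structure φ α,
    fun S hS => OperadAlgebra.existsUnique_algebra φ hbij S hS⟩,
    fun A B α α' S S' hS hS' f hf => algebra_morphism_iff hbij hS hS' hf⟩
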